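/- Let $\Omega\subset\mathbb R^2$ be a bounded polygonal domain (lying on one side of its boundary). Let $\alpha$ be a bounded diffusion coefficient on $\Omega$ (scalar or $2\times2$-matrix valued) with $\alpha(x)\xi\cdot\xi\ge\alpha_0|\xi|^2$ for all $x\in\Omega$, $\xi\in\mathbb R^2$, where $\alpha_0>0$; let $\boldsymbol\beta\in[C^1(\overline\Omega)]^2$; let $c$ be bounded and measurable on $\Omega$, with $c-\frac12\nabla\cdot\boldsymbol\beta\ge0$ in $\Omega$. Let $\kappa>0$, $\rho>0$, $L\ge0$. Let $\mathcal T_h$ be a partition of $\Omega$ into finitely many closed non-overlapping polygons $T$ whose edges are matched (each interior edge is an edge of exactly the two elements on its sides; vertices with a straight angle are allowed). Write $h_T$ for the diameter of $T$ and $h=\max_T h_T$. Assume that $\mathcal T_h$ is shape regular with parameter $\rho$ (every $T$ is star-shaped with respect to a disc of radius $\rho h_T$), and that $\alpha$ is Lipschitz with constant $L$ in the interior of each $T$ (as holds, with a suitable $L$, if $\alpha$ is smooth on $\overline\Omega$, or smooth piecewise with respect to $\mathcal T_h$). Let $W_h$ be the space of functions $v_b$ that are constant on each edge (a single value per edge),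 and $W_h^0$ the subspace of those vanishing on the edges contained in $\partial\Omega$. For an element $T$ with edges $e_i$ of length $|e_i|$, midpoints $M_i$ and outward unit normals $\mathbf n_i$, and $v_b|_{e_i}=v_{b,i}$, put on $T$ $$\nabla_wv_b=\frac1{|T|}\sum_i v_{b,i}|e_i|\mathbf n_i ,$$ and let $\mathfrak s(v_b)\in P_1(T)$ be determined by $\sum_i(\mathfrak s(v_b)(M_i)-v_{b,i})\phi(M_i)|e_i|=0$ for all $\phi\in P_1(T)$. Let $$S(u_b,v_b)=\sum_T h^{-1}\sum_i(\mathfrak s(u_b)(M_i)-u_{b,i})(\mathfrak s(v_b)(M_i)-v_{b,i})|e_i| ,$$ $$\mathcal B(u_b,v_b)=\sum_T\big[(\alpha\nabla_wu_b,\nabla_wv_b)_T+(\boldsymbol\beta\cdot\nabla_wu_b,\mathfrak s(v_b))_T+(c\,\mathfrak s(u_b),\mathfrak s(v_b))_T\big],$$ and let $Q_bw\in W_h$ be given by the averages of $w$ on the edges. Let $f\in L^2(\Omega)$ and let $u\in H^2(\Omega)$, identified with its representative that is continuous on $\overline\Omega$, satisfy $-\nabla\cdot(\alpha\nabla u)+\boldsymbol\beta\cdot\nabla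 u+cu=f$ in $\Omega$ (in the sense of distributions) and $u=g$ on $\partial\Omega$. Let $u_b\in W_h$ satisfy $u_b=Q_bg$ on the boundary edges and $$\kappa S(u_b,v_b)+\mathcal B(u_b,v_b)=\sum_T(f,\mathfrak s(v_b))_T\qquad\text{for all }v_b\in W_h^0 .$$ Then there are constants $C>0$ and $h_0>0$, depending only on $\Omega,\alpha,\boldsymbol\beta,c,\alpha_0,\kappa,\rho,L$ (and not on $\mathcal T_h,f,g,u,u_b$), such that, whenever $h\le h_0$, the error $e_b=Q_bu-u_b$ satisfies $$\kappa S(e_b,e_b)+(\alpha\nabla_we_b,\nabla_we_b)\le C h^2\|u\|_2^2 ,$$ and, consequently, $\|\nabla_wu_b-\nabla u\|\le C h\|u\|_2$. Here $\|\cdot\|_2$ is the norm of $H^2(\Omega)$, $\|\cdot\|$ that of $L^2(\Omega)$, and $\nabla_w$, $(\alpha\nabla_we_b,\nabla_we_b)$ are taken element by element. -/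

import Mathlib

open MeasureTheory Set Filter Topology
open scoped NNReal ContDiff

/-- The Euclidean plane `ℝ²`. -/
abbrev Plane := EuclideanSpace ℝ (Fin 2)

/-! ### Domains, coefficients and Sobolev functions -/

/-- A bounded polygonal domain: open, connected, bounded, bounded by finitely many segments, and
lying on one side of its boundary (no slits, no isolated boundary points). -/
structure IsPolygonalDomain (Ω : Set Plane) : Prop where
  isOpen : IsOpen Ω
  isConnected : IsConnected Ω
  isBounded : Bornology.IsBounded Ω
  interior_closure : interior (closure Ω) = Ω
  frontier_eq : ∃ F : Finset (Plane × Plane), frontier Ω = ⋃ p ∈ F, segment ℝ p.1 p.2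

/-- The divergence of a plane vector field. -/
noncomputable def divergence (β : Plane → Plane) (x : Plane) : ℝ :=
  ∑ i : Fin 2, (fderiv ℝ β x (EuclideanSpace.single i 1)) i

/-- `β ∈ [C¹(Ω̄)]²`: differentiable in `Ω`, the field and its derivative being continuous up to
the boundary. -/
def IsC1UpToBoundary (Ω : Set Plane) (β : Plane → Plane) : Prop :=
  ContinuousOn β (closure Ω) ∧
    ∃ D : Plane → (Plane →L[ℝ] Plane),
      ContinuousOn D (closure Ω) ∧ ∀ x ∈ Ω, HasFDerivAt β (D x) x

/-- Test functions: `φ ∈ C_c^∞(Ω)`. -/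
structure IsTestFunction (Ω : Set Plane) (φ : Plane → ℝ) : Prop where
  smooth : ContDiff ℝ ∞ φ
  compact : HasCompactSupport φ
  support : tsupport φ ⊆ Ω

/-- `G` is the weak (distributional) gradient of `w` in `Ω`; used for `w`, `G` in `L²(Ω)`. -/
def IsWeakGradient (Ω : Set Plane) (w : Plane → ℝ) (G : Plane → Plane) : Prop :=
  ∀ φ, IsTestFunction Ω φ → ∀ i : Fin 2,
    ∫ x in Ω, w x * (gradient φ x) i = - ∫ x in Ω, (G x) i * φ x

/-- `u ∈ H²(Ω)` with weak gradient `G`, and with `H i` the weak gradient of `∂ᵢu`. -/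
structure IsH2 (Ω : Set Plane) (u : Plane → ℝ) (G : Plane → Plane) (H : Fin 2 → Plane → Plane) :
    Prop where
  memLp : MemLp u 2 (volume.restrict Ω)
  memLp_grad : MemLp G 2 (volume.restrict Ω)
  memLp_hess : ∀ i, MemLp (H i) 2 (volume.restrict Ω)
  weak_grad : IsWeakGradient Ω u G
  weak_hess : ∀ i, IsWeakGradient Ω (fun x => (G x) i) (H i)

/-- The norm `‖u‖₂` of `H²(Ω)`, for `u` with weak gradient `G` and weak second derivatives `H`. -/
noncomputable def h2Norm (Ω : Set Plane) (u : Plane → ℝ) (G : Plane → Plane)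
    (H : Fin 2 → Plane → Plane) : ℝ :=
  Real.sqrt ((∫ x in Ω, u x ^ 2) + (∫ x in Ω, ‖G x‖ ^ 2) + ∑ i, ∫ x in Ω, ‖H i x‖ ^ 2)

/-- `-∇·(α∇u) + β·∇u + cu = f` in `Ω` in the sense of distributions, where `G = ∇u`. -/
def SolvesEquation (Ω : Set Plane) (α : Plane → (Plane →L[ℝ] Plane)) (β : Plane → Plane)
    (c f : Plane → ℝ) (u : Plane → ℝ) (G : Plane → Plane) : Prop :=
  ∀ φ, IsTestFunction Ω φ →
    ∫ x in Ω, (inner ℝ (α x (G x)) (gradient φ x) + inner ℝ (β x) (G x) * φ x + c x * u x * φ x)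
      = ∫ x in Ω, f x * φ x

/-! ### Polygonal partitions -/

/-- A finite partition of `Ω` into closed polygons. The edges of the elements form one global
finite family of closed segments meeting only in endpoints; thus an interior edge is shared by the
two elements on its sides (a hanging node is a vertex with a straight angle).
For `e ∈ bdry i`, `normal i e` is the unit outward normal of the element `i` on the edge `e`. -/
structure PolyMesh (Ω : Set Plane) where
  numElem : ℕ
  numEdge : ℕ
  elem : Fin numElem → Set Plane
  src : Fin numEdge → Plane
  tgt : Fin numEdge → Plane
  bdry : Fin numElem → Finset (Fin numEdge)
  normal : Fin numElem → Fin numEdge → Plane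
  isCompact_elem : ∀ i, IsCompact (elem i)
  nonempty_interior : ∀ i, (interior (elem i)).Nonempty
  closure_interior : ∀ i, closure (interior (elem i)) = elem i
  iUnion_elem : ⋃ i, elem i = closure Ω
  disjoint_interior : ∀ i j, i ≠ j → Disjoint (interior (elem i)) (interior (elem j))
  src_ne_tgt : ∀ e, src e ≠ tgt e
  edge_inter : ∀ e e', e ≠ e' →
    segment ℝ (src e) (tgt e) ∩ segment ℝ (src e') (tgt e') ⊆ {src e, tgt e}
  frontier_elem : ∀ i, frontier (elem i) = ⋃ e ∈ bdry i, segment ℝ (src e) (tgt e)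
  exists_elem : ∀ e, ∃ i, e ∈ bdry i
  norm_normal : ∀ i, ∀ e ∈ bdry i, ‖normal i e‖ = 1
  normal_orthogonal : ∀ i, ∀ e ∈ bdry i, inner ℝ (normal i e) (tgt e - src e) = 0
  normal_outward : ∀ i, ∀ e ∈ bdry i, ∀ x ∈ openSegment ℝ (src e) (tgt e),
    ∀ᶠ t : ℝ in 𝓝[>] 0, x + t • normal i e ∉ elem i

/-- Solvability of the weighted least-squares problem: the normal equations for fitting an affine
function to the values `v` at the points `m` with nonnegative weights `w` have a solution. -/
theorem exists_leastSquares {ι : Type} (s : Finset ι) (w : ι → ℝ) (hw : ∀ e, 0 ≤ w e)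
    (m : ι → Plane) (v : ι → ℝ) :
    ∃ σ : Plane →ᵃ[ℝ] ℝ, ∀ φ : Plane →ᵃ[ℝ] ℝ,
      ∑ e ∈ s, (σ (m e) - v e) * φ (m e) * w e = 0 := by
  classical
  let A : (Plane →ᵃ[ℝ] ℝ) →ₗ[ℝ] EuclideanSpace ℝ s :=
    { toFun := fun φ => WithLp.toLp 2 (fun e : s => Real.sqrt (w e) * φ (m e))
      map_add' := by
        intro a b
        ext e
        simp [mul_add]
      map_smul' := by
        intro a b
        ext e
        simp
        ring }
  let y : EuclideanSpace ℝ s := WithLp.toLp 2 (fun e : s => Real.sqrt (w e) * v e)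
  obtain ⟨σ, hσ⟩ : (LinearMap.range A).starProjection y ∈ LinearMap.range A :=
    Submodule.starProjection_apply_mem _ _
  refine ⟨σ, fun φ => ?_⟩
  have h := (LinearMap.range A).starProjection_inner_eq_zero y (A φ) ⟨φ, rfl⟩
  rw [← hσ, PiLp.inner_apply] at h
  rw [← Finset.sum_coe_sort, ← neg_eq_zero, ← Finset.sum_neg_distrib, ← h]
  refine Finset.sum_congr rfl fun e _ => ?_
  have h2 := Real.mul_self_sqrt (hw e)
  simp only [A, y, LinearMap.coe_mk, AddHom.coe_mk, PiLp.sub_apply, RCLike.inner_apply, conj_trivial]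
  linear_combination (-(σ (m e) - v e) * φ (m e)) * (-h2)

namespace PolyMesh

variable {Ω : Set Plane} (M : PolyMesh Ω)

/-- The meshsize `h`, the maximal diameter of the elements. -/
noncomputable def meshSize : ℝ := ⨆ i, Metric.diam (M.elem i)

/-- Shape regularity with parameter `ρ`: every element `T` is star-shaped with respect to all
points of some disc of radius `ρ h_T`, where `h_T` is the diameter of `T`. -/
def IsShapeRegular (ρ : ℝ) : Prop :=
  ∀ i, ∃ z : Plane, ∀ y ∈ Metric.closedBall z (ρ * Metric.diam (M.elem i)),
    StarConvex ℝ y (M.elem i)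

/-- The length `|e|` of an edge. -/
noncomputable def len (e : Fin M.numEdge) : ℝ := dist (M.src e) (M.tgt e)

/-- The midpoint of an edge. -/
noncomputable def mid (e : Fin M.numEdge) : Plane := midpoint ℝ (M.src e) (M.tgt e)

/-- `e` is a boundary edge, `e ⊆ ∂Ω`. -/
def IsBoundaryEdge (e : Fin M.numEdge) : Prop :=
  segment ℝ (M.src e) (M.tgt e) ⊆ frontier Ω

/-- The finite element space `W_h`: one real value on each edge. -/
abbrev W : Type := Fin M.numEdge → ℝ

/-- Membership in `W_h⁰`: vanishing on all boundary edges. -/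
def VanishesOnBoundary (v : M.W) : Prop := ∀ e, M.IsBoundaryEdge e → v e = 0

/-- The edge-wise average `Q_b g`. -/
noncomputable def Qb (g : Plane → ℝ) : M.W :=
  fun e => ∫ t in (0 : ℝ)..1, g (AffineMap.lineMap (M.src e) (M.tgt e) t)

/-- The weak gradient `∇_w v` on the element `i`, a constant vector. -/
noncomputable def weakGrad (v : M.W) (i : Fin M.numElem) : Plane :=
  (volume.real (M.elem i))⁻¹ • ∑ e ∈ M.bdry i, (v e * M.len e) • M.normal i e

/-- The least-squares linear extension `𝔰(v)` on the element `i`, see `ext_spec`. -/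
noncomputable def ext (v : M.W) (i : Fin M.numElem) : Plane →ᵃ[ℝ] ℝ :=
  Classical.choose (exists_leastSquares (M.bdry i) M.len (fun _ => dist_nonneg) M.mid v)

/-- The defining property of `𝔰(v)`. -/
theorem ext_spec (v : M.W) (i : Fin M.numElem) (φ : Plane →ᵃ[ℝ] ℝ) :
    ∑ e ∈ M.bdry i, (M.ext v i (M.mid e) - v e) * φ (M.mid e) * M.len e = 0 :=
  Classical.choose_spec
    (exists_leastSquares (M.bdry i) M.len (fun _ => dist_nonneg) M.mid v) φ

/-- The stabilizer `S(v, w)`. -/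
noncomputable def S (v w : M.W) : ℝ :=
  ∑ i, M.meshSize⁻¹ *
    ∑ e ∈ M.bdry i, (M.ext v i (M.mid e) - v e) * (M.ext w i (M.mid e) - w e) * M.len e

/-- `(α∇_w v, ∇_w w)`. -/
noncomputable def aForm (α : Plane → (Plane →L[ℝ] Plane)) (v w : M.W) : ℝ :=
  ∑ i, ∫ x in M.elem i, inner ℝ (α x (M.weakGrad v i)) (M.weakGrad w i)

/-- `(β·∇_w v, 𝔰(w))`. -/
noncomputable def bForm (β : Plane → Plane) (v w : M.W) : ℝ :=
  ∑ i, ∫ x in M.elem i, inner ℝ (β x) (M.weakGrad v i) * M.ext w i x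

/-- `(c𝔰(v), 𝔰(w))`. -/
noncomputable def cForm (c : Plane → ℝ) (v w : M.W) : ℝ :=
  ∑ i, ∫ x in M.elem i, c x * M.ext v i x * M.ext w i x

/-- `u_b` solves the simplified weak Galerkin scheme with data `f` and `g`. -/
def IsSWGSolution (α : Plane → (Plane →L[ℝ] Plane)) (β : Plane → Plane) (c : Plane → ℝ)
    (κ : ℝ) (f g : Plane → ℝ) (u_b : M.W) : Prop :=
  (∀ e, M.IsBoundaryEdge e → u_b e = M.Qb g e) ∧
    ∀ v : M.W, M.VanishesOnBoundary v →
      κ * M.S u_b v + (M.aForm α u_b v + M.bForm β u_b v + M.cForm c u_b v)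
        = ∑ i, ∫ x in M.elem i, f x * M.ext v i x

/-- The broken `L²` norm `‖∇_w v - G‖`. -/
noncomputable def gradError (v : M.W) (G : Plane → Plane) : ℝ :=
  Real.sqrt (∑ i, ∫ x in M.elem i, ‖M.weakGrad v i - G x‖ ^ 2)

end PolyMesh

/-!
# Error estimate for the simplified weak Galerkin method on polygonal meshes

The error `e = Q_b u - u_b` vanishes on the boundary edges and satisfies an error equation
(`PolyMesh.error_equation`): tested with `e` itself, the discrete form of `e` equals the
stabilizer of `Q_b u`, plus the defect of the form at `Q_b u`, plus the consistency error of the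
flux `α∇u`.

*Stability.* On one element, the divergence theorem for `𝔰(v)² β` gives a discrete integration by
parts (`IsStarPolygon.abs_convection_sub_le`) in which the edge values `v` enter through the
fluxes of `v² β`. Over the mesh these fluxes cancel (`PolyMesh.sum_flux_sq_eq_zero`), so the
convection form on `W_h⁰` is skew-symmetric up to half the divergence of `β` and to `O(h)` times
the energy `S(v, v) + ‖∇_w v‖²` plus `‖𝔰(v)‖²` (`PolyMesh.abs_bForm_add_le`). As `c - ½∇·β ≥ 0`,
the lower-order terms are nonnegative up to this defect. The same identity for the field
`β(x) = x`, of divergence `2`, is a discrete Poincaré inequality (`PolyMesh.extSq_le`), so no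
duality argument is needed for `𝔰(v)`. The cancellation is not read off from the combinatorics of
the mesh: the edge values are approximated by test functions of `Ω`
(`PolyMesh.exists_isTestFunction_tendsto`), for which the divergence theorem holds on all of `Ω`.

*Consistency.* The Poincaré inequality (`IsStarPolygon.integral_sub_average_sq_le`) on the
elements yields an affine approximation of `u`, and hence the errors of `𝔰(Q_b u)` and `∇_w Q_b u`
(`leastSquares_consistency`, `gradient_consistency`). For the flux, whose normal trace is only
weakly defined, the value `α(z) m` for the slope `m` of the affine approximation is subtracted on
each element; the contribution of this constant vector is a sum over the edges which disappears
when the test functions tend to `v`. The rest has norm `O(h)`, also in thin layers at the boundary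
relative to their width (a trace inequality, `integral_boundaryLayer_sq_le`), and boundary terms
are bounded by averages over such layers of vanishing width (`abs_integral_weakDivergence_le`,
`abs_integral_flux_le`). Altogether the consistency error is `O(h)` times the square root of the
energy (`PolyMesh.abs_sum_flux_le`); for small `h` all terms with the energy of `e` on the
right-hand side are absorbed.

Traces and the divergence theorem on an element `T`, star-shaped with respect to a disc, are
obtained from polar coordinates about its centre: `T` is, up to a null set, the union of the
triangles over its edges (`IsStarPolygon.restrict_eq_sum_map`). The resulting formula for an
integral over `T` does not depend on the centre, and its derivative with respect to the centre is
an integral identity that implies the divergence theorem (`IsStarPolygon.integral_fderiv`). Weak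
derivatives are treated by approximation with smooth functions up to the boundary, by
mollification combined with a contraction towards the centre (`exists_smooth_approx`).
-/

open scoped ENNReal

/-! ### Star-shaped polygons -/

/-- A compact polygon `T`, star-shaped with respect to all points of the disc of radius `r` about
`z`, with edges `[a e, b e]`, `e ∈ E`, meeting only in endpoints, and unit outward normals `n e`. -/
structure IsStarPolygon {ι : Type*} (T : Set Plane) (E : Finset ι) (a b n : ι → Plane) (z : Plane)
    (r : ℝ) : Prop where
  isCompact : IsCompact T
  nonempty : T.Nonempty
  pos : 0 < r
  starConvex : ∀ y ∈ Metric.closedBall z r, StarConvex ℝ y T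
  ne : ∀ e ∈ E, a e ≠ b e
  inter : ∀ e ∈ E, ∀ e' ∈ E, e ≠ e' →
    segment ℝ (a e) (b e) ∩ segment ℝ (a e') (b e') ⊆ {a e, b e}
  frontier_eq : frontier T = ⋃ e ∈ E, segment ℝ (a e) (b e)
  norm_normal : ∀ e ∈ E, ‖n e‖ = 1
  orthogonal : ∀ e ∈ E, inner ℝ (n e) (b e - a e) = 0
  outward : ∀ e ∈ E, ∀ x ∈ openSegment ℝ (a e) (b e), ∀ᶠ t : ℝ in 𝓝[>] 0, x + t • n e ∉ T

/-- In the plane, a unit vector and a nonzero vector orthogonal to it span. -/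
theorem exists_eq_inner_smul_add_smul {n τ : Plane} (hn : ‖n‖ = 1) (hτ : τ ≠ 0)
    (h : inner ℝ n τ = 0) (v : Plane) : ∃ μ : ℝ, v = (inner ℝ n v : ℝ) • n + μ • τ := by
  have h1 : n 0 ^ 2 + n 1 ^ 2 = 1 := by
    have := EuclideanSpace.real_norm_sq_eq n
    rw [hn, Fin.sum_univ_two] at this
    linarith
  rw [PiLp.inner_apply, Fin.sum_univ_two] at h
  simp only [RCLike.inner_apply, conj_trivial] at h
  set k := n 0 * τ 1 - n 1 * τ 0 with hk
  have e0 : τ 0 = - k * n 1 := by rw [hk]; linear_combination (-τ 0) * h1 + n 0 * h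
  have e1 : τ 1 = k * n 0 := by rw [hk]; linear_combination (-τ 1) * h1 + n 1 * h
  have hk0 : k ≠ 0 := by
    intro h0
    apply hτ
    ext i
    fin_cases i
    · simp [e0, h0]
    · simp [e1, h0]
  refine ⟨(n 0 * v 1 - n 1 * v 0) / k, ?_⟩
  ext i
  fin_cases i
  · simp only [PiLp.inner_apply, Fin.sum_univ_two, RCLike.inner_apply, conj_trivial, Fin.zero_eta,
      PiLp.add_apply, PiLp.smul_apply, smul_eq_mul, e0]
    field_simp
    linear_combination (-v 0) * h1
  · simp only [PiLp.inner_apply, Fin.sum_univ_two, RCLike.inner_apply, conj_trivial, Fin.mk_one,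
      PiLp.add_apply, PiLp.smul_apply, smul_eq_mul, e1]
    field_simp
    linear_combination (-v 1) * h1

/-- Polar coordinates about `z` over the segment `[a, b]`: the point at the fraction `p.1` of the
way from `z` to the point of the segment with parameter `p.2`. -/
noncomputable def rayPt (z a b : Plane) (p : ℝ × ℝ) : Plane :=
  z + p.1 • (AffineMap.lineMap a b p.2 - z)

theorem continuous_rayPt (z a b : Plane) : Continuous (rayPt z a b) := by
  unfold rayPt
  simp only [AffineMap.lineMap_apply, vsub_eq_sub, vadd_eq_add]
  fun_prop

namespace IsStarPolygon

variable {ι : Type*} {T : Set Plane} {E : Finset ι} {a b n : ι → Plane} {z : Plane} {r : ℝ}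

theorem closedBall_subset (hT : IsStarPolygon T E a b n z r) : Metric.closedBall z r ⊆ T :=
  fun y hy => (hT.starConvex y hy).mem hT.nonempty

/-- Shrinking `T` towards the centre by the factor `l` leaves a margin of `(1 - l) * r`. -/
theorem closedBall_shrink_subset (hT : IsStarPolygon T E a b n z r) {x : Plane} (hx : x ∈ T)
    {l : ℝ} (hl0 : 0 ≤ l) (hl1 : l ≤ 1) :
    Metric.closedBall (z + l • (x - z)) ((1 - l) * r) ⊆ T := by
  intro w hw
  rw [mem_closedBall_iff_norm] at hw
  rcases hl1.eq_or_lt with rfl | hl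
  · simp only [sub_self, zero_mul, norm_le_zero_iff] at hw
    have : w = x := by rw [sub_eq_zero] at hw; rw [hw]; simp
    rwa [this]
  · have hl' : 0 < 1 - l := by linarith
    have hy : z + (1 - l)⁻¹ • (w - (z + l • (x - z))) ∈ Metric.closedBall z r := by
      rw [mem_closedBall_iff_norm, add_sub_cancel_left, norm_smul, norm_inv, Real.norm_eq_abs,
        abs_of_pos hl', inv_mul_le_iff₀ hl']
      exact hw
    have := hT.starConvex _ hy hx hl'.le hl0 (by ring)
    convert this using 1
    rw [smul_add, smul_smul, mul_inv_cancel₀ hl'.ne']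
    module

theorem shrink_mem_interior (hT : IsStarPolygon T E a b n z r) {x : Plane} (hx : x ∈ T)
    {l : ℝ} (hl0 : 0 ≤ l) (hl1 : l < 1) : z + l • (x - z) ∈ interior T := by
  rw [mem_interior_iff_mem_nhds]
  exact mem_of_superset (Metric.closedBall_mem_nhds _ (mul_pos (by linarith) hT.pos))
    (hT.closedBall_shrink_subset hx hl0 hl1.le)

theorem center_mem (hT : IsStarPolygon T E a b n z r) : z ∈ T :=
  hT.closedBall_subset (Metric.mem_closedBall_self hT.pos.le)

theorem isClosed (hT : IsStarPolygon T E a b n z r) : IsClosed T := hT.isCompact.isClosed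

theorem measurableSet (hT : IsStarPolygon T E a b n z r) : MeasurableSet T :=
  hT.isClosed.measurableSet

theorem edge_subset_frontier (hT : IsStarPolygon T E a b n z r) {e : ι} (he : e ∈ E) :
    segment ℝ (a e) (b e) ⊆ frontier T := by
  rw [hT.frontier_eq]
  exact subset_biUnion_of_mem (u := fun e => segment ℝ (a e) (b e)) he

theorem edge_subset (hT : IsStarPolygon T E a b n z r) {e : ι} (he : e ∈ E) :
    segment ℝ (a e) (b e) ⊆ T :=
  (hT.edge_subset_frontier he).trans hT.isClosed.frontier_subset

theorem lineMap_mem_frontier (hT : IsStarPolygon T E a b n z r) {e : ι} (he : e ∈ E) {t : ℝ}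
    (ht : t ∈ Icc (0 : ℝ) 1) : AffineMap.lineMap (a e) (b e) t ∈ frontier T := by
  apply hT.edge_subset_frontier he
  rw [segment_eq_image_lineMap]
  exact mem_image_of_mem _ ht

theorem lineMap_mem (hT : IsStarPolygon T E a b n z r) {e : ι} (he : e ∈ E) {t : ℝ}
    (ht : t ∈ Icc (0 : ℝ) 1) : AffineMap.lineMap (a e) (b e) t ∈ T :=
  hT.isClosed.frontier_subset (hT.lineMap_mem_frontier he ht)

theorem inner_lineMap (hT : IsStarPolygon T E a b n z r) {e : ι} (he : e ∈ E) (y : Plane) (t : ℝ) :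
    inner ℝ (n e) (AffineMap.lineMap (a e) (b e) t - y) = (inner ℝ (n e) (a e - y) : ℝ) := by
  have h : AffineMap.lineMap (a e) (b e) t - y = t • (b e - a e) + (a e - y) := by
    rw [AffineMap.lineMap_apply, vsub_eq_sub, vadd_eq_add]; abel
  rw [h, inner_add_right, inner_smul_right, hT.orthogonal e he]
  ring

/-- The kernel of `T` lies on the inner side of each edge. -/
theorem inner_normal_nonneg (hT : IsStarPolygon T E a b n z r) {e : ι} (he : e ∈ E) {y : Plane}
    (hy : y ∈ Metric.closedBall z r) : (0 : ℝ) ≤ inner ℝ (n e) (a e - y) := by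
  by_contra! hneg
  set x : Plane := AffineMap.lineMap (a e) (b e) (1 / 2 : ℝ) with hx
  have hxo : x ∈ openSegment ℝ (a e) (b e) := by
    rw [openSegment_eq_image_lineMap]
    exact mem_image_of_mem _ (by norm_num)
  set c : ℝ := inner ℝ (n e) (y - x) with hc
  have hc0 : 0 < c := by
    have := hT.inner_lineMap he y (1 / 2)
    rw [hc, ← neg_sub x y, inner_neg_right, hx, this]
    linarith
  obtain ⟨μ, hμ⟩ := exists_eq_inner_smul_add_smul (hT.norm_normal e he)
    (sub_ne_zero.2 (hT.ne e he).symm) (hT.orthogonal e he) (y - x)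
  rw [← hc] at hμ
  -- for small `t`, the point `x + t • n e` lies on a segment from `y` to a point of the edge
  have key : ∀ᶠ t : ℝ in 𝓝[>] 0, x + t • n e ∈ T := by
    have c1 : ContinuousAt (fun t : ℝ => 1 / 2 - (t / c) * μ / (1 - t / c)) 0 := by
      apply ContinuousAt.sub continuousAt_const
      apply ContinuousAt.div
      · fun_prop
      · fun_prop
      · simp
    have e1 : ∀ᶠ t : ℝ in 𝓝 0, 1 / 2 - (t / c) * μ / (1 - t / c) ∈ Icc (0 : ℝ) 1 := by
      apply c1.eventually_mem
      simp only [zero_div, zero_mul, sub_zero]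
      exact Icc_mem_nhds (by norm_num) (by norm_num)
    have e2 : ∀ᶠ t : ℝ in 𝓝 0, t < c := eventually_lt_nhds hc0
    filter_upwards [mem_nhdsWithin_of_mem_nhds e1, mem_nhdsWithin_of_mem_nhds e2,
      self_mem_nhdsWithin] with t ht1 ht2 ht0
    have ht0 : 0 < t := ht0
    have hl0 : 0 < t / c := div_pos ht0 hc0
    have hl1 : 0 < 1 - t / c := by rw [sub_pos, div_lt_one hc0]; exact ht2
    have := hT.starConvex y hy (hT.lineMap_mem he ht1) hl0.le hl1.le (by ring)
    convert this using 1
    have hy' : y = x + (c • n e + μ • (b e - a e)) := by rw [← hμ]; abel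
    have e3 : AffineMap.lineMap (a e) (b e) (1 / 2 - (t / c) * μ / (1 - t / c))
        = x - ((t / c) * μ / (1 - t / c)) • (b e - a e) := by
      rw [hx]; simp only [AffineMap.lineMap_apply, vsub_eq_sub, vadd_eq_add]; module
    have e4 : (t / c) • (c • n e) = t • n e := by
      rw [smul_smul, div_mul_cancel₀ _ hc0.ne']
    have e5 : (1 - t / c) • ((t / c * μ / (1 - t / c)) • (b e - a e))
        = (t / c * μ) • (b e - a e) := by
      rw [smul_smul, mul_div_cancel₀ _ hl1.ne']
    rw [e3, hy', smul_sub (1 - t / c), e5, smul_add (t / c), smul_add (t / c), e4]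
    module
  obtain ⟨t, h1, h2⟩ := (key.and (hT.outward e he x hxo)).exists
  exact h2 h1

/-- The distance of the centre to the line through an edge is at least `r`. -/
theorem le_inner_normal (hT : IsStarPolygon T E a b n z r) {e : ι} (he : e ∈ E) :
    r ≤ inner ℝ (n e) (a e - z) := by
  have hy : z + r • n e ∈ Metric.closedBall z r := by
    rw [mem_closedBall_iff_norm, add_sub_cancel_left, norm_smul, hT.norm_normal e he,
      Real.norm_eq_abs, abs_of_pos hT.pos, mul_one]
  have h := hT.inner_normal_nonneg he hy
  rw [← sub_sub, inner_sub_right, inner_smul_right, real_inner_self_eq_norm_sq,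
    hT.norm_normal e he] at h
  linarith

theorem recenter (hT : IsStarPolygon T E a b n z r) {y : Plane} {r' : ℝ} (hr' : 0 < r')
    (hy : Metric.closedBall y r' ⊆ Metric.closedBall z r) : IsStarPolygon T E a b n y r' :=
  { hT with pos := hr', starConvex := fun x hx => hT.starConvex x (hy hx) }

/-- Rays from the centre meet the boundary only once. -/
theorem eq_of_ray_eq (hT : IsStarPolygon T E a b n z r) {y y' : Plane} (hy : y ∈ frontier T)
    (hy' : y' ∈ frontier T) {s s' : ℝ} (hs : 0 < s) (hs' : 0 < s')
    (h : z + s • (y - z) = z + s' • (y' - z)) : s = s' := by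
  wlog hle : s' ≤ s generalizing s s' y y'
  · exact (this hy' hy hs' hs h.symm (le_of_not_ge hle)).symm
  rcases hle.eq_or_lt with h' | h'
  · exact h'.symm
  exfalso
  have e : y = z + (s' / s) • (y' - z) := by
    have h1 : s • (y - z) = s' • (y' - z) := add_left_cancel h
    rw [div_eq_inv_mul, mul_smul, ← h1, smul_smul, inv_mul_cancel₀ hs.ne']
    simp
  have := hT.shrink_mem_interior (hT.isClosed.frontier_subset hy') (div_nonneg hs'.le hs.le)
    ((div_lt_one hs).2 h')
  rw [← e] at this
  exact hy.2 this

/-- Every point of `T` lies on a segment from the centre to a boundary point. -/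
theorem exists_frontier_ray (hT : IsStarPolygon T E a b n z r) {x : Plane} (hx : x ∈ T)
    (hxz : x ≠ z) : ∃ y ∈ frontier T, ∃ s ∈ Ioc (0 : ℝ) 1, x = z + s • (y - z) := by
  set A : Set ℝ := (fun l : ℝ => z + l • (x - z)) ⁻¹' T with hA
  have hcl : IsClosed A := hT.isClosed.preimage (by fun_prop)
  have hpos : 0 < ‖x - z‖ := norm_pos_iff.2 (sub_ne_zero.2 hxz)
  obtain ⟨R, hR⟩ := hT.isCompact.isBounded.subset_closedBall z
  have hbd : BddAbove A := by
    refine ⟨R / ‖x - z‖, fun l hl => ?_⟩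
    have h1 := hR hl
    simp only [mem_closedBall_iff_norm, add_sub_cancel_left, norm_smul] at h1
    rw [le_div_iff₀ hpos]
    exact le_trans (mul_le_mul_of_nonneg_right (le_abs_self l) hpos.le) h1
  have h1A : (1 : ℝ) ∈ A := by simp [hA, hx]
  have hmem : sSup A ∈ A := hcl.csSup_mem ⟨1, h1A⟩ hbd
  have hge : 1 ≤ sSup A := le_csSup hbd h1A
  have hS0 : 0 < sSup A := by linarith
  refine ⟨z + sSup A • (x - z), ⟨subset_closure hmem, fun hint => ?_⟩, (sSup A)⁻¹,
    ⟨inv_pos.2 hS0, inv_le_one_of_one_le₀ hge⟩, ?_⟩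
  · have hc : ContinuousAt (fun l : ℝ => z + l • (x - z)) (sSup A) := by fun_prop
    have hev : ∀ᶠ l in 𝓝 (sSup A), l ∈ A := by
      filter_upwards [hc.eventually_mem (isOpen_interior.mem_nhds hint)] with l hl
      exact (interior_subset hl : _ ∈ T)
    have hev' : ∀ᶠ l in 𝓝[>] (sSup A), l ∈ A := mem_nhdsWithin_of_mem_nhds hev
    obtain ⟨l, hl, hl2⟩ := (hev'.and self_mem_nhdsWithin).exists
    exact absurd (le_csSup hbd hl) (not_le.2 hl2)
  · rw [add_sub_cancel_left, smul_smul, inv_mul_cancel₀ hS0.ne']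
    simp

end IsStarPolygon

/-! ### Polar coordinates about the centre -/

/-- The open unit square, the parameter domain of `rayPt`. -/
abbrev unitSquare : Set (ℝ × ℝ) := Ioo (0 : ℝ) 1 ×ˢ Ioo (0 : ℝ) 1

/-- The measure `s w ds dt` on the unit square: the area element of `rayPt` over an edge of
length `ℓ` at distance `d` from the centre is `s ℓ d ds dt`. -/
noncomputable def rayMeasure (w : ℝ) : Measure (ℝ × ℝ) :=
  (volume.restrict unitSquare).withDensity (fun p => ENNReal.ofReal (p.1 * w))

theorem measurableSet_unitSquare : MeasurableSet unitSquare :=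
  measurableSet_Ioo.prod measurableSet_Ioo

/-- The coordinates of the plane, as a measurable equivalence. -/
noncomputable def planeCoord : Plane ≃ᵐ ℝ × ℝ :=
  (MeasurableEquiv.toLp 2 (Fin 2 → ℝ)).symm.trans MeasurableEquiv.finTwoArrow

theorem planeCoord_apply (x : Plane) : planeCoord x = (x 0, x 1) := rfl

theorem measurePreserving_planeCoord : MeasurePreserving planeCoord :=
  (volume_preserving_finTwoArrow ℝ).comp
    (EuclideanSpace.volume_preserving_symm_measurableEquiv_toLp (Fin 2))

/-- The derivative of polar coordinates, as a matrix in the coordinates of the plane, for which the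
Jacobian determinant can be computed. -/
theorem hasFDerivAt_planeCoord_rayPt (z a b : Plane) (p : ℝ × ℝ) :
    HasFDerivAt (fun p => planeCoord (rayPt z a b p))
      (Matrix.toLin (.finTwoProd ℝ) (.finTwoProd ℝ)
        !![(a 0 - z 0) + p.2 * (b 0 - a 0), p.1 * (b 0 - a 0);
          (a 1 - z 1) + p.2 * (b 1 - a 1), p.1 * (b 1 - a 1)]).toContinuousLinearMap p := by
  rw [Matrix.toLin_finTwoProd_toContinuousLinearMap]
  have hf : (fun p => planeCoord (rayPt z a b p)) = fun p : ℝ × ℝ =>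
      (z 0 + p.1 * ((a 0 - z 0) + p.2 * (b 0 - a 0)),
        z 1 + p.1 * ((a 1 - z 1) + p.2 * (b 1 - a 1))) := by
    funext p
    rw [planeCoord_apply]
    simp only [rayPt, AffineMap.lineMap_apply, vsub_eq_sub, vadd_eq_add, PiLp.add_apply,
      PiLp.smul_apply, PiLp.sub_apply, smul_eq_mul]
    ext <;> simp only [] <;> ring
  rw [hf]
  have h (i : Fin 2) : HasFDerivAt
      (fun p : ℝ × ℝ => z i + p.1 * ((a i - z i) + p.2 * (b i - a i)))
      (((a i - z i) + p.2 * (b i - a i)) • ContinuousLinearMap.fst ℝ ℝ ℝ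
        + (p.1 * (b i - a i)) • ContinuousLinearMap.snd ℝ ℝ ℝ) p := by
    have h1 : HasFDerivAt (fun p : ℝ × ℝ => p.1) (ContinuousLinearMap.fst ℝ ℝ ℝ) p :=
      hasFDerivAt_fst
    have h2 : HasFDerivAt (fun p : ℝ × ℝ => p.2) (ContinuousLinearMap.snd ℝ ℝ ℝ) p :=
      hasFDerivAt_snd
    refine ((h1.fun_mul ((h2.mul_const (b i - a i)).const_add (a i - z i))).const_add
      (z i)).congr_fderiv ?_
    rw [smul_smul, add_comm]
  exact (h 0).prodMk (h 1)

theorem injOn_rayPt {z a b n : Plane} (hab : a ≠ b)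
    (ho : inner ℝ n (b - a) = 0) (hd : (0 : ℝ) < inner ℝ n (a - z)) :
    InjOn (rayPt z a b) unitSquare := by
  have hinner (p : ℝ × ℝ) : inner ℝ n (rayPt z a b p - z) = p.1 * inner ℝ n (a - z) := by
    have : rayPt z a b p - z = p.1 • (a - z) + (p.1 * p.2) • (b - a) := by
      simp only [rayPt, AffineMap.lineMap_apply, vsub_eq_sub, vadd_eq_add]; module
    rw [this, inner_add_right, inner_smul_right, inner_smul_right, ho]; ring
  rintro ⟨s, t⟩ ⟨hs, ht⟩ ⟨s', t'⟩ ⟨hs', ht'⟩ h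
  have h1 := hinner (s, t)
  rw [h, hinner] at h1
  have h2 : s' = s := mul_right_cancel₀ hd.ne' h1
  subst h2
  simp only [rayPt] at h
  have h3 := smul_right_injective _ (ne_of_gt hs.1) (add_left_cancel h)
  have h4 := AffineMap.lineMap_injective ℝ hab (sub_left_injective h3)
  rw [h4]

/-- The part of a star polygon over one edge in polar coordinates. -/
theorem map_rayMeasure {z a b n : Plane} (hab : a ≠ b) (hn : ‖n‖ = 1)
    (ho : inner ℝ n (b - a) = 0) (hd : (0 : ℝ) < inner ℝ n (a - z)) :
    Measure.map (rayPt z a b) (rayMeasure (dist a b * inner ℝ n (a - z)))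
      = volume.restrict (rayPt z a b '' unitSquare) := by
  have hinj := injOn_rayPt hab ho hd
  -- the Jacobian determinant: writing `b - a` as a multiple of the rotated normal, it is
  -- `p.1 * |e| * d`, with `d` the distance of `z` to the edge
  have hdet (p : ℝ × ℝ) (hp : p ∈ unitSquare) :
      |(Matrix.toLin (.finTwoProd ℝ) (.finTwoProd ℝ)
        !![(a 0 - z 0) + p.2 * (b 0 - a 0), p.1 * (b 0 - a 0);
          (a 1 - z 1) + p.2 * (b 1 - a 1), p.1 * (b 1 - a 1)]).toContinuousLinearMap.det|
        = p.1 * (dist a b * inner ℝ n (a - z)) := by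
    have hp0 : 0 < p.1 := hp.1.1
    rw [ContinuousLinearMap.det, LinearMap.coe_toContinuousLinearMap, LinearMap.det_toLin,
      Matrix.det_fin_two_of]
    have hn1 : n 0 ^ 2 + n 1 ^ 2 = 1 := by
      have := EuclideanSpace.real_norm_sq_eq n
      rw [hn, Fin.sum_univ_two] at this
      linarith
    set d : ℝ := inner ℝ n (a - z) with hdd
    have ho' := ho
    rw [PiLp.inner_apply, Fin.sum_univ_two] at ho' hdd
    simp only [RCLike.inner_apply, conj_trivial, PiLp.sub_apply] at ho' hdd
    obtain ⟨k, hk⟩ : ∃ k, k = n 0 * (b 1 - a 1) - n 1 * (b 0 - a 0) := ⟨_, rfl⟩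
    have e0 : b 0 - a 0 = - k * n 1 := by
      rw [hk]; linear_combination (-(b 0 - a 0)) * hn1 + n 0 * ho'
    have e1 : b 1 - a 1 = k * n 0 := by
      rw [hk]; linear_combination (-(b 1 - a 1)) * hn1 + n 1 * ho'
    have hdist : dist a b = |k| := by
      rw [EuclideanSpace.dist_eq, Fin.sum_univ_two, Real.dist_eq, Real.dist_eq, sq_abs, sq_abs,
        ← Real.sqrt_sq_eq_abs]
      congr 1
      linear_combination (-(a 0 - b 0 + k * n 1)) * e0 - (a 1 - b 1 - k * n 0) * e1 + k ^ 2 * hn1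
    have : ((a 0 - z 0) + p.2 * (b 0 - a 0)) * (p.1 * (b 1 - a 1))
        - p.1 * (b 0 - a 0) * ((a 1 - z 1) + p.2 * (b 1 - a 1)) = p.1 * (k * d) := by
      rw [e0, e1, hdd]; ring
    rw [this, abs_mul, abs_mul, abs_of_pos hp0, abs_of_pos hd, hdist]
  -- change of variables in coordinates, to be transferred back to the plane
  have hmap := map_withDensity_abs_det_fderiv_eq_addHaar
    (volume : Measure (ℝ × ℝ)) measurableSet_unitSquare.nullMeasurableSet
    (fun p _ => (hasFDerivAt_planeCoord_rayPt z a b p).hasFDerivWithinAt)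
    (planeCoord.injective.comp_injOn hinj)
  have hdens : (volume.restrict unitSquare).withDensity (fun p => ENNReal.ofReal
      |(Matrix.toLin (.finTwoProd ℝ) (.finTwoProd ℝ)
        !![(a 0 - z 0) + p.2 * (b 0 - a 0), p.1 * (b 0 - a 0);
          (a 1 - z 1) + p.2 * (b 1 - a 1), p.1 * (b 1 - a 1)]).toContinuousLinearMap.det|)
      = rayMeasure (dist a b * inner ℝ n (a - z)) := by
    apply withDensity_congr_ae
    filter_upwards [ae_restrict_mem measurableSet_unitSquare] with p hp
    rw [hdet p hp]
  rw [hdens] at hmap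
  have h2 := congrArg (Measure.map planeCoord.symm) hmap
  have hm : Measurable fun p => planeCoord (rayPt z a b p) :=
    planeCoord.measurable.comp (continuous_rayPt z a b).measurable
  rw [Measure.map_map planeCoord.symm.measurable hm] at h2
  have e1 : planeCoord.symm ∘ (fun p => planeCoord (rayPt z a b p)) = rayPt z a b := by
    funext p; simp
  have e2 : (fun p => planeCoord (rayPt z a b p)) '' unitSquare
      = planeCoord.symm ⁻¹' (rayPt z a b '' unitSquare) := by
    rw [← MeasurableEquiv.image_eq_preimage_symm, image_image]
  rw [e1, e2] at h2
  rw [h2]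
  exact (measurePreserving_planeCoord.symm.restrict_preimage_emb
    planeCoord.symm.measurableEmbedding _).map_eq

theorem volume_segment_eq_zero (a b : Plane) : volume (segment ℝ a b) = 0 := by
  refine measure_mono_null ?_
    (Measure.addHaar_affineSubspace volume (affineSpan ℝ {a, b}) fun h => ?_)
  · rw [← convexHull_pair]
    exact convexHull_subset_affineSpan _
  · have h1 : Module.finrank ℝ (vectorSpan ℝ {a, b}) ≤ 1 :=
      collinear_iff_finrank_le_one.1 (collinear_pair ℝ a b)
    rw [← direction_affineSpan, h, AffineSubspace.direction_top, finrank_top,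
      finrank_euclideanSpace_fin] at h1
    omega

theorem restrict_biUnion_finset_eq_sum {X ι : Type*} [MeasurableSpace X] {μ : Measure X}
    (E : Finset ι) {s : ι → Set X} (hd : ∀ e ∈ E, ∀ e' ∈ E, e ≠ e' → Disjoint (s e) (s e'))
    (hm : ∀ e ∈ E, MeasurableSet (s e)) :
    μ.restrict (⋃ e ∈ E, s e) = ∑ e ∈ E, μ.restrict (s e) := by
  classical
  induction E using Finset.induction_on with
  | empty => simp
  | insert e E he ih =>
    rw [Finset.set_biUnion_insert, Finset.sum_insert he, ← ih, Measure.restrict_union]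
    · rw [Set.disjoint_iUnion₂_right]
      intro e' he'
      exact hd e (by simp) e' (by simp [he']) (by rintro rfl; exact he he')
    · exact Finset.measurableSet_biUnion _ fun e' he' => hm e' (by simp [he'])
    · exact fun e₁ h₁ e₂ h₂ => hd e₁ (by simp [h₁]) e₂ (by simp [h₂])
    · exact fun e₁ h₁ => hm e₁ (by simp [h₁])

namespace IsStarPolygon

variable {ι : Type*} {T : Set Plane} {E : Finset ι} {a b n : ι → Plane} {z : Plane} {r : ℝ}

theorem volume_frontier (hT : IsStarPolygon T E a b n z r) : volume (frontier T) = 0 := by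
  rw [hT.frontier_eq]
  exact (measure_biUnion_null_iff E.countable_toSet).2 fun e _ => volume_segment_eq_zero _ _

theorem rayPt_mem (hT : IsStarPolygon T E a b n z r) {e : ι} (he : e ∈ E) {p : ℝ × ℝ}
    (h1 : p.1 ∈ Icc (0 : ℝ) 1) (h2 : p.2 ∈ Icc (0 : ℝ) 1) : rayPt z (a e) (b e) p ∈ T := by
  apply hT.closedBall_shrink_subset (hT.lineMap_mem he h2) h1.1 h1.2
  exact Metric.mem_closedBall_self (mul_nonneg (by linarith [h1.2]) hT.pos.le)

theorem inner_normal_pos (hT : IsStarPolygon T E a b n z r) {e : ι} (he : e ∈ E) :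
    (0 : ℝ) < inner ℝ (n e) (a e - z) := hT.pos.trans_le (hT.le_inner_normal he)

theorem disjoint_image_rayPt (hT : IsStarPolygon T E a b n z r) {e e' : ι} (he : e ∈ E)
    (he' : e' ∈ E) (hne : e ≠ e') :
    Disjoint (rayPt z (a e) (b e) '' unitSquare) (rayPt z (a e') (b e') '' unitSquare) := by
  rw [Set.disjoint_left]
  rintro _ ⟨⟨s, t⟩, ⟨hs, ht⟩, rfl⟩ ⟨⟨s', t'⟩, ⟨hs', ht'⟩, h⟩
  have h1 := hT.lineMap_mem_frontier he (Ioo_subset_Icc_self ht)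
  have h2 := hT.lineMap_mem_frontier he' (Ioo_subset_Icc_self ht')
  have h3 := hT.eq_of_ray_eq h2 h1 hs'.1 hs.1 h
  simp only [rayPt] at h h3
  subst h3
  have h4 := sub_left_injective (smul_right_injective _ (ne_of_gt hs.1) (add_left_cancel h))
  have h5 : AffineMap.lineMap (a e) (b e) t ∈ segment ℝ (a e) (b e) ∩ segment ℝ (a e') (b e') := by
    constructor
    · rw [segment_eq_image_lineMap]; exact mem_image_of_mem _ (Ioo_subset_Icc_self ht)
    · rw [← h4, segment_eq_image_lineMap]; exact mem_image_of_mem _ (Ioo_subset_Icc_self ht')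
  have hinj := AffineMap.lineMap_injective ℝ (hT.ne e he)
  rcases hT.inter e he e' he' hne h5 with h6 | h6
  · have := hinj (h6.trans (AffineMap.lineMap_apply_zero (k := ℝ) (a e) (b e)).symm)
    exact ht.1.ne' this
  · have := hinj (Eq.trans h6 (AffineMap.lineMap_apply_one (k := ℝ) (a e) (b e)).symm)
    exact ht.2.ne this

/-- Up to a null set, a star polygon is the union of the open triangles over its edges. -/
theorem ae_eq_biUnion (hT : IsStarPolygon T E a b n z r) :
    (⋃ e ∈ E, rayPt z (a e) (b e) '' unitSquare) =ᵐ[volume] T := by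
  -- the boundary and the segments from the centre to the vertices are negligible
  have hnull : volume (frontier T ∪ ⋃ e ∈ E, (segment ℝ z (a e) ∪ segment ℝ z (b e))) = 0 := by
    rw [measure_union_null_iff]
    refine ⟨hT.volume_frontier, (measure_biUnion_null_iff E.countable_toSet).2 fun e _ => ?_⟩
    rw [measure_union_null_iff]
    exact ⟨volume_segment_eq_zero _ _, volume_segment_eq_zero _ _⟩
  have hpt : volume ({z} : Set Plane) = 0 := measure_singleton z
  have hae : ∀ᵐ x : Plane, x ∉ frontier T ∪ ⋃ e ∈ E, (segment ℝ z (a e) ∪ segment ℝ z (b e)) :=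
    measure_eq_zero_iff_ae_notMem.1 hnull
  filter_upwards [hae, measure_eq_zero_iff_ae_notMem.1 hpt] with x hx hxz
  apply propext
  constructor
  · intro h
    obtain ⟨e, he, p, hp, rfl⟩ := mem_iUnion₂.1 h
    exact hT.rayPt_mem he (Ioo_subset_Icc_self hp.1) (Ioo_subset_Icc_self hp.2)
  · intro h
    obtain ⟨y, hy, s, hs, rfl⟩ := hT.exists_frontier_ray h hxz
    have hy' := hy
    rw [hT.frontier_eq] at hy'
    obtain ⟨e, he, hye⟩ := mem_iUnion₂.1 hy'
    rw [segment_eq_image_lineMap] at hye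
    obtain ⟨t, ht, rfl⟩ := hye
    have hs1 : s < 1 := lt_of_le_of_ne hs.2 (by
      rintro rfl
      apply hx
      left
      simpa using hy)
    have hseg (w : Plane) : z + s • (w - z) ∈ segment ℝ z w := by
      rw [segment_eq_image_lineMap]
      exact ⟨s, ⟨hs.1.le, hs.2⟩, by
        rw [AffineMap.lineMap_apply, vsub_eq_sub, vadd_eq_add, add_comm]⟩
    have ht0 : 0 < t := lt_of_le_of_ne ht.1 (by
      rintro rfl
      apply hx
      right
      refine mem_iUnion₂.2 ⟨e, he, Or.inl ?_⟩
      rw [AffineMap.lineMap_apply_zero]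
      exact hseg _)
    have ht1 : t < 1 := lt_of_le_of_ne ht.2 (by
      rintro rfl
      apply hx
      right
      refine mem_iUnion₂.2 ⟨e, he, Or.inr ?_⟩
      rw [AffineMap.lineMap_apply_one]
      exact hseg _)
    exact mem_iUnion₂.2 ⟨e, he, (s, t), ⟨⟨hs.1, hs1⟩, ⟨ht0, ht1⟩⟩, rfl⟩

/-- Polar coordinates on a star polygon. -/
theorem restrict_eq_sum_map (hT : IsStarPolygon T E a b n z r) :
    volume.restrict T = ∑ e ∈ E, Measure.map (rayPt z (a e) (b e))
      (rayMeasure (dist (a e) (b e) * inner ℝ (n e) (a e - z))) := by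
  rw [← Measure.restrict_congr_set hT.ae_eq_biUnion, restrict_biUnion_finset_eq_sum]
  · refine Finset.sum_congr rfl fun e he => ?_
    rw [map_rayMeasure (hT.ne e he) (hT.norm_normal e he) (hT.orthogonal e he)
      (hT.inner_normal_pos he)]
  · exact fun e he e' he' => hT.disjoint_image_rayPt he he'
  · exact fun e he => measurableSet_unitSquare.image_of_continuousOn_injOn
      (continuous_rayPt _ _ _).continuousOn
      (injOn_rayPt (hT.ne e he) (hT.orthogonal e he) (hT.inner_normal_pos he))

theorem setIntegral_eq_sum (hT : IsStarPolygon T E a b n z r) {f : Plane → ℝ}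
    (hf : IntegrableOn f T) : ∫ x in T, f x = ∑ e ∈ E, ∫ p in unitSquare,
      p.1 * (dist (a e) (b e) * inner ℝ (n e) (a e - z)) * f (rayPt z (a e) (b e) p) := by
  unfold IntegrableOn at hf
  rw [hT.restrict_eq_sum_map] at hf ⊢
  rw [integrable_finsetSum_measure] at hf
  rw [integral_finsetSum_measure hf]
  refine Finset.sum_congr rfl fun e he => ?_
  rw [integral_map (continuous_rayPt _ _ _).measurable.aemeasurable (hf e he).aestronglyMeasurable,
    rayMeasure, integral_withDensity_eq_integral_toReal_smul (by fun_prop)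
      (by exact Eventually.of_forall fun _ => ENNReal.ofReal_lt_top)]
  refine setIntegral_congr_fun measurableSet_unitSquare fun p hp => ?_
  rw [ENNReal.toReal_ofReal, smul_eq_mul]
  exact mul_nonneg hp.1.1.le (mul_nonneg dist_nonneg (hT.inner_normal_pos he).le)

end IsStarPolygon

/-! ### Boundary profiles and layers -/

/-- The weighted sum over the edges of the averages of `f` over the boundary scaled by `s` about
`z`. With the weights `w e = |e| d_e`, `d_e` being the distance of `z` to the edge, `s` times this
is the density in `s` of the integral of `f` over the polygon. -/
noncomputable def edgeProfile {ι : Type*} (E : Finset ι) (a b : ι → Plane) (z : Plane) (w : ι → ℝ)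
    (f : Plane → ℝ) (s : ℝ) : ℝ :=
  ∑ e ∈ E, w e * ∫ t in (0 : ℝ)..1, f (rayPt z (a e) (b e) (s, t))

/-- The weight `|e| d_e` of an edge in polar coordinates. -/
noncomputable abbrev edgeWeight {ι : Type*} (a b n : ι → Plane) (z : Plane) (e : ι) : ℝ :=
  dist (a e) (b e) * inner ℝ (n e) (a e - z)

/-- The points of `T` outside of `T` scaled by `1 - δ` about `z`. -/
def boundaryLayer (T : Set Plane) (z : Plane) (δ : ℝ) : Set Plane :=
  {x ∈ T | z + (1 - δ)⁻¹ • (x - z) ∉ T}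

section Profile

variable {ι : Type*} {E : Finset ι} {a b : ι → Plane} {z : Plane} {w : ι → ℝ} {f g : Plane → ℝ}

theorem continuous_rayAvg (hf : Continuous f) (z a b : Plane) :
    Continuous fun s : ℝ => ∫ t in (0 : ℝ)..1, f (rayPt z a b (s, t)) := by
  apply intervalIntegral.continuous_parametric_intervalIntegral_of_continuous'
  have := continuous_rayPt z a b
  exact hf.comp (this.comp (by fun_prop : Continuous fun p : ℝ × ℝ => (p.1, p.2)))

theorem intervalIntegrable_ray (hf : Continuous f) (z a b : Plane) (s : ℝ) :
    IntervalIntegrable (fun t => f (rayPt z a b (s, t))) volume 0 1 := by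
  apply Continuous.intervalIntegrable
  exact hf.comp ((continuous_rayPt z a b).comp (by fun_prop))

theorem continuous_edgeProfile (hf : Continuous f) : Continuous (edgeProfile E a b z w f) :=
  continuous_finsetSum _ fun _ _ => continuous_const.mul (continuous_rayAvg hf _ _ _)

theorem edgeProfile_const_mul (c : ℝ) (s : ℝ) :
    edgeProfile E a b z w (fun x => c * f x) s = c * edgeProfile E a b z w f s := by
  unfold edgeProfile
  rw [Finset.mul_sum]
  refine Finset.sum_congr rfl fun e _ => ?_
  rw [intervalIntegral.integral_const_mul]
  ring

theorem edgeProfile_mono (hw : ∀ e ∈ E, 0 ≤ w e) (hf : Continuous f) (hg : Continuous g)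
    {s : ℝ} (h : ∀ e ∈ E, ∀ t ∈ Icc (0 : ℝ) 1,
      f (rayPt z (a e) (b e) (s, t)) ≤ g (rayPt z (a e) (b e) (s, t))) :
    edgeProfile E a b z w f s ≤ edgeProfile E a b z w g s := by
  refine Finset.sum_le_sum fun e he => mul_le_mul_of_nonneg_left ?_ (hw e he)
  exact intervalIntegral.integral_mono_on zero_le_one (intervalIntegrable_ray hf _ _ _ _)
    (intervalIntegrable_ray hg _ _ _ _) (h e he)

theorem rayPt_scale (z a b : Plane) (ρ s t : ℝ) :
    z + ρ • (rayPt z a b (s, t) - z) = rayPt z a b (ρ * s, t) := by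
  simp only [rayPt, add_sub_cancel_left, smul_smul]

theorem edgeProfile_scale (ρ s : ℝ) :
    edgeProfile E a b z w (fun x => f (z + ρ • (x - z))) s = edgeProfile E a b z w f (ρ * s) := by
  simp only [edgeProfile, rayPt_scale]

theorem setIntegral_prod_ray (hf : Continuous f) {k : ℝ → ℝ} (hk : Continuous k) (z a b : Plane)
    {l : ℝ} (hl : l ≤ 1) :
    ∫ p in Ioo l 1 ×ˢ Ioo (0 : ℝ) 1, k p.1 * f (rayPt z a b p)
      = ∫ s in l..1, k s * ∫ t in (0 : ℝ)..1, f (rayPt z a b (s, t)) := by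
  have hc : Continuous fun p : ℝ × ℝ => k p.1 * f (rayPt z a b p) :=
    (hk.comp continuous_fst).mul (hf.comp (continuous_rayPt z a b))
  have hi : IntegrableOn (fun p : ℝ × ℝ => k p.1 * f (rayPt z a b p)) (Ioo l 1 ×ˢ Ioo (0 : ℝ) 1)
      (volume.prod volume) :=
    ((hc.continuousOn.integrableOn_compact (μ := volume)
      (isCompact_Icc.prod isCompact_Icc)).mono_set
      (prod_mono Ioo_subset_Icc_self Ioo_subset_Icc_self) :)
  rw [Measure.volume_eq_prod, setIntegral_prod _ hi, intervalIntegral.integral_of_le hl,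
    ← integral_Ioc_eq_integral_Ioo]
  congr 1
  funext s
  rw [intervalIntegral.integral_of_le zero_le_one, ← integral_const_mul,
    ← integral_Ioc_eq_integral_Ioo]

end Profile

namespace IsStarPolygon

variable {ι : Type*} {T : Set Plane} {E : Finset ι} {a b n : ι → Plane} {z : Plane} {r : ℝ}

theorem edgeWeight_nonneg (hT : IsStarPolygon T E a b n z r) {e : ι} (he : e ∈ E) :
    0 ≤ edgeWeight a b n z e := mul_nonneg dist_nonneg (hT.inner_normal_pos he).le

theorem integrableOn (hT : IsStarPolygon T E a b n z r) {f : Plane → ℝ} (hf : Continuous f) :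
    IntegrableOn f T := hf.continuousOn.integrableOn_compact hT.isCompact

theorem integral_eq_edgeProfile (hT : IsStarPolygon T E a b n z r) {f : Plane → ℝ}
    (hf : Continuous f) :
    ∫ x in T, f x = ∫ s in (0 : ℝ)..1, s * edgeProfile E a b z (edgeWeight a b n z) f s := by
  rw [hT.setIntegral_eq_sum (hT.integrableOn hf)]
  simp only [edgeProfile, Finset.mul_sum]
  rw [intervalIntegral.integral_finsetSum]
  · refine Finset.sum_congr rfl fun e he => ?_
    have h := setIntegral_prod_ray (k := fun s => s * edgeWeight a b n z e) hf (by fun_prop) z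
      (a e) (b e) zero_le_one
    simp only [mul_assoc] at h ⊢
    exact h
  · intro e he
    apply Continuous.intervalIntegrable
    exact continuous_id.mul (continuous_const.mul (continuous_rayAvg hf _ _ _))

theorem measurableSet_boundaryLayer (hT : IsStarPolygon T E a b n z r) (δ : ℝ) :
    MeasurableSet (boundaryLayer T z δ) := by
  have : boundaryLayer T z δ = T ∩ ((fun x => z + (1 - δ)⁻¹ • (x - z)) ⁻¹' T)ᶜ := rfl
  rw [this]
  exact hT.measurableSet.inter (hT.measurableSet.preimage (by fun_prop)).compl

/-- In polar coordinates the boundary layer is the set `1 - δ < s`. -/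
theorem rayPt_mem_boundaryLayer_iff (hT : IsStarPolygon T E a b n z r) {δ : ℝ}
    (hδ1 : δ < 1) {e : ι} (he : e ∈ E) {p : ℝ × ℝ} (hp : p ∈ unitSquare) :
    rayPt z (a e) (b e) p ∈ boundaryLayer T z δ ↔ 1 - δ < p.1 := by
  have hδ : 0 < 1 - δ := by linarith
  have hscale : z + (1 - δ)⁻¹ • (rayPt z (a e) (b e) p - z)
      = rayPt z (a e) (b e) ((1 - δ)⁻¹ * p.1, p.2) := rayPt_scale _ _ _ _ _ _
  have hmem := hT.rayPt_mem he (Ioo_subset_Icc_self hp.1) (Ioo_subset_Icc_self hp.2)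
  simp only [boundaryLayer, mem_ofPred_eq, hmem, true_and, hscale]
  constructor
  · intro h
    by_contra! hle
    exact h (hT.rayPt_mem he ⟨mul_nonneg (inv_nonneg.2 hδ.le) hp.1.1.le,
      by rw [inv_mul_le_iff₀ hδ]; linarith⟩ (Ioo_subset_Icc_self hp.2))
  · intro h hin
    have h1 : 1 < (1 - δ)⁻¹ * p.1 := by rw [lt_inv_mul_iff₀ hδ]; linarith
    have h0 : 0 < (1 - δ)⁻¹ * p.1 := by linarith
    have := hT.shrink_mem_interior hin (inv_nonneg.2 h0.le) (inv_lt_one_of_one_lt₀ h1)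
    rw [rayPt, add_sub_cancel_left, smul_smul, inv_mul_cancel₀ h0.ne', one_smul,
      add_sub_cancel] at this
    exact (hT.lineMap_mem_frontier he (Ioo_subset_Icc_self hp.2)).2 this

/-- Integration over a boundary layer in polar coordinates. -/
theorem integral_boundaryLayer (hT : IsStarPolygon T E a b n z r) {f : Plane → ℝ}
    (hf : Continuous f) {δ : ℝ} (hδ0 : 0 < δ) (hδ1 : δ < 1) :
    ∫ x in boundaryLayer T z δ, f x
      = ∫ s in (1 - δ)..1, s * edgeProfile E a b z (edgeWeight a b n z) f s := by
  have hsub : boundaryLayer T z δ ⊆ T := fun x hx => hx.1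
  have hm := hT.measurableSet_boundaryLayer δ
  have h1 : ∫ x in boundaryLayer T z δ, f x = ∫ x in T, (boundaryLayer T z δ).indicator f x := by
    rw [setIntegral_indicator hm, inter_eq_self_of_subset_right hsub]
  rw [h1, hT.setIntegral_eq_sum ((hT.integrableOn hf).indicator hm)]
  simp only [edgeProfile, Finset.mul_sum]
  rw [intervalIntegral.integral_finsetSum]
  · refine Finset.sum_congr rfl fun e he => ?_
    have h := setIntegral_prod_ray (k := fun s => s * edgeWeight a b n z e) hf (by fun_prop) z
      (a e) (b e) (by linarith : 1 - δ ≤ 1)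
    simp only [mul_assoc] at h ⊢
    rw [← h]
    have hss : Ioo (1 - δ) 1 ×ˢ Ioo (0 : ℝ) 1 ⊆ unitSquare :=
      prod_mono (Ioo_subset_Ioo (by linarith) le_rfl) le_rfl
    rw [← inter_eq_self_of_subset_right hss,
      ← setIntegral_indicator (measurableSet_Ioo.prod measurableSet_Ioo)]
    refine setIntegral_congr_fun measurableSet_unitSquare fun p hp => ?_
    by_cases hp1 : 1 - δ < p.1
    · have hm1 : p ∈ Ioo (1 - δ) 1 ×ˢ Ioo (0 : ℝ) 1 := ⟨⟨hp1, hp.1.2⟩, hp.2⟩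
      simp only [indicator_of_mem hm1,
        indicator_of_mem ((hT.rayPt_mem_boundaryLayer_iff hδ1 he hp).2 hp1)]
    · have hm1 : p ∉ Ioo (1 - δ) 1 ×ˢ Ioo (0 : ℝ) 1 := fun h => hp1 h.1.1
      simp only [indicator_of_notMem hm1, indicator_of_notMem
        (fun h => hp1 ((hT.rayPt_mem_boundaryLayer_iff hδ1 he hp).1 h)), mul_zero]
  · intro e he
    apply Continuous.intervalIntegrable
    exact continuous_id.mul (continuous_const.mul (continuous_rayAvg hf _ _ _))

end IsStarPolygon

/-! ### The divergence theorem -/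

/-- The derivative, with respect to the centre, of an integral over a triangle. -/
theorem hasDerivAt_integral_rayPt {f : Plane → ℝ} (hf : ContDiff ℝ 1 f) (z a b v : Plane) :
    HasDerivAt (fun τ : ℝ => ∫ p in unitSquare, p.1 * f (rayPt (z + τ • v) a b p))
      (∫ p in unitSquare, p.1 * ((1 - p.1) * fderiv ℝ f (rayPt z a b p) v)) 0 := by
  have hray : Continuous fun q : ℝ × (ℝ × ℝ) => rayPt (z + q.1 • v) a b q.2 := by
    unfold rayPt
    simp only [AffineMap.lineMap_apply, vsub_eq_sub, vadd_eq_add]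
    fun_prop
  have hdf : Continuous fun q : ℝ × (ℝ × ℝ) =>
      q.2.1 * ((1 - q.2.1) * fderiv ℝ f (rayPt (z + q.1 • v) a b q.2) v) := by
    have : Continuous fun q : ℝ × (ℝ × ℝ) => fderiv ℝ f (rayPt (z + q.1 • v) a b q.2) v :=
      ((hf.continuous_fderiv one_ne_zero).comp hray).clm_apply continuous_const
    fun_prop
  have hcf : Continuous fun q : ℝ × (ℝ × ℝ) => q.2.1 * f (rayPt (z + q.1 • v) a b q.2) :=
    (by fun_prop : Continuous fun q : ℝ × (ℝ × ℝ) => q.2.1).mul (hf.continuous.comp hray)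
  obtain ⟨B, hB⟩ := ((isCompact_Icc (a := (-1 : ℝ)) (b := 1)).prod
    ((isCompact_Icc (a := (0 : ℝ)) (b := 1)).prod
    (isCompact_Icc (a := (0 : ℝ)) (b := 1)))).exists_bound_of_continuousOn hdf.continuousOn
  have hint (g : ℝ × ℝ → ℝ) (hg : Continuous g) : IntegrableOn g unitSquare :=
    (hg.continuousOn.integrableOn_compact (μ := volume)
      ((isCompact_Icc (a := (0 : ℝ)) (b := 1)).prod
        (isCompact_Icc (a := (0 : ℝ)) (b := 1)))).mono_set
      (prod_mono Ioo_subset_Icc_self Ioo_subset_Icc_self)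
  have key := (hasDerivAt_integral_of_dominated_loc_of_deriv_le
    (μ := volume.restrict unitSquare) (x₀ := (0 : ℝ)) (s := Ioo (-1) 1)
    (F := fun τ p => p.1 * f (rayPt (z + τ • v) a b p))
    (F' := fun τ p => p.1 * ((1 - p.1) * fderiv ℝ f (rayPt (z + τ • v) a b p) v))
    (bound := fun _ => B) (Ioo_mem_nhds (by norm_num) (by norm_num))
    (Eventually.of_forall fun τ =>
      (hcf.comp (Continuous.prodMk_right τ)).aestronglyMeasurable)
    (hint _ (hcf.comp (Continuous.prodMk_right 0)))
    (hdf.comp (Continuous.prodMk_right 0)).aestronglyMeasurable ?_ ?_ ?_).2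
  · simpa using key
  · filter_upwards [ae_restrict_mem measurableSet_unitSquare] with p hp τ hτ
    exact hB (τ, p) ⟨Ioo_subset_Icc_self hτ, Ioo_subset_Icc_self hp.1, Ioo_subset_Icc_self hp.2⟩
  · exact hint _ continuous_const
  · refine Eventually.of_forall fun p τ _ => ?_
    have h1 : HasDerivAt (fun τ : ℝ => rayPt (z + τ • v) a b p) ((1 - p.1) • v) τ := by
      have : (fun τ : ℝ => rayPt (z + τ • v) a b p)
          = fun τ : ℝ => rayPt z a b p + τ • ((1 - p.1) • v) := by
        funext τ; simp only [rayPt]; module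
      rw [this]
      simpa using ((hasDerivAt_id τ).smul_const ((1 - p.1) • v)).const_add (rayPt z a b p)
    have h2 :=
      ((hf.differentiable one_ne_zero) (rayPt (z + τ • v) a b p)).hasFDerivAt.comp_hasDerivAt
        τ h1
    simp only [map_smul, smul_eq_mul] at h2
    exact h2.const_mul p.1

namespace IsStarPolygon

variable {ι : Type*} {T : Set Plane} {E : Finset ι} {a b n : ι → Plane} {z : Plane} {r : ℝ}

/-- The weight `|e| n_e · v` of an edge in the flux of the constant field `v`. -/
noncomputable abbrev _root_.fluxWeight {ι : Type*} (a b n : ι → Plane) (v : Plane) (e : ι) : ℝ :=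
  dist (a e) (b e) * inner ℝ (n e) v

/-- The formula for the integral in polar coordinates does not depend on the centre; its
derivative in the direction `v` of the centre is an identity between interior and boundary
integrals. -/
theorem integral_edgeProfile_fderiv_aux (hT : IsStarPolygon T E a b n z r) {f : Plane → ℝ}
    (hf : ContDiff ℝ 1 f) (v : Plane) :
    ∫ s in (0 : ℝ)..1, s * (1 - s) * edgeProfile E a b z (edgeWeight a b n z)
        (fun x => fderiv ℝ f x v) s
      = ∫ s in (0 : ℝ)..1, s * edgeProfile E a b z (fluxWeight a b n v) f s := by
  have hdf : Continuous fun x => fderiv ℝ f x v :=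
    (hf.continuous_fderiv one_ne_zero).clm_apply continuous_const
  -- `G τ` is the integral over `T` in polar coordinates about `z + τ v`; it is constant near `0`,
  -- as every point close to `z` is a possible centre
  set G : ℝ → ℝ := fun τ => ∑ e ∈ E, dist (a e) (b e) *
    ((inner ℝ (n e) (a e - z) - τ * inner ℝ (n e) v) *
      ∫ p in unitSquare, p.1 * f (rayPt (z + τ • v) (a e) (b e) p)) with hG
  have hconst : ∀ᶠ τ : ℝ in 𝓝 0, G τ = ∫ x in T, f x := by
    have hc : ContinuousAt (fun τ : ℝ => ‖τ • v‖) 0 := by fun_prop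
    have : ∀ᶠ τ : ℝ in 𝓝 0, ‖τ • v‖ < r / 2 := by
      apply hc.eventually_lt continuousAt_const
      simpa using hT.pos
    filter_upwards [this] with τ hτ
    have hT' := hT.recenter (y := z + τ • v) (r' := r / 2) (half_pos hT.pos) (by
      intro x hx
      rw [mem_closedBall_iff_norm] at hx ⊢
      calc ‖x - z‖ = ‖(x - (z + τ • v)) + τ • v‖ := by congr 1; abel
        _ ≤ r / 2 + r / 2 := (norm_add_le _ _).trans (add_le_add hx hτ.le)
        _ = r := by ring)
    rw [hT'.setIntegral_eq_sum (hT'.integrableOn hf.continuous), hG]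
    refine Finset.sum_congr rfl fun e _ => ?_
    rw [← mul_assoc, ← integral_const_mul]
    congr 1
    funext p
    have hin : (inner ℝ (n e) (a e - (z + τ • v)) : ℝ)
        = inner ℝ (n e) (a e - z) - τ * inner ℝ (n e) v := by
      rw [← sub_sub, inner_sub_right, inner_smul_right]
    rw [hin]
    ring
  have hd1 : HasDerivAt G 0 0 := by
    refine (hasDerivAt_const (0 : ℝ) (∫ x in T, f x)).congr_of_eventuallyEq ?_
    filter_upwards [hconst] with τ hτ using hτ
  -- differentiation of the weights and of the integrals over the edges
  have hd2 : HasDerivAt G (∑ e ∈ E, dist (a e) (b e) *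
      ((-inner ℝ (n e) v) * (∫ p in unitSquare, p.1 * f (rayPt z (a e) (b e) p))
        + inner ℝ (n e) (a e - z) *
          ∫ p in unitSquare, p.1 * ((1 - p.1) * fderiv ℝ f (rayPt z (a e) (b e) p) v))) 0 := by
    rw [hG]
    refine HasDerivAt.fun_sum fun e _ => HasDerivAt.const_mul _ ?_
    have h1 : HasDerivAt (fun τ : ℝ => (inner ℝ (n e) (a e - z) : ℝ) - τ * inner ℝ (n e) v)
        (-inner ℝ (n e) v) 0 := by
      simpa using ((hasDerivAt_id (0 : ℝ)).mul_const (inner ℝ (n e) v : ℝ)).const_sub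
        (inner ℝ (n e) (a e - z) : ℝ)
    have h2 := h1.fun_mul (hasDerivAt_integral_rayPt hf z (a e) (b e) v)
    simpa using h2
  have h0 := hd1.unique hd2
  have e1 : ∫ s in (0 : ℝ)..1, s * (1 - s) * edgeProfile E a b z (edgeWeight a b n z)
        (fun x => fderiv ℝ f x v) s = ∑ e ∈ E, dist (a e) (b e) * (inner ℝ (n e) (a e - z) *
          ∫ p in unitSquare, p.1 * ((1 - p.1) * fderiv ℝ f (rayPt z (a e) (b e) p) v)) := by
    simp only [edgeProfile, Finset.mul_sum]
    rw [intervalIntegral.integral_finsetSum]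
    · refine Finset.sum_congr rfl fun e _ => ?_
      have h := setIntegral_prod_ray (k := fun s => s * (1 - s)) hdf (by fun_prop) z (a e) (b e)
        zero_le_one
      simp only [mul_assoc] at h ⊢
      rw [h, ← mul_assoc (dist _ _), ← intervalIntegral.integral_const_mul]
      congr 1
      funext s
      ring
    · intro e _
      apply Continuous.intervalIntegrable
      have := continuous_rayAvg hdf z (a e) (b e)
      fun_prop
  have e2 : ∫ s in (0 : ℝ)..1, s * edgeProfile E a b z (fluxWeight a b n v) f s
      = ∑ e ∈ E, dist (a e) (b e) * (inner ℝ (n e) v *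
          ∫ p in unitSquare, p.1 * f (rayPt z (a e) (b e) p)) := by
    simp only [edgeProfile, Finset.mul_sum]
    rw [intervalIntegral.integral_finsetSum]
    · refine Finset.sum_congr rfl fun e _ => ?_
      have h := setIntegral_prod_ray (k := fun s => s) hf.continuous (by fun_prop) z (a e) (b e)
        zero_le_one
      rw [h, ← mul_assoc (dist _ _), ← intervalIntegral.integral_const_mul]
      congr 1
      funext s
      ring
    · intro e _
      apply Continuous.intervalIntegrable
      have := continuous_rayAvg hf.continuous z (a e) (b e)
      fun_prop
  rw [e1, e2, ← sub_eq_zero, ← Finset.sum_sub_distrib, h0]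
  refine Finset.sum_congr rfl fun e _ => ?_
  ring

/-- The divergence theorem on the polygon scaled by `ρ` about its centre. -/
theorem integral_edgeProfile_fderiv (hT : IsStarPolygon T E a b n z r) {f : Plane → ℝ}
    (hf : ContDiff ℝ 1 f) (v : Plane) (ρ : ℝ) :
    ∫ s in (0 : ℝ)..ρ, s * edgeProfile E a b z (edgeWeight a b n z) (fun x => fderiv ℝ f x v) s
      = ρ * edgeProfile E a b z (fluxWeight a b n v) f ρ := by
  have hdf : Continuous fun x => fderiv ℝ f x v :=
    (hf.continuous_fderiv one_ne_zero).clm_apply continuous_const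
  set A := edgeProfile E a b z (edgeWeight a b n z) (fun x => fderiv ℝ f x v) with hA
  set F := edgeProfile E a b z (fluxWeight a b n v) f with hF
  have hAc : Continuous A := continuous_edgeProfile hdf
  have hFc : Continuous F := continuous_edgeProfile hf.continuous
  -- the identity for `f` scaled by `ρ`
  have h1 (ρ : ℝ) : ρ * (∫ s in (0 : ℝ)..ρ, s * A s) - ∫ s in (0 : ℝ)..ρ, s * (s * A s)
      = ∫ s in (0 : ℝ)..ρ, s * F s := by
    have hfρ : ContDiff ℝ 1 fun x => f (z + ρ • (x - z)) :=
      hf.comp (contDiff_const.add ((contDiff_id.sub contDiff_const).const_smul ρ))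
    have h := hT.integral_edgeProfile_fderiv_aux hfρ v
    have hder : (fun x => fderiv ℝ (fun x => f (z + ρ • (x - z))) x v)
        = fun x => ρ * (fun y => fderiv ℝ f y v) (z + ρ • (x - z)) := by
      funext x
      have h2 : HasFDerivAt (fun x : Plane => z + ρ • (x - z))
          (ρ • ContinuousLinearMap.id ℝ Plane) x :=
        (((hasFDerivAt_id x).sub_const z).const_smul ρ).const_add z
      have h3 := ((hf.differentiable one_ne_zero) (z + ρ • (x - z))).hasFDerivAt.comp x h2
      have h4 : fderiv ℝ (fun x => f (z + ρ • (x - z))) x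
        = (fderiv ℝ f (z + ρ • (x - z))).comp (ρ • ContinuousLinearMap.id ℝ Plane) := h3.fderiv
      rw [h4]
      simp
    rw [hder] at h
    simp only [edgeProfile_const_mul] at h
    have hs (s : ℝ) : edgeProfile E a b z (edgeWeight a b n z)
        (fun x => fderiv ℝ f (z + ρ • (x - z)) v) s = A (ρ * s) :=
      edgeProfile_scale (f := fun y => fderiv ℝ f y v) ρ s
    simp only [hs, edgeProfile_scale, ← hF] at h
    have s1 := intervalIntegral.smul_integral_comp_mul_left (a := 0) (b := 1)
      (fun σ => σ * (ρ - σ) * A σ) ρ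
    have s2 := intervalIntegral.smul_integral_comp_mul_left (a := 0) (b := 1)
      (fun σ => σ * F σ) ρ
    rw [mul_zero, mul_one, smul_eq_mul, ← intervalIntegral.integral_const_mul] at s1 s2
    rw [← s2, ← intervalIntegral.integral_const_mul, ← intervalIntegral.integral_sub]
    · have h5 := congrArg (fun x => ρ ^ 2 * x) h
      simp only [← intervalIntegral.integral_const_mul] at h5
      refine Eq.trans ?_ (h5.trans ?_)
      · refine Eq.trans ?_ (s1.symm.trans ?_)
        · congr 1; funext s; ring
        · congr 1; funext s; ring
      · congr 1; funext s; ring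
    · exact (by fun_prop : Continuous fun s => ρ * (s * A s)).intervalIntegrable _ _
    · exact (by fun_prop : Continuous fun s => s * (s * A s)).intervalIntegrable _ _
  have hFTC {g : ℝ → ℝ} (hg : Continuous g) (x : ℝ) :
      HasDerivAt (fun ρ => ∫ s in (0 : ℝ)..ρ, g s) (g x) x :=
    intervalIntegral.integral_hasDerivAt_right (hg.intervalIntegrable _ _)
      (hg.stronglyMeasurableAtFilter _ _) hg.continuousAt
  -- differentiation in `ρ` removes the weight `ρ - s`
  have d1 := ((hasDerivAt_id ρ).fun_mul
    (hFTC (by fun_prop : Continuous fun s => s * A s) ρ)).fun_sub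
    (hFTC (by fun_prop : Continuous fun s => s * (s * A s)) ρ)
  have d2 := hFTC (by fun_prop : Continuous fun s => s * F s) ρ
  simp only [id] at d1
  rw [funext h1] at d1
  have := d1.unique d2
  linarith

/-- The divergence theorem for `C¹` functions. -/
theorem integral_fderiv (hT : IsStarPolygon T E a b n z r) {f : Plane → ℝ}
    (hf : ContDiff ℝ 1 f) (v : Plane) :
    ∫ x in T, fderiv ℝ f x v = edgeProfile E a b z (fluxWeight a b n v) f 1 := by
  rw [hT.integral_eq_edgeProfile ((hf.continuous_fderiv one_ne_zero).clm_apply continuous_const),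
    hT.integral_edgeProfile_fderiv hf v, one_mul]

end IsStarPolygon

/-! ### Boundary layer estimates -/

/-- The partial derivative in the `j`-th coordinate direction. -/
noncomputable abbrev partialDeriv (j : Fin 2) (w : Plane → ℝ) (x : Plane) : ℝ :=
  fderiv ℝ w x (EuclideanSpace.single j 1)

theorem continuous_partialDeriv {w : Plane → ℝ} (hw : ContDiff ℝ 1 w) (j : Fin 2) :
    Continuous (partialDeriv j w) :=
  (hw.continuous_fderiv one_ne_zero).clm_apply continuous_const

theorem fderiv_apply_eq_sum (w : Plane → ℝ) (x v : Plane) :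
    fderiv ℝ w x v = ∑ j, v j * partialDeriv j w x := by
  conv_lhs => rw [← (EuclideanSpace.basisFun (Fin 2) ℝ).sum_repr v]
  simp [partialDeriv]

theorem sq_fderiv_apply_le (w : Plane → ℝ) (x v : Plane) :
    (fderiv ℝ w x v) ^ 2 ≤ ‖v‖ ^ 2 * ∑ j, partialDeriv j w x ^ 2 := by
  rw [fderiv_apply_eq_sum, EuclideanSpace.real_norm_sq_eq]
  exact Finset.sum_mul_sq_le_sq_mul_sq _ _ _

/-- On the half of a ray next to the boundary, the trace is controlled by the `H¹` norm. -/
theorem sq_le_integral_sq_add_sq {φ φ' : ℝ → ℝ} (hφ : ∀ s, HasDerivAt φ (φ' s) s)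
    (hφ' : Continuous φ') {ρ : ℝ} (hρ : ρ ∈ Icc (1 / 2 : ℝ) 1) :
    φ ρ ^ 2 ≤ ∫ s in (1 / 2 : ℝ)..1, (3 * φ s ^ 2 + φ' s ^ 2) := by
  have hφc : Continuous φ := continuous_iff_continuousAt.2 fun s => (hφ s).continuousAt
  have hI (g : ℝ → ℝ) (hg : Continuous g) (x y : ℝ) : IntervalIntegrable g volume x y :=
    hg.intervalIntegrable _ _
  -- the fundamental theorem of calculus between `σ` and `ρ`, to be averaged over `σ`
  have h1 (σ : ℝ) (hσ : σ ∈ Icc (1 / 2 : ℝ) 1) :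
      φ ρ ^ 2 ≤ φ σ ^ 2 + ∫ s in (1 / 2 : ℝ)..1, (φ s ^ 2 + φ' s ^ 2) := by
    have h2 : ∫ s in σ..ρ, 2 * φ s * φ' s = φ ρ ^ 2 - φ σ ^ 2 := by
      apply intervalIntegral.integral_eq_sub_of_hasDerivAt
      · intro s _
        have := (hφ s).fun_pow 2
        exact this.congr_deriv (by norm_num)
      · exact hI _ (by fun_prop) _ _
    have h3 : |∫ s in σ..ρ, 2 * φ s * φ' s|
        ≤ ∫ s in (1 / 2 : ℝ)..1, (φ s ^ 2 + φ' s ^ 2) := by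
      rw [← Real.norm_eq_abs]
      refine (intervalIntegral.norm_integral_le_integral_norm_uIoc).trans ?_
      rw [intervalIntegral.integral_of_le (by norm_num)]
      refine (setIntegral_mono_on (g := fun s => φ s ^ 2 + φ' s ^ 2) ?_ ?_ measurableSet_uIoc
        fun s _ => ?_).trans ?_
      · exact ((by fun_prop : Continuous fun s => ‖2 * φ s * φ' s‖).integrableOn_uIoc)
      · exact ((by fun_prop : Continuous fun s => φ s ^ 2 + φ' s ^ 2).integrableOn_uIoc)
      · rw [Real.norm_eq_abs, abs_le]
        constructor <;> nlinarith [sq_nonneg (φ s + φ' s), sq_nonneg (φ s - φ' s)]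
      · apply setIntegral_mono_set
        · exact ((by fun_prop : Continuous fun s => φ s ^ 2 + φ' s ^ 2).integrableOn_Ioc)
        · exact Eventually.of_forall fun s => by positivity
        · refine (Ioc_subset_Ioc ?_ ?_).eventuallyLE
          · exact le_min hσ.1 hρ.1
          · exact max_le hσ.2 hρ.2
    have := (abs_le.1 h3).2
    linarith
  have h4 : ∫ _ in (1 / 2 : ℝ)..1, φ ρ ^ 2 ≤ ∫ σ in (1 / 2 : ℝ)..1,
      (φ σ ^ 2 + ∫ s in (1 / 2 : ℝ)..1, (φ s ^ 2 + φ' s ^ 2)) := by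
    apply intervalIntegral.integral_mono_on (by norm_num) (hI _ (by fun_prop) _ _)
      (hI _ (by fun_prop) _ _) h1
  rw [intervalIntegral.integral_add (hI _ (by fun_prop) _ _) (hI _ (by fun_prop) _ _),
    intervalIntegral.integral_const, intervalIntegral.integral_const,
    intervalIntegral.integral_add (hI _ (by fun_prop) _ _) (hI _ (by fun_prop) _ _)] at h4
  rw [intervalIntegral.integral_add (hI _ (by fun_prop) _ _) (hI _ (by fun_prop) _ _),
    intervalIntegral.integral_const_mul]
  simp only [smul_eq_mul] at h4
  linarith

namespace IsStarPolygon

variable {ι : Type*} {T : Set Plane} {E : Finset ι} {a b n : ι → Plane} {z : Plane} {r : ℝ}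

/-- The flux through the edges is controlled by polar coordinates: as every edge has distance at
least `r` from the centre, its length is at most `r⁻¹` times its polar weight. -/
theorem abs_fluxProfile_le (hT : IsStarPolygon T E a b n z r) {F : Fin 2 → Plane → ℝ}
    (hF : ∀ j, Continuous (F j)) (ρ : ℝ) :
    |∑ j, edgeProfile E a b z (fluxWeight a b n (EuclideanSpace.single j 1)) (F j) ρ|
      ≤ r⁻¹ * edgeProfile E a b z (edgeWeight a b n z) (fun x => ∑ j, |F j x|) ρ := by
  unfold edgeProfile
  rw [Finset.sum_comm, Finset.mul_sum]
  refine (Finset.abs_sum_le_sum_abs _ _).trans (Finset.sum_le_sum fun e he => ?_)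
  have hI (j : Fin 2) : IntervalIntegrable (fun t => |F j (rayPt z (a e) (b e) (ρ, t))|)
    volume 0 1 := intervalIntegrable_ray (hF j).abs _ _ _ _
  rw [intervalIntegral.integral_finsetSum fun j _ => hI j, Finset.mul_sum, Finset.mul_sum]
  refine (Finset.abs_sum_le_sum_abs _ _).trans (Finset.sum_le_sum fun j _ => ?_)
  have h1 : |(inner ℝ (n e) (EuclideanSpace.single j 1) : ℝ)| ≤ 1 := by
    refine (abs_real_inner_le_norm _ _).trans ?_
    simp [hT.norm_normal e he]
  have h2 : |∫ t in (0 : ℝ)..1, F j (rayPt z (a e) (b e) (ρ, t))|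
      ≤ ∫ t in (0 : ℝ)..1, |F j (rayPt z (a e) (b e) (ρ, t))| :=
    intervalIntegral.abs_integral_le_integral_abs zero_le_one
  have h3 : 1 ≤ r⁻¹ * inner ℝ (n e) (a e - z) := by
    rw [le_inv_mul_iff₀ hT.pos, mul_one]
    exact hT.le_inner_normal he
  have h4 : 0 ≤ ∫ t in (0 : ℝ)..1, |F j (rayPt z (a e) (b e) (ρ, t))| :=
    (abs_nonneg _).trans h2
  rw [abs_mul, abs_mul, abs_of_nonneg dist_nonneg]
  calc dist (a e) (b e) * |(inner ℝ (n e) (EuclideanSpace.single j 1) : ℝ)|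
        * |∫ t in (0 : ℝ)..1, F j (rayPt z (a e) (b e) (ρ, t))|
      ≤ dist (a e) (b e) * 1 * ∫ t in (0 : ℝ)..1, |F j (rayPt z (a e) (b e) (ρ, t))| := by
        gcongr
    _ ≤ dist (a e) (b e) * (r⁻¹ * inner ℝ (n e) (a e - z)) *
          ∫ t in (0 : ℝ)..1, |F j (rayPt z (a e) (b e) (ρ, t))| := by
        gcongr
    _ = _ := by ring

/-- The total flux of a `C¹` field is controlled by its size in a boundary layer. -/
theorem abs_integral_divergence_le (hT : IsStarPolygon T E a b n z r) {F : Fin 2 → Plane → ℝ}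
    (hF : ∀ j, ContDiff ℝ 1 (F j)) {δ : ℝ} (hδ0 : 0 < δ) (hδ1 : δ < 1) :
    |∫ x in T, ∑ j, partialDeriv j (F j) x|
      ≤ (∫ x in boundaryLayer T z δ, |∑ j, partialDeriv j (F j) x|)
        + (r * δ)⁻¹ * ∫ x in boundaryLayer T z δ, ∑ j, |F j x| := by
  have hdc : Continuous fun x => ∑ j, partialDeriv j (F j) x :=
    continuous_finsetSum _ fun j _ => continuous_partialDeriv (hF j) j
  have hFc : Continuous fun x => ∑ j, |F j x| :=
    continuous_finsetSum _ fun j _ => (hF j).continuous.abs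
  rw [hT.integral_boundaryLayer hdc.abs hδ0 hδ1, hT.integral_boundaryLayer hFc hδ0 hδ1,
    hT.integral_eq_edgeProfile hdc]
  set A := edgeProfile E a b z (edgeWeight a b n z) (fun x => ∑ j, partialDeriv j (F j) x) with hA
  set Q := edgeProfile E a b z (edgeWeight a b n z) (fun x => |∑ j, partialDeriv j (F j) x|)
    with hQ
  set P := edgeProfile E a b z (edgeWeight a b n z) (fun x => ∑ j, |F j x|) with hP
  have hAc : Continuous A := continuous_edgeProfile hdc
  have hQc : Continuous Q := continuous_edgeProfile hdc.abs
  have hPc : Continuous P := continuous_edgeProfile hFc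
  have hI (g : ℝ → ℝ) (hg : Continuous g) (x y : ℝ) : IntervalIntegrable g volume x y :=
    hg.intervalIntegrable _ _
  have hw (e) (he : e ∈ E) := hT.edgeWeight_nonneg he
  have hAQ (s : ℝ) : |A s| ≤ Q s := by
    rw [abs_le]
    constructor
    · have hneg : Continuous fun x => (-1) * |∑ j, partialDeriv j (F j) x| :=
        continuous_const.mul hdc.abs
      have := edgeProfile_mono (z := z) (a := a) (b := b) hw hneg hdc (s := s)
        (fun e _ t _ => by
          linarith [neg_abs_le (∑ j, partialDeriv j (F j) (rayPt z (a e) (b e) (s, t)))])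
      rw [edgeProfile_const_mul] at this
      linarith
    · exact edgeProfile_mono hw hdc hdc.abs (fun e _ t _ => le_abs_self _)
  -- the divergence theorem on `T` scaled by `ρ`; the remaining part of `T` lies in the layer
  have hpart (ρ : ℝ) (hρ : ρ ∈ Icc (1 - δ) 1) : |∫ s in (0 : ℝ)..1, s * A s|
      ≤ (∫ s in (1 - δ)..1, s * Q s) + r⁻¹ * (ρ * P ρ) := by
    have hρ0 : 0 ≤ ρ := by linarith [hρ.1]
    have h1 : ∫ s in (0 : ℝ)..ρ, s * A s
        = ρ * ∑ j, edgeProfile E a b z (fluxWeight a b n (EuclideanSpace.single j 1)) (F j) ρ := by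
      rw [Finset.mul_sum]
      simp only [← hT.integral_edgeProfile_fderiv (hF _)]
      rw [← intervalIntegral.integral_finsetSum]
      · congr 1
        funext s
        rw [hA, ← Finset.mul_sum]
        congr 1
        simp only [edgeProfile]
        rw [Finset.sum_comm]
        refine Finset.sum_congr rfl fun e _ => ?_
        rw [← Finset.mul_sum, intervalIntegral.integral_finsetSum]
        exact fun j _ => intervalIntegrable_ray (continuous_partialDeriv (hF j) j) _ _ _ _
      · intro j _
        exact hI _
          (continuous_id.mul (continuous_edgeProfile (continuous_partialDeriv (hF j) j))) _ _
    have h2 : |∫ s in ρ..1, s * A s| ≤ ∫ s in (1 - δ)..1, s * Q s := by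
      calc |∫ s in ρ..1, s * A s| ≤ ∫ s in ρ..1, |s * A s| :=
            intervalIntegral.abs_integral_le_integral_abs hρ.2
        _ ≤ ∫ s in ρ..1, s * Q s := by
            apply intervalIntegral.integral_mono_on hρ.2 (hI _ (by fun_prop) _ _)
              (hI _ (by fun_prop) _ _)
            intro s hs
            rw [abs_mul, abs_of_nonneg (hρ0.trans hs.1)]
            exact mul_le_mul_of_nonneg_left (hAQ s) (hρ0.trans hs.1)
        _ ≤ ∫ s in (1 - δ)..1, s * Q s := by
            rw [← intervalIntegral.integral_add_adjacent_intervals (a := 1 - δ) (b := ρ) (c := 1)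
              (hI _ (by fun_prop) _ _) (hI _ (by fun_prop) _ _)]
            have : 0 ≤ ∫ s in (1 - δ)..ρ, s * Q s := by
              apply intervalIntegral.integral_nonneg hρ.1
              intro s hs
              exact mul_nonneg (by linarith [hs.1]) ((abs_nonneg _).trans (hAQ s))
            linarith
    rw [← intervalIntegral.integral_add_adjacent_intervals (a := 0) (b := ρ) (c := 1)
      (hI _ (by fun_prop) _ _) (hI _ (by fun_prop) _ _), h1]
    refine (abs_add_le _ _).trans ?_
    rw [abs_mul, abs_of_nonneg hρ0, add_comm]
    refine add_le_add h2 ?_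
    calc _ ≤ ρ * (r⁻¹ * P ρ) := mul_le_mul_of_nonneg_left
          (hT.abs_fluxProfile_le (fun j => (hF j).continuous) ρ) hρ0
      _ = _ := by ring
  -- averaging over `ρ` turns the boundary term into an integral over the layer
  have hint : ∫ _ in (1 - δ)..1, |∫ s in (0 : ℝ)..1, s * A s|
      ≤ ∫ ρ in (1 - δ)..1, ((∫ s in (1 - δ)..1, s * Q s) + r⁻¹ * (ρ * P ρ)) :=
    intervalIntegral.integral_mono_on (by linarith) (hI _ (by fun_prop) _ _)
      (hI _ (by fun_prop) _ _) hpart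
  rw [intervalIntegral.integral_add (hI _ (by fun_prop) _ _) (hI _ (by fun_prop) _ _),
    intervalIntegral.integral_const, intervalIntegral.integral_const,
    intervalIntegral.integral_const_mul, smul_eq_mul, smul_eq_mul, sub_sub_cancel] at hint
  refine le_of_mul_le_mul_left ?_ hδ0
  refine hint.trans (le_of_eq ?_)
  rw [mul_add]
  congr 1
  rw [mul_inv]
  field_simp

/-- The trace inequality for smooth functions, in a boundary layer. -/
theorem integral_boundaryLayer_sq_le (hT : IsStarPolygon T E a b n z r) {D : ℝ}
    (hD : ∀ x ∈ T, ‖x - z‖ ≤ D) {w : Plane → ℝ} (hw : ContDiff ℝ 1 w) {δ : ℝ} (hδ0 : 0 < δ)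
    (hδ1 : δ ≤ 1 / 2) :
    ∫ x in boundaryLayer T z δ, w x ^ 2
      ≤ δ * (2 * ∫ x in T, (3 * w x ^ 2 + D ^ 2 * ∑ j, partialDeriv j w x ^ 2)) := by
  have hgc : Continuous fun x => 3 * w x ^ 2 + D ^ 2 * ∑ j, partialDeriv j w x ^ 2 := by
    have := hw.continuous
    have := continuous_partialDeriv hw 0
    have := continuous_partialDeriv hw 1
    simp only [Fin.sum_univ_two]
    fun_prop
  have hwc : Continuous fun x => w x ^ 2 := hw.continuous.pow 2
  have hI (g : ℝ → ℝ) (hg : Continuous g) (x y : ℝ) : IntervalIntegrable g volume x y :=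
    hg.intervalIntegrable _ _
  rw [hT.integral_boundaryLayer hwc hδ0 (by linarith), hT.integral_eq_edgeProfile hgc]
  set P := edgeProfile E a b z (edgeWeight a b n z) (fun x => w x ^ 2) with hP
  set Q := edgeProfile E a b z (edgeWeight a b n z)
    (fun x => 3 * w x ^ 2 + D ^ 2 * ∑ j, partialDeriv j w x ^ 2) with hQ
  have hPc : Continuous P := continuous_edgeProfile hwc
  have hQc : Continuous Q := continuous_edgeProfile hgc
  have hQ0 (s : ℝ) : 0 ≤ Q s := by
    refine Finset.sum_nonneg fun e he => mul_nonneg (hT.edgeWeight_nonneg he) ?_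
    exact intervalIntegral.integral_nonneg zero_le_one fun t _ => by positivity
  -- the one-dimensional trace inequality on each ray
  have key (ρ : ℝ) (hρ : ρ ∈ Icc (1 / 2 : ℝ) 1) : P ρ ≤ ∫ s in (1 / 2 : ℝ)..1, Q s := by
    rw [hP, hQ]
    simp only [edgeProfile]
    have hIe (e) (_ : e ∈ E) : IntervalIntegrable (fun s => edgeWeight a b n z e *
        ∫ t in (0 : ℝ)..1, (3 * w (rayPt z (a e) (b e) (s, t)) ^ 2
          + D ^ 2 * ∑ j, partialDeriv j w (rayPt z (a e) (b e) (s, t)) ^ 2)) volume (1 / 2) 1 :=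
      hI _ (continuous_const.mul (continuous_rayAvg hgc _ _ _)) _ _
    rw [intervalIntegral.integral_finsetSum hIe]
    refine Finset.sum_le_sum fun e he => ?_
    rw [intervalIntegral.integral_const_mul]
    refine mul_le_mul_of_nonneg_left ?_ (hT.edgeWeight_nonneg he)
    have hcont : Continuous fun q : ℝ × ℝ => 3 * w (rayPt z (a e) (b e) q) ^ 2
        + D ^ 2 * ∑ j, partialDeriv j w (rayPt z (a e) (b e) q) ^ 2 :=
      hgc.comp (continuous_rayPt z (a e) (b e))
    rw [intervalIntegral_intervalIntegral_swap]
    · apply intervalIntegral.integral_mono_on zero_le_one (intervalIntegrable_ray hwc _ _ _ _)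
      · apply hI
        apply intervalIntegral.continuous_parametric_intervalIntegral_of_continuous'
        exact hcont.comp (by fun_prop : Continuous fun q : ℝ × ℝ => (q.2, q.1))
      · intro t ht
        have hline (s : ℝ) : HasDerivAt (fun s => w (rayPt z (a e) (b e) (s, t)))
            (fderiv ℝ w (rayPt z (a e) (b e) (s, t)) (AffineMap.lineMap (a e) (b e) t - z)) s := by
          have h1 : HasDerivAt (fun s : ℝ => rayPt z (a e) (b e) (s, t))
              (AffineMap.lineMap (a e) (b e) t - z) s := by
            simp only [rayPt]
            simpa using ((hasDerivAt_id s).smul_const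
              (AffineMap.lineMap (a e) (b e) t - z)).const_add z
          exact ((hw.differentiable one_ne_zero) _).hasFDerivAt.comp_hasDerivAt s h1
        have hray : Continuous fun s : ℝ => rayPt z (a e) (b e) (s, t) :=
          (continuous_rayPt _ _ _).comp (by fun_prop)
        have hdc : Continuous fun s => fderiv ℝ w (rayPt z (a e) (b e) (s, t))
            (AffineMap.lineMap (a e) (b e) t - z) :=
          ((hw.continuous_fderiv one_ne_zero).comp hray).clm_apply continuous_const
        refine (sq_le_integral_sq_add_sq hline hdc hρ).trans ?_
        have hwr : Continuous fun s => w (rayPt z (a e) (b e) (s, t)) := hw.continuous.comp hray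
        apply intervalIntegral.integral_mono_on (by norm_num) (hI _ (by fun_prop) _ _)
          (hI _ (hcont.comp (by fun_prop : Continuous fun s : ℝ => (s, t))) _ _)
        intro s _
        have h2 := sq_fderiv_apply_le w (rayPt z (a e) (b e) (s, t))
          (AffineMap.lineMap (a e) (b e) t - z)
        have h3 : ‖AffineMap.lineMap (a e) (b e) t - z‖ ^ 2 ≤ D ^ 2 :=
          pow_le_pow_left₀ (norm_nonneg _) (hD _ (hT.lineMap_mem he ht)) 2
        have h4 : 0 ≤ ∑ j, partialDeriv j w (rayPt z (a e) (b e) (s, t)) ^ 2 :=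
          Finset.sum_nonneg fun j _ => sq_nonneg _
        have h5 := mul_le_mul_of_nonneg_right h3 h4
        exact add_le_add le_rfl (h2.trans h5)
    · refine (hcont.continuousOn.integrableOn_compact (isCompact_uIcc.prod isCompact_uIcc)).mono_set
        (prod_mono uIoc_subset_uIcc uIoc_subset_uIcc)
  -- the area element `s` is at least `1 / 2` on this half of the rays
  have h1 : ∫ s in (1 / 2 : ℝ)..1, Q s ≤ 2 * ∫ s in (0 : ℝ)..1, s * Q s := by
    rw [← intervalIntegral.integral_add_adjacent_intervals (a := 0) (b := 1 / 2) (c := 1)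
      (hI _ (by fun_prop) _ _) (hI _ (by fun_prop) _ _), mul_add,
      ← intervalIntegral.integral_const_mul, ← intervalIntegral.integral_const_mul]
    have h2 : 0 ≤ ∫ s in (0 : ℝ)..(1 / 2), 2 * (s * Q s) :=
      intervalIntegral.integral_nonneg (by norm_num) fun s hs =>
        mul_nonneg (by norm_num) (mul_nonneg hs.1 (hQ0 s))
    have h3 : ∫ s in (1 / 2 : ℝ)..1, Q s ≤ ∫ s in (1 / 2 : ℝ)..1, 2 * (s * Q s) := by
      apply intervalIntegral.integral_mono_on (by norm_num) (hI _ (by fun_prop) _ _)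
        (hI _ (by fun_prop) _ _)
      intro s hs
      nlinarith [hQ0 s, hs.1]
    linarith
  have h4 : ∫ s in (1 - δ)..1, s * P s ≤ ∫ _ in (1 - δ)..1, ∫ s in (1 / 2 : ℝ)..1, Q s := by
    apply intervalIntegral.integral_mono_on (by linarith) (hI _ (by fun_prop) _ _)
      (hI _ (by fun_prop) _ _)
    intro s hs
    have h5 := key s ⟨by linarith [hs.1], hs.2⟩
    have h6 : 0 ≤ P s := by
      refine Finset.sum_nonneg fun e he => mul_nonneg (hT.edgeWeight_nonneg he) ?_
      exact intervalIntegral.integral_nonneg zero_le_one fun t _ => by positivity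
    nlinarith [hs.2]
  rw [intervalIntegral.integral_const, smul_eq_mul, sub_sub_cancel] at h4
  exact h4.trans (mul_le_mul_of_nonneg_left h1 hδ0.le)

end IsStarPolygon

/-! ### The Poincaré inequality -/

/-- The Cauchy–Schwarz inequality for the square of an average. -/
theorem sq_integral_le_measureReal_mul {X : Type*} [MeasurableSpace X] {μ : Measure X}
    [IsFiniteMeasure μ] {f : X → ℝ} (hf : Integrable f μ) (hf2 : Integrable (fun x => f x ^ 2) μ) :
    (∫ x, f x ∂μ) ^ 2 ≤ μ.real univ * ∫ x, f x ^ 2 ∂μ := by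
  set m := μ.real univ with hm
  rcases (measureReal_nonneg (μ := μ) (s := univ)).eq_or_lt with h0 | h0
  · have : μ = 0 := by
      rw [measureReal_def, eq_comm, ENNReal.toReal_eq_zero_iff] at h0
      simpa using h0
    simp [this]
  · set I := ∫ x, f x ∂μ with hI
    have h1 : 0 ≤ ∫ x, (m * f x - I) ^ 2 ∂μ := integral_nonneg fun x => sq_nonneg _
    have h2 : ∫ x, (m * f x - I) ^ 2 ∂μ = m ^ 2 * (∫ x, f x ^ 2 ∂μ) - m * I ^ 2 := by
      have e : (fun x => (m * f x - I) ^ 2)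
          = fun x => (m ^ 2 * f x ^ 2 - 2 * m * I * f x) + I ^ 2 := by
        funext x; ring
      have i1 : Integrable (fun x => m ^ 2 * f x ^ 2 - 2 * m * I * f x) μ :=
        (hf2.const_mul _).sub (hf.const_mul _)
      rw [e, integral_add i1 (integrable_const _),
        integral_sub (hf2.const_mul _) (hf.const_mul _), integral_const_mul, integral_const_mul,
        integral_const, smul_eq_mul, ← hI, ← hm]
      ring
    rw [h2] at h1
    have h3 : m * (m * (∫ x, f x ^ 2 ∂μ) - I ^ 2) ≥ 0 := by linarith
    have := nonneg_of_mul_nonneg_right h3 h0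
    linarith

theorem lintegral_comp_add_smul (f : Plane → ℝ≥0∞) (hf : Measurable f) (y : Plane) {t : ℝ}
    (ht : 0 < t) :
    ∫⁻ x, f (y + t • x) = ENNReal.ofReal ((t ^ 2)⁻¹) * ∫⁻ x, f x := by
  have h1 : ∫⁻ x, f (y + t • x)
      = ∫⁻ x, f (y + x) ∂(Measure.map (fun x : Plane => t • x) volume) := by
    rw [lintegral_map (by fun_prop) (by fun_prop)]
  have h2 := Measure.map_addHaar_smul (volume : Measure Plane) ht.ne'
  rw [h1, h2, lintegral_smul_measure, lintegral_add_left_eq_self f y, finrank_euclideanSpace_fin,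
    abs_of_pos (by positivity), smul_eq_mul]

namespace IsStarPolygon

variable {ι : Type*} {T : Set Plane} {E : Finset ι} {a b n : ι → Plane} {z : Plane} {r : ℝ}

/-- Integration over the segments between the points of `T` and those of the kernel disc: one of
the endpoints can be replaced by the intermediate point, with Jacobian at most `4`. -/
theorem lintegral_segments_le (hT : IsStarPolygon T E a b n z r) {F : Plane → ℝ≥0∞}
    (hF : Measurable F) :
    ∫⁻ x in T, ∫⁻ y in Metric.closedBall z r, ∫⁻ t in Ioc (0 : ℝ) 1, F (y + t • (x - y))
      ≤ 4 * volume T * ∫⁻ x, F x := by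
  have hB : volume (Metric.closedBall z r) ≤ volume T := measure_mono hT.closedBall_subset
  have hm : Measurable fun q : (Plane × Plane) × ℝ => F (q.1.2 + q.2 • (q.1.1 - q.1.2)) :=
    hF.comp (by fun_prop)
  have hswap : ∫⁻ x in T, ∫⁻ y in Metric.closedBall z r, ∫⁻ t in Ioc (0 : ℝ) 1,
        F (y + t • (x - y))
      = ∫⁻ t in Ioc (0 : ℝ) 1, ∫⁻ x in T, ∫⁻ y in Metric.closedBall z r, F (y + t • (x - y)) := by
    have h1 (x : Plane) : ∫⁻ y in Metric.closedBall z r, ∫⁻ t in Ioc (0 : ℝ) 1, F (y + t • (x - y))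
        = ∫⁻ t in Ioc (0 : ℝ) 1, ∫⁻ y in Metric.closedBall z r, F (y + t • (x - y)) :=
      lintegral_lintegral_swap
        (hm.comp (by fun_prop : Measurable fun q : Plane × ℝ => ((x, q.1), q.2))).aemeasurable
    simp only [h1]
    apply lintegral_lintegral_swap
    have h2 : Measurable fun q : (Plane × ℝ) × Plane => F (q.2 + q.1.2 • (q.1.1 - q.2)) :=
      hF.comp (by fun_prop)
    exact (h2.lintegral_prod_right' (ν := volume.restrict (Metric.closedBall z r))).aemeasurable
  rw [hswap]
  have hpt (t : ℝ) (ht : t ∈ Ioc (0 : ℝ) 1) :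
      ∫⁻ x in T, ∫⁻ y in Metric.closedBall z r, F (y + t • (x - y))
        ≤ 4 * volume T * ∫⁻ x, F x := by
    -- for `t ≥ 1 / 2` the intermediate point replaces `x`, otherwise it replaces `y`
    rcases le_total (1 / 2) t with h | h
    · rw [lintegral_lintegral_swap]
      · calc ∫⁻ y in Metric.closedBall z r, ∫⁻ x in T, F (y + t • (x - y))
            ≤ ∫⁻ _ in Metric.closedBall z r, 4 * ∫⁻ x, F x := by
              refine lintegral_mono fun y => ?_
              refine (setLIntegral_le_lintegral _ _).trans ?_
              have e (x : Plane) : y + t • (x - y) = (y - t • y) + t • x := by module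
              simp only [e]
              rw [lintegral_comp_add_smul F hF _ ht.1]
              gcongr
              rw [← ENNReal.ofReal_ofNat]
              apply ENNReal.ofReal_le_ofReal
              rw [inv_le_comm₀ (by positivity) (by norm_num)]
              nlinarith
          _ = 4 * (∫⁻ x, F x) * volume (Metric.closedBall z r) := by
              rw [lintegral_const, Measure.restrict_apply_univ]
          _ ≤ 4 * (∫⁻ x, F x) * volume T := by gcongr
          _ = _ := by ring
      · exact (hF.comp (by fun_prop : Measurable fun q : Plane × Plane =>
          q.2 + t • (q.1 - q.2))).aemeasurable
    · calc ∫⁻ x in T, ∫⁻ y in Metric.closedBall z r, F (y + t • (x - y))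
            ≤ ∫⁻ _ in T, 4 * ∫⁻ x, F x := by
              refine lintegral_mono fun x => ?_
              refine (setLIntegral_le_lintegral _ _).trans ?_
              have e (y : Plane) : y + t • (x - y) = t • x + (1 - t) • y := by module
              simp only [e]
              rw [lintegral_comp_add_smul F hF _ (by linarith)]
              gcongr
              rw [← ENNReal.ofReal_ofNat]
              apply ENNReal.ofReal_le_ofReal
              have : 0 < (1 - t) ^ 2 := by nlinarith
              rw [inv_le_comm₀ this (by norm_num)]
              nlinarith
          _ = 4 * (∫⁻ x, F x) * volume T := by
              rw [lintegral_const, Measure.restrict_apply_univ]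
          _ = _ := by ring
  calc ∫⁻ t in Ioc (0 : ℝ) 1, ∫⁻ x in T, ∫⁻ y in Metric.closedBall z r, F (y + t • (x - y))
      ≤ ∫⁻ _ in Ioc (0 : ℝ) 1, 4 * volume T * ∫⁻ x, F x :=
        setLIntegral_mono' measurableSet_Ioc hpt
    _ = _ := by rw [lintegral_const, Measure.restrict_apply_univ, Real.volume_Ioc]; simp

/-- The Poincaré inequality for smooth functions on a domain star-shaped with respect to a disc,
with the mean over that disc. -/
theorem integral_sub_average_sq_le (hT : IsStarPolygon T E a b n z r) {D : ℝ}
    (hD : ∀ x ∈ T, ∀ y ∈ T, ‖x - y‖ ≤ D) {w : Plane → ℝ} (hw : ContDiff ℝ 1 w) :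
    volume.real (Metric.closedBall z r) * ∫ x in T, (w x - (volume.real (Metric.closedBall z r))⁻¹ *
        ∫ y in Metric.closedBall z r, w y) ^ 2
      ≤ 4 * volume.real T * D ^ 2 * ∫ x in T, ∑ j, partialDeriv j w x ^ 2 := by
  set B := Metric.closedBall z r with hB
  set m := volume.real B with hm
  have hBc : IsCompact B := isCompact_closedBall z r
  have hm0 : 0 < m := by
    rw [hm, measureReal_def]
    exact ENNReal.toReal_pos (Metric.measure_closedBall_pos volume z hT.pos).ne'
      hBc.measure_lt_top.ne
  have : IsFiniteMeasure (volume.restrict B) := ⟨by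
    rw [Measure.restrict_apply_univ]; exact hBc.measure_lt_top⟩
  set c := m⁻¹ * ∫ y in B, w y with hc
  set g : Plane → ℝ := fun x => ∑ j, partialDeriv j w x ^ 2 with hg
  have hgc : Continuous g := by
    have := continuous_partialDeriv hw 0
    have := continuous_partialDeriv hw 1
    simp only [hg, Fin.sum_univ_two]
    fun_prop
  have hg0 (x : Plane) : 0 ≤ g x := Finset.sum_nonneg fun j _ => sq_nonneg _
  have hwc := hw.continuous
  set F : Plane → ℝ≥0∞ := T.indicator fun x => ENNReal.ofReal (g x) with hF
  have hFm : Measurable F := (by fun_prop : Measurable fun x => ENNReal.ofReal (g x)).indicator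
    hT.measurableSet
  have hFint : ∫⁻ x, F x = ENNReal.ofReal (∫ x in T, g x) := by
    rw [hF, lintegral_indicator hT.measurableSet, ofReal_integral_eq_lintegral_ofReal
      (hT.integrableOn hgc) (Eventually.of_forall hg0)]
  -- the mean value theorem along a segment
  have h1 (x : Plane) (hx : x ∈ T) (y : Plane) (hy : y ∈ B) :
      ENNReal.ofReal ((w x - w y) ^ 2)
        ≤ ENNReal.ofReal (D ^ 2) * ∫⁻ t in Ioc (0 : ℝ) 1, F (y + t • (x - y)) := by
    have hline (t : ℝ) : HasDerivAt (fun t : ℝ => w (y + t • (x - y)))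
        (fderiv ℝ w (y + t • (x - y)) (x - y)) t := by
      have h1 : HasDerivAt (fun t : ℝ => y + t • (x - y)) (x - y) t := by
        simpa using ((hasDerivAt_id t).smul_const (x - y)).const_add y
      exact ((hw.differentiable one_ne_zero) _).hasFDerivAt.comp_hasDerivAt t h1
    have hseg : Continuous fun t : ℝ => y + t • (x - y) := by fun_prop
    have hdc : Continuous fun t : ℝ => fderiv ℝ w (y + t • (x - y)) (x - y) :=
      ((hw.continuous_fderiv one_ne_zero).comp hseg).clm_apply continuous_const
    have h2 : ∫ t in Ioc (0 : ℝ) 1, fderiv ℝ w (y + t • (x - y)) (x - y) = w x - w y := by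
      rw [← intervalIntegral.integral_of_le zero_le_one,
        intervalIntegral.integral_eq_sub_of_hasDerivAt (fun t _ => hline t)
          (hdc.intervalIntegrable _ _)]
      simp
    have h3 := sq_integral_le_measureReal_mul (μ := volume.restrict (Ioc (0 : ℝ) 1))
      hdc.integrableOn_Ioc (hdc.pow 2).integrableOn_Ioc
    have h4 : ∫ t in Ioc (0 : ℝ) 1, (fderiv ℝ w (y + t • (x - y)) (x - y)) ^ 2
        ≤ ∫ t in Ioc (0 : ℝ) 1, D ^ 2 * g (y + t • (x - y)) := by
      apply setIntegral_mono (hdc.pow 2).integrableOn_Ioc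
        ((continuous_const.mul (hgc.comp hseg)).integrableOn_Ioc)
      intro t
      refine (sq_fderiv_apply_le w _ _).trans (mul_le_mul_of_nonneg_right ?_ (hg0 _))
      exact pow_le_pow_left₀ (norm_nonneg _) (hD x hx y (hT.closedBall_subset hy)) 2
    have hone : (volume.restrict (Ioc (0 : ℝ) 1)).real univ = 1 := by simp
    rw [h2, hone, one_mul] at h3
    calc ENNReal.ofReal ((w x - w y) ^ 2)
        ≤ ENNReal.ofReal (∫ t in Ioc (0 : ℝ) 1, D ^ 2 * g (y + t • (x - y))) :=
          ENNReal.ofReal_le_ofReal (h3.trans h4)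
      _ = ∫⁻ t in Ioc (0 : ℝ) 1, ENNReal.ofReal (D ^ 2 * g (y + t • (x - y))) :=
          ofReal_integral_eq_lintegral_ofReal
            ((continuous_const.mul (hgc.comp hseg)).integrableOn_Ioc)
            (Eventually.of_forall fun t => mul_nonneg (sq_nonneg _) (hg0 _))
      _ = ∫⁻ t in Ioc (0 : ℝ) 1, ENNReal.ofReal (D ^ 2) * F (y + t • (x - y)) := by
          refine setLIntegral_congr_fun measurableSet_Ioc fun t ht => ?_
          have hmem : y + t • (x - y) ∈ T := by
            have := hT.starConvex y hy hx (sub_nonneg.2 ht.2) ht.1.le (by ring)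
            convert this using 1
            module
          simp only [hF, indicator_of_mem hmem]
          rw [ENNReal.ofReal_mul (sq_nonneg _)]
      _ = _ := by
          exact lintegral_const_mul _ (hFm.comp hseg.measurable)
  -- Jensen's inequality for the average over the disc
  have h2 (x : Plane) : ENNReal.ofReal m * ENNReal.ofReal ((w x - c) ^ 2)
      ≤ ∫⁻ y in B, ENNReal.ofReal ((w x - w y) ^ 2) := by
    have hcb : Continuous fun y => w x - w y := by fun_prop
    have hib : IntegrableOn (fun y => w x - w y) B := hcb.continuousOn.integrableOn_compact hBc
    have hib2 : IntegrableOn (fun y => (w x - w y) ^ 2) B :=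
      (hcb.pow 2).continuousOn.integrableOn_compact hBc
    rw [← ofReal_integral_eq_lintegral_ofReal hib2 (Eventually.of_forall fun y => sq_nonneg _),
      ← ENNReal.ofReal_mul hm0.le]
    apply ENNReal.ofReal_le_ofReal
    have h3 := sq_integral_le_measureReal_mul (μ := volume.restrict B) hib hib2
    have h4 : ∫ y in B, (w x - w y) = m * (w x - c) := by
      rw [integral_sub (integrable_const _) (hwc.continuousOn.integrableOn_compact hBc),
        integral_const, hc, mul_sub, mul_inv_cancel_left₀ hm0.ne', measureReal_restrict_apply_univ,
        smul_eq_mul]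
    rw [h4, measureReal_restrict_apply_univ, ← hm] at h3
    have h5 : m * (m * (w x - c) ^ 2) ≤ m * ∫ y in B, (w x - w y) ^ 2 := by
      calc _ = (m * (w x - c)) ^ 2 := by ring
        _ ≤ _ := h3
    exact le_of_mul_le_mul_left h5 hm0
  have h3 : ENNReal.ofReal m * ENNReal.ofReal (∫ x in T, (w x - c) ^ 2)
      ≤ ENNReal.ofReal (D ^ 2) * (4 * volume T * ENNReal.ofReal (∫ x in T, g x)) := by
    have hc2 : Continuous fun x => (w x - c) ^ 2 := by fun_prop
    rw [ofReal_integral_eq_lintegral_ofReal (hT.integrableOn hc2)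
      (Eventually.of_forall fun x => sq_nonneg _), ← lintegral_const_mul _ (by fun_prop), ← hFint]
    calc ∫⁻ x in T, ENNReal.ofReal m * ENNReal.ofReal ((w x - c) ^ 2)
        ≤ ∫⁻ x in T, ∫⁻ y in B, ENNReal.ofReal (D ^ 2) *
            ∫⁻ t in Ioc (0 : ℝ) 1, F (y + t • (x - y)) := by
          refine setLIntegral_mono' hT.measurableSet fun x hx => (h2 x).trans ?_
          exact setLIntegral_mono' hBc.measurableSet fun y hy => h1 x hx y hy
      _ = ENNReal.ofReal (D ^ 2) * ∫⁻ x in T, ∫⁻ y in B,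
            ∫⁻ t in Ioc (0 : ℝ) 1, F (y + t • (x - y)) := by
          simp only [lintegral_const_mul' _ _ ENNReal.ofReal_ne_top]
      _ ≤ _ := by gcongr; exact hT.lintegral_segments_le hFm
  have hTv : volume T = ENNReal.ofReal (volume.real T) := by
    rw [measureReal_def, ENNReal.ofReal_toReal hT.isCompact.measure_lt_top.ne]
  have hg1 : 0 ≤ ∫ x in T, g x := integral_nonneg hg0
  rw [hTv, ← ENNReal.ofReal_mul hm0.le, ← ENNReal.ofReal_ofNat 4,
    ← ENNReal.ofReal_mul (by norm_num),
    ← ENNReal.ofReal_mul (by positivity), ← ENNReal.ofReal_mul (by positivity),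
    ENNReal.ofReal_le_ofReal_iff (by positivity)] at h3
  refine h3.trans (le_of_eq ?_)
  ring

end IsStarPolygon

/-! ### Mollification with contraction -/

theorem gradient_apply (φ : Plane → ℝ) (x : Plane) (i : Fin 2) :
    gradient φ x i = partialDeriv i φ x := by
  have h : inner ℝ (gradient φ x) (EuclideanSpace.single i (1 : ℝ)) = partialDeriv i φ x := by
    rw [gradient, InnerProductSpace.toDual_symm_apply]
  rw [← h, EuclideanSpace.inner_single_right]
  simp

/-- The scaling factors `1 - 1 / (k + 2)`, tending to `1`. -/
noncomputable def shrinkFactor (k : ℕ) : ℝ := 1 - 1 / ((k : ℝ) + 2)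

theorem shrinkFactor_lt_one (k : ℕ) : shrinkFactor k < 1 := by
  unfold shrinkFactor
  have : (0 : ℝ) < 1 / ((k : ℝ) + 2) := by positivity
  linarith

theorem half_le_shrinkFactor (k : ℕ) : 1 / 2 ≤ shrinkFactor k := by
  unfold shrinkFactor
  have : 1 / ((k : ℝ) + 2) ≤ 1 / 2 := by
    apply one_div_le_one_div_of_le (by norm_num)
    linarith [k.cast_nonneg (α := ℝ)]
  linarith

theorem tendsto_shrinkFactor : Tendsto shrinkFactor atTop (𝓝 1) := by
  have h : Tendsto (fun k : ℕ => 1 / ((k : ℝ) + 2)) atTop (𝓝 0) := by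
    have h1 : Tendsto (fun k : ℕ => (k : ℝ) + 2) atTop atTop :=
      tendsto_atTop_add_const_right _ _ tendsto_natCast_atTop_atTop
    simpa [Function.comp_def] using tendsto_inv_atTop_zero.comp h1
  have := h.const_sub 1
  rw [sub_zero] at this
  exact this

/-- A bump function of radius `(1 - shrinkFactor k) * r / 2`: half the margin of a star polygon
shrunk by the factor `shrinkFactor k`. -/
noncomputable def mollBump {r : ℝ} (hr : 0 < r) (k : ℕ) : ContDiffBump (0 : Plane) where
  rIn := (1 - shrinkFactor k) * r / 4
  rOut := (1 - shrinkFactor k) * r / 2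
  rIn_pos := by have := mul_pos (sub_pos.2 (shrinkFactor_lt_one k)) hr; positivity
  rIn_lt_rOut := by have := mul_pos (sub_pos.2 (shrinkFactor_lt_one k)) hr; linarith

/-- The mollification kernel: as a function of `y`, a bump about the image of `x` under the
contraction towards `z` with factor `shrinkFactor k`. -/
noncomputable def mollKernel (z : Plane) {r : ℝ} (hr : 0 < r) (k : ℕ) (x y : Plane) : ℝ :=
  (mollBump hr k).normed volume (z + shrinkFactor k • (x - z) - y)

/-- Mollification combined with a contraction towards `z`: for star polygons, this approximates
functions on `T` up to the boundary by smooth functions. -/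
noncomputable def mollify (T : Set Plane) (z : Plane) {r : ℝ} (hr : 0 < r) (k : ℕ)
    (f : Plane → ℝ) (x : Plane) : ℝ :=
  ∫ y in T, f y * mollKernel z hr k x y

theorem mollKernel_def (z : Plane) {r : ℝ} (hr : 0 < r) (k : ℕ) (x y : Plane) :
    mollKernel z hr k x y
      = (mollBump hr k).normed volume (z + shrinkFactor k • (x - z) - y) := rfl

theorem mollKernel_nonneg (z : Plane) {r : ℝ} (hr : 0 < r) (k : ℕ) (x y : Plane) :
    0 ≤ mollKernel z hr k x y := (mollBump hr k).nonneg_normed _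

theorem continuous_mollKernel (z : Plane) {r : ℝ} (hr : 0 < r) (k : ℕ) :
    Continuous fun q : Plane × Plane => mollKernel z hr k q.1 q.2 := by
  unfold mollKernel
  exact (mollBump hr k).continuous_normed.comp (by fun_prop)

theorem continuous_mollKernel_right (z : Plane) {r : ℝ} (hr : 0 < r) (k : ℕ) (x : Plane) :
    Continuous (mollKernel z hr k x) := by
  unfold mollKernel
  exact (mollBump hr k).continuous_normed.comp (by fun_prop)

theorem continuous_mollKernel_left (z : Plane) {r : ℝ} (hr : 0 < r) (k : ℕ) (y : Plane) :
    Continuous fun x => mollKernel z hr k x y := by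
  unfold mollKernel
  exact (mollBump hr k).continuous_normed.comp (by fun_prop)

theorem mollKernel_eq_zero (z : Plane) {r : ℝ} (hr : 0 < r) (k : ℕ) {x y : Plane}
    (h : (1 - shrinkFactor k) * r / 2 ≤ ‖z + shrinkFactor k • (x - z) - y‖) :
    mollKernel z hr k x y = 0 := by
  unfold mollKernel
  rw [← Function.notMem_support, ContDiffBump.support_normed_eq, mem_ball_zero_iff, not_lt]
  exact h

theorem integral_mollKernel (z : Plane) {r : ℝ} (hr : 0 < r) (k : ℕ) (x : Plane) :
    ∫ y, mollKernel z hr k x y = 1 := by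
  unfold mollKernel
  rw [integral_sub_left_eq_self (fun y => (mollBump hr k).normed volume y)]
  exact (mollBump hr k).integral_normed

namespace IsStarPolygon

variable {ι : Type*} {T : Set Plane} {E : Finset ι} {a b n : ι → Plane} {z : Plane} {r : ℝ}

theorem closedBall_mollKernel_subset (hT : IsStarPolygon T E a b n z r) (k : ℕ) {x : Plane}
    (hx : x ∈ T) : Metric.closedBall (z + shrinkFactor k • (x - z)) ((1 - shrinkFactor k) * r / 2)
      ⊆ interior T := by
  have h0 := mul_pos (sub_pos.2 (shrinkFactor_lt_one k)) hT.pos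
  have h1 : Metric.ball (z + shrinkFactor k • (x - z)) ((1 - shrinkFactor k) * r) ⊆ interior T :=
    interior_maximal (Metric.ball_subset_closedBall.trans
      (hT.closedBall_shrink_subset hx (by linarith [half_le_shrinkFactor k])
        (shrinkFactor_lt_one k).le)) Metric.isOpen_ball
  exact (Metric.closedBall_subset_ball (by linarith)).trans h1

theorem isTestFunction_mollKernel (hT : IsStarPolygon T E a b n z r) (k : ℕ) {x : Plane}
    (hx : x ∈ T) : IsTestFunction (interior T) (mollKernel z hT.pos k x) := by
  have hsub : tsupport (mollKernel z hT.pos k x)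
      ⊆ Metric.closedBall (z + shrinkFactor k • (x - z)) ((1 - shrinkFactor k) * r / 2) := by
    apply closure_minimal _ Metric.isClosed_closedBall
    intro y hy
    rw [Function.mem_support] at hy
    rw [mem_closedBall_iff_norm']
    by_contra! h
    exact hy (mollKernel_eq_zero z hT.pos k h.le)
  refine ⟨?_, ?_, hsub.trans (hT.closedBall_mollKernel_subset k hx)⟩
  · unfold mollKernel
    exact ((mollBump hT.pos k).contDiff_normed (n := ⊤)).comp (contDiff_const.sub contDiff_id)
  · exact (isCompact_closedBall _ _).of_isClosed_subset (isClosed_tsupport _) hsub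

theorem setIntegral_mollKernel (hT : IsStarPolygon T E a b n z r) (k : ℕ) {x : Plane}
    (hx : x ∈ T) : ∫ y in T, mollKernel z hT.pos k x y = 1 := by
  rw [setIntegral_eq_integral_of_forall_compl_eq_zero, integral_mollKernel]
  intro y hy
  by_contra h
  exact hy (interior_subset ((hT.isTestFunction_mollKernel k hx).support
    (subset_tsupport _ h)))

theorem isFiniteMeasure (hT : IsStarPolygon T E a b n z r) :
    IsFiniteMeasure (volume.restrict T) := ⟨by
  rw [Measure.restrict_apply_univ]; exact hT.isCompact.measure_lt_top⟩

/-- Multiplying an integrable function by a continuous one preserves integrability on `T`. -/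
theorem integrableOn_mul_continuous (hT : IsStarPolygon T E a b n z r) {f g : Plane → ℝ}
    (hf : IntegrableOn f T) (hg : Continuous g) : IntegrableOn (fun y => f y * g y) T :=
  hf.mul_continuousOn hg.continuousOn hT.isCompact

theorem mollify_eq_convolution (hT : IsStarPolygon T E a b n z r) (k : ℕ) (f : Plane → ℝ)
    (x : Plane) : mollify T z hT.pos k f x
      = (MeasureTheory.convolution ((mollBump hT.pos k).normed volume) (T.indicator f)
        (ContinuousLinearMap.lsmul ℝ ℝ) volume) (z + shrinkFactor k • (x - z)) := by
  rw [convolution_lsmul_swap, mollify, ← integral_indicator hT.measurableSet]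
  congr 1
  funext y
  by_cases hy : y ∈ T
  · simp only [indicator_of_mem hy, mollKernel, smul_eq_mul]; ring
  · simp only [indicator_of_notMem hy, smul_zero]

/-- Mollifications are `C¹` up to the boundary. Their derivatives are expressed by derivatives of
the kernel in the variable of integration, as in the definition of weak derivatives; the factor
comes from the contraction. -/
theorem hasFDerivAt_mollify (hT : IsStarPolygon T E a b n z r) (k : ℕ) {f : Plane → ℝ}
    (hf : IntegrableOn f T) : ContDiff ℝ 1 (mollify T z hT.pos k f) ∧
      ∀ x j, partialDeriv j (mollify T z hT.pos k f) x
        = - shrinkFactor k * ∫ y in T, f y * partialDeriv j (mollKernel z hT.pos k x) y := by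
  set φ := (mollBump hT.pos k).normed (volume : Measure Plane) with hφ
  have hloc : LocallyIntegrable (T.indicator f) volume :=
    (hf.integrable_indicator hT.measurableSet).locallyIntegrable
  have hφs : ContDiff ℝ 1 φ := (mollBump hT.pos k).contDiff_normed (n := 1)
  have hφc : HasCompactSupport φ := (mollBump hT.pos k).hasCompactSupport_normed
  have hfun : mollify T z hT.pos k f = (MeasureTheory.convolution φ (T.indicator f)
      (ContinuousLinearMap.lsmul ℝ ℝ) volume) ∘ fun x => z + shrinkFactor k • (x - z) :=
    funext fun x => hT.mollify_eq_convolution k f x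
  constructor
  · rw [hfun]
    have h1 : ContDiff ℝ ((1 : ℕ∞) : WithTop ℕ∞) (MeasureTheory.convolution φ (T.indicator f)
        (ContinuousLinearMap.lsmul ℝ ℝ) volume) :=
      hφc.contDiff_convolution_left _ hφs hloc
    exact h1.comp (contDiff_const.add ((contDiff_id.sub contDiff_const).const_smul _))
  · intro x j
    set x' := z + shrinkFactor k • (x - z) with hx'
    have hd := hφc.hasFDerivAt_convolution_left (ContinuousLinearMap.lsmul ℝ ℝ) hφs hloc x'
    have haff : HasFDerivAt (fun x : Plane => z + shrinkFactor k • (x - z))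
        (shrinkFactor k • ContinuousLinearMap.id ℝ Plane) x :=
      (((hasFDerivAt_id x).sub_const z).const_smul (shrinkFactor k)).const_add z
    have hd2 := hd.comp x haff
    rw [← hfun] at hd2
    have hcs : Continuous (fderiv ℝ φ) := hφs.continuous_fderiv one_ne_zero
    have hint : Integrable (fun y => (ContinuousLinearMap.lsmul ℝ ℝ).precompL Plane
        (fderiv ℝ φ (x' - y)) (T.indicator f y)) volume := by
      have := (hφc.fderiv (𝕜 := ℝ)).convolutionExists_left
        (L := (ContinuousLinearMap.lsmul ℝ ℝ).precompL Plane) hcs hloc x'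
      exact this.integrable_swap
    simp only [partialDeriv]
    rw [hd2.fderiv, ContinuousLinearMap.comp_apply, convolution_eq_swap,
      ContinuousLinearMap.integral_apply hint, ← integral_indicator hT.measurableSet, neg_mul,
      ← mul_neg, ← integral_neg, ← integral_const_mul]
    congr 1
    funext y
    have hker : HasFDerivAt (mollKernel z hT.pos k x) (-fderiv ℝ φ (x' - y)) y := by
      have h1 : HasFDerivAt (fun y : Plane => x' - y) (-ContinuousLinearMap.id ℝ Plane) y :=
        (hasFDerivAt_id y).const_sub x'
      have h2 := ((hφs.differentiable one_ne_zero) (x' - y)).hasFDerivAt.comp y h1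
      refine h2.congr_fderiv ?_
      ext v
      simp
    by_cases hy : y ∈ T
    · simp only [indicator_of_mem hy, hker.fderiv]
      simp [ContinuousLinearMap.precompL_apply]
      exact Or.inl (by ring)
    · simp [indicator_of_notMem hy]

end IsStarPolygon

-- The kernel is used through the lemmas above only; unfolding it makes unification expensive.
attribute [irreducible] mollKernel

namespace IsStarPolygon

variable {ι : Type*} {T : Set Plane} {E : Finset ι} {a b n : ι → Plane} {z : Plane} {r : ℝ}

/-- Jensen's inequality: for `x ∈ T` the kernel is a probability density on `T`. -/
theorem mollify_sq_le (hT : IsStarPolygon T E a b n z r) (k : ℕ) {f : Plane → ℝ}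
    (hf : MemLp f 2 (volume.restrict T)) {x : Plane} (hx : x ∈ T) :
    mollify T z hT.pos k f x ^ 2 ≤ ∫ y in T, f y ^ 2 * mollKernel z hT.pos k x y := by
  have := hT.isFiniteMeasure
  have hi2 : IntegrableOn (fun y => f y ^ 2) T := hf.integrable_sq
  have hi1 : IntegrableOn f T := hf.integrable (by norm_num)
  have hψc : Continuous (mollKernel z hT.pos k x) :=
    continuous_mollKernel_right z hT.pos k x
  have i2 : IntegrableOn (fun y => f y ^ 2 * mollKernel z hT.pos k x y) T :=
    hT.integrableOn_mul_continuous hi2 hψc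
  have i1 : IntegrableOn (fun y => f y * mollKernel z hT.pos k x y) T :=
    hT.integrableOn_mul_continuous hi1 hψc
  set I := mollify T z hT.pos k f x with hI
  have h0 : 0 ≤ ∫ y in T, (f y - I) ^ 2 * mollKernel z hT.pos k x y :=
    integral_nonneg fun y => mul_nonneg (sq_nonneg _) (mollKernel_nonneg _ _ _ _ _)
  have h1 : ∫ y in T, (f y - I) ^ 2 * mollKernel z hT.pos k x y
      = (∫ y in T, f y ^ 2 * mollKernel z hT.pos k x y) - I ^ 2 := by
    have e : (fun y => (f y - I) ^ 2 * mollKernel z hT.pos k x y)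
        = fun y => (f y ^ 2 * mollKernel z hT.pos k x y
          - 2 * I * (f y * mollKernel z hT.pos k x y)) + I ^ 2 * mollKernel z hT.pos k x y := by
      funext y; ring
    have i3 : IntegrableOn (fun y => f y ^ 2 * mollKernel z hT.pos k x y
        - 2 * I * (f y * mollKernel z hT.pos k x y)) T := i2.sub (i1.const_mul _)
    rw [e, integral_add i3 ((hT.integrableOn hψc).const_mul _), integral_sub i2 (i1.const_mul _),
      integral_const_mul, integral_const_mul, hT.setIntegral_mollKernel k hx]
    have : ∫ y in T, f y * mollKernel z hT.pos k x y = I := rfl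
    rw [this]
    ring
  linarith

theorem continuous_mollify (hT : IsStarPolygon T E a b n z r) (k : ℕ) {f : Plane → ℝ}
    (hf : IntegrableOn f T) : Continuous (mollify T z hT.pos k f) :=
  (hT.hasFDerivAt_mollify k hf).1.continuous

/-- Mollification is bounded in `L²(T)`, with a bound uniform in the parameter. -/
theorem eLpNorm_mollify_le (hT : IsStarPolygon T E a b n z r) (k : ℕ) {f : Plane → ℝ}
    (hf : MemLp f 2 (volume.restrict T)) :
    eLpNorm (mollify T z hT.pos k f) 2 (volume.restrict T)
      ≤ 2 * eLpNorm f 2 (volume.restrict T) := by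
  have := hT.isFiniteMeasure
  have hψ := continuous_mollKernel z hT.pos k
  -- Jensen's inequality and Fubini's theorem; in the variable `x` the kernel has integral at most
  -- `4`, as the factor of the contraction is at least `1 / 2`
  have h1 : ∫⁻ x in T, ‖mollify T z hT.pos k f x‖ₑ ^ (2 : ℝ)
      ≤ 4 * ∫⁻ y in T, ‖f y‖ₑ ^ (2 : ℝ) := by
    have hle : ∀ x ∈ T, ‖mollify T z hT.pos k f x‖ₑ ^ (2 : ℝ)
        ≤ ∫⁻ y in T, ‖f y‖ₑ ^ (2 : ℝ) * ENNReal.ofReal (mollKernel z hT.pos k x y) := by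
      intro x hx
      have h := hT.mollify_sq_le k hf hx
      have e (t : ℝ) : ‖t‖ₑ ^ (2 : ℝ) = ENNReal.ofReal (t ^ 2) := by
        rw [← ofReal_norm, Real.norm_eq_abs,
          ENNReal.ofReal_rpow_of_nonneg (abs_nonneg t) (by norm_num)]
        norm_num
      have hψc : Continuous (mollKernel z hT.pos k x) := continuous_mollKernel_right z hT.pos k x
      have i2 : IntegrableOn (fun y => f y ^ 2 * mollKernel z hT.pos k x y) T :=
        hT.integrableOn_mul_continuous hf.integrable_sq hψc
      simp only [e]
      have e2 (y : Plane) : ENNReal.ofReal (f y ^ 2) * ENNReal.ofReal (mollKernel z hT.pos k x y)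
          = ENNReal.ofReal (f y ^ 2 * mollKernel z hT.pos k x y) :=
        (ENNReal.ofReal_mul (sq_nonneg _)).symm
      simp only [e2]
      rw [← ofReal_integral_eq_lintegral_ofReal i2 (Eventually.of_forall fun y =>
        mul_nonneg (sq_nonneg _) (mollKernel_nonneg _ _ _ _ _))]
      exact ENNReal.ofReal_le_ofReal h
    refine (setLIntegral_mono' hT.measurableSet hle).trans ?_
    rw [lintegral_lintegral_swap]
    · rw [← lintegral_const_mul'' _ (by
        exact (hf.aestronglyMeasurable.enorm.pow_const _))]
      refine lintegral_mono fun y => ?_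
      have hmeas : Measurable fun x => ENNReal.ofReal (mollKernel z hT.pos k x y) :=
        ENNReal.measurable_ofReal.comp (continuous_mollKernel_left z hT.pos k y).measurable
      calc ∫⁻ x in T, ‖f y‖ₑ ^ (2 : ℝ) * ENNReal.ofReal (mollKernel z hT.pos k x y)
          = ‖f y‖ₑ ^ (2 : ℝ) * ∫⁻ x in T, ENNReal.ofReal (mollKernel z hT.pos k x y) :=
            lintegral_const_mul _ hmeas
        _ ≤ ‖f y‖ₑ ^ (2 : ℝ) * 4 := by
            gcongr
            refine (setLIntegral_le_lintegral _ _).trans ?_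
            have h2 := lintegral_comp_add_smul
              (fun x => ENNReal.ofReal ((mollBump hT.pos k).normed volume x))
              (ENNReal.measurable_ofReal.comp (mollBump hT.pos k).continuous_normed.measurable)
              (z - shrinkFactor k • z - y) (t := shrinkFactor k)
              (by linarith [half_le_shrinkFactor k])
            have e3 (x : Plane) : mollKernel z hT.pos k x y = (mollBump hT.pos k).normed volume
                (z - shrinkFactor k • z - y + shrinkFactor k • x) := by
              rw [mollKernel_def]; congr 1; module
            simp only [e3]
            rw [h2, ← ofReal_integral_eq_lintegral_ofReal (mollBump hT.pos k).integrable_normed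
              (Eventually.of_forall (mollBump hT.pos k).nonneg_normed),
              (mollBump hT.pos k).integral_normed, ENNReal.ofReal_one, mul_one,
              ← ENNReal.ofReal_ofNat]
            apply ENNReal.ofReal_le_ofReal
            have := half_le_shrinkFactor k
            rw [inv_le_comm₀ (by positivity) (by norm_num)]
            nlinarith
        _ = 4 * ‖f y‖ₑ ^ (2 : ℝ) := mul_comm _ _
    · apply AEMeasurable.mul
      · exact (hf.aestronglyMeasurable.enorm.pow_const (2 : ℝ)).comp_snd
      · exact (ENNReal.measurable_ofReal.comp hψ.measurable).aemeasurable
  rw [eLpNorm_eq_lintegral_rpow_enorm_toReal (by norm_num) (by norm_num),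
    eLpNorm_eq_lintegral_rpow_enorm_toReal (by norm_num) (by norm_num), ENNReal.toReal_ofNat]
  calc (∫⁻ x in T, ‖mollify T z hT.pos k f x‖ₑ ^ (2 : ℝ)) ^ (1 / (2 : ℝ))
      ≤ (4 * ∫⁻ y in T, ‖f y‖ₑ ^ (2 : ℝ)) ^ (1 / (2 : ℝ)) :=
        ENNReal.rpow_le_rpow h1 (by norm_num)
    _ = _ := by
        rw [ENNReal.mul_rpow_of_nonneg _ _ (by norm_num)]
        congr 1
        have : (4 : ℝ≥0∞) = 2 ^ (2 : ℝ) := by norm_num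
        rw [this, ← ENNReal.rpow_mul]
        norm_num

/-- For continuous functions the mollifications converge uniformly on `T`. -/
theorem mollify_uniform (hT : IsStarPolygon T E a b n z r) {g : Plane → ℝ}
    (hg : ContinuousOn g T) {η : ℝ} (hη : 0 < η) :
    ∀ᶠ k in atTop, ∀ x ∈ T, |mollify T z hT.pos k g x - g x| ≤ η := by
  have huc := hT.isCompact.uniformContinuousOn_of_continuous hg
  rw [Metric.uniformContinuousOn_iff] at huc
  obtain ⟨d, hd, hdg⟩ := huc η hη
  obtain ⟨R, hR⟩ := hT.isCompact.isBounded.subset_closedBall z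
  have hlim : Tendsto (fun k => (1 - shrinkFactor k) * (r / 2 + R)) atTop (𝓝 0) := by
    have := (tendsto_shrinkFactor.const_sub 1).mul_const (r / 2 + R)
    simpa using this
  filter_upwards [hlim.eventually_lt_const hd] with k hk x hx
  have hψc : Continuous (mollKernel z hT.pos k x) :=
    continuous_mollKernel_right z hT.pos k x
  have hi : IntegrableOn (fun y => g y * mollKernel z hT.pos k x y) T :=
    (hg.mul hψc.continuousOn).integrableOn_compact hT.isCompact
  have e : mollify T z hT.pos k g x - g x
      = ∫ y in T, (g y - g x) * mollKernel z hT.pos k x y := by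
    have e1 : (fun y => (g y - g x) * mollKernel z hT.pos k x y)
      = fun y => g y * mollKernel z hT.pos k x y - g x * mollKernel z hT.pos k x y := by
        funext y; ring
    rw [e1, integral_sub hi ((hT.integrableOn hψc).const_mul _), integral_const_mul,
      hT.setIntegral_mollKernel k hx, mul_one]
    rfl
  rw [e]
  have hi2 : IntegrableOn (fun y => |(g y - g x) * mollKernel z hT.pos k x y|) T :=
    (((hg.sub continuousOn_const).mul hψc.continuousOn).abs).integrableOn_compact hT.isCompact
  calc |∫ y in T, (g y - g x) * mollKernel z hT.pos k x y|
      ≤ ∫ y in T, |(g y - g x) * mollKernel z hT.pos k x y| := abs_integral_le_integral_abs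
    _ ≤ ∫ y in T, η * mollKernel z hT.pos k x y := by
        refine setIntegral_mono_on hi2 ((hT.integrableOn hψc).const_mul _) hT.measurableSet
          fun y hy => ?_
        have hψ0 := mollKernel_nonneg z hT.pos k x y
        rw [abs_mul, abs_of_nonneg hψ0]
        rcases hψ0.eq_or_lt with h0 | h0
        · rw [← h0, mul_zero, mul_zero]
        · refine mul_le_mul_of_nonneg_right ?_ hψ0
          have hnorm : ‖z + shrinkFactor k • (x - z) - y‖ < (1 - shrinkFactor k) * r / 2 := by
            by_contra! h
            exact h0.ne' (mollKernel_eq_zero z hT.pos k h)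
          have hxR : ‖x - z‖ ≤ R := mem_closedBall_iff_norm.1 (hR hx)
          have hlt := sub_pos.2 (shrinkFactor_lt_one k)
          have hdist : dist y x < d := by
            rw [dist_eq_norm']
            calc ‖x - y‖ = ‖(z + shrinkFactor k • (x - z) - y)
                  + (1 - shrinkFactor k) • (x - z)‖ := by congr 1; module
              _ ≤ (1 - shrinkFactor k) * r / 2 + (1 - shrinkFactor k) * R := by
                  refine (norm_add_le _ _).trans (add_le_add hnorm.le ?_)
                  rw [norm_smul, Real.norm_eq_abs, abs_of_pos hlt]
                  exact mul_le_mul_of_nonneg_left hxR hlt.le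
              _ = (1 - shrinkFactor k) * (r / 2 + R) := by ring
              _ < d := hk
          exact (hdg y hy x hx hdist).le
    _ = η := by rw [integral_const_mul, hT.setIntegral_mollKernel k hx, mul_one]

theorem memLp_of_continuous (hT : IsStarPolygon T E a b n z r) {f : Plane → ℝ}
    (hf : Continuous f) : MemLp f 2 (volume.restrict T) := by
  have := hT.isFiniteMeasure
  obtain ⟨B, hB⟩ := hT.isCompact.exists_bound_of_continuousOn hf.continuousOn
  refine MemLp.of_bound hf.aestronglyMeasurable B ?_
  filter_upwards [ae_restrict_mem hT.measurableSet] with x hx using hB x hx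

/-- The mollifications converge in `L²(T)`. -/
theorem tendsto_eLpNorm_mollify_sub (hT : IsStarPolygon T E a b n z r) {f : Plane → ℝ}
    (hf : MemLp f 2 (volume.restrict T)) :
    Tendsto (fun k => eLpNorm (mollify T z hT.pos k f - f) 2 (volume.restrict T)) atTop (𝓝 0) := by
  have := hT.isFiniteMeasure
  rw [ENNReal.tendsto_nhds_zero]
  intro ε hε
  set V := (volume.restrict T) univ ^ (1 / (2 : ℝ)) with hV
  have hVt : V ≠ ⊤ := ENNReal.rpow_ne_top_of_nonneg (by norm_num) (measure_ne_top _ _)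
  obtain ⟨η, hη, hηε⟩ : ∃ η : ℝ, 0 < η ∧ ENNReal.ofReal η * (3 + V) ≤ ε := by
    rcases eq_or_ne ε ⊤ with rfl | hεt
    · exact ⟨1, one_pos, le_top⟩
    · have h3 : 3 + V ≠ ⊤ := by simp [hVt]
      have h30 : 3 + V ≠ 0 := by simp
      refine ⟨(ε / (3 + V)).toReal, ENNReal.toReal_pos (ENNReal.div_pos hε.ne' h3).ne'
        (ENNReal.div_lt_top hεt h30).ne, ?_⟩
      rw [ENNReal.ofReal_toReal (ENNReal.div_lt_top hεt h30).ne, ENNReal.div_mul_cancel h30 h3]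
  -- approximation by a continuous function, for which the convergence is uniform
  obtain ⟨g, hfg, hgL, hgc⟩ : ∃ g : Plane → ℝ, eLpNorm (f - g) 2 (volume.restrict T)
      ≤ ENNReal.ofReal η ∧ MemLp g 2 (volume.restrict T) ∧ Continuous g := by
    obtain ⟨g, hfg, hgL⟩ := hf.exists_boundedContinuous_eLpNorm_sub_le (by norm_num)
      (ε := ENNReal.ofReal η) (by simpa using hη)
    exact ⟨g, hfg, hgL, g.continuous⟩
  filter_upwards [hT.mollify_uniform hgc.continuousOn hη] with k hk
  have hi1 : IntegrableOn f T := hf.integrable (by norm_num)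
  have hg1 : IntegrableOn g T := hgL.integrable (by norm_num)
  have m1 := (hT.continuous_mollify k hi1).aestronglyMeasurable (μ := volume.restrict T)
  have m2 := (hT.continuous_mollify k hg1).aestronglyMeasurable (μ := volume.restrict T)
  have m3 := (hT.continuous_mollify k (hi1.sub hg1)).aestronglyMeasurable (μ := volume.restrict T)
  have hsplit : mollify T z hT.pos k f - f =ᵐ[volume.restrict T]
      (mollify T z hT.pos k (f - g) + (mollify T z hT.pos k g - g)) + (g - f) := by
    filter_upwards [ae_restrict_mem hT.measurableSet] with x hx
    have hψc : Continuous (mollKernel z hT.pos k x) :=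
      continuous_mollKernel_right z hT.pos k x
    have : mollify T z hT.pos k (f - g) x
        = mollify T z hT.pos k f x - mollify T z hT.pos k g x := by
      unfold mollify
      rw [← integral_sub (hT.integrableOn_mul_continuous hi1 hψc)
        (hT.integrableOn_mul_continuous hg1 hψc)]
      congr 1
      funext y
      simp only [Pi.sub_apply]
      ring
    simp only [Pi.sub_apply, Pi.add_apply, this]
    ring
  rw [eLpNorm_congr_ae hsplit]
  have hu : eLpNorm (mollify T z hT.pos k g - g) 2 (volume.restrict T) ≤ V * ENNReal.ofReal η := by
    have := eLpNorm_le_of_ae_bound (p := 2) (μ := volume.restrict T)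
      (f := mollify T z hT.pos k g - g) (C := η) (by
        filter_upwards [ae_restrict_mem hT.measurableSet] with x hx
        exact hk x hx)
    refine this.trans (le_of_eq ?_)
    rw [hV]
    norm_num
  calc _ ≤ eLpNorm (mollify T z hT.pos k (f - g) + (mollify T z hT.pos k g - g)) 2
            (volume.restrict T) + eLpNorm (g - f) 2 (volume.restrict T) :=
        eLpNorm_add_le (m3.add (m2.sub hgc.aestronglyMeasurable))
          (hgc.aestronglyMeasurable.sub hf.aestronglyMeasurable) (by norm_num)
    _ ≤ (eLpNorm (mollify T z hT.pos k (f - g)) 2 (volume.restrict T)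
          + eLpNorm (mollify T z hT.pos k g - g) 2 (volume.restrict T))
          + eLpNorm (g - f) 2 (volume.restrict T) := by
        gcongr
        exact eLpNorm_add_le m3 (m2.sub hgc.aestronglyMeasurable) (by norm_num)
    _ ≤ (2 * ENNReal.ofReal η + V * ENNReal.ofReal η) + ENNReal.ofReal η := by
        gcongr
        · exact (hT.eLpNorm_mollify_le k (hf.sub hgL)).trans (by gcongr)
        · rwa [eLpNorm_sub_comm]
    _ = ENNReal.ofReal η * (3 + V) := by ring
    _ ≤ ε := hηε

end IsStarPolygon

/-! ### `L²` convergence and weak divergence -/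

/-- Convergence in `L²(μ)` of a sequence of functions. -/
structure L2Tendsto (μ : Measure Plane) (F : ℕ → Plane → ℝ) (f : Plane → ℝ) : Prop where
  memLp : ∀ k, MemLp (F k) 2 μ
  memLp_lim : MemLp f 2 μ
  tendsto : Tendsto (fun k => eLpNorm (F k - f) 2 μ) atTop (𝓝 0)

namespace L2Tendsto

variable {μ : Measure Plane} {F F' : ℕ → Plane → ℝ} {f f' : Plane → ℝ}

theorem tendsto_toLp (h : L2Tendsto μ F f) :
    Tendsto (fun k => (h.memLp k).toLp (F k)) atTop (𝓝 (h.memLp_lim.toLp f)) :=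
  (Lp.tendsto_Lp_iff_tendsto_eLpNorm'' F h.memLp f h.memLp_lim).2 h.tendsto

theorem tendsto_integral_mul (h : L2Tendsto μ F f) (h' : L2Tendsto μ F' f') :
    Tendsto (fun k => ∫ x, F k x * F' k x ∂μ) atTop (𝓝 (∫ x, f x * f' x ∂μ)) := by
  have key {g g' : Plane → ℝ} (hg : MemLp g 2 μ) (hg' : MemLp g' 2 μ) :
      inner ℝ (hg'.toLp g') (hg.toLp g) = ∫ x, g x * g' x ∂μ := by
    rw [L2.inner_def]
    refine integral_congr_ae ?_
    filter_upwards [hg.coeFn_toLp, hg'.coeFn_toLp] with x h1 h2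
    rw [h1, h2]
    simp
  have := h'.tendsto_toLp.inner (𝕜 := ℝ) h.tendsto_toLp
  simpa only [key] using this

theorem tendsto_integral_sq (h : L2Tendsto μ F f) :
    Tendsto (fun k => ∫ x, F k x ^ 2 ∂μ) atTop (𝓝 (∫ x, f x ^ 2 ∂μ)) := by
  simpa only [sq] using h.tendsto_integral_mul h

theorem const {f : Plane → ℝ} (hf : MemLp f 2 μ) : L2Tendsto μ (fun _ => f) f :=
  ⟨fun _ => hf, hf, by simp⟩

theorem tendsto_integral [IsFiniteMeasure μ] (h : L2Tendsto μ F f) :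
    Tendsto (fun k => ∫ x, F k x ∂μ) atTop (𝓝 (∫ x, f x ∂μ)) := by
  have := h.tendsto_integral_mul (const (memLp_const (1 : ℝ)))
  simpa using this

theorem mono (h : L2Tendsto μ F f) {ν : Measure Plane} (hν : ν ≤ μ) : L2Tendsto ν F f :=
  ⟨fun k => (h.memLp k).mono_measure hν, h.memLp_lim.mono_measure hν,
    tendsto_of_tendsto_of_tendsto_of_le_of_le tendsto_const_nhds h.tendsto (fun _ => zero_le)
      fun _ => eLpNorm_mono_measure _ hν⟩

theorem abs (h : L2Tendsto μ F f) : L2Tendsto μ (fun k x => |F k x|) (fun x => |f x|) := by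
  refine ⟨fun k => (h.memLp k).abs, h.memLp_lim.abs,
    tendsto_of_tendsto_of_tendsto_of_le_of_le tendsto_const_nhds h.tendsto (fun _ => zero_le)
      fun k => eLpNorm_mono fun x => ?_⟩
  simpa using abs_abs_sub_abs_le (F k x) (f x)

theorem add (h : L2Tendsto μ F f) (h' : L2Tendsto μ F' f') :
    L2Tendsto μ (fun k x => F k x + F' k x) (fun x => f x + f' x) := by
  refine ⟨fun k => (h.memLp k).add (h'.memLp k), h.memLp_lim.add h'.memLp_lim, ?_⟩
  have hs := h.tendsto.add h'.tendsto
  rw [add_zero] at hs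
  refine tendsto_of_tendsto_of_tendsto_of_le_of_le tendsto_const_nhds hs (fun _ => zero_le)
    fun k => ?_
  have e : ((fun x => F k x + F' k x) - fun x => f x + f' x) = (F k - f) + (F' k - f') := by
    funext x; simp only [Pi.sub_apply, Pi.add_apply]; ring
  simp only [e]
  exact eLpNorm_add_le ((h.memLp k).sub h.memLp_lim).aestronglyMeasurable
    ((h'.memLp k).sub h'.memLp_lim).aestronglyMeasurable (by norm_num)

theorem const_mul (h : L2Tendsto μ F f) {c : ℕ → ℝ} {c' : ℝ} (hc : Tendsto c atTop (𝓝 c')) :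
    L2Tendsto μ (fun k x => c k * F k x) (fun x => c' * f x) := by
  refine ⟨fun k => (h.memLp k).const_mul _, h.memLp_lim.const_mul _, ?_⟩
  have h1 : Tendsto (fun k => ‖c k‖ₑ * eLpNorm (F k - f) 2 μ + ‖c k - c'‖ₑ * eLpNorm f 2 μ) atTop
      (𝓝 (‖c'‖ₑ * 0 + ‖c' - c'‖ₑ * eLpNorm f 2 μ)) := by
    refine (ENNReal.Tendsto.mul hc.enorm (Or.inr (by simp)) h.tendsto (Or.inr (by simp))).add ?_
    exact ENNReal.Tendsto.mul_const (hc.sub_const c').enorm (Or.inr h.memLp_lim.eLpNorm_ne_top)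
  simp only [sub_self, enorm_zero, mul_zero, zero_mul, add_zero] at h1
  refine tendsto_of_tendsto_of_tendsto_of_le_of_le tendsto_const_nhds h1 (fun _ => zero_le)
    fun k => ?_
  have e : ((fun x => c k * F k x) - fun x => c' * f x)
      = c k • (F k - f) + (c k - c') • f := by
    funext x; simp only [Pi.sub_apply, Pi.add_apply, Pi.smul_apply, smul_eq_mul]; ring
  simp only [e]
  refine (eLpNorm_add_le (((h.memLp k).sub h.memLp_lim).const_smul _).aestronglyMeasurable
    (h.memLp_lim.const_smul _).aestronglyMeasurable (by norm_num)).trans ?_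
  rw [eLpNorm_const_smul, eLpNorm_const_smul]

theorem sum {ι : Type*} (s : Finset ι) {F : ι → ℕ → Plane → ℝ} {f : ι → Plane → ℝ}
    (h : ∀ j ∈ s, L2Tendsto μ (F j) (f j)) :
    L2Tendsto μ (fun k x => ∑ j ∈ s, F j k x) (fun x => ∑ j ∈ s, f j x) := by
  classical
  induction s using Finset.induction_on with
  | empty => simp only [Finset.sum_empty]; exact const (MemLp.zero (p := 2))
  | insert j s hj ih =>
    simp only [Finset.sum_insert hj]
    exact (h j (Finset.mem_insert_self _ _)).add
      (ih fun i hi => h i (Finset.mem_insert_of_mem hi))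

theorem congr (h : L2Tendsto μ F f) (hF : ∀ k, F k =ᵐ[μ] F' k) (hf : f =ᵐ[μ] f') :
    L2Tendsto μ F' f' := by
  refine ⟨fun k => (h.memLp k).ae_eq (hF k), h.memLp_lim.ae_eq hf, h.tendsto.congr fun k => ?_⟩
  exact eLpNorm_congr_ae ((hF k).sub hf)

end L2Tendsto

namespace IsStarPolygon

variable {ι : Type*} {T : Set Plane} {E : Finset ι} {a b n : ι → Plane} {z : Plane} {r : ℝ}

theorem restrict_interior (hT : IsStarPolygon T E a b n z r) :
    volume.restrict (interior T) = volume.restrict T :=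
  Measure.restrict_congr_set (interior_ae_eq_of_null_frontier hT.volume_frontier)

theorem l2Tendsto_mollify (hT : IsStarPolygon T E a b n z r) {f : Plane → ℝ}
    (hf : MemLp f 2 (volume.restrict T)) :
    L2Tendsto (volume.restrict T) (fun k => mollify T z hT.pos k f) f := by
  have := hT.isFiniteMeasure
  exact ⟨fun k => hT.memLp_of_continuous (hT.continuous_mollify k (hf.integrable (by norm_num))),
    hf, hT.tendsto_eLpNorm_mollify_sub hf⟩

/-- The field `F` has weak divergence `ψ` in the open set `U`. -/
def _root_.IsWeakDivergence (U : Set Plane) (F : Fin 2 → Plane → ℝ) (ψ : Plane → ℝ) : Prop :=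
  ∀ φ, IsTestFunction U φ →
    ∫ x in U, ∑ j, F j x * partialDeriv j φ x = - ∫ x in U, ψ x * φ x

theorem _root_.continuous_partialDeriv_of_isTestFunction {U : Set Plane} {φ : Plane → ℝ}
    (hφ : IsTestFunction U φ) (j : Fin 2) : Continuous (partialDeriv j φ) :=
  continuous_partialDeriv (hφ.smooth.of_le (by exact_mod_cast le_top)) j

/-- Mollification commutes with the divergence, up to the contraction factor. -/
theorem divergence_mollify (hT : IsStarPolygon T E a b n z r) (k : ℕ) {F : Fin 2 → Plane → ℝ}
    {ψ : Plane → ℝ} (hF : ∀ j, IntegrableOn (F j) T)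
    (h : IsWeakDivergence (interior T) F ψ) {x : Plane} (hx : x ∈ T) :
    ∑ j, partialDeriv j (mollify T z hT.pos k (F j)) x
      = shrinkFactor k * mollify T z hT.pos k ψ x := by
  have hφ := hT.isTestFunction_mollKernel k hx
  have h1 := h _ hφ
  rw [hT.restrict_interior, integral_finsetSum _ fun j _ => hT.integrableOn_mul_continuous (hF j)
    (continuous_partialDeriv_of_isTestFunction hφ j)] at h1
  simp only [(hT.hasFDerivAt_mollify k (hF _)).2]
  rw [← Finset.mul_sum, h1]
  unfold mollify
  ring

theorem partialDeriv_mollify (hT : IsStarPolygon T E a b n z r) (k : ℕ) {w : Plane → ℝ}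
    {G : Plane → Plane} (hw : IntegrableOn w T) (h : IsWeakGradient (interior T) w G)
    (j : Fin 2) {x : Plane} (hx : x ∈ T) :
    partialDeriv j (mollify T z hT.pos k w) x
      = shrinkFactor k * mollify T z hT.pos k (fun y => G y j) x := by
  have hφ := hT.isTestFunction_mollKernel k hx
  have h1 := h _ hφ j
  simp only [gradient_apply] at h1
  rw [hT.restrict_interior] at h1
  rw [(hT.hasFDerivAt_mollify k hw).2, h1]
  unfold mollify
  ring

/-- Smooth approximation in `H¹(T)`, uniform on `T` for continuous functions. -/
theorem exists_smooth_approx (hT : IsStarPolygon T E a b n z r) {w : Plane → ℝ}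
    {G : Plane → Plane} (hw : MemLp w 2 (volume.restrict T))
    (hG : ∀ j, MemLp (fun x => G x j) 2 (volume.restrict T))
    (h : IsWeakGradient (interior T) w G) :
    ∃ W : ℕ → Plane → ℝ, (∀ k, ContDiff ℝ 1 (W k)) ∧ L2Tendsto (volume.restrict T) W w ∧
      (∀ j, L2Tendsto (volume.restrict T) (fun k => partialDeriv j (W k)) fun x => G x j) ∧
      (ContinuousOn w T → ∀ η > 0, ∀ᶠ k in atTop, ∀ x ∈ T, |W k x - w x| ≤ η) := by
  have := hT.isFiniteMeasure
  have hw1 : IntegrableOn w T := hw.integrable (by norm_num)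
  refine ⟨fun k => mollify T z hT.pos k w, fun k => (hT.hasFDerivAt_mollify k hw1).1,
    hT.l2Tendsto_mollify hw, fun j => ?_, fun hc η hη => hT.mollify_uniform hc hη⟩
  refine ((hT.l2Tendsto_mollify (hG j)).const_mul tendsto_shrinkFactor).congr (fun k => ?_)
    (Eventually.of_forall fun x => one_mul _)
  filter_upwards [ae_restrict_mem hT.measurableSet] with x hx
  exact (hT.partialDeriv_mollify k hw1 h j hx).symm

/-- Smooth approximation of an `L²` field together with its weak divergence. -/
theorem exists_smooth_approx_divergence (hT : IsStarPolygon T E a b n z r)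
    {F : Fin 2 → Plane → ℝ} {ψ : Plane → ℝ} (hF : ∀ j, MemLp (F j) 2 (volume.restrict T))
    (hψ : MemLp ψ 2 (volume.restrict T)) (h : IsWeakDivergence (interior T) F ψ) :
    ∃ W : ℕ → Fin 2 → Plane → ℝ, (∀ k j, ContDiff ℝ 1 (W k j)) ∧
      (∀ j, L2Tendsto (volume.restrict T) (fun k => W k j) (F j)) ∧
      L2Tendsto (volume.restrict T) (fun k x => ∑ j, partialDeriv j (W k j) x) ψ := by
  have := hT.isFiniteMeasure
  have hF1 (j) : IntegrableOn (F j) T := (hF j).integrable (by norm_num)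
  refine ⟨fun k j => mollify T z hT.pos k (F j), fun k j => (hT.hasFDerivAt_mollify k (hF1 j)).1,
    fun j => hT.l2Tendsto_mollify (hF j), ?_⟩
  refine ((hT.l2Tendsto_mollify hψ).const_mul tendsto_shrinkFactor).congr (fun k => ?_)
    (Eventually.of_forall fun x => one_mul _)
  filter_upwards [ae_restrict_mem hT.measurableSet] with x hx
  exact (hT.divergence_mollify k hF1 h hx).symm

end IsStarPolygon

/-! ### Sobolev functions on a star-shaped polygon -/

/-- `w ∈ H¹(T)` with weak gradient `G` in the interior of `T`. -/
structure HasL2Gradient (T : Set Plane) (w : Plane → ℝ) (G : Plane → Plane) : Prop where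
  memLp : MemLp w 2 (volume.restrict T)
  memLp_grad : ∀ j, MemLp (fun x => G x j) 2 (volume.restrict T)
  weak_grad : IsWeakGradient (interior T) w G

/-- Integrals over the boundary converge for functions that converge uniformly on the edges. -/
theorem tendsto_edgeProfile_one {ι : Type*} {E : Finset ι} {a b : ι → Plane} {z : Plane}
    {w : ι → ℝ} {F : ℕ → Plane → ℝ} {f : Plane → ℝ} (hF : ∀ k, Continuous (F k))
    (hf : Continuous f) (h : ∀ η > 0, ∀ᶠ k in atTop, ∀ e ∈ E, ∀ t ∈ Icc (0 : ℝ) 1,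
      |F k (AffineMap.lineMap (a e) (b e) t) - f (AffineMap.lineMap (a e) (b e) t)| ≤ η) :
    Tendsto (fun k => edgeProfile E a b z w (F k) 1) atTop (𝓝 (edgeProfile E a b z w f 1)) := by
  unfold edgeProfile
  refine tendsto_finsetSum _ fun e he => Tendsto.const_mul _ ?_
  rw [Metric.tendsto_nhds]
  intro η hη
  filter_upwards [h (η / 2) (half_pos hη)] with k hk
  rw [Real.dist_eq, ← intervalIntegral.integral_sub (intervalIntegrable_ray (hF k) _ _ _ _)
    (intervalIntegrable_ray hf _ _ _ _), ← Real.norm_eq_abs]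
  have := intervalIntegral.norm_integral_le_of_norm_le_const (a := (0 : ℝ)) (b := 1)
    (C := η / 2) (f := fun t => F k (rayPt z (a e) (b e) (1, t)) - f (rayPt z (a e) (b e) (1, t)))
    (fun t ht => by
      rw [uIoc_of_le zero_le_one] at ht
      have e1 : rayPt z (a e) (b e) (1, t) = AffineMap.lineMap (a e) (b e) t := by
        simp [rayPt]
      rw [e1]
      exact hk e he t ⟨ht.1.le, ht.2⟩)
  rw [sub_zero, abs_one, mul_one] at this
  linarith

namespace IsStarPolygon

variable {ι : Type*} {T : Set Plane} {E : Finset ι} {a b n : ι → Plane} {z : Plane} {r : ℝ}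

theorem boundaryLayer_subset (T : Set Plane) (z : Plane) (δ : ℝ) : boundaryLayer T z δ ⊆ T :=
  fun _ hx => hx.1

theorem l2Tendsto_boundaryLayer {T : Set Plane} {F : ℕ → Plane → ℝ} {f : Plane → ℝ}
    (h : L2Tendsto (volume.restrict T) F f) (z : Plane) (δ : ℝ) :
    L2Tendsto (volume.restrict (boundaryLayer T z δ)) F f :=
  h.mono (Measure.restrict_mono (boundaryLayer_subset T z δ) le_rfl)

theorem integrableOn_of_memLp (hT : IsStarPolygon T E a b n z r) {f : Plane → ℝ}
    (hf : MemLp f 2 (volume.restrict T)) : IntegrableOn f T :=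
  have := hT.isFiniteMeasure
  hf.integrable (by norm_num)

/-- The layer averages of a continuous function converge to its weighted boundary integral. -/
theorem tendsto_integral_boundaryLayer (hT : IsStarPolygon T E a b n z r) {f : Plane → ℝ}
    (hf : Continuous f) :
    Tendsto (fun δ => δ⁻¹ * ∫ x in boundaryLayer T z δ, f x) (𝓝[>] 0)
      (𝓝 (edgeProfile E a b z (edgeWeight a b n z) f 1)) := by
  set g : ℝ → ℝ := fun s => s * edgeProfile E a b z (edgeWeight a b n z) f s with hg
  have hgc : Continuous g := continuous_id.mul (continuous_edgeProfile hf)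
  have hd : HasDerivAt (fun l => ∫ s in l..1, g s) (-g 1) 1 :=
    intervalIntegral.integral_hasDerivAt_left (hgc.intervalIntegrable _ _)
      (hgc.stronglyMeasurableAtFilter _ _) hgc.continuousAt
  have hd2 : HasDerivAt (fun δ : ℝ => ∫ s in (1 - δ)..1, g s) (g 1) 0 := by
    have h1 : HasDerivAt (fun δ : ℝ => 1 - δ) (-1) 0 := (hasDerivAt_id' (0 : ℝ)).const_sub 1
    have h2 : HasDerivAt (fun l => ∫ s in l..1, g s) (-g 1) (1 - 0) := by rwa [sub_zero]
    have := h2.comp (0 : ℝ) h1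
    simpa [Function.comp_def] using this
  have hs := hd2.tendsto_slope_zero_right
  have e : g 1 = edgeProfile E a b z (edgeWeight a b n z) f 1 := one_mul _
  rw [← e]
  refine hs.congr' ?_
  filter_upwards [Ioo_mem_nhdsGT (zero_lt_one (α := ℝ))] with δ hδ
  rw [hT.integral_boundaryLayer hf hδ.1 hδ.2]
  simp [hg]

/-- Poincaré's inequality with the average over the disc. -/
theorem poincare (hT : IsStarPolygon T E a b n z r) {D : ℝ}
    (hD : ∀ x ∈ T, ∀ y ∈ T, ‖x - y‖ ≤ D) {w : Plane → ℝ} {G : Plane → Plane}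
    (h : HasL2Gradient T w G) :
    volume.real (Metric.closedBall z r) * ∫ x in T, (w x - (volume.real (Metric.closedBall z r))⁻¹ *
        ∫ y in Metric.closedBall z r, w y) ^ 2
      ≤ 4 * volume.real T * D ^ 2 * ∫ x in T, ∑ j, G x j ^ 2 := by
  have := hT.isFiniteMeasure
  obtain ⟨W, hW, hWw, hWG, -⟩ := hT.exists_smooth_approx h.memLp h.memLp_grad h.weak_grad
  have hB : IsFiniteMeasure (volume.restrict (Metric.closedBall z r)) :=
    ⟨by rw [Measure.restrict_apply_univ]; exact (isCompact_closedBall _ _).measure_lt_top⟩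
  have h1 := (hWw.mono (Measure.restrict_mono hT.closedBall_subset le_rfl)).tendsto_integral
  have h2 := (hWw.add ((L2Tendsto.const (memLp_const (1 : ℝ))).const_mul
    (((h1.const_mul (volume.real (Metric.closedBall z r))⁻¹)).neg))).tendsto_integral_sq
  have h3 := tendsto_finsetSum Finset.univ fun j _ => (hWG j).tendsto_integral_sq
  simp only [mul_one, ← sub_eq_add_neg] at h2
  rw [integral_finsetSum _ fun j _ => (h.memLp_grad j).integrable_sq]
  refine le_of_tendsto_of_tendsto' (h2.const_mul _) (h3.const_mul _) fun k => ?_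
  refine (hT.integral_sub_average_sq_le hD (hW k)).trans_eq ?_
  rw [integral_finsetSum _ fun j _ => ((hWG j).memLp k).integrable_sq]

/-- The squared `L²` norm over a layer of width proportional to `δ` is of order `δ`. -/
theorem integral_layer_sq_le (hT : IsStarPolygon T E a b n z r) {D : ℝ}
    (hD : ∀ x ∈ T, ‖x - z‖ ≤ D) {w : Plane → ℝ} {G : Plane → Plane}
    (h : HasL2Gradient T w G) {δ : ℝ} (hδ0 : 0 < δ) (hδ1 : δ ≤ 1 / 2) :
    ∫ x in boundaryLayer T z δ, w x ^ 2
      ≤ δ * (6 * (∫ x in T, w x ^ 2) + 2 * D ^ 2 * ∑ j, ∫ x in T, G x j ^ 2) := by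
  obtain ⟨W, hW, hWw, hWG, -⟩ := hT.exists_smooth_approx h.memLp h.memLp_grad h.weak_grad
  have h1 := (l2Tendsto_boundaryLayer hWw z δ).tendsto_integral_sq
  have h3 := tendsto_finsetSum Finset.univ fun j _ => (hWG j).tendsto_integral_sq
  have h4 := hWw.tendsto_integral_sq
  refine le_of_tendsto_of_tendsto' h1
    (((h4.const_mul 6).add (h3.const_mul (2 * D ^ 2))).const_mul δ) fun k => ?_
  refine (hT.integral_boundaryLayer_sq_le hD (hW k) hδ0 hδ1).trans_eq ?_
  have i1 : IntegrableOn (fun x => W k x ^ 2) T := (hWw.memLp k).integrable_sq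
  have i2 (j) : IntegrableOn (fun x => partialDeriv j (W k) x ^ 2) T :=
    ((hWG j).memLp k).integrable_sq
  rw [integral_add (i1.const_mul 3) ((integrable_finsetSum _ fun j _ => i2 j).const_mul _),
    integral_const_mul, integral_const_mul, integral_finsetSum _ fun j _ => i2 j]
  ring

/-- The divergence theorem as a bound by the mass of the field in a thin layer. -/
theorem abs_integral_weakDivergence_le (hT : IsStarPolygon T E a b n z r) {F : Fin 2 → Plane → ℝ}
    {ψ : Plane → ℝ} (hF : ∀ j, MemLp (F j) 2 (volume.restrict T))
    (hψ : MemLp ψ 2 (volume.restrict T)) (h : IsWeakDivergence (interior T) F ψ)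
    {δ : ℝ} (hδ0 : 0 < δ) (hδ1 : δ < 1) :
    |∫ x in T, ψ x| ≤ (∫ x in boundaryLayer T z δ, |ψ x|)
        + (r * δ)⁻¹ * ∫ x in boundaryLayer T z δ, ∑ j, |F j x| := by
  have := hT.isFiniteMeasure
  have hB : IsFiniteMeasure (volume.restrict (boundaryLayer T z δ)) :=
    ⟨by
      rw [Measure.restrict_apply_univ]
      exact (measure_mono (boundaryLayer_subset T z δ)).trans_lt hT.isCompact.measure_lt_top⟩
  obtain ⟨W, hW, hWF, hWψ⟩ := hT.exists_smooth_approx_divergence hF hψ h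
  have h1 := (l2Tendsto_boundaryLayer hWψ z δ).abs.tendsto_integral
  have h2 := (L2Tendsto.sum Finset.univ
    fun j _ => (l2Tendsto_boundaryLayer (hWF j) z δ).abs).tendsto_integral
  exact le_of_tendsto_of_tendsto' hWψ.tendsto_integral.abs
    (h1.add (h2.const_mul _)) fun k => hT.abs_integral_divergence_le (hW k) hδ0 hδ1

/-- The integral of the weak gradient as a boundary integral. -/
theorem integral_grad_eq (hT : IsStarPolygon T E a b n z r) {w : Plane → ℝ} {G : Plane → Plane}
    (h : HasL2Gradient T w G) (hw : Continuous w) (j : Fin 2) :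
    ∫ x in T, G x j
      = edgeProfile E a b z (fluxWeight a b n (EuclideanSpace.single j 1)) w 1 := by
  have := hT.isFiniteMeasure
  obtain ⟨W, hW, -, hWG, hWu⟩ := hT.exists_smooth_approx h.memLp h.memLp_grad h.weak_grad
  refine tendsto_nhds_unique (hWG j).tendsto_integral ?_
  have := tendsto_edgeProfile_one (E := E) (a := a) (b := b) (z := z)
    (w := fluxWeight a b n (EuclideanSpace.single j 1)) (fun k => (hW k).continuous) hw
    fun η hη => by
      filter_upwards [hWu hw.continuousOn η hη] with k hk e he t ht
      exact hk _ (hT.lineMap_mem he ht)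
  refine this.congr fun k => ?_
  exact (hT.integral_fderiv (hW k) _).symm

/-- The trace inequality. -/
theorem edgeProfile_sq_le (hT : IsStarPolygon T E a b n z r) {D : ℝ}
    (hD : ∀ x ∈ T, ‖x - z‖ ≤ D) {w : Plane → ℝ} {G : Plane → Plane}
    (h : HasL2Gradient T w G) (hw : Continuous w) :
    edgeProfile E a b z (edgeWeight a b n z) (fun x => w x ^ 2) 1
      ≤ 6 * (∫ x in T, w x ^ 2) + 2 * D ^ 2 * ∑ j, ∫ x in T, G x j ^ 2 := by
  refine le_of_tendsto (hT.tendsto_integral_boundaryLayer (f := fun x => w x ^ 2) (hw.pow 2)) ?_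
  filter_upwards [Ioc_mem_nhdsGT (show (0 : ℝ) < 1 / 2 by norm_num)] with δ hδ
  rw [inv_mul_le_iff₀ hδ.1]
  exact hT.integral_layer_sq_le hD h hδ.1 hδ.2

end IsStarPolygon

/-! ### Polygonal meshes -/

theorem IsTestFunction.hasCompactSupport_partialDeriv {U : Set Plane} {φ : Plane → ℝ}
    (hφ : IsTestFunction U φ) (j : Fin 2) : HasCompactSupport (partialDeriv j φ) :=
  hφ.compact.fderiv_apply (𝕜 := ℝ) (EuclideanSpace.single j 1)

theorem IsTestFunction.support_partialDeriv_subset {U : Set Plane} {φ : Plane → ℝ}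
    (hφ : IsTestFunction U φ) (j : Fin 2) : Function.support (partialDeriv j φ) ⊆ U := by
  intro x hx
  apply hφ.support
  refine support_fderiv_subset ℝ (f := φ) ?_
  intro h
  apply hx
  simp only [partialDeriv, h]
  rfl

/-- The weak gradient of a function that is classically differentiable in `U`. -/
theorem isWeakGradient_of_hasFDerivAt {U : Set Plane} {f : Plane → ℝ} {D : Plane → Plane}
    (hf : Continuous f) (hD : ∀ j, Continuous fun x => D x j)
    (h : ∀ x ∈ U, DifferentiableAt ℝ f x)
    (h' : ∀ x ∈ U, ∀ j, partialDeriv j f x = D x j) : IsWeakGradient U f D := by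
  intro φ hφ j
  simp only [gradient_apply]
  have hφ1 : Differentiable ℝ φ := hφ.smooth.differentiable (by simp)
  have hφc : Continuous φ := hφ.smooth.continuous
  have e (x) : fderiv ℝ f x (EuclideanSpace.single j 1) * φ x = D x j * φ x := by
    by_cases hx : x ∈ U
    · rw [← h' x hx j]
    · rw [show φ x = 0 from by
        by_contra h0; exact hx (hφ.support (subset_tsupport _ h0)), mul_zero, mul_zero]
  rw [setIntegral_eq_integral_of_forall_compl_eq_zero,
    setIntegral_eq_integral_of_forall_compl_eq_zero]
  · rw [integral_mul_fderiv_eq_neg_fderiv_mul_of_integrable]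
    · simp only [e]
    · simp only [e]
      exact ((hD j).mul hφc).integrable_of_hasCompactSupport hφ.compact.mul_left
    · exact
        (hf.mul (continuous_partialDeriv_of_isTestFunction hφ j)).integrable_of_hasCompactSupport
        (hφ.hasCompactSupport_partialDeriv j).mul_left
    · exact (hf.mul hφc).integrable_of_hasCompactSupport hφ.compact.mul_left
    · exact fun x hx => h x (hφ.support hx)
    · exact fun x _ => hφ1 x
  · intro x hx
    rw [show φ x = 0 from by
      by_contra h0; exact hx (hφ.support (subset_tsupport _ h0)), mul_zero]
  · intro x hx
    rw [show partialDeriv j φ x = 0 from by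
      by_contra h0; exact hx (hφ.support_partialDeriv_subset j h0), mul_zero]

namespace IsPolygonalDomain

variable {Ω : Set Plane}

theorem isCompact_closure (hΩ : IsPolygonalDomain Ω) : IsCompact (closure Ω) :=
  hΩ.isBounded.isCompact_closure

theorem volume_frontier (hΩ : IsPolygonalDomain Ω) : volume (frontier Ω) = 0 := by
  obtain ⟨F, hF⟩ := hΩ.frontier_eq
  rw [hF]
  exact (measure_biUnion_null_iff F.countable_toSet).2 fun p _ => volume_segment_eq_zero _ _

end IsPolygonalDomain

namespace PolyMesh

variable {Ω : Set Plane} (M : PolyMesh Ω)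

theorem elem_subset (i : Fin M.numElem) : M.elem i ⊆ closure Ω :=
  M.iUnion_elem ▸ subset_iUnion M.elem i

theorem interior_elem_subset (hΩ : IsPolygonalDomain Ω) (i : Fin M.numElem) :
    interior (M.elem i) ⊆ Ω :=
  (interior_mono (M.elem_subset i)).trans_eq hΩ.interior_closure

theorem edge_subset_elem {i : Fin M.numElem} {e : Fin M.numEdge} (he : e ∈ M.bdry i) :
    segment ℝ (M.src e) (M.tgt e) ⊆ M.elem i := by
  have h := subset_biUnion_of_mem (u := fun e => segment ℝ (M.src e) (M.tgt e))
    (show e ∈ (M.bdry i : Set (Fin M.numEdge)) from he)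
  have h2 : segment ℝ (M.src e) (M.tgt e) ⊆ frontier (M.elem i) := by
    rw [M.frontier_elem i]; exact h
  exact h2.trans (M.isCompact_elem i).isClosed.frontier_subset

theorem edge_subset_closure (e : Fin M.numEdge) : segment ℝ (M.src e) (M.tgt e) ⊆ closure Ω := by
  obtain ⟨i, hi⟩ := M.exists_elem e
  exact (M.edge_subset_elem hi).trans (M.elem_subset i)

theorem diam_le_meshSize (i : Fin M.numElem) : Metric.diam (M.elem i) ≤ M.meshSize :=
  le_ciSup (f := fun i => Metric.diam (M.elem i)) (finite_range _).bddAbove i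

theorem diam_pos (i : Fin M.numElem) : 0 < Metric.diam (M.elem i) := by
  obtain ⟨x, hx⟩ := M.nonempty_interior i
  obtain ⟨ε, hε, hb⟩ := Metric.isOpen_iff.1 isOpen_interior x hx
  have hb2 := hb.trans interior_subset
  have hd : Metric.diam (Metric.ball x ε) ≤ Metric.diam (M.elem i) :=
    Metric.diam_mono hb2 (M.isCompact_elem i).isBounded
  have hmem : x + EuclideanSpace.single 0 (ε / 2) ∈ Metric.ball x ε := by
    rw [mem_ball_iff_norm, add_sub_cancel_left, PiLp.norm_single, Real.norm_eq_abs,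
      abs_of_pos (half_pos hε)]
    linarith
  have := Metric.dist_le_diam_of_mem Metric.isBounded_ball hmem (Metric.mem_ball_self hε)
  rw [dist_eq_norm, add_sub_cancel_left, PiLp.norm_single, Real.norm_eq_abs,
      abs_of_pos (half_pos hε)] at this
  linarith

theorem numElem_pos (hΩ : IsPolygonalDomain Ω) : Nonempty (Fin M.numElem) := by
  obtain ⟨x, hx⟩ := hΩ.isConnected.nonempty
  have := subset_closure hx
  rw [← M.iUnion_elem, mem_iUnion] at this
  exact ⟨this.choose⟩

theorem meshSize_pos (hΩ : IsPolygonalDomain Ω) : 0 < M.meshSize := by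
  obtain ⟨i⟩ := M.numElem_pos hΩ
  exact (M.diam_pos i).trans_le (M.diam_le_meshSize i)

theorem isStarPolygon {ρ : ℝ} (hρ : 0 < ρ) {i : Fin M.numElem} {z : Plane}
    (hz : ∀ y ∈ Metric.closedBall z (ρ * Metric.diam (M.elem i)), StarConvex ℝ y (M.elem i)) :
    IsStarPolygon (M.elem i) (M.bdry i) M.src M.tgt (M.normal i) z
      (ρ * Metric.diam (M.elem i)) where
  isCompact := M.isCompact_elem i
  nonempty := (M.nonempty_interior i).mono interior_subset
  pos := mul_pos hρ (M.diam_pos i)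
  starConvex := hz
  ne e _ := M.src_ne_tgt e
  inter e _ e' _ h := M.edge_inter e e' h
  frontier_eq := M.frontier_elem i
  norm_normal := M.norm_normal i
  orthogonal := M.normal_orthogonal i
  outward := M.normal_outward i

theorem volume_frontier_elem (i : Fin M.numElem) : volume (frontier (M.elem i)) = 0 := by
  rw [M.frontier_elem]
  exact (measure_biUnion_null_iff (M.bdry i).countable_toSet).2 fun p _ =>
    volume_segment_eq_zero _ _

theorem measurableSet_elem (i : Fin M.numElem) : MeasurableSet (M.elem i) :=
  (M.isCompact_elem i).isClosed.measurableSet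

theorem restrict_interior_elem (i : Fin M.numElem) :
    volume.restrict (interior (M.elem i)) = volume.restrict (M.elem i) :=
  Measure.restrict_congr_set (interior_ae_eq_of_null_frontier (M.volume_frontier_elem i))

theorem restrict_closure (hΩ : IsPolygonalDomain Ω) :
    volume.restrict (closure Ω) = volume.restrict Ω :=
  (Measure.restrict_congr_set (by
    have := closure_ae_eq_of_null_frontier hΩ.volume_frontier
    exact this))

theorem restrict_elem_le (hΩ : IsPolygonalDomain Ω) (i : Fin M.numElem) :
    volume.restrict (M.elem i) ≤ volume.restrict Ω := by
  rw [← restrict_closure hΩ]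
  exact Measure.restrict_mono (M.elem_subset i) le_rfl

theorem aedisjoint_elem {i j : Fin M.numElem} (hij : i ≠ j) :
    AEDisjoint volume (M.elem i) (M.elem j) := by
  have h (i) := interior_ae_eq_of_null_frontier (M.volume_frontier_elem i)
  exact (M.disjoint_interior i j hij).aedisjoint.congr (h i).symm (h j).symm

/-- An integral over `Ω` is the sum of the integrals over the elements. -/
theorem integral_eq_sum (hΩ : IsPolygonalDomain Ω) {f : Plane → ℝ}
    (hf : IntegrableOn f Ω) : ∫ x in Ω, f x = ∑ i, ∫ x in M.elem i, f x := by
  rw [← restrict_closure hΩ, ← M.iUnion_elem, integral_iUnion_ae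
    (fun i => (M.measurableSet_elem i).nullMeasurableSet) (fun i j hij => M.aedisjoint_elem hij),
    tsum_fintype]
  rw [M.iUnion_elem, IntegrableOn, restrict_closure hΩ]
  exact hf

/-- The edges without their endpoints are disjoint from all other edges. -/
theorem notMem_segment {e e' : Fin M.numEdge} (h : e ≠ e') {x : Plane}
    (hx : x ∈ openSegment ℝ (M.src e) (M.tgt e)) : x ∉ segment ℝ (M.src e') (M.tgt e') := by
  intro hx'
  have := M.edge_inter e e' h ⟨openSegment_subset_segment _ _ _ hx, hx'⟩
  rcases this with h1 | h1
  · rw [h1, left_mem_openSegment_iff] at hx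
    exact M.src_ne_tgt e hx
  · rw [mem_singleton_iff.1 h1, right_mem_openSegment_iff] at hx
    exact M.src_ne_tgt e hx

/-- A preconnected set that meets the interior of an element but no edge lies in the element. -/
theorem subset_elem_of_isPreconnected {s : Set Plane} (hs : IsPreconnected s)
    (hse : ∀ e, Disjoint s (segment ℝ (M.src e) (M.tgt e))) {i : Fin M.numElem}
    (hi : (s ∩ M.elem i).Nonempty) : s ⊆ M.elem i := by
  have hfr : Disjoint s (frontier (M.elem i)) := by
    rw [M.frontier_elem, disjoint_iUnion₂_right]
    exact fun e _ => hse e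
  have hcl := (M.isCompact_elem i).isClosed
  have key : s ⊆ interior (M.elem i) := by
    refine hs.subset_left_of_subset_union (v := (M.elem i)ᶜ) isOpen_interior hcl.isOpen_compl
      (disjoint_compl_right.mono_left interior_subset) ?_ ?_
    · intro x hx
      by_cases hxi : x ∈ M.elem i
      · left
        by_contra h
        exact hfr.notMem_of_mem_left hx (hcl.frontier_eq ▸ ⟨hxi, h⟩)
      · exact Or.inr hxi
    · obtain ⟨x, hx, hxi⟩ := hi
      refine ⟨x, hx, ?_⟩
      by_contra h
      exact hfr.notMem_of_mem_left hx (hcl.frontier_eq ▸ ⟨hxi, h⟩)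
  exact key.trans interior_subset

/-- A point of an edge, not an endpoint, all of whose neighbourhoods on the edge meet `Ω`, lies in
`Ω`: both half discs about the point are contained in elements. -/
theorem exists_ball_openSegment_subset (hΩ : IsPolygonalDomain Ω) {e : Fin M.numEdge} {x : Plane}
    (hx : x ∈ openSegment ℝ (M.src e) (M.tgt e)) :
    ∃ ε > 0, (Metric.ball x ε ∩ segment ℝ (M.src e) (M.tgt e) ∩ Ω).Nonempty → x ∈ Ω := by
  classical
  obtain ⟨i, hi⟩ := M.exists_elem e
  set n := M.normal i e with hn
  have hno := M.normal_orthogonal i e hi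
  have hn1 : ‖n‖ = 1 := M.norm_normal i e hi
  -- a disc avoiding the other edges
  have hcl : IsClosed (⋃ e' ∈ Finset.univ.erase e, segment ℝ (M.src e') (M.tgt e')) :=
    Set.Finite.isClosed_biUnion (Finset.finite_toSet (Finset.univ.erase e)) fun e' _ => by
      rw [segment_eq_image_lineMap]
      exact (isCompact_Icc.image (AffineMap.lineMap_continuous)).isClosed
  obtain ⟨ε, hε, hball⟩ := Metric.isOpen_iff.1 hcl.isOpen_compl x (by
    simp only [mem_compl_iff, mem_iUnion, not_exists]
    intro e' he'
    exact M.notMem_segment (Finset.ne_of_mem_erase he').symm hx)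
  refine ⟨ε, hε, fun ⟨y, ⟨hyb, hys⟩, hyΩ⟩ => ?_⟩
  have hseg : ∀ p ∈ segment ℝ (M.src e) (M.tgt e), inner ℝ n p = (inner ℝ n (M.src e) : ℝ) := by
    intro p hp
    rw [segment_eq_image'] at hp
    obtain ⟨t, -, rfl⟩ := hp
    rw [inner_add_right, inner_smul_right, hno, mul_zero, add_zero]
  -- the two half discs lie in the closure of `Ω`
  have half (σ : ℝ) (hσ : σ ≠ 0) :
      {p ∈ Metric.ball x ε | 0 < σ * (inner ℝ n p - inner ℝ n (M.src e))} ⊆ closure Ω := by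
    set s := {p ∈ Metric.ball x ε | 0 < σ * (inner ℝ n p - inner ℝ n (M.src e))} with hs
    have hconv : Convex ℝ s := by
      intro p hp q hq s t hs ht hst
      refine ⟨convex_ball x ε hp.1 hq.1 hs ht hst, ?_⟩
      have hp2 := hp.2
      have hq2 := hq.2
      rw [inner_add_right, inner_smul_right, inner_smul_right]
      have hs' : s = 1 - t := by linarith
      have e1 : σ * (s * inner ℝ n p + t * inner ℝ n q - inner ℝ n (M.src e))
          = s * (σ * (inner ℝ n p - inner ℝ n (M.src e)))
            + t * (σ * (inner ℝ n q - inner ℝ n (M.src e))) := by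
        rw [hs']; ring
      rw [e1]
      rcases hs.eq_or_lt with h0 | h0
      · rw [← h0] at hst ⊢
        rw [zero_add] at hst
        simpa [hst] using hq2
      · exact add_pos_of_pos_of_nonneg (mul_pos h0 hp2) (mul_nonneg ht hq2.le)
    have hdisj : ∀ e', Disjoint s (segment ℝ (M.src e') (M.tgt e')) := by
      intro e'
      rw [Set.disjoint_left]
      rintro p ⟨hp1, hp2⟩ hp3
      by_cases h : e' = e
      · subst h
        rw [hseg p hp3, sub_self, mul_zero] at hp2
        exact lt_irrefl _ hp2
      · refine hball hp1 ?_
        simp only [mem_iUnion]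
        exact ⟨e', Finset.mem_erase.2 ⟨h, Finset.mem_univ _⟩, hp3⟩
    -- a point of the half disc close to `y ∈ Ω`
    have hnear : ∃ p ∈ s, p ∈ Ω := by
      have hopen := (hΩ.isOpen.inter (Metric.isOpen_ball (x := x) (ε := ε))).mem_nhds ⟨hyΩ, hyb⟩
      have ht : Tendsto (fun t : ℝ => y + (t * σ) • n) (𝓝[>] 0) (𝓝 y) := by
        have : Continuous fun t : ℝ => y + (t * σ) • n := by fun_prop
        have h0 := this.tendsto 0
        simp only [zero_mul, zero_smul, add_zero] at h0
        exact h0.mono_left nhdsWithin_le_nhds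
      obtain ⟨t, ht1, ht0⟩ := ((ht.eventually hopen).and self_mem_nhdsWithin).exists
      refine ⟨_, ⟨ht1.2, ?_⟩, ht1.1⟩
      rw [inner_add_right, inner_smul_right, real_inner_self_eq_norm_sq, hn1, hseg y hys]
      have : 0 < t := ht0
      have := mul_pos this (mul_self_pos.2 hσ)
      nlinarith
    obtain ⟨p, hps, hpΩ⟩ := hnear
    have hp2 := subset_closure hpΩ
    rw [← M.iUnion_elem, mem_iUnion] at hp2
    obtain ⟨j, hj⟩ := hp2
    exact (M.subset_elem_of_isPreconnected hconv.isPreconnected hdisj ⟨p, hps, hj⟩).trans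
      (M.elem_subset j)
  -- hence so does the whole disc
  have hwhole : Metric.ball x ε ⊆ closure Ω := by
    intro p hp
    rcases lt_trichotomy (inner ℝ n p - inner ℝ n (M.src e) : ℝ) 0 with h | h | h
    · exact half (-1) (by norm_num) ⟨hp, by linarith⟩
    · rw [← closure_closure]
      have ht : Tendsto (fun t : ℝ => p + t • n) (𝓝[>] 0) (𝓝 p) := by
        have : Continuous fun t : ℝ => p + t • n := by fun_prop
        have h0 := this.tendsto 0
        simp only [zero_smul, add_zero] at h0
        exact h0.mono_left nhdsWithin_le_nhds
      refine mem_closure_of_tendsto ht ?_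
      filter_upwards [ht.eventually (Metric.isOpen_ball.mem_nhds hp), self_mem_nhdsWithin]
        with t ht1 ht0
      refine half 1 one_ne_zero ⟨ht1, ?_⟩
      rw [inner_add_right, inner_smul_right, real_inner_self_eq_norm_sq, hn1]
      have : 0 < t := ht0
      linarith
    · exact half 1 one_ne_zero ⟨hp, by linarith⟩
  rw [← hΩ.interior_closure]
  exact interior_maximal hwhole Metric.isOpen_ball (Metric.mem_ball_self hε)

/-- An edge that is not a boundary edge lies in `Ω`, except possibly for its endpoints. -/
theorem openSegment_subset (hΩ : IsPolygonalDomain Ω) {e : Fin M.numEdge}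
    (he : ¬ M.IsBoundaryEdge e) : openSegment ℝ (M.src e) (M.tgt e) ⊆ Ω := by
  have hcl : closure (openSegment ℝ (M.src e) (M.tgt e)) = segment ℝ (M.src e) (M.tgt e) :=
    closure_openSegment _ _
  have hpre : IsPreconnected (openSegment ℝ (M.src e) (M.tgt e)) :=
    (convex_openSegment _ _).isPreconnected
  obtain ⟨y, hy, hyΩ⟩ : (openSegment ℝ (M.src e) (M.tgt e) ∩ Ω).Nonempty := by
    unfold IsBoundaryEdge at he
    rw [not_subset] at he
    obtain ⟨p, hp, hpf⟩ := he
    have hpΩ : p ∈ Ω := by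
      by_contra h
      refine hpf ?_
      rw [hΩ.isOpen.frontier_eq]
      exact ⟨M.edge_subset_closure e hp, h⟩
    rw [← hcl] at hp
    have := mem_closure_iff.1 hp Ω hΩ.isOpen hpΩ
    rwa [inter_comm] at this
  set V : Set Plane := ⋃ U ∈ {U : Set Plane | IsOpen U ∧
    Disjoint (U ∩ segment ℝ (M.src e) (M.tgt e)) Ω}, U with hV
  have hVo : IsOpen V := isOpen_biUnion fun U hU => hU.1
  have hcover : openSegment ℝ (M.src e) (M.tgt e) ⊆ Ω ∪ V := by
    intro x hx
    by_cases hxΩ : x ∈ Ω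
    · exact Or.inl hxΩ
    · obtain ⟨ε, hε, h⟩ := M.exists_ball_openSegment_subset hΩ hx
      refine Or.inr (mem_biUnion (x := Metric.ball x ε) ⟨Metric.isOpen_ball, ?_⟩
        (Metric.mem_ball_self hε))
      rw [Set.disjoint_iff_inter_eq_empty]
      by_contra h0
      exact hxΩ (h (nonempty_iff_ne_empty.2 h0))
  by_contra hnot
  rw [not_subset] at hnot
  obtain ⟨x, hx, hxΩ⟩ := hnot
  obtain ⟨p, hp, hpΩ, hpV⟩ := hpre Ω V hΩ.isOpen hVo hcover ⟨y, hy, hyΩ⟩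
    ⟨x, hx, (hcover hx).resolve_left hxΩ⟩
  rw [hV, mem_iUnion₂] at hpV
  obtain ⟨U, hU, hpU⟩ := hpV
  exact hU.2.notMem_of_mem_left ⟨hpU, openSegment_subset_segment _ _ _ hp⟩ hpΩ

end PolyMesh

/-! ### Test functions approximating edge values -/

theorem IsTestFunction.zero {U : Set Plane} : IsTestFunction U fun _ => 0 :=
  ⟨contDiff_const, HasCompactSupport.zero, by simp [tsupport, Function.support]⟩

theorem IsTestFunction.add {U : Set Plane} {φ ψ : Plane → ℝ} (hφ : IsTestFunction U φ)
    (hψ : IsTestFunction U ψ) : IsTestFunction U fun x => φ x + ψ x :=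
  ⟨hφ.smooth.add hψ.smooth, hφ.compact.add hψ.compact,
    (tsupport_add φ ψ).trans (union_subset hφ.support hψ.support)⟩

theorem IsTestFunction.const_mul {U : Set Plane} {φ : Plane → ℝ} (hφ : IsTestFunction U φ)
    (c : ℝ) : IsTestFunction U fun x => c * φ x :=
  ⟨contDiff_const.mul hφ.smooth, hφ.compact.mul_left,
    (tsupport_mul_subset_right (f := fun _ => c)).trans hφ.support⟩

theorem IsTestFunction.mul {U : Set Plane} {φ ψ : Plane → ℝ} (hφ : IsTestFunction U φ)
    (hψ : IsTestFunction U ψ) : IsTestFunction U fun x => φ x * ψ x :=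
  ⟨hφ.smooth.mul hψ.smooth, hφ.compact.mul_right,
    (tsupport_mul_subset_right (f := φ)).trans hψ.support⟩

theorem IsTestFunction.sum {U : Set Plane} {ι : Type*} (s : Finset ι) {φ : ι → Plane → ℝ}
    (hφ : ∀ i ∈ s, IsTestFunction U (φ i)) : IsTestFunction U fun x => ∑ i ∈ s, φ i x := by
  classical
  induction s using Finset.induction_on with
  | empty => simpa using IsTestFunction.zero
  | insert i s hi ih =>
    simp only [Finset.sum_insert hi]
    exact (hφ i (Finset.mem_insert_self _ _)).add
      (ih fun j hj => hφ j (Finset.mem_insert_of_mem hj))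

theorem IsTestFunction.mono {U V : Set Plane} {φ : Plane → ℝ} (hφ : IsTestFunction U φ)
    (h : U ⊆ V) : IsTestFunction V φ := ⟨hφ.smooth, hφ.compact, hφ.support.trans h⟩

/-- A smooth cutoff function. -/
theorem exists_isTestFunction_eq_one {K U : Set Plane} (hK : IsCompact K) (hU : IsOpen U)
    (hKU : K ⊆ U) : ∃ φ, IsTestFunction U φ ∧ (∀ x ∈ K, φ x = 1) ∧ ∀ x, |φ x| ≤ 1 := by
  obtain ⟨K', hK', hKK', hK'U⟩ := exists_compact_between hK hU hKU
  obtain ⟨f, hf0, hf1, hf⟩ := exists_contMDiffMap_zero_one_of_isClosed (n := ⊤)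
    (modelWithCornersSelf ℝ Plane) (s := (interior K')ᶜ) (t := K) isOpen_interior.isClosed_compl
    hK.isClosed (Set.disjoint_left.2 fun x hx hxK => hx (hKK' hxK))
  have hsub : tsupport f ⊆ K' := by
    refine closure_minimal (fun x hx => ?_) hK'.isClosed
    by_contra h
    exact hx (hf0 fun h' => h (interior_subset h'))
  refine ⟨f, ⟨f.contMDiff.contDiff, hK'.of_isClosed_subset (isClosed_tsupport _) hsub,
    hsub.trans hK'U⟩, fun x hx => hf1 hx, fun x => ?_⟩
  rw [abs_of_nonneg (hf x).1]
  exact (hf x).2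

namespace PolyMesh

variable {Ω : Set Plane} (M : PolyMesh Ω)

/-- A function on the edges that vanishes on the boundary edges is a bounded pointwise limit, on
the edges without their endpoints, of test functions in `Ω`. -/
theorem exists_isTestFunction_tendsto (hΩ : IsPolygonalDomain Ω) {v : M.W}
    (hv : M.VanishesOnBoundary v) :
    ∃ Ψ : ℕ → Plane → ℝ, (∀ k, IsTestFunction Ω (Ψ k)) ∧ (∃ B, ∀ k x, |Ψ k x| ≤ B) ∧
      ∀ e, ∀ t ∈ Ioo (0 : ℝ) 1, ∀ᶠ k in atTop,
        Ψ k (AffineMap.lineMap (M.src e) (M.tgt e) t) = v e := by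
  classical
  have hseg (e : Fin M.numEdge) : IsClosed (segment ℝ (M.src e) (M.tgt e)) := by
    rw [segment_eq_image_lineMap]
    exact (isCompact_Icc.image (AffineMap.lineMap_continuous)).isClosed
  have hopen {e : Fin M.numEdge} {t : ℝ} (ht : t ∈ Ioo (0 : ℝ) 1) :
      AffineMap.lineMap (M.src e) (M.tgt e) t ∈ openSegment ℝ (M.src e) (M.tgt e) := by
    rw [openSegment_eq_image_lineMap]
    exact mem_image_of_mem _ ht
  -- cutoff functions equal to one in the middle of a given edge, vanishing on all other edges
  have key (e : Fin M.numEdge) (k : ℕ) : ∃ φ, (¬ M.IsBoundaryEdge e → IsTestFunction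
      (Ω \ ⋃ e' ∈ Finset.univ.erase e, segment ℝ (M.src e') (M.tgt e')) φ ∧
      (∀ t ∈ Icc (1 / ((k : ℝ) + 2)) (1 - 1 / ((k : ℝ) + 2)),
        φ (AffineMap.lineMap (M.src e) (M.tgt e) t) = 1) ∧ ∀ x, |φ x| ≤ 1) := by
    by_cases he : M.IsBoundaryEdge e
    · exact ⟨0, fun h => absurd he h⟩
    have hk : (0 : ℝ) < 1 / ((k : ℝ) + 2) := by positivity
    obtain ⟨φ, hφ, h1, h2⟩ := exists_isTestFunction_eq_one
      (K := AffineMap.lineMap (M.src e) (M.tgt e) ''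
        Icc (1 / ((k : ℝ) + 2)) (1 - 1 / ((k : ℝ) + 2)))
      (U := Ω \ ⋃ e' ∈ Finset.univ.erase e, segment ℝ (M.src e') (M.tgt e'))
      (isCompact_Icc.image (AffineMap.lineMap_continuous))
      (hΩ.isOpen.sdiff (Set.Finite.isClosed_biUnion (Finset.finite_toSet (Finset.univ.erase e))
        fun e' _ => hseg e')) (by
        rintro _ ⟨t, ht, rfl⟩
        have hx := hopen (e := e) (t := t) ⟨hk.trans_le ht.1, by linarith [ht.2]⟩
        refine ⟨M.openSegment_subset hΩ he hx, ?_⟩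
        simp only [mem_iUnion, not_exists]
        exact fun e' he' => M.notMem_segment (Finset.ne_of_mem_erase he').symm hx)
    exact ⟨φ, fun _ => ⟨hφ, fun t ht => h1 _ (mem_image_of_mem _ ht), h2⟩⟩
  choose φ hφ using key
  set I : Finset (Fin M.numEdge) := Finset.univ.filter fun e => ¬ M.IsBoundaryEdge e with hI
  have hIm {e} : e ∈ I ↔ ¬ M.IsBoundaryEdge e := by simp [hI]
  refine ⟨fun k x => ∑ e ∈ I, v e * φ e k x, fun k => ?_, ⟨∑ e ∈ I, |v e|, fun k x => ?_⟩, ?_⟩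
  · exact IsTestFunction.sum _ fun e he =>
      ((hφ e k (hIm.1 he)).1.mono sdiff_subset).const_mul _
  · refine (Finset.abs_sum_le_sum_abs _ _).trans (Finset.sum_le_sum fun e he => ?_)
    rw [abs_mul]
    exact mul_le_of_le_one_right (abs_nonneg _) ((hφ e k (hIm.1 he)).2.2 x)
  · intro e t ht
    have hlim : Tendsto (fun k : ℕ => 1 / ((k : ℝ) + 2)) atTop (𝓝 0) := by
      have := tendsto_shrinkFactor.const_sub 1
      simpa [shrinkFactor] using this
    filter_upwards [hlim.eventually_lt_const ht.1,
      hlim.eventually_lt_const (show 0 < 1 - t by linarith [ht.2])] with k hk1 hk2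
    have hother : ∀ e' ∈ I, e' ≠ e →
        v e' * φ e' k (AffineMap.lineMap (M.src e) (M.tgt e) t) = 0 := by
      intro e' he' hne
      rw [mul_eq_zero]
      right
      by_contra h0
      have h1 := (hφ e' k (hIm.1 he')).1.support (subset_tsupport _ h0)
      refine h1.2 ?_
      simp only [mem_iUnion]
      exact ⟨e, Finset.mem_erase.2 ⟨hne.symm, Finset.mem_univ _⟩,
        openSegment_subset_segment _ _ _ (hopen ht)⟩
    by_cases he : M.IsBoundaryEdge e
    · rw [hv e he]
      refine Finset.sum_eq_zero fun e' he' => hother e' he' ?_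
      rintro rfl
      exact hIm.1 he' he
    · rw [Finset.sum_eq_single_of_mem e (hIm.2 he) hother,
        (hφ e k he).2.1 t ⟨hk1.le, by linarith⟩, mul_one]

end PolyMesh

/-! ### Edge averages and affine functions -/

/-- The average of `f` over the edge `e`. -/
noncomputable abbrev edgeAvg {ι : Type*} (a b : ι → Plane) (f : Plane → ℝ) (e : ι) : ℝ :=
  ∫ t in (0 : ℝ)..1, f (AffineMap.lineMap (a e) (b e) t)

theorem edgeProfile_one {ι : Type*} (E : Finset ι) (a b : ι → Plane) (z : Plane) (w : ι → ℝ)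
    (f : Plane → ℝ) : edgeProfile E a b z w f 1 = ∑ e ∈ E, w e * edgeAvg a b f e := by
  have e1 (e : ι) (t : ℝ) : rayPt z (a e) (b e) (1, t) = AffineMap.lineMap (a e) (b e) t := by
    simp [rayPt]
  simp only [edgeProfile, e1]

theorem continuous_comp_lineMap {f : Plane → ℝ} (hf : Continuous f) (a b : Plane) :
    Continuous fun t : ℝ => f (AffineMap.lineMap a b t) :=
  hf.comp AffineMap.lineMap_continuous

theorem edgeAvg_mono {ι : Type*} {a b : ι → Plane} {f g : Plane → ℝ} (hf : Continuous f)
    (hg : Continuous g) {e : ι} (h : ∀ t ∈ Icc (0 : ℝ) 1,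
      f (AffineMap.lineMap (a e) (b e) t) ≤ g (AffineMap.lineMap (a e) (b e) t)) :
    edgeAvg a b f e ≤ edgeAvg a b g e :=
  intervalIntegral.integral_mono_on zero_le_one
    ((continuous_comp_lineMap hf _ _).intervalIntegrable _ _)
    ((continuous_comp_lineMap hg _ _).intervalIntegrable _ _) h

theorem edgeAvg_add {ι : Type*} {a b : ι → Plane} {f g : Plane → ℝ} (hf : Continuous f)
    (hg : Continuous g) (e : ι) :
    edgeAvg a b (fun x => f x + g x) e = edgeAvg a b f e + edgeAvg a b g e :=
  intervalIntegral.integral_add ((continuous_comp_lineMap hf _ _).intervalIntegrable _ _)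
    ((continuous_comp_lineMap hg _ _).intervalIntegrable _ _)

theorem edgeAvg_sub {ι : Type*} {a b : ι → Plane} {f g : Plane → ℝ} (hf : Continuous f)
    (hg : Continuous g) (e : ι) :
    edgeAvg a b (fun x => f x - g x) e = edgeAvg a b f e - edgeAvg a b g e :=
  intervalIntegral.integral_sub ((continuous_comp_lineMap hf _ _).intervalIntegrable _ _)
    ((continuous_comp_lineMap hg _ _).intervalIntegrable _ _)

theorem edgeAvg_const_mul {ι : Type*} {a b : ι → Plane} {f : Plane → ℝ} (c : ℝ) (e : ι) :
    edgeAvg a b (fun x => c * f x) e = c * edgeAvg a b f e :=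
  intervalIntegral.integral_const_mul _ _

theorem edgeAvg_const {ι : Type*} {a b : ι → Plane} (c : ℝ) (e : ι) :
    edgeAvg a b (fun _ => c) e = c := by simp [edgeAvg]

theorem edgeAvg_nonneg {ι : Type*} {a b : ι → Plane} {f : Plane → ℝ} (h : ∀ x, 0 ≤ f x) (e : ι) :
    0 ≤ edgeAvg a b f e := intervalIntegral.integral_nonneg zero_le_one fun _ _ => h _

/-- Jensen's inequality for edge averages. -/
theorem sq_edgeAvg_le {ι : Type*} {a b : ι → Plane} {f : Plane → ℝ} (hf : Continuous f) (e : ι) :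
    edgeAvg a b f e ^ 2 ≤ edgeAvg a b (fun x => f x ^ 2) e := by
  have h0 : 0 ≤ edgeAvg a b (fun x => (f x - edgeAvg a b f e) ^ 2) e :=
    edgeAvg_nonneg (fun _ => sq_nonneg _) e
  have e1 : (fun x => (f x - edgeAvg a b f e) ^ 2)
      = fun x => (f x ^ 2 - 2 * edgeAvg a b f e * f x) + edgeAvg a b f e ^ 2 := by
    funext x; ring
  rw [e1, edgeAvg_add (by fun_prop) (by fun_prop), edgeAvg_sub (by fun_prop) (by fun_prop),
    edgeAvg_const_mul, edgeAvg_const] at h0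
  nlinarith

/-- The gradient of an affine function. -/
noncomputable def affineGrad (s : Plane →ᵃ[ℝ] ℝ) : Plane :=
  (InnerProductSpace.toDual ℝ Plane).symm (LinearMap.toContinuousLinearMap s.linear)

theorem affine_eq_add_inner (s : Plane →ᵃ[ℝ] ℝ) (x y : Plane) :
    s x = s y + inner ℝ (affineGrad s) (x - y) := by
  have h := s.map_vadd y (x - y)
  rw [vadd_eq_add, sub_add_cancel, vadd_eq_add] at h
  rw [h, affineGrad, InnerProductSpace.toDual_symm_apply, add_comm]
  rfl

theorem affine_eq (s : Plane →ᵃ[ℝ] ℝ) :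
    (s : Plane → ℝ) = fun x => s 0 + inner ℝ (affineGrad s) x := by
  funext x
  rw [affine_eq_add_inner s x 0, sub_zero]

theorem contDiff_affine (s : Plane →ᵃ[ℝ] ℝ) : ContDiff ℝ ∞ s := by
  rw [affine_eq]
  exact contDiff_const.add (contDiff_const.inner ℝ contDiff_id)

theorem continuous_affine (s : Plane →ᵃ[ℝ] ℝ) : Continuous s := (contDiff_affine s).continuous

theorem inner_single_one (v : Plane) (j : Fin 2) :
    inner ℝ v (EuclideanSpace.single j (1 : ℝ)) = v j := by
  rw [EuclideanSpace.inner_single_right]; simp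

theorem fderiv_affine (s : Plane →ᵃ[ℝ] ℝ) (x v : Plane) :
    fderiv ℝ s x v = inner ℝ (affineGrad s) v := by
  have h : HasFDerivAt s (innerSL ℝ (affineGrad s)) x := by
    rw [affine_eq]
    exact (innerSL ℝ (affineGrad s)).hasFDerivAt.const_add _
  rw [h.fderiv]
  rfl

theorem partialDeriv_affine (s : Plane →ᵃ[ℝ] ℝ) (j : Fin 2) (x : Plane) :
    partialDeriv j s x = affineGrad s j := by
  rw [partialDeriv, fderiv_affine, inner_single_one]

theorem lineMap_half {ι : Type*} (a b : ι → Plane) (e : ι) :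
    AffineMap.lineMap (a e) (b e) (1 / 2 : ℝ) = midpoint ℝ (a e) (b e) := by
  rw [midpoint, one_div, invOf_eq_inv]

theorem edgeAvg_affine {ι : Type*} (a b : ι → Plane) (s : Plane →ᵃ[ℝ] ℝ) (e : ι) :
    edgeAvg a b s e = s (midpoint ℝ (a e) (b e)) := by
  have h (t : ℝ) : s (AffineMap.lineMap (a e) (b e) t) = s (a e) + t * (s (b e) - s (a e)) := by
    rw [AffineMap.apply_lineMap, AffineMap.lineMap_apply]
    simp only [vsub_eq_sub, vadd_eq_add, smul_eq_mul]
    ring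
  rw [← lineMap_half, h, edgeAvg]
  simp only [h]
  have hc : Continuous fun t : ℝ => t * (s (b e) - s (a e)) := by fun_prop
  rw [intervalIntegral.integral_add (by simp) (hc.intervalIntegrable _ _),
    intervalIntegral.integral_mul_const, integral_id, intervalIntegral.integral_const]
  simp

/-- A weighted Cauchy–Schwarz inequality for sums of multiples of unit vectors. -/
theorem norm_sum_smul_sq_le {ι : Type*} (E : Finset ι) (l c : ι → ℝ) (n : ι → Plane)
    (hl : ∀ e ∈ E, 0 ≤ l e) (hn : ∀ e ∈ E, ‖n e‖ = 1) :
    ‖∑ e ∈ E, (c e * l e) • n e‖ ^ 2 ≤ (∑ e ∈ E, l e) * ∑ e ∈ E, c e ^ 2 * l e := by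
  have h1 : ‖∑ e ∈ E, (c e * l e) • n e‖ ≤ ∑ e ∈ E, |c e| * l e := by
    refine (norm_sum_le _ _).trans (Finset.sum_le_sum fun e he => ?_)
    rw [norm_smul, hn e he, mul_one, Real.norm_eq_abs, abs_mul, abs_of_nonneg (hl e he)]
  refine (pow_le_pow_left₀ (norm_nonneg _) h1 2).trans ?_
  refine Finset.sum_sq_le_sum_mul_sum_of_sq_le_mul E hl
    (fun e he => mul_nonneg (sq_nonneg _) (hl e he)) fun e _ => ?_
  rw [mul_pow, sq_abs]
  exact (by ring : _ = _).le

namespace IsStarPolygon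

variable {ι : Type*} {T : Set Plane} {E : Finset ι} {a b n : ι → Plane} {z : Plane} {r : ℝ}

theorem volume_pos (hT : IsStarPolygon T E a b n z r) : 0 < volume.real T := by
  rw [measureReal_def, ENNReal.toReal_pos_iff]
  exact ⟨(Metric.measure_closedBall_pos volume z hT.pos).trans_le
    (measure_mono hT.closedBall_subset), hT.isCompact.measure_lt_top⟩

theorem two_mul_volume (hT : IsStarPolygon T E a b n z r) :
    2 * volume.real T = ∑ e ∈ E, edgeWeight a b n z e := by
  have h := hT.integral_eq_edgeProfile (f := fun _ => 1) continuous_const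
  have e1 (s : ℝ) : edgeProfile E a b z (edgeWeight a b n z) (fun _ => 1) s
      = ∑ e ∈ E, edgeWeight a b n z e := by simp [edgeProfile]
  simp only [e1, intervalIntegral.integral_mul_const, integral_id] at h
  rw [setIntegral_const, smul_eq_mul, mul_one] at h
  linarith

theorem midpoint_mem (hT : IsStarPolygon T E a b n z r) {e : ι} (he : e ∈ E) :
    midpoint ℝ (a e) (b e) ∈ T := by
  rw [← lineMap_half]
  exact hT.lineMap_mem he ⟨by norm_num, by norm_num⟩

theorem src_mem (hT : IsStarPolygon T E a b n z r) {e : ι} (he : e ∈ E) : a e ∈ T :=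
  hT.edge_subset he (left_mem_segment ℝ _ _)

section diameter

variable {ρ d : ℝ}

theorem diam_pos (hT : IsStarPolygon T E a b n z (ρ * d)) (hρ : 0 < ρ) : 0 < d :=
  pos_of_mul_pos_right hT.pos hρ.le

theorem mul_perimeter_le (hT : IsStarPolygon T E a b n z (ρ * d)) :
    ρ * d * ∑ e ∈ E, dist (a e) (b e) ≤ 2 * volume.real T := by
  rw [hT.two_mul_volume, Finset.mul_sum]
  refine Finset.sum_le_sum fun e he => ?_
  rw [mul_comm]
  exact mul_le_mul_of_nonneg_left (hT.le_inner_normal he) dist_nonneg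

theorem edgeWeight_le (hT : IsStarPolygon T E a b n z r)
    (hd : ∀ x ∈ T, ∀ y ∈ T, ‖x - y‖ ≤ d) {e : ι} (he : e ∈ E) :
    edgeWeight a b n z e ≤ d * dist (a e) (b e) := by
  rw [mul_comm d]
  refine mul_le_mul_of_nonneg_left ?_ dist_nonneg
  refine (real_inner_le_norm _ _).trans ?_
  rw [hT.norm_normal e he, one_mul]
  exact hd _ (hT.src_mem he) _ hT.center_mem

theorem two_mul_volume_le (hT : IsStarPolygon T E a b n z r)
    (hd : ∀ x ∈ T, ∀ y ∈ T, ‖x - y‖ ≤ d) :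
    2 * volume.real T ≤ d * ∑ e ∈ E, dist (a e) (b e) := by
  rw [hT.two_mul_volume, Finset.mul_sum]
  exact Finset.sum_le_sum fun e he => hT.edgeWeight_le hd he

theorem volume_le_volume_ball (hT : IsStarPolygon T E a b n z (ρ * d)) (hρ : 0 < ρ)
    (hd : ∀ x ∈ T, ∀ y ∈ T, ‖x - y‖ ≤ d) :
    ρ ^ 2 * volume.real T ≤ volume.real (Metric.closedBall z (ρ * d)) := by
  have hd0 := hT.diam_pos hρ
  have hsub : T ⊆ Metric.closedBall z d := fun x hx =>
    mem_closedBall_iff_norm.2 (hd x hx z hT.center_mem)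
  have h1 : volume.real T ≤ volume.real (Metric.closedBall z d) :=
    measureReal_mono hsub (isCompact_closedBall z d).measure_lt_top.ne
  have h2 : volume.real (Metric.closedBall z (ρ * d))
      = ρ ^ 2 * volume.real (Metric.closedBall z d) := by
    rw [Measure.addHaar_real_closedBall _ _ hT.pos.le, Measure.addHaar_real_closedBall _ _ hd0.le]
    simp only [finrank_euclideanSpace, Fintype.card_fin]
    ring
  rw [h2]
  exact mul_le_mul_of_nonneg_left h1 (sq_nonneg ρ)

/-- A vector that is a weighted sum of the normals is bounded by the weights. -/
theorem norm_sq_le_of_smul_eq_sum (hT : IsStarPolygon T E a b n z (ρ * d)) (hρ : 0 < ρ)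
    {w : Plane} {c : ι → ℝ}
    (h : volume.real T • w = ∑ e ∈ E, (c e * dist (a e) (b e)) • n e) :
    d * (volume.real T * ‖w‖ ^ 2) ≤ 2 / ρ * ∑ e ∈ E, c e ^ 2 * dist (a e) (b e) := by
  have h1 := norm_sum_smul_sq_le E (fun e => dist (a e) (b e)) c n (fun _ _ => dist_nonneg)
    hT.norm_normal
  rw [← h, norm_smul, Real.norm_eq_abs, abs_of_pos hT.volume_pos, mul_pow] at h1
  set Q := ∑ e ∈ E, c e ^ 2 * dist (a e) (b e) with hQ
  have hQ0 : 0 ≤ Q := Finset.sum_nonneg fun e _ => mul_nonneg (sq_nonneg _) dist_nonneg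
  have h2 := mul_le_mul_of_nonneg_right hT.mul_perimeter_le hQ0
  have hV := hT.volume_pos
  have hd0 := hT.diam_pos hρ
  have h3 : volume.real T * (ρ * (d * (volume.real T * ‖w‖ ^ 2))) ≤ volume.real T * (2 * Q) := by
    have := mul_le_mul_of_nonneg_left h1 hT.pos.le
    nlinarith
  have h4 := le_of_mul_le_mul_left h3 hV
  rw [div_mul_eq_mul_div, le_div_iff₀ hρ]
  linarith

theorem volume_smul_affineGrad (hT : IsStarPolygon T E a b n z r) (s : Plane →ᵃ[ℝ] ℝ) :
    volume.real T • affineGrad s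
      = ∑ e ∈ E, (s (midpoint ℝ (a e) (b e)) * dist (a e) (b e)) • n e := by
  ext j
  have h := hT.integral_fderiv (f := s) ((contDiff_affine s).of_le (by exact_mod_cast le_top))
    (EuclideanSpace.single j 1)
  simp only [fderiv_affine, inner_single_one, setIntegral_const, smul_eq_mul, edgeProfile_one,
    fluxWeight, edgeAvg_affine] at h
  rw [PiLp.smul_apply, smul_eq_mul, h, WithLp.ofLp_sum, Finset.sum_apply]
  refine Finset.sum_congr rfl fun e _ => ?_
  rw [PiLp.smul_apply, smul_eq_mul]
  ring

/-- The gradient of an affine function `s` and the weak gradient `g` of edge values differ by the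
residuals of `s` at the midpoints, both being weighted sums of the normals. -/
theorem norm_affineGrad_sub_sq_le (hT : IsStarPolygon T E a b n z (ρ * d)) (hρ : 0 < ρ)
    {v : ι → ℝ} {g : Plane} (hg : volume.real T • g = ∑ e ∈ E, (v e * dist (a e) (b e)) • n e)
    (s : Plane →ᵃ[ℝ] ℝ) :
    d * (volume.real T * ‖affineGrad s - g‖ ^ 2)
      ≤ 2 / ρ * ∑ e ∈ E, (s (midpoint ℝ (a e) (b e)) - v e) ^ 2 * dist (a e) (b e) := by
  apply hT.norm_sq_le_of_smul_eq_sum hρ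
  rw [smul_sub, hT.volume_smul_affineGrad, hg, ← Finset.sum_sub_distrib]
  refine Finset.sum_congr rfl fun e _ => ?_
  rw [← sub_smul, sub_mul]

theorem abs_affine_sub_le {d : ℝ} (hd : ∀ x ∈ T, ∀ y ∈ T, ‖x - y‖ ≤ d) (s : Plane →ᵃ[ℝ] ℝ)
    {x y : Plane} (hx : x ∈ T) (hy : y ∈ T) : |s x - s y| ≤ ‖affineGrad s‖ * d := by
  rw [affine_eq_add_inner s x y, add_sub_cancel_left]
  exact (abs_real_inner_le_norm _ _).trans
    (mul_le_mul_of_nonneg_left (hd x hx y hy) (norm_nonneg _))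

/-- The gradient of the linear extension is controlled by the discrete gradient and the
stabilizer. -/
theorem norm_affineGrad_sq_le (hT : IsStarPolygon T E a b n z (ρ * d)) (hρ : 0 < ρ)
    {v : ι → ℝ} {g : Plane} (hg : volume.real T • g = ∑ e ∈ E, (v e * dist (a e) (b e)) • n e)
    (s : Plane →ᵃ[ℝ] ℝ) :
    d * (volume.real T * ‖affineGrad s‖ ^ 2)
      ≤ (2 + 4 / ρ) * ((∑ e ∈ E, (s (midpoint ℝ (a e) (b e)) - v e) ^ 2 * dist (a e) (b e))
        + d * (volume.real T * ‖g‖ ^ 2)) := by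
  have h1 := hT.norm_affineGrad_sub_sq_le hρ hg s
  have hd0 := hT.diam_pos hρ
  have hV := hT.volume_pos
  set J := ∑ e ∈ E, (s (midpoint ℝ (a e) (b e)) - v e) ^ 2 * dist (a e) (b e)
  have hJ : 0 ≤ J := Finset.sum_nonneg fun e _ => mul_nonneg (sq_nonneg _) dist_nonneg
  have h2 : ‖affineGrad s‖ ^ 2 ≤ 2 * ‖affineGrad s - g‖ ^ 2 + 2 * ‖g‖ ^ 2 := by
    have := norm_add_le (affineGrad s - g) g
    rw [sub_add_cancel] at this
    nlinarith [norm_nonneg (affineGrad s), norm_nonneg g, norm_nonneg (affineGrad s - g),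
      sq_nonneg (‖affineGrad s - g‖ - ‖g‖)]
  have h3 := mul_le_mul_of_nonneg_left h2 (mul_pos hd0 hV).le
  have h4 : 0 ≤ d * (volume.real T * ‖g‖ ^ 2) := by positivity
  have h5 : 0 ≤ 4 / ρ * (d * (volume.real T * ‖g‖ ^ 2)) := by positivity
  have h6 : 2 * (2 / ρ * J) = 4 / ρ * J := by ring
  nlinarith

/-- The distance between the edge values and the linear extension, on the whole boundary. -/
theorem sum_edgeAvg_sub_sq_le (hT : IsStarPolygon T E a b n z (ρ * d)) (hρ : 0 < ρ)
    (hd : ∀ x ∈ T, ∀ y ∈ T, ‖x - y‖ ≤ d)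
    {v : ι → ℝ} {g : Plane} (hg : volume.real T • g = ∑ e ∈ E, (v e * dist (a e) (b e)) • n e)
    (s : Plane →ᵃ[ℝ] ℝ) :
    ∑ e ∈ E, dist (a e) (b e) * edgeAvg a b (fun x => (s x - v e) ^ 2) e
      ≤ (2 + 4 / ρ * (2 + 4 / ρ)) *
        ((∑ e ∈ E, (s (midpoint ℝ (a e) (b e)) - v e) ^ 2 * dist (a e) (b e))
          + d * (volume.real T * ‖g‖ ^ 2)) := by
  have h1 := hT.norm_affineGrad_sq_le hρ hg s
  have hd0 := hT.diam_pos hρ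
  have hV := hT.volume_pos
  set J := ∑ e ∈ E, (s (midpoint ℝ (a e) (b e)) - v e) ^ 2 * dist (a e) (b e) with hJd
  have hJ : 0 ≤ J := Finset.sum_nonneg fun e _ => mul_nonneg (sq_nonneg _) dist_nonneg
  have hs := continuous_affine s
  have h2 : ∑ e ∈ E, dist (a e) (b e) * edgeAvg a b (fun x => (s x - v e) ^ 2) e
      ≤ 2 * J + 2 * (∑ e ∈ E, dist (a e) (b e)) * (d ^ 2 * ‖affineGrad s‖ ^ 2) := by
    rw [hJd, Finset.mul_sum, Finset.mul_sum, Finset.sum_mul, ← Finset.sum_add_distrib]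
    refine Finset.sum_le_sum fun e he => ?_
    have h3 : edgeAvg a b (fun x => (s x - v e) ^ 2) e
        ≤ edgeAvg a b (fun _ => 2 * (s (midpoint ℝ (a e) (b e)) - v e) ^ 2
          + 2 * (d ^ 2 * ‖affineGrad s‖ ^ 2)) e := by
      refine edgeAvg_mono (by fun_prop) continuous_const fun t ht => ?_
      have h4 := abs_affine_sub_le hd s (hT.lineMap_mem he ht) (hT.midpoint_mem he)
      have h5 := sq_le_sq' (by linarith [neg_abs_le (s (AffineMap.lineMap (a e) (b e) t)
        - s (midpoint ℝ (a e) (b e)))]) ((le_abs_self _).trans h4)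
      nlinarith [sq_nonneg ((s (AffineMap.lineMap (a e) (b e) t) - s (midpoint ℝ (a e) (b e)))
        - (s (midpoint ℝ (a e) (b e)) - v e))]
    rw [edgeAvg_const] at h3
    have := mul_le_mul_of_nonneg_left h3 (dist_nonneg (x := a e) (y := b e))
    linarith
  have h3 := hT.mul_perimeter_le
  have h4 : (∑ e ∈ E, dist (a e) (b e)) * (d ^ 2 * ‖affineGrad s‖ ^ 2)
      ≤ 2 / ρ * (d * (volume.real T * ‖affineGrad s‖ ^ 2)) := by
    rw [div_mul_eq_mul_div, le_div_iff₀ hρ]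
    have := mul_le_mul_of_nonneg_right h3 (mul_nonneg hd0.le (sq_nonneg ‖affineGrad s‖))
    nlinarith
  have h5 : 4 / ρ * (d * (volume.real T * ‖affineGrad s‖ ^ 2))
      ≤ 4 / ρ * ((2 + 4 / ρ) * (J + d * (volume.real T * ‖g‖ ^ 2))) :=
    mul_le_mul_of_nonneg_left h1 (by positivity)
  have h6 : 0 ≤ d * (volume.real T * ‖g‖ ^ 2) := by positivity
  have e2 : 2 * (2 / ρ * (d * (volume.real T * ‖affineGrad s‖ ^ 2)))
    = 4 / ρ * (d * (volume.real T * ‖affineGrad s‖ ^ 2)) := by ring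
  nlinarith

/-- An affine function is bounded in `L²(T)` by its values at the edge midpoints. -/
theorem integral_affine_sq_le (hT : IsStarPolygon T E a b n z (ρ * d)) (hρ : 0 < ρ)
    (hd : ∀ x ∈ T, ∀ y ∈ T, ‖x - y‖ ≤ d) (s : Plane →ᵃ[ℝ] ℝ) :
    ∫ x in T, s x ^ 2 ≤ (1 + 4 / ρ) * d *
      ∑ e ∈ E, s (midpoint ℝ (a e) (b e)) ^ 2 * dist (a e) (b e) := by
  have h1 := hT.norm_sq_le_of_smul_eq_sum hρ (hT.volume_smul_affineGrad s)
  have hd0 := hT.diam_pos hρ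
  have hV := hT.volume_pos
  have hPV := hT.two_mul_volume_le hd
  set P := ∑ e ∈ E, dist (a e) (b e) with hP
  set J := ∑ e ∈ E, s (midpoint ℝ (a e) (b e)) ^ 2 * dist (a e) (b e) with hJd
  have hP0 : 0 < P := pos_of_mul_pos_right (by linarith : 0 < d * P) hd0.le
  -- comparison with each midpoint value, weighted by the edge lengths
  have hpt : ∀ x ∈ T, s x ^ 2 ≤ P⁻¹ * (2 * J) + 2 * (d ^ 2 * ‖affineGrad s‖ ^ 2) := by
    intro x hx
    have h2 : P * s x ^ 2 ≤ 2 * J + P * (2 * (d ^ 2 * ‖affineGrad s‖ ^ 2)) := by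
      rw [hP, hJd, Finset.mul_sum, Finset.sum_mul, Finset.sum_mul, ← Finset.sum_add_distrib]
      refine Finset.sum_le_sum fun e he => ?_
      have h4 := abs_affine_sub_le hd s hx (hT.midpoint_mem he)
      have h5 := sq_le_sq' (by linarith [neg_abs_le (s x - s (midpoint ℝ (a e) (b e)))])
        ((le_abs_self _).trans h4)
      have h6 : s x ^ 2
          ≤ 2 * s (midpoint ℝ (a e) (b e)) ^ 2 + 2 * (d ^ 2 * ‖affineGrad s‖ ^ 2) := by
        nlinarith [sq_nonneg ((s x - s (midpoint ℝ (a e) (b e))) - s (midpoint ℝ (a e) (b e)))]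
      have := mul_le_mul_of_nonneg_left h6 (dist_nonneg (x := a e) (y := b e))
      linarith
    have h3 := mul_le_mul_of_nonneg_left h2 (inv_pos.2 hP0).le
    rw [← mul_assoc, inv_mul_cancel₀ hP0.ne', one_mul, mul_add, ← mul_assoc P⁻¹ P,
      inv_mul_cancel₀ hP0.ne', one_mul] at h3
    exact h3
  have h2 : ∫ x in T, s x ^ 2 ≤ volume.real T *
      (P⁻¹ * (2 * J) + 2 * (d ^ 2 * ‖affineGrad s‖ ^ 2)) := by
    have := setIntegral_mono_on (μ := volume) (hT.integrableOn ((continuous_affine s).pow 2))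
      (hT.integrableOn continuous_const) hT.measurableSet hpt
    rwa [setIntegral_const, smul_eq_mul] at this
  refine h2.trans ?_
  have hJ : 0 ≤ J := Finset.sum_nonneg fun e _ => mul_nonneg (sq_nonneg _) dist_nonneg
  have h3 : volume.real T * (P⁻¹ * (2 * J)) ≤ d * J := by
    have : 2 * volume.real T * P⁻¹ ≤ d := by
      rw [← div_eq_mul_inv, div_le_iff₀ hP0]; exact hPV
    nlinarith
  have h4 : 2 * d * (d * (volume.real T * ‖affineGrad s‖ ^ 2)) ≤ 2 * d * (2 / ρ * J) :=
    mul_le_mul_of_nonneg_left h1 (by positivity)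
  have e : (1 + 4 / ρ) * d * J = d * J + 2 * d * (2 / ρ * J) := by ring
  rw [e]
  nlinarith

end diameter

end IsStarPolygon

/-! ### Approximation by affine functions -/

theorem exists_affine_eq (c : ℝ) (m : Plane) :
    ∃ p : Plane →ᵃ[ℝ] ℝ, (∀ x, p x = c + inner ℝ m x) ∧ affineGrad p = m := by
  set p : Plane →ᵃ[ℝ] ℝ :=
    ((innerSL ℝ m : Plane →L[ℝ] ℝ) : Plane →ₗ[ℝ] ℝ).toAffineMap + AffineMap.const ℝ Plane c with hp
  have hpx (x : Plane) : p x = c + inner ℝ m x := by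
    rw [hp]; simp [add_comm]
  refine ⟨p, hpx, ext_inner_right ℝ fun v => ?_⟩
  have := affine_eq_add_inner p v 0
  rw [hpx, hpx, inner_zero_right, sub_zero] at this
  linarith

/-- A least-squares fit minimizes the residual, and its distance to any other affine function is
bounded by the residual of the latter. -/
theorem leastSquares_le {ι : Type*} {E : Finset ι} {l v : ι → ℝ} {m : ι → Plane}
    {s : Plane →ᵃ[ℝ] ℝ}
    (hs : ∀ φ : Plane →ᵃ[ℝ] ℝ, ∑ e ∈ E, (s (m e) - v e) * φ (m e) * l e = 0)
    (p : Plane →ᵃ[ℝ] ℝ) :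
    (∑ e ∈ E, (s (m e) - v e) ^ 2 * l e) + ∑ e ∈ E, ((s - p) (m e)) ^ 2 * l e
      = ∑ e ∈ E, (p (m e) - v e) ^ 2 * l e := by
  have h := hs (s - p)
  rw [← sub_eq_zero, ← Finset.sum_add_distrib, ← Finset.sum_sub_distrib]
  rw [← mul_zero 2, ← h, Finset.mul_sum]
  refine Finset.sum_congr rfl fun e _ => ?_
  simp only [AffineMap.coe_sub, Pi.sub_apply]
  ring

namespace IsStarPolygon

variable {ι : Type*} {T : Set Plane} {E : Finset ι} {a b n : ι → Plane} {z : Plane} {r : ℝ}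

theorem hasL2Gradient_of_contDiff (hT : IsStarPolygon T E a b n z r) {f : Plane → ℝ}
    {D : Plane → Plane} (hf : ContDiff ℝ 1 f) (hD : ∀ x j, partialDeriv j f x = D x j) :
    HasL2Gradient T f D := by
  have hDc (j) : Continuous fun x => D x j := by
    simp only [← hD]; exact continuous_partialDeriv hf j
  exact ⟨hT.memLp_of_continuous hf.continuous, fun j => hT.memLp_of_continuous (hDc j),
    isWeakGradient_of_hasFDerivAt hf.continuous hDc (fun x _ => hf.differentiable one_ne_zero x)
      fun x _ j => hD x j⟩

theorem hasL2Gradient_sub (hT : IsStarPolygon T E a b n z r) {f g : Plane → ℝ}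
    {F G : Plane → Plane} (hf : HasL2Gradient T f F) (hg : HasL2Gradient T g G) :
    HasL2Gradient T (fun x => f x - g x) (fun x => F x - G x) := by
  refine ⟨hf.memLp.sub hg.memLp, fun j => (hf.memLp_grad j).sub (hg.memLp_grad j),
    fun φ hφ j => ?_⟩
  have h1 := hf.weak_grad φ hφ j
  have h2 := hg.weak_grad φ hφ j
  have hc := continuous_partialDeriv_of_isTestFunction hφ j
  have hc' := hφ.smooth.continuous
  simp only [gradient_apply, hT.restrict_interior] at h1 h2 ⊢
  simp only [PiLp.sub_apply, sub_mul]
  rw [integral_sub (hT.integrableOn_mul_continuous (hT.integrableOn_of_memLp hf.memLp) hc)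
    (hT.integrableOn_mul_continuous (hT.integrableOn_of_memLp hg.memLp) hc),
    integral_sub (hT.integrableOn_mul_continuous (hT.integrableOn_of_memLp (hf.memLp_grad j)) hc')
    (hT.integrableOn_mul_continuous (hT.integrableOn_of_memLp (hg.memLp_grad j)) hc'), h1, h2]
  ring

theorem hasL2Gradient_const (hT : IsStarPolygon T E a b n z r) (c : ℝ) :
    HasL2Gradient T (fun _ => c) (fun _ => 0) :=
  hT.hasL2Gradient_of_contDiff contDiff_const fun x j => by simp [partialDeriv]

theorem hasL2Gradient_affine (hT : IsStarPolygon T E a b n z r) (p : Plane →ᵃ[ℝ] ℝ) :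
    HasL2Gradient T p (fun _ => affineGrad p) :=
  hT.hasL2Gradient_of_contDiff ((contDiff_affine p).of_le (by exact_mod_cast le_top))
    fun x j => partialDeriv_affine p j x

/-- The average of a function over the disc about `z` of radius `r`. -/
noncomputable def _root_.discAvg (z : Plane) (r : ℝ) (w : Plane → ℝ) : ℝ :=
  (volume.real (Metric.closedBall z r))⁻¹ * ∫ y in Metric.closedBall z r, w y

section diameter

variable {ρ d : ℝ}

theorem integral_sub_discAvg_sq_le (hT : IsStarPolygon T E a b n z (ρ * d)) (hρ : 0 < ρ)
    (hd : ∀ x ∈ T, ∀ y ∈ T, ‖x - y‖ ≤ d) {w : Plane → ℝ} {G : Plane → Plane}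
    (h : HasL2Gradient T w G) :
    ∫ x in T, (w x - discAvg z (ρ * d) w) ^ 2
      ≤ 4 / ρ ^ 2 * d ^ 2 * ∑ j, ∫ x in T, G x j ^ 2 := by
  have h1 := hT.poincare hd h
  rw [integral_finsetSum _ fun j _ => (h.memLp_grad j).integrable_sq] at h1
  have hV := hT.volume_pos
  have h2 := hT.volume_le_volume_ball hρ hd
  have hI : 0 ≤ ∫ x in T, (w x - discAvg z (ρ * d) w) ^ 2 := integral_nonneg fun _ => sq_nonneg _
  have h3 := (mul_le_mul_of_nonneg_right h2 hI).trans h1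
  set X := ∫ x in T, (w x - discAvg z (ρ * d) w) ^ 2
  set Y := ∑ j, ∫ x in T, G x j ^ 2
  have h4 : volume.real T * (X * ρ ^ 2) ≤ volume.real T * (4 * d ^ 2 * Y) := by nlinarith
  have h5 := le_of_mul_le_mul_left h4 hV
  rw [div_mul_eq_mul_div, div_mul_eq_mul_div, le_div_iff₀ (by positivity)]
  exact h5

/-- The average over the disc is bounded in terms of the norm on `T`, as the disc contains a fixed
fraction of the area of `T`. -/
theorem volume_mul_discAvg_sq_le (hT : IsStarPolygon T E a b n z (ρ * d)) (hρ : 0 < ρ)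
    (hd : ∀ x ∈ T, ∀ y ∈ T, ‖x - y‖ ≤ d) {w : Plane → ℝ}
    (h : MemLp w 2 (volume.restrict T)) :
    volume.real T * discAvg z (ρ * d) w ^ 2 ≤ (ρ ^ 2)⁻¹ * ∫ x in T, w x ^ 2 := by
  have hB : IsFiniteMeasure (volume.restrict (Metric.closedBall z (ρ * d))) :=
    ⟨by rw [Measure.restrict_apply_univ]; exact (isCompact_closedBall _ _).measure_lt_top⟩
  have hle := Measure.restrict_mono (μ := volume) hT.closedBall_subset le_rfl
  have hB2 := h.mono_measure hle
  have h1 := sq_integral_le_measureReal_mul (hB2.integrable (by norm_num)) hB2.integrable_sq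
  rw [measureReal_restrict_apply_univ] at h1
  have h2 : ∫ x in Metric.closedBall z (ρ * d), w x ^ 2 ≤ ∫ x in T, w x ^ 2 :=
    integral_mono_measure hle (Eventually.of_forall fun _ => sq_nonneg _) h.integrable_sq
  have h3 := hT.volume_le_volume_ball hρ hd
  have hV := hT.volume_pos
  set V := volume.real (Metric.closedBall z (ρ * d)) with hVd
  have hV' : 0 < V := lt_of_lt_of_le (by positivity) h3
  set I := ∫ x in Metric.closedBall z (ρ * d), w x
  have e : discAvg z (ρ * d) w = V⁻¹ * I := rfl
  rw [e, mul_pow, inv_mul_eq_div, le_div_iff₀ (by positivity)]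
  have h4 : V⁻¹ ^ 2 * I ^ 2 ≤ V⁻¹ * ∫ x in T, w x ^ 2 := by
    have : V⁻¹ ^ 2 * I ^ 2 ≤ V⁻¹ ^ 2 * (V * ∫ x in T, w x ^ 2) :=
      mul_le_mul_of_nonneg_left (h1.trans (mul_le_mul_of_nonneg_left h2 hV'.le)) (by positivity)
    refine this.trans_eq ?_
    field_simp
  calc volume.real T * (V⁻¹ ^ 2 * I ^ 2) * ρ ^ 2
      = (ρ ^ 2 * volume.real T) * (V⁻¹ ^ 2 * I ^ 2) := by ring
    _ ≤ V * (V⁻¹ * ∫ x in T, w x ^ 2) :=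
        mul_le_mul h3 h4 (by positivity) hV'.le
    _ = ∫ x in T, w x ^ 2 := by rw [← mul_assoc, mul_inv_cancel₀ hV'.ne', one_mul]

/-- Approximation of `H²` functions by affine functions on `T`. -/
theorem exists_affine_approx (hT : IsStarPolygon T E a b n z (ρ * d)) (hρ : 0 < ρ)
    (hd : ∀ x ∈ T, ∀ y ∈ T, ‖x - y‖ ≤ d) {u : Plane → ℝ} {G : Plane → Plane}
    {H : Fin 2 → Plane → Plane} (huc : Continuous u) (hu : HasL2Gradient T u G)
    (hG : ∀ i, HasL2Gradient T (fun x => G x i) (H i)) :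
    ∃ p : Plane →ᵃ[ℝ] ℝ,
      (∑ j, ∫ x in T, (G x j - affineGrad p j) ^ 2
        ≤ 4 / ρ ^ 2 * d ^ 2 * ∑ i, ∑ j, ∫ x in T, H i x j ^ 2) ∧
      (∫ x in T, (u x - p x) ^ 2
        ≤ (4 / ρ ^ 2) ^ 2 * d ^ 4 * ∑ i, ∑ j, ∫ x in T, H i x j ^ 2) ∧
      (∑ e ∈ E, dist (a e) (b e) * edgeAvg a b (fun x => (u x - p x) ^ 2) e
        ≤ (6 * (4 / ρ ^ 2) ^ 2 + 2 * (4 / ρ ^ 2)) / ρ * d ^ 3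
          * ∑ i, ∑ j, ∫ x in T, H i x j ^ 2) ∧
      volume.real T * ‖affineGrad p‖ ^ 2 ≤ (ρ ^ 2)⁻¹ * ∑ j, ∫ x in T, G x j ^ 2 := by
  have hd0 := hT.diam_pos hρ
  set NH := ∑ i, ∑ j, ∫ x in T, H i x j ^ 2 with hNH
  -- the slope of `p` is the average of the gradient over the disc; then the mean value is matched
  set m : Plane := WithLp.toLp 2 fun i => discAvg z (ρ * d) fun x => G x i with hm
  obtain ⟨q, -, hqm⟩ := exists_affine_eq 0 m
  set c := discAvg z (ρ * d) fun x => u x - q x with hc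
  obtain ⟨p, hp, hpm⟩ := exists_affine_eq (q 0 + c) m
  have hpq (x) : u x - p x = u x - q x - c := by
    rw [hp, affine_eq_add_inner q x 0, hqm, sub_zero]; ring
  have h1 : ∑ j, ∫ x in T, (G x j - m j) ^ 2 ≤ 4 / ρ ^ 2 * d ^ 2 * NH := by
    rw [hNH, Finset.mul_sum]
    exact Finset.sum_le_sum fun i _ => hT.integral_sub_discAvg_sq_le hρ hd (hG i)
  have hgrad := hT.hasL2Gradient_sub hu (hT.hasL2Gradient_affine q)
  rw [hqm] at hgrad
  have h2 : ∫ x in T, (u x - p x) ^ 2 ≤ (4 / ρ ^ 2) ^ 2 * d ^ 4 * NH := by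
    simp only [hpq]
    have h3 := hT.integral_sub_discAvg_sq_le hρ hd hgrad
    refine h3.trans ?_
    have h4 := mul_le_mul_of_nonneg_left h1 (show 0 ≤ 4 / ρ ^ 2 * d ^ 2 by positivity)
    simp only [PiLp.sub_apply]
    refine h4.trans_eq (by ring)
  refine ⟨p, by rwa [hpm], h2, ?_, ?_⟩
  · have hgrad2 := hT.hasL2Gradient_sub hu (hT.hasL2Gradient_affine p)
    rw [hpm] at hgrad2
    have hcont : Continuous fun x => u x - p x := huc.sub (continuous_affine p)
    have h3 := hT.edgeProfile_sq_le (fun x hx => hd x hx z hT.center_mem) hgrad2 hcont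
    simp only [PiLp.sub_apply, edgeProfile_one] at h3
    have h5 : ρ * d * ∑ e ∈ E, dist (a e) (b e) * edgeAvg a b (fun x => (u x - p x) ^ 2) e
        ≤ ∑ e ∈ E, edgeWeight a b n z e * edgeAvg a b (fun x => (u x - p x) ^ 2) e := by
      rw [Finset.mul_sum]
      refine Finset.sum_le_sum fun e he => ?_
      rw [← mul_assoc, mul_comm (ρ * d)]
      exact mul_le_mul_of_nonneg_right (mul_le_mul_of_nonneg_left (hT.le_inner_normal he)
        dist_nonneg) (edgeAvg_nonneg (fun _ => sq_nonneg _) e)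
    have h6 := mul_le_mul_of_nonneg_left h1 (show 0 ≤ 2 * d ^ 2 by positivity)
    have h7 : d * (ρ * ∑ e ∈ E, dist (a e) (b e) * edgeAvg a b (fun x => (u x - p x) ^ 2) e)
        ≤ d * ((6 * (4 / ρ ^ 2) ^ 2 + 2 * (4 / ρ ^ 2)) * d ^ 3 * NH) := by
      calc _ = ρ * d * ∑ e ∈ E, dist (a e) (b e)
            * edgeAvg a b (fun x => (u x - p x) ^ 2) e := by ring
        _ ≤ 6 * ((4 / ρ ^ 2) ^ 2 * d ^ 4 * NH) + 2 * d ^ 2 * (4 / ρ ^ 2 * d ^ 2 * NH) := by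
            linarith
        _ = _ := by ring
    have h8 := le_of_mul_le_mul_left h7 hd0
    rw [div_mul_eq_mul_div, div_mul_eq_mul_div, le_div_iff₀ hρ]
    linarith
  · rw [hpm, EuclideanSpace.real_norm_sq_eq, Finset.mul_sum, Finset.mul_sum]
    exact Finset.sum_le_sum fun j _ => hT.volume_mul_discAvg_sq_le hρ hd (hu.memLp_grad j)

/-- The constant in the bound of the least-squares residual of the edge averages of an `H²`
function. -/
noncomputable def _root_.approxConst (ρ : ℝ) : ℝ :=
  (6 * (4 / ρ ^ 2) ^ 2 + 2 * (4 / ρ ^ 2)) / ρ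

theorem sum_sub_edgeAvg_sq_le {u : Plane → ℝ} (huc : Continuous u) (p : Plane →ᵃ[ℝ] ℝ) :
    ∑ e ∈ E, (p (midpoint ℝ (a e) (b e)) - edgeAvg a b u e) ^ 2 * dist (a e) (b e)
      ≤ ∑ e ∈ E, dist (a e) (b e) * edgeAvg a b (fun x => (u x - p x) ^ 2) e := by
  refine Finset.sum_le_sum fun e _ => ?_
  rw [mul_comm, ← edgeAvg_affine a b p e, ← neg_sq, neg_sub,
    ← edgeAvg_sub huc (continuous_affine p)]
  exact mul_le_mul_of_nonneg_left (sq_edgeAvg_le (huc.sub (continuous_affine p)) e) dist_nonneg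

/-- Consistency of the least-squares fit of the edge averages: it is compared with the affine
function of `exists_affine_approx`, which has a larger residual. -/
theorem leastSquares_consistency (hT : IsStarPolygon T E a b n z (ρ * d)) (hρ : 0 < ρ)
    (hd : ∀ x ∈ T, ∀ y ∈ T, ‖x - y‖ ≤ d) {u : Plane → ℝ} {G : Plane → Plane}
    {H : Fin 2 → Plane → Plane} (huc : Continuous u) (hu : HasL2Gradient T u G)
    (hG : ∀ i, HasL2Gradient T (fun x => G x i) (H i)) {s : Plane →ᵃ[ℝ] ℝ}
    (hs : ∀ φ : Plane →ᵃ[ℝ] ℝ, ∑ e ∈ E, (s (midpoint ℝ (a e) (b e)) - edgeAvg a b u e)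
      * φ (midpoint ℝ (a e) (b e)) * dist (a e) (b e) = 0) :
    (∑ e ∈ E, (s (midpoint ℝ (a e) (b e)) - edgeAvg a b u e) ^ 2 * dist (a e) (b e)
      ≤ approxConst ρ * d ^ 3 * ∑ i, ∑ j, ∫ x in T, H i x j ^ 2) ∧
    ∫ x in T, (s x - u x) ^ 2 ≤ (2 * ((1 + 4 / ρ) * approxConst ρ) + 2 * (4 / ρ ^ 2) ^ 2) * d ^ 4 *
      ∑ i, ∑ j, ∫ x in T, H i x j ^ 2 := by
  have hd0 := hT.diam_pos hρ
  obtain ⟨p, -, h2, h3, -⟩ := hT.exists_affine_approx hρ hd huc hu hG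
  set NH := ∑ i, ∑ j, ∫ x in T, H i x j ^ 2 with hNH
  have h4 := leastSquares_le hs p
  have h5 := sum_sub_edgeAvg_sq_le (E := E) (a := a) (b := b) huc p
  have h6 : 0 ≤ ∑ e ∈ E, ((s - p) (midpoint ℝ (a e) (b e))) ^ 2 * dist (a e) (b e) :=
    Finset.sum_nonneg fun e _ => mul_nonneg (sq_nonneg _) dist_nonneg
  have h7 : 0 ≤ ∑ e ∈ E, (s (midpoint ℝ (a e) (b e)) - edgeAvg a b u e) ^ 2 * dist (a e) (b e) :=
    Finset.sum_nonneg fun e _ => mul_nonneg (sq_nonneg _) dist_nonneg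
  have h3' : _ ≤ approxConst ρ * d ^ 3 * NH := h3
  refine ⟨by linarith, ?_⟩
  have h8 := hT.integral_affine_sq_le hρ hd (s - p)
  have h9 : ∑ e ∈ E, ((s - p) (midpoint ℝ (a e) (b e))) ^ 2 * dist (a e) (b e)
      ≤ approxConst ρ * d ^ 3 * NH := by linarith
  have h10 := h8.trans (mul_le_mul_of_nonneg_left h9 (by positivity))
  have hcs := continuous_affine (s - p)
  have hcp := continuous_affine p
  have h11 : ∫ x in T, (s x - u x) ^ 2
      ≤ ∫ x in T, (2 * (s - p) x ^ 2 + 2 * (u x - p x) ^ 2) := by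
    refine setIntegral_mono_on (hT.integrableOn ((continuous_affine s).sub huc |>.pow 2))
      (hT.integrableOn (by fun_prop)) hT.measurableSet fun x _ => ?_
    simp only [AffineMap.coe_sub, Pi.sub_apply]
    nlinarith [sq_nonneg ((s x - p x) + (u x - p x))]
  rw [integral_add (hT.integrableOn (by fun_prop)) (hT.integrableOn (by fun_prop)),
    integral_const_mul, integral_const_mul] at h11
  refine h11.trans ?_
  calc _ ≤ 2 * ((1 + 4 / ρ) * d * (approxConst ρ * d ^ 3 * NH))
        + 2 * ((4 / ρ ^ 2) ^ 2 * d ^ 4 * NH) := by linarith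
    _ = _ := by ring

/-- The weak gradient of the edge averages is the mean of the gradient, close to the gradient. -/
theorem gradient_consistency (hT : IsStarPolygon T E a b n z (ρ * d)) (hρ : 0 < ρ)
    (hd : ∀ x ∈ T, ∀ y ∈ T, ‖x - y‖ ≤ d) {u : Plane → ℝ} {G : Plane → Plane}
    {H : Fin 2 → Plane → Plane} (huc : Continuous u) (hu : HasL2Gradient T u G)
    (hG : ∀ i, HasL2Gradient T (fun x => G x i) (H i)) {g : Plane}
    (hg : volume.real T • g = ∑ e ∈ E, (edgeAvg a b u e * dist (a e) (b e)) • n e) :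
    ∑ j, ∫ x in T, (G x j - g j) ^ 2
      ≤ 4 / ρ ^ 2 * d ^ 2 * ∑ i, ∑ j, ∫ x in T, H i x j ^ 2 := by
  have := hT.isFiniteMeasure
  obtain ⟨p, h1, -⟩ := hT.exists_affine_approx hρ hd huc hu hG
  refine le_trans (Finset.sum_le_sum fun j _ => ?_) h1
  have hgj : volume.real T * g j = ∫ x in T, G x j := by
    rw [hT.integral_grad_eq hu huc j, edgeProfile_one]
    have := congrArg (fun v : Plane => v j) hg
    simp only [PiLp.smul_apply, smul_eq_mul, WithLp.ofLp_sum, Finset.sum_apply] at this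
    rw [this]
    refine Finset.sum_congr rfl fun e _ => ?_
    rw [fluxWeight, inner_single_one]
    ring
  have i2 : IntegrableOn (fun x => G x j ^ 2) T := (hu.memLp_grad j).integrable_sq
  have i1 : IntegrableOn (fun x => G x j) T := hT.integrableOn_of_memLp (hu.memLp_grad j)
  -- this quadratic function of `c` is minimal at the mean value `g j`
  have key (c : ℝ) : ∫ x in T, (G x j - c) ^ 2
      = (∫ x in T, G x j ^ 2) - 2 * c * (volume.real T * g j) + volume.real T * c ^ 2 := by
    have e : (fun x => (G x j - c) ^ 2) = fun x => (G x j ^ 2 - 2 * c * G x j) + c ^ 2 := by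
      funext x; ring
    have i3 : IntegrableOn (fun x => G x j ^ 2 - 2 * c * G x j) T := i2.sub (i1.const_mul _)
    rw [e, integral_add i3 (integrable_const _), integral_sub i2 (i1.const_mul _),
      integral_const_mul, setIntegral_const, hgj, smul_eq_mul]
  rw [key, key]
  have hV := hT.volume_pos
  nlinarith [mul_nonneg hV.le (sq_nonneg (affineGrad p j - g j))]

end diameter

end IsStarPolygon

/-! ### Discrete integration by parts -/

/-- The trace of the derivative `D`, that is, the divergence of a field with derivative `D`. -/
noncomputable def traceField (D : Plane → (Plane →L[ℝ] Plane)) (x : Plane) : ℝ :=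
  ∑ i : Fin 2, (D x (EuclideanSpace.single i 1)) i

theorem continuous_traceField {D : Plane → (Plane →L[ℝ] Plane)} (hD : Continuous D) :
    Continuous (traceField D) := by
  unfold traceField
  fun_prop

theorem partialDeriv_mul {f g : Plane → ℝ} {x : Plane} (hf : DifferentiableAt ℝ f x)
    (hg : DifferentiableAt ℝ g x) (j : Fin 2) :
    partialDeriv j (fun y => f y * g y) x
      = partialDeriv j f x * g x + f x * partialDeriv j g x := by
  rw [partialDeriv, fderiv_fun_mul hf hg]
  simp only [add_apply, smul_apply, smul_eq_mul, partialDeriv]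
  ring

theorem hasFDerivAt_coord {β : Plane → Plane} {D : Plane →L[ℝ] Plane} {x : Plane}
    (h : HasFDerivAt β D x) (j : Fin 2) :
    HasFDerivAt (fun y => β y j) ((EuclideanSpace.proj j : Plane →L[ℝ] ℝ) ∘L D) x :=
  (EuclideanSpace.proj j : Plane →L[ℝ] ℝ).hasFDerivAt.comp x h

theorem isWeakGradient_field_mul {U : Set Plane} {β : Plane → Plane}
    {D : Plane → (Plane →L[ℝ] Plane)} (hβ : Continuous β) (hD : Continuous D)
    (h : ∀ x ∈ U, HasFDerivAt β (D x) x) {χ : Plane → ℝ} (hχ : ContDiff ℝ 1 χ) (j : Fin 2) :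
    IsWeakGradient U (fun x => β x j * χ x) (fun x => WithLp.toLp 2 fun i =>
      (D x (EuclideanSpace.single i 1)) j * χ x + β x j * partialDeriv i χ x) := by
  have hχc := hχ.continuous
  have hβj : Continuous fun x => β x j := by fun_prop
  have hp (i) := continuous_partialDeriv hχ i
  refine isWeakGradient_of_hasFDerivAt (hβj.mul hχc) (fun i => ?_) (fun x hx => ?_)
    fun x hx i => ?_
  · have h1 : Continuous fun x => (D x (EuclideanSpace.single i 1)) j := by fun_prop
    exact (h1.mul hχc).add (hβj.mul (hp i))
  · exact (hasFDerivAt_coord (h x hx) j).differentiableAt.mul (hχ.differentiable one_ne_zero x)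
  · rw [partialDeriv_mul (hasFDerivAt_coord (h x hx) j).differentiableAt
      (hχ.differentiable one_ne_zero x), partialDeriv, (hasFDerivAt_coord (h x hx) j).fderiv]
    rfl

theorem IsTestFunction.contDiff_one {U : Set Plane} {φ : Plane → ℝ} (hφ : IsTestFunction U φ) :
    ContDiff ℝ 1 φ := hφ.smooth.of_le (by exact_mod_cast le_top)

theorem IsTestFunction.integrable_mul {U : Set Plane} {φ f : Plane → ℝ} (hφ : IsTestFunction U φ)
    (hf : Continuous f) : Integrable fun x => f x * φ x :=
  (hf.mul hφ.smooth.continuous).integrable_of_hasCompactSupport hφ.compact.mul_left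

theorem IsTestFunction.integrable_mul_partialDeriv {U : Set Plane} {φ f : Plane → ℝ}
    (hφ : IsTestFunction U φ) (hf : Continuous f) (j : Fin 2) :
    Integrable fun x => f x * partialDeriv j φ x :=
  (hf.mul (continuous_partialDeriv_of_isTestFunction hφ j)).integrable_of_hasCompactSupport
    (hφ.hasCompactSupport_partialDeriv j).mul_left

/-- A compactly supported field has divergence with vanishing integral. -/
theorem integral_divergence_mul_eq_zero {U : Set Plane} {β : Plane → Plane}
    {D : Plane → (Plane →L[ℝ] Plane)} (hβ : Continuous β) (hD : Continuous D)
    (h : ∀ x ∈ U, HasFDerivAt β (D x) x) {φ : Plane → ℝ} (hφ : IsTestFunction U φ) :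
    ∫ x in U, (traceField D x * φ x + fderiv ℝ φ x (β x)) = 0 := by
  have hβj (j : Fin 2) : Continuous fun x => β x j := by fun_prop
  have hDj (j : Fin 2) : Continuous fun x => (D x (EuclideanSpace.single j 1)) j := by fun_prop
  have key (j : Fin 2) : (∫ x in U, ((D x (EuclideanSpace.single j 1)) j * φ x
      + β x j * partialDeriv j φ x)) = 0 := by
    have hw := isWeakGradient_field_mul hβ hD h (χ := fun _ => 1) contDiff_const j φ hφ j
    simp only [gradient_apply, mul_one] at hw
    have e0 (x : Plane) : partialDeriv j (fun _ => (1 : ℝ)) x = 0 := by simp [partialDeriv]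
    simp only [e0, mul_zero, add_zero] at hw
    rw [integral_add (hφ.integrable_mul (hDj j)).integrableOn
      (hφ.integrable_mul_partialDeriv (hβj j) j).integrableOn, hw]
    ring
  have e (x : Plane) : traceField D x * φ x + fderiv ℝ φ x (β x)
      = ∑ j, ((D x (EuclideanSpace.single j 1)) j * φ x + β x j * partialDeriv j φ x) := by
    rw [Finset.sum_add_distrib, ← Finset.sum_mul, fderiv_apply_eq_sum]
    rfl
  have hint (j : Fin 2) : IntegrableOn (fun x => (D x (EuclideanSpace.single j 1)) j * φ x
      + β x j * partialDeriv j φ x) U :=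
    ((hφ.integrable_mul (hDj j)).add (hφ.integrable_mul_partialDeriv (hβj j) j)).integrableOn
  simp only [e]
  rw [integral_finsetSum _ fun j _ => hint j]
  exact Finset.sum_eq_zero fun j _ => key j

namespace IsStarPolygon

variable {ι : Type*} {T : Set Plane} {E : Finset ι} {a b n : ι → Plane} {z : Plane} {r : ℝ}

/-- The divergence theorem for `χ β`, where `β` is `C¹` up to the boundary. -/
theorem integral_divergence_mul (hT : IsStarPolygon T E a b n z r) {β : Plane → Plane}
    {D : Plane → (Plane →L[ℝ] Plane)} (hβ : Continuous β) (hD : Continuous D)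
    (h : ∀ x ∈ interior T, HasFDerivAt β (D x) x) {χ : Plane → ℝ} (hχ : ContDiff ℝ 1 χ) :
    ∫ x in T, (traceField D x * χ x + fderiv ℝ χ x (β x))
      = ∑ e ∈ E, dist (a e) (b e) * edgeAvg a b (fun x => inner ℝ (n e) (β x) * χ x) e := by
  have hχc := hχ.continuous
  have hβj (j : Fin 2) : Continuous fun x => β x j := by fun_prop
  have hDj (i j : Fin 2) : Continuous fun x => (D x (EuclideanSpace.single i 1)) j := by fun_prop
  have hp (i) := continuous_partialDeriv hχ i
  have hgr (j : Fin 2) : HasL2Gradient T (fun x => β x j * χ x) (fun x => WithLp.toLp 2 fun i =>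
      (D x (EuclideanSpace.single i 1)) j * χ x + β x j * partialDeriv i χ x) :=
    ⟨hT.memLp_of_continuous ((hβj j).mul hχc), fun i => hT.memLp_of_continuous
      (((hDj i j).mul hχc).add ((hβj j).mul (hp i))), isWeakGradient_field_mul hβ hD h hχ j⟩
  have key (j : Fin 2) := hT.integral_grad_eq (hgr j) ((hβj j).mul hχc) j
  simp only [edgeProfile_one, fluxWeight, inner_single_one] at key
  have e (x : Plane) : traceField D x * χ x + fderiv ℝ χ x (β x)
      = ∑ j, ((D x (EuclideanSpace.single j 1)) j * χ x + β x j * partialDeriv j χ x) := by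
    rw [Finset.sum_add_distrib, ← Finset.sum_mul, fderiv_apply_eq_sum]
    rfl
  have hint (j : Fin 2) : IntegrableOn (fun x => (D x (EuclideanSpace.single j 1)) j * χ x
      + β x j * partialDeriv j χ x) T :=
    hT.integrableOn (((hDj j j).mul hχc).add ((hβj j).mul (hp j)))
  simp only [e]
  rw [integral_finsetSum _ fun j _ => hint j, Finset.sum_congr rfl fun j _ => key j,
    Finset.sum_comm]
  refine Finset.sum_congr rfl fun e _ => ?_
  simp only [mul_assoc]
  rw [← Finset.mul_sum]
  congr 1
  simp only [← edgeAvg_const_mul]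
  rw [Fin.sum_univ_two, ← intervalIntegral.integral_add
    ((continuous_comp_lineMap (f := fun x => n e 0 * (β x 0 * χ x)) (by fun_prop) _
      _).intervalIntegrable _ _)
    ((continuous_comp_lineMap (f := fun x => n e 1 * (β x 1 * χ x)) (by fun_prop) _
      _).intervalIntegrable _ _)]
  congr 1
  funext t
  beta_reduce
  rw [PiLp.inner_apply, Fin.sum_univ_two]
  simp only [RCLike.inner_apply, conj_trivial]
  ring

/-- A field with bounded derivative varies little over a star polygon. -/
theorem norm_field_sub_le (hT : IsStarPolygon T E a b n z r) {d : ℝ}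
    (hd : ∀ x ∈ T, ∀ y ∈ T, ‖x - y‖ ≤ d) {β : Plane → Plane}
    {D : Plane → (Plane →L[ℝ] Plane)} (hβ : Continuous β)
    (h : ∀ x ∈ interior T, HasFDerivAt β (D x) x) {L : ℝ} (hL : ∀ x ∈ T, ‖D x‖ ≤ L)
    {x : Plane} (hx : x ∈ T) : ‖β x - β z‖ ≤ L * d := by
  have hL0 : 0 ≤ L := (norm_nonneg _).trans (hL x hx)
  have hderiv : ∀ t ∈ Ico (0 : ℝ) 1, HasDerivWithinAt (fun t : ℝ => β (z + t • (x - z)))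
      (D (z + t • (x - z)) (x - z)) (Ici t) t := by
    intro t ht
    have h1 : HasDerivAt (fun t : ℝ => z + t • (x - z)) (x - z) t := by
      simpa using ((hasDerivAt_id t).smul_const (x - z)).const_add z
    exact ((h _ (hT.shrink_mem_interior hx ht.1 ht.2)).comp_hasDerivAt t h1).hasDerivWithinAt
  have := norm_image_sub_le_of_norm_deriv_right_le_segment (C := L * d)
    (f := fun t : ℝ => β (z + t • (x - z))) (a := 0) (b := 1)
    (hβ.comp (by fun_prop)).continuousOn hderiv (fun t ht => by
      refine (ContinuousLinearMap.le_opNorm _ _).trans (mul_le_mul (hL _ ?_)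
        (hd x hx z hT.center_mem) (norm_nonneg _) hL0)
      exact interior_subset (hT.shrink_mem_interior hx ht.1 ht.2)) 1 (by simp)
  simpa using this

section diameter

variable {ρ d : ℝ}

theorem affine_sq_le (hT : IsStarPolygon T E a b n z r)
    (hd : ∀ x ∈ T, ∀ y ∈ T, ‖x - y‖ ≤ d) (s : Plane →ᵃ[ℝ] ℝ) {x : Plane} (hx : x ∈ T) :
    volume.real T * s x ^ 2
      ≤ 2 * (∫ y in T, s y ^ 2) + 2 * (d ^ 2 * (volume.real T * ‖affineGrad s‖ ^ 2)) := by
  have hc := continuous_affine s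
  have h1 : ∫ y in T, s x ^ 2 ≤ ∫ y in T, (2 * s y ^ 2 + 2 * (d ^ 2 * ‖affineGrad s‖ ^ 2)) := by
    refine setIntegral_mono_on (hT.integrableOn continuous_const)
      (hT.integrableOn (by fun_prop)) hT.measurableSet fun y hy => ?_
    have h4 := abs_affine_sub_le hd s hx hy
    have h5 := sq_le_sq' (by linarith [neg_abs_le (s x - s y)]) ((le_abs_self _).trans h4)
    nlinarith [sq_nonneg ((s x - s y) - s y)]
  rw [integral_add (hT.integrableOn (by fun_prop)) (hT.integrableOn continuous_const),
    integral_const_mul, setIntegral_const, setIntegral_const, smul_eq_mul, smul_eq_mul] at h1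
  linarith

/-- The interior remainder in the discrete integration by parts: the convection term tested with
`w`, from which its value at the centre `z` is subtracted. -/
noncomputable def _root_.interiorRemainder (β : Plane → Plane) (s : Plane →ᵃ[ℝ] ℝ) (z w x : Plane) :
    ℝ := inner ℝ (β x) w * s x - s z * inner ℝ (β z) w

/-- The remainder on an edge with normal `n` and value `v` in the discrete integration by parts. -/
noncomputable def _root_.edgeRemainder (β : Plane → Plane) (s : Plane →ᵃ[ℝ] ℝ) (z n : Plane) (v : ℝ)
    (x : Plane) : ℝ :=
  1 / 2 * (inner ℝ n (β x) * (s x ^ 2 - v ^ 2)) - s z * inner ℝ n (β z) * (s x - v)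

theorem _root_.continuous_interiorRemainder {β : Plane → Plane} (hβ : Continuous β)
    (s : Plane →ᵃ[ℝ] ℝ) (z w : Plane) : Continuous (interiorRemainder β s z w) := by
  have := continuous_affine s
  unfold interiorRemainder
  fun_prop

theorem _root_.continuous_edgeRemainder {β : Plane → Plane} (hβ : Continuous β)
    (s : Plane →ᵃ[ℝ] ℝ) (z n : Plane) (v : ℝ) : Continuous (edgeRemainder β s z n v) := by
  have := continuous_affine s
  unfold edgeRemainder
  fun_prop

theorem integral_interiorRemainder (hT : IsStarPolygon T E a b n z r) {β : Plane → Plane}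
    (hβ : Continuous β) (s : Plane →ᵃ[ℝ] ℝ) (g : Plane) :
    ∫ x in T, interiorRemainder β s z (g - affineGrad s) x = (∫ x in T, inner ℝ (β x) g * s x)
        - (1 / 2) * (∫ x in T, 2 * s x * inner ℝ (affineGrad s) (β x))
        - s z * (volume.real T * inner ℝ (β z) (g - affineGrad s)) := by
  have hsc := continuous_affine s
  have : interiorRemainder β s z (g - affineGrad s) = fun x => (inner ℝ (β x) g * s x
      - (1 / 2) * (2 * s x * inner ℝ (affineGrad s) (β x)))
        - s z * inner ℝ (β z) (g - affineGrad s) := by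
    funext x
    simp only [interiorRemainder, inner_sub_right, real_inner_comm (affineGrad s) (β x)]
    ring
  rw [this, integral_sub (hT.integrableOn (by fun_prop)) (hT.integrableOn continuous_const),
    integral_sub (hT.integrableOn (by fun_prop)) (hT.integrableOn (by fun_prop)),
    integral_const_mul, setIntegral_const, smul_eq_mul]
  ring

theorem _root_.edgeAvg_edgeRemainder {β : Plane → Plane} (hβ : Continuous β) (s : Plane →ᵃ[ℝ] ℝ)
    (z n : Plane) (v : ℝ) (e : ι) :
    edgeAvg a b (edgeRemainder β s z n v) e
      = 1 / 2 * edgeAvg a b (fun x => inner ℝ n (β x) * s x ^ 2) e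
        - 1 / 2 * (v ^ 2 * edgeAvg a b (fun x => inner ℝ n (β x)) e)
        - s z * (inner ℝ n (β z) * (s (midpoint ℝ (a e) (b e)) - v)) := by
  have hsc := continuous_affine s
  have : edgeRemainder β s z n v = fun x => (1 / 2 * (inner ℝ n (β x) * s x ^ 2)
      - (1 / 2 * v ^ 2) * inner ℝ n (β x)) - (s z * inner ℝ n (β z)) * (s x - v) := by
    funext x
    unfold edgeRemainder
    ring
  rw [this, edgeAvg_sub (by fun_prop) (by fun_prop), edgeAvg_sub (by fun_prop) (by fun_prop),
    edgeAvg_const_mul, edgeAvg_const_mul, edgeAvg_const_mul,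
    edgeAvg_sub hsc continuous_const, edgeAvg_const, edgeAvg_affine]
  ring

/-- Discrete integration by parts on one element. Subtracting the values of `β` and `s` at the
centre changes neither side, since the corresponding terms cancel. -/
theorem convection_eq_remainder (hT : IsStarPolygon T E a b n z r) {β : Plane → Plane}
    {D : Plane → (Plane →L[ℝ] Plane)} (hβ : Continuous β) (hD : Continuous D)
    (h : ∀ x ∈ interior T, HasFDerivAt β (D x) x) {v : ι → ℝ} {g : Plane}
    (hg : volume.real T • g = ∑ e ∈ E, (v e * dist (a e) (b e)) • n e) (s : Plane →ᵃ[ℝ] ℝ) :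
    (∫ x in T, inner ℝ (β x) g * s x) + 1 / 2 * (∫ x in T, traceField D x * s x ^ 2)
      - 1 / 2 * ∑ e ∈ E, dist (a e) (b e) *
        (v e ^ 2 * edgeAvg a b (fun x => inner ℝ (n e) (β x)) e)
    = (∫ x in T, interiorRemainder β s z (g - affineGrad s) x)
      + ∑ e ∈ E, dist (a e) (b e) * edgeAvg a b (edgeRemainder β s z (n e) (v e)) e := by
  have hsc := continuous_affine s
  have hs1 : ContDiff ℝ 1 s := (contDiff_affine s).of_le (by exact_mod_cast le_top)
  have hdiv := hT.integral_divergence_mul hβ hD h (χ := fun x => s x ^ 2) (hs1.pow 2)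
  have hfd (x v : Plane) :
      fderiv ℝ (fun x => s x ^ 2) x v = 2 * s x * inner ℝ (affineGrad s) v := by
    have := (((hs1.differentiable one_ne_zero) x).hasFDerivAt.pow 2).fderiv
    rw [this]
    simp [fderiv_affine]
  simp only [hfd] at hdiv
  have htr := continuous_traceField hD
  rw [integral_add (hT.integrableOn (by fun_prop)) (hT.integrableOn (by fun_prop))] at hdiv
  have e2 : volume.real T * inner ℝ (β z) (g - affineGrad s) = - ∑ e ∈ E, dist (a e) (b e) *
      (inner ℝ (n e) (β z) * (s (midpoint ℝ (a e) (b e)) - v e)) := by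
    rw [← inner_smul_right, smul_sub, hg, hT.volume_smul_affineGrad, ← Finset.sum_sub_distrib,
      inner_sum, ← Finset.sum_neg_distrib]
    refine Finset.sum_congr rfl fun e _ => ?_
    rw [← sub_smul, inner_smul_right, real_inner_comm (n e) (β z)]
    ring
  have e4 : ∑ e ∈ E, dist (a e) (b e) * edgeAvg a b (edgeRemainder β s z (n e) (v e)) e
      = 1 / 2 * (∑ e ∈ E, dist (a e) (b e)
          * edgeAvg a b (fun x => inner ℝ (n e) (β x) * s x ^ 2) e)
        - 1 / 2 * (∑ e ∈ E, dist (a e) (b e)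
          * (v e ^ 2 * edgeAvg a b (fun x => inner ℝ (n e) (β x)) e))
        - s z * ∑ e ∈ E, dist (a e) (b e) *
          (inner ℝ (n e) (β z) * (s (midpoint ℝ (a e) (b e)) - v e)) := by
    rw [Finset.mul_sum, Finset.mul_sum, Finset.mul_sum, ← Finset.sum_sub_distrib,
      ← Finset.sum_sub_distrib]
    refine Finset.sum_congr rfl fun e _ => ?_
    rw [edgeAvg_edgeRemainder hβ]
    ring
  rw [e4, hT.integral_interiorRemainder hβ, e2, ← hdiv]
  ring

/-- The interior remainder is of higher order, since both the field and `s` vary by `O(d)` over the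
element. -/
theorem abs_integral_interiorRemainder_le (hT : IsStarPolygon T E a b n z r) (hd0 : 0 ≤ d)
    (hd : ∀ x ∈ T, ∀ y ∈ T, ‖x - y‖ ≤ d) {β : Plane → Plane} (hβ : Continuous β) {L B : ℝ}
    (hL : 0 ≤ L) (hB : ‖β z‖ ≤ B) (hvar : ∀ x ∈ T, ‖β x - β z‖ ≤ L * d) (s : Plane →ᵃ[ℝ] ℝ)
    (w : Plane) :
    |∫ x in T, interiorRemainder β s z w x|
      ≤ (L + B) * (d * (volume.real T * ‖w‖ ^ 2) + d * (∫ x in T, s x ^ 2)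
        + d * (volume.real T * ‖affineGrad s‖ ^ 2)) := by
  have hzT := hT.center_mem
  have hB0 : 0 ≤ B := (norm_nonneg _).trans hB
  have hsc := continuous_affine s
  have hpt : ∀ x ∈ T, |interiorRemainder β s z w x|
      ≤ (L + B) * d * (‖w‖ ^ 2 + s x ^ 2 + ‖affineGrad s‖ ^ 2) := by
    intro x hx
    have e1 : interiorRemainder β s z w x
        = inner ℝ (β x - β z) w * s x + inner ℝ (β z) w * (s x - s z) := by
      rw [interiorRemainder, inner_sub_left]; ring
    have h1 : |inner ℝ (β x - β z) w| ≤ L * d * ‖w‖ :=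
      (abs_real_inner_le_norm _ _).trans (mul_le_mul_of_nonneg_right (hvar x hx) (norm_nonneg _))
    have h2 : |inner ℝ (β z) w| ≤ B * ‖w‖ :=
      (abs_real_inner_le_norm _ _).trans (mul_le_mul_of_nonneg_right hB (norm_nonneg _))
    have h3 := abs_affine_sub_le hd s hx hzT
    have hw0 := norm_nonneg w
    have hσ0 := norm_nonneg (affineGrad s)
    calc |interiorRemainder β s z w x|
        ≤ |inner ℝ (β x - β z) w| * |s x| + |inner ℝ (β z) w| * |s x - s z| := by
          rw [e1, ← abs_mul, ← abs_mul]; exact abs_add_le _ _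
      _ ≤ L * d * ‖w‖ * |s x| + B * ‖w‖ * (‖affineGrad s‖ * d) := by gcongr
      _ ≤ (L + B) * d * (‖w‖ ^ 2 + s x ^ 2 + ‖affineGrad s‖ ^ 2) := by
          have h5 : ‖w‖ * |s x| ≤ ‖w‖ ^ 2 + s x ^ 2 + ‖affineGrad s‖ ^ 2 := by
            nlinarith [sq_nonneg (‖w‖ - |s x|), sq_abs (s x), sq_nonneg ‖w‖]
          have h6 : ‖w‖ * ‖affineGrad s‖ ≤ ‖w‖ ^ 2 + s x ^ 2 + ‖affineGrad s‖ ^ 2 := by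
            nlinarith [sq_nonneg (‖w‖ - ‖affineGrad s‖), sq_nonneg (s x), sq_nonneg ‖w‖]
          have h7 := mul_le_mul_of_nonneg_left h5 (mul_nonneg hL hd0)
          have h8 := mul_le_mul_of_nonneg_left h6 (mul_nonneg hB0 hd0)
          linarith
  refine (abs_integral_le_integral_abs).trans ((setIntegral_mono_on
    (hT.integrableOn (continuous_interiorRemainder hβ s z w).abs)
    (hT.integrableOn (by fun_prop)) hT.measurableSet hpt).trans ?_)
  rw [integral_const_mul, integral_add (hT.integrableOn (by fun_prop))
    (hT.integrableOn continuous_const), integral_add (hT.integrableOn continuous_const)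
    (hT.integrableOn (by fun_prop)), setIntegral_const, setIntegral_const, smul_eq_mul,
    smul_eq_mul]
  exact (by ring : _ = _).le

/-- The pointwise bound of the remainder on an edge: `q₁` and `q₂` stand for the normal components
of `β(x) - β(z)` and `β(z)`, `x` and `x₀` for the values of `s` at a point of the edge and
at `z`. -/
theorem _root_.abs_remainder_combination_le {L B d q₁ q₂ x₀ x v Y S₀ : ℝ} (hL : 0 ≤ L) (hd0 : 0 < d)
    (hd1 : d ≤ 1) (h1 : |q₁| ≤ L * d) (h2 : |q₂| ≤ B) (hY : (x - x₀) ^ 2 ≤ Y) (hS : x ^ 2 ≤ S₀) :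
    |q₁ * (1 / 2 * (x ^ 2 - v ^ 2)) + q₂ * ((x - v) * (x - x₀) - 1 / 2 * (x - v) ^ 2)|
      ≤ (L + B) * ((x - v) ^ 2 + (1 / 2 * (d ^ 2 * S₀) + 1 / 2 * Y)) := by
  have hB0 : 0 ≤ B := (abs_nonneg _).trans h2
  have hS00 : 0 ≤ S₀ := (sq_nonneg _).trans hS
  have hY0 : 0 ≤ Y := (sq_nonneg _).trans hY
  have h5 : d * |1 / 2 * (x ^ 2 - v ^ 2)| ≤ (x - v) ^ 2 + 1 / 2 * (d ^ 2 * S₀) := by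
    have h6 : |1 / 2 * (x ^ 2 - v ^ 2)| ≤ |x| * |x - v| + 1 / 2 * (x - v) ^ 2 := by
      have : 1 / 2 * (x ^ 2 - v ^ 2) = x * (x - v) - 1 / 2 * (x - v) ^ 2 := by ring
      rw [this, ← abs_mul]
      refine (abs_sub _ _).trans (add_le_add le_rfl ?_)
      rw [abs_of_nonneg (by positivity)]
    have h7 := mul_le_mul_of_nonneg_left h6 hd0.le
    have h8 : d * (|x| * |x - v|) ≤ 1 / 2 * (x - v) ^ 2 + 1 / 2 * (d ^ 2 * x ^ 2) := by
      nlinarith [sq_nonneg (d * |x| - |x - v|), sq_abs x, sq_abs (x - v)]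
    have h9 : d ^ 2 * x ^ 2 ≤ d ^ 2 * S₀ := mul_le_mul_of_nonneg_left hS (sq_nonneg d)
    have h10 : d * (1 / 2 * (x - v) ^ 2) ≤ 1 / 2 * (x - v) ^ 2 :=
      mul_le_of_le_one_left (by positivity) hd1
    linarith
  have h6 : |(x - v) * (x - x₀) - 1 / 2 * (x - v) ^ 2| ≤ (x - v) ^ 2 + 1 / 2 * Y := by
    rw [abs_le]
    constructor <;> nlinarith [sq_nonneg ((x - v) - (x - x₀)),
      sq_nonneg ((x - v) + (x - x₀)), sq_nonneg (x - v)]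
  calc _ ≤ |q₁| * |1 / 2 * (x ^ 2 - v ^ 2)|
        + |q₂| * |(x - v) * (x - x₀) - 1 / 2 * (x - v) ^ 2| := by
        rw [← abs_mul, ← abs_mul]; exact abs_add_le _ _
    _ ≤ L * d * |1 / 2 * (x ^ 2 - v ^ 2)| + B * ((x - v) ^ 2 + 1 / 2 * Y) := by gcongr
    _ ≤ L * ((x - v) ^ 2 + 1 / 2 * (d ^ 2 * S₀)) + B * ((x - v) ^ 2 + 1 / 2 * Y) := by
        rw [mul_assoc]; gcongr
    _ ≤ _ := by
        have h11 : 0 ≤ L * (1 / 2 * Y) := by positivity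
        have h12 : 0 ≤ B * (1 / 2 * (d ^ 2 * S₀)) := by positivity
        linarith

/-- The edge remainders are of higher order, up to the deviation of `s` from the edge values. -/
theorem abs_sum_edgeRemainder_le (hT : IsStarPolygon T E a b n z r) (hd0 : 0 < d)
    (hd : ∀ x ∈ T, ∀ y ∈ T, ‖x - y‖ ≤ d) (hd1 : d ≤ 1) {β : Plane → Plane} (hβ : Continuous β)
    {L B : ℝ} (hL : 0 ≤ L) (hB : ‖β z‖ ≤ B) (hvar : ∀ x ∈ T, ‖β x - β z‖ ≤ L * d)
    (s : Plane →ᵃ[ℝ] ℝ) (v : ι → ℝ) {S₀ : ℝ} (hS : ∀ x ∈ T, s x ^ 2 ≤ S₀) :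
    |∑ e ∈ E, dist (a e) (b e) * edgeAvg a b (edgeRemainder β s z (n e) (v e)) e|
      ≤ (L + B) * ((∑ e ∈ E, dist (a e) (b e) * edgeAvg a b (fun x => (s x - v e) ^ 2) e)
        + (∑ e ∈ E, dist (a e) (b e))
          * (1 / 2 * (d ^ 2 * S₀) + 1 / 2 * (d ^ 2 * ‖affineGrad s‖ ^ 2))) := by
  have hzT := hT.center_mem
  have hsc := continuous_affine s
  rw [Finset.sum_mul, ← Finset.sum_add_distrib, Finset.mul_sum]
  refine (Finset.abs_sum_le_sum_abs _ _).trans (Finset.sum_le_sum fun e he => ?_)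
  have hpt : ∀ x ∈ T, |edgeRemainder β s z (n e) (v e) x|
      ≤ (L + B) * ((s x - v e) ^ 2
        + (1 / 2 * (d ^ 2 * S₀) + 1 / 2 * (d ^ 2 * ‖affineGrad s‖ ^ 2))) := by
    intro x hx
    have e1 : edgeRemainder β s z (n e) (v e) x
        = inner ℝ (n e) (β x - β z) * (1 / 2 * (s x ^ 2 - v e ^ 2))
          + inner ℝ (n e) (β z) * ((s x - v e) * (s x - s z) - 1 / 2 * (s x - v e) ^ 2) := by
      rw [edgeRemainder, inner_sub_right]; ring
    have hn1 := hT.norm_normal e he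
    have h1 : |inner ℝ (n e) (β x - β z)| ≤ L * d := by
      refine (abs_real_inner_le_norm _ _).trans ?_
      rw [hn1, one_mul]; exact hvar x hx
    have h2 : |inner ℝ (n e) (β z)| ≤ B := by
      refine (abs_real_inner_le_norm _ _).trans ?_
      rw [hn1, one_mul]; exact hB
    have h3 := abs_affine_sub_le hd s hx hzT
    have h3' : (s x - s z) ^ 2 ≤ d ^ 2 * ‖affineGrad s‖ ^ 2 := by
      have := sq_le_sq' (by linarith [neg_abs_le (s x - s z)]) ((le_abs_self _).trans h3)
      rw [mul_pow] at this
      linarith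
    rw [e1]
    exact abs_remainder_combination_le hL hd0 hd1 h1 h2 h3' (hS x hx)
  have hc := continuous_edgeRemainder hβ s z (n e) (v e)
  have havg : |edgeAvg a b (edgeRemainder β s z (n e) (v e)) e|
      ≤ (L + B) * (edgeAvg a b (fun x => (s x - v e) ^ 2) e
        + (1 / 2 * (d ^ 2 * S₀) + 1 / 2 * (d ^ 2 * ‖affineGrad s‖ ^ 2))) := by
    rw [← edgeAvg_const (a := a) (b := b)
      (1 / 2 * (d ^ 2 * S₀) + 1 / 2 * (d ^ 2 * ‖affineGrad s‖ ^ 2)) e,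
      ← edgeAvg_add (by fun_prop) continuous_const, ← edgeAvg_const_mul]
    refine (intervalIntegral.abs_integral_le_integral_abs zero_le_one).trans ?_
    exact edgeAvg_mono (f := fun x => |edgeRemainder β s z (n e) (v e) x|) hc.abs (by fun_prop)
      fun t ht => hpt _ (hT.lineMap_mem he ht)
  rw [abs_mul, abs_of_nonneg dist_nonneg]
  refine (mul_le_mul_of_nonneg_left havg dist_nonneg).trans_eq ?_
  ring

/-- The convection term against the linear extension equals half of the boundary
term minus half of the divergence term, up to a perturbation of higher order. -/
theorem abs_convection_sub_le (hT : IsStarPolygon T E a b n z (ρ * d)) (hρ : 0 < ρ)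
    (hd : ∀ x ∈ T, ∀ y ∈ T, ‖x - y‖ ≤ d) (hd1 : d ≤ 1) {β : Plane → Plane}
    {D : Plane → (Plane →L[ℝ] Plane)} (hβ : Continuous β) (hD : Continuous D)
    (h : ∀ x ∈ interior T, HasFDerivAt β (D x) x) {L B : ℝ} (hL : ∀ x ∈ T, ‖D x‖ ≤ L)
    (hB : ∀ x ∈ T, ‖β x‖ ≤ B) {v : ι → ℝ} {g : Plane}
    (hg : volume.real T • g = ∑ e ∈ E, (v e * dist (a e) (b e)) • n e) (s : Plane →ᵃ[ℝ] ℝ) :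
    |(∫ x in T, inner ℝ (β x) g * s x) + 1 / 2 * (∫ x in T, traceField D x * s x ^ 2)
      - 1 / 2 * ∑ e ∈ E, dist (a e) (b e) *
        (v e ^ 2 * edgeAvg a b (fun x => inner ℝ (n e) (β x)) e)|
    ≤ (L + B) * ((1 + 3 / ρ) * (4 + 6 / ρ + 4 / ρ * (2 + 4 / ρ))) *
      ((∑ e ∈ E, (s (midpoint ℝ (a e) (b e)) - v e) ^ 2 * dist (a e) (b e))
        + d * (volume.real T * ‖g‖ ^ 2) + d * ∫ x in T, s x ^ 2) := by
  have hd0 := hT.diam_pos hρ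
  have hV := hT.volume_pos
  have hzT := hT.center_mem
  have hL0 : 0 ≤ L := (norm_nonneg _).trans (hL z hzT)
  have hB0 : 0 ≤ B := (norm_nonneg _).trans (hB z hzT)
  have hA := hT.norm_affineGrad_sq_le hρ hg s
  have hW := hT.norm_affineGrad_sub_sq_le hρ hg s
  rw [norm_sub_rev] at hW
  have hQ := hT.sum_edgeAvg_sub_sq_le hρ hd hg s
  have hP := hT.mul_perimeter_le
  have hvar : ∀ x ∈ T, ‖β x - β z‖ ≤ L * d := fun x hx => hT.norm_field_sub_le hd hβ h hL hx
  rw [hT.convection_eq_remainder hβ hD h hg s]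
  have hin := hT.abs_integral_interiorRemainder_le hd0.le hd hβ hL0 (hB z hzT) hvar s
    (g - affineGrad s)
  set N := ∫ x in T, s x ^ 2 with hN
  set V := volume.real T with hVd
  set S0 := V⁻¹ * (2 * N + 2 * (d ^ 2 * (V * ‖affineGrad s‖ ^ 2))) with hS0
  have hVS : V * S0 = 2 * N + 2 * (d ^ 2 * (V * ‖affineGrad s‖ ^ 2)) := by
    rw [hS0, ← mul_assoc, mul_inv_cancel₀ hV.ne', one_mul]
  have hed := hT.abs_sum_edgeRemainder_le hd0 hd hd1 hβ hL0 (hB z hzT) hvar s v (S₀ := S0)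
    fun x hx => le_of_mul_le_mul_left ((hT.affine_sq_le hd s hx).trans_eq hVS.symm) hV
  refine (abs_add_le _ _).trans ((add_le_add hin hed).trans ?_)
  have hJ : 0 ≤ ∑ e ∈ E, (s (midpoint ℝ (a e) (b e)) - v e) ^ 2 * dist (a e) (b e) :=
    Finset.sum_nonneg fun e _ => mul_nonneg (sq_nonneg _) dist_nonneg
  have hN0 : 0 ≤ N := integral_nonneg fun _ => sq_nonneg _
  have hP0 : 0 ≤ ∑ e ∈ E, dist (a e) (b e) := Finset.sum_nonneg fun _ _ => dist_nonneg
  have hQ0 : 0 ≤ ∑ e ∈ E, dist (a e) (b e) * edgeAvg a b (fun x => (s x - v e) ^ 2) e :=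
    Finset.sum_nonneg fun e _ => mul_nonneg dist_nonneg (edgeAvg_nonneg (fun _ => sq_nonneg _) e)
  generalize (∑ e ∈ E, (s (midpoint ℝ (a e) (b e)) - v e) ^ 2 * dist (a e) (b e)) = J at *
  generalize (∑ e ∈ E, dist (a e) (b e) * edgeAvg a b (fun x => (s x - v e) ^ 2) e) = Q at *
  generalize (∑ e ∈ E, dist (a e) (b e)) = P at *
  generalize ‖g - affineGrad s‖ = w at *
  generalize ‖affineGrad s‖ = σ at *
  generalize ‖g‖ = γ at *
  clear hin hed hvar
  have hS00 : 0 ≤ S0 := by rw [hS0]; positivity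
  clear_value N V S0
  -- collecting the constants
  set A := d * (V * σ ^ 2) with hAd
  set X := J + d * (V * γ ^ 2) with hX
  have hA0 : 0 ≤ A := by positivity
  have hX0 : 0 ≤ X := by positivity
  have hρi : 0 < 1 / ρ := by positivity
  have hPS : P * (1 / 2 * (d ^ 2 * S0)) ≤ 2 / ρ * (d * N + A) := by
    rw [div_mul_eq_mul_div 2 ρ, le_div_iff₀ hρ]
    have h1 := mul_le_mul_of_nonneg_right hP (mul_nonneg hd0.le hS00)
    have h2 : 2 * V * (d * S0) = 4 * (d * N) + 4 * (d ^ 2 * A) := by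
      rw [hAd]; linear_combination (2 * d) * hVS
    have h3 : d ^ 2 * A ≤ A := mul_le_of_le_one_left hA0 (pow_le_one₀ hd0.le hd1)
    linarith
  have hPσ : P * (1 / 2 * (d ^ 2 * σ ^ 2)) ≤ 1 / ρ * A := by
    rw [div_mul_eq_mul_div 1 ρ, le_div_iff₀ hρ, hAd]
    have h1 := mul_le_mul_of_nonneg_right hP (mul_nonneg hd0.le (sq_nonneg σ))
    linarith
  have hJX : J ≤ X := by rw [hX]; linarith [show 0 ≤ d * (V * γ ^ 2) by positivity]
  have hWX : d * (V * w ^ 2) ≤ 2 / ρ * X := hW.trans (by gcongr)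
  have hdN : 0 ≤ d * N := by positivity
  have hLB : 0 ≤ L + B := by positivity
  have hW0 : 0 ≤ d * (V * w ^ 2) := by positivity
  have hfin : d * (V * w ^ 2) + d * N + A
        + (Q + P * (1 / 2 * (d ^ 2 * S0) + 1 / 2 * (d ^ 2 * σ ^ 2)))
      ≤ (1 + 3 / ρ) * (d * (V * w ^ 2) + Q + A + d * N) := by
    have e1 : (1 + 3 / ρ) * (d * (V * w ^ 2) + Q + A + d * N)
      = (d * (V * w ^ 2) + Q + A + d * N) + 3 * (1 / ρ * (d * (V * w ^ 2)))
        + 3 * (1 / ρ * Q) + 3 * (1 / ρ * A) + 3 * (1 / ρ * (d * N)) := by ring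
    have e2 : 2 / ρ * (d * N + A) = 2 * (1 / ρ * (d * N)) + 2 * (1 / ρ * A) := by ring
    have p1 := mul_nonneg hρi.le hW0
    have p2 := mul_nonneg hρi.le hQ0
    have p3 := mul_nonneg hρi.le hdN
    rw [e1, mul_add]
    linarith
  have hsum : d * (V * w ^ 2) + Q + A + d * N
      ≤ (4 + 6 / ρ + 4 / ρ * (2 + 4 / ρ)) * (X + d * N) := by
    have h1 : d * N ≤ (4 + 6 / ρ + 4 / ρ * (2 + 4 / ρ)) * (d * N) := by
      refine le_mul_of_one_le_left hdN ?_
      have : 0 ≤ 6 / ρ + 4 / ρ * (2 + 4 / ρ) := by positivity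
      linarith
    have e1 : (4 + 6 / ρ + 4 / ρ * (2 + 4 / ρ)) * (X + d * N)
      = 2 / ρ * X + (2 + 4 / ρ * (2 + 4 / ρ)) * X + (2 + 4 / ρ) * X
        + (4 + 6 / ρ + 4 / ρ * (2 + 4 / ρ)) * (d * N) := by ring
    rw [e1]
    linarith
  calc _ = (L + B) * (d * (V * w ^ 2) + d * N + A
        + (Q + P * (1 / 2 * (d ^ 2 * S0) + 1 / 2 * (d ^ 2 * σ ^ 2)))) := by ring
    _ ≤ (L + B) * ((1 + 3 / ρ) * ((4 + 6 / ρ + 4 / ρ * (2 + 4 / ρ)) * (X + d * N))) := by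
        gcongr
        exact hfin.trans (by gcongr)
    _ = _ := by ring

end diameter

end IsStarPolygon

/-! ### Flux of fields that are small near the boundary -/

theorem sum_mul_eq_inner (v w : Plane) : ∑ j, v j * w j = inner ℝ v w := by
  rw [PiLp.inner_apply]
  exact Finset.sum_congr rfl fun j _ => by simp [mul_comm]

theorem sum_mul_partialDeriv (v : Plane) (φ : Plane → ℝ) (x : Plane) :
    ∑ j, v j * partialDeriv j φ x = inner ℝ v (gradient φ x) := by
  rw [← sum_mul_eq_inner]
  simp only [gradient_apply]

namespace IsStarPolygon

variable {ι : Type*} {T : Set Plane} {E : Finset ι} {a b n : ι → Plane} {z : Plane} {r : ℝ}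

/-- Integrability of products of square integrable functions with continuous ones. -/
theorem integrableOn_mul_of_memLp (hT : IsStarPolygon T E a b n z r) {f g : Plane → ℝ}
    (hf : MemLp f 2 (volume.restrict T)) (hg : Continuous g) :
    IntegrableOn (fun x => f x * g x) T :=
  hT.integrableOn_mul_continuous (hT.integrableOn_of_memLp hf) hg

theorem memLp_mul_continuous (hT : IsStarPolygon T E a b n z r) {f g : Plane → ℝ}
    (hf : MemLp f 2 (volume.restrict T)) (hg : Continuous g) :
    MemLp (fun x => f x * g x) 2 (volume.restrict T) := by
  obtain ⟨C, hC⟩ := hT.isCompact.exists_bound_of_continuousOn hg.continuousOn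
  refine MemLp.of_le_mul (c := C) hf (hf.aestronglyMeasurable.mul hg.aestronglyMeasurable) ?_
  filter_upwards [ae_restrict_mem hT.measurableSet] with x hx
  rw [norm_mul, mul_comm]
  exact mul_le_mul_of_nonneg_right (hC x hx) (norm_nonneg _)

/-- The product rule for a field with weak divergence `R` and a smooth function. -/
theorem isWeakDivergence_mul (hT : IsStarPolygon T E a b n z r) {k : Fin 2 → Plane → ℝ}
    {R : Plane → ℝ} (hk : ∀ j, MemLp (k j) 2 (volume.restrict T))
    (hR : MemLp R 2 (volume.restrict T)) (hdiv : IsWeakDivergence (interior T) k R)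
    {w : Plane → ℝ} (hw : ContDiff ℝ ∞ w) :
    IsWeakDivergence (interior T) (fun j x => k j x * w x)
      (fun x => (∑ j, k j x * partialDeriv j w x) + R x * w x) := by
  intro φ hφ
  have hw1 : ContDiff ℝ 1 w := hw.of_le (by exact_mod_cast le_top)
  have hwφ : IsTestFunction (interior T) fun x => w x * φ x :=
    ⟨hw.mul hφ.smooth, hφ.compact.mul_left,
      (tsupport_mul_subset_right (f := w)).trans hφ.support⟩
  have h := hdiv _ hwφ
  have hp (j) := continuous_partialDeriv hw1 j
  have hpφ (j) := continuous_partialDeriv_of_isTestFunction hφ j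
  have hφc := hφ.smooth.continuous
  have hwc := hw1.continuous
  have e (x : Plane) : ∑ j, k j x * partialDeriv j (fun x => w x * φ x) x
      = (∑ j, k j x * (partialDeriv j w x * φ x)) + ∑ j, k j x * w x * partialDeriv j φ x := by
    rw [← Finset.sum_add_distrib]
    refine Finset.sum_congr rfl fun j _ => ?_
    rw [partialDeriv_mul (hw1.differentiable one_ne_zero x)
      (hφ.contDiff_one.differentiable one_ne_zero x)]
    ring
  have i1 : IntegrableOn (fun x => ∑ j, k j x * (partialDeriv j w x * φ x)) T :=
    integrable_finsetSum _ fun j _ => hT.integrableOn_mul_of_memLp (hk j) ((hp j).mul hφc)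
  have i2 : IntegrableOn (fun x => ∑ j, k j x * w x * partialDeriv j φ x) T := by
    refine integrable_finsetSum _ fun j _ => ?_
    simp only [mul_assoc]
    exact hT.integrableOn_mul_of_memLp (hk j) (hwc.mul (hpφ j))
  rw [hT.restrict_interior] at h ⊢
  simp only [e] at h
  rw [integral_add i1 i2] at h
  have hi3 : IntegrableOn (fun x => R x * (w x * φ x)) T :=
    hT.integrableOn_mul_of_memLp hR (hwc.mul hφc)
  have e2 (x : Plane) : ((∑ j, k j x * partialDeriv j w x) + R x * w x) * φ x
      = (∑ j, k j x * (partialDeriv j w x * φ x)) + R x * (w x * φ x) := by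
    rw [add_mul, Finset.sum_mul]
    simp only [mul_assoc]
  simp only [e2]
  rw [integral_add i1 hi3]
  linarith

/-- The layers shrink to a null set: their area is bounded by the layer estimate for the constant
function `1`. -/
theorem tendsto_volume_boundaryLayer (hT : IsStarPolygon T E a b n z r) :
    Tendsto (fun δ => (volume.restrict T) (boundaryLayer T z δ)) (𝓝[>] 0) (𝓝 0) := by
  obtain ⟨D, hD⟩ := hT.isCompact.isBounded.subset_closedBall z
  have hD' : ∀ x ∈ T, ‖x - z‖ ≤ D := fun x hx => mem_closedBall_iff_norm.1 (hD hx)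
  have hb : ∀ δ ∈ Ioc (0 : ℝ) (1 / 2), (volume.restrict T) (boundaryLayer T z δ)
      ≤ ENNReal.ofReal (δ * (6 * volume.real T)) := by
    intro δ hδ
    have h := hT.integral_layer_sq_le hD' (hT.hasL2Gradient_const 1) hδ.1 hδ.2
    rw [Measure.restrict_apply (hT.measurableSet_boundaryLayer δ),
      inter_eq_left.2 (boundaryLayer_subset T z δ)]
    have hfin : volume (boundaryLayer T z δ) ≠ ⊤ :=
      ((measure_mono (boundaryLayer_subset T z δ)).trans_lt hT.isCompact.measure_lt_top).ne
    rw [← ENNReal.ofReal_toReal hfin]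
    apply ENNReal.ofReal_le_ofReal
    simpa [measureReal_def] using h
  refine tendsto_of_tendsto_of_tendsto_of_le_of_le' (h := fun δ : ℝ =>
    ENNReal.ofReal (δ * (6 * volume.real T))) tendsto_const_nhds ?_
    (Eventually.of_forall fun _ => zero_le) ?_
  · have : Continuous fun δ : ℝ => ENNReal.ofReal (δ * (6 * volume.real T)) :=
      ENNReal.continuous_ofReal.comp (by fun_prop)
    have h0 := this.tendsto 0
    simp only [zero_mul, ENNReal.ofReal_zero] at h0
    exact h0.mono_left nhdsWithin_le_nhds
  · filter_upwards [Ioc_mem_nhdsGT (show (0 : ℝ) < 1 / 2 by norm_num)] with δ hδ using hb δ hδ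

section diameter

variable {ρ d : ℝ}

/-- The flux of `w k` through the boundary, for a field `k` that is small near the boundary. The
divergence theorem is applied on thin boundary layers, whose width tends to zero. -/
theorem abs_integral_flux_le (hT : IsStarPolygon T E a b n z (ρ * d)) (hρ : 0 < ρ)
    (hd : ∀ x ∈ T, ∀ y ∈ T, ‖x - y‖ ≤ d) {k : Fin 2 → Plane → ℝ}
    {R : Plane → ℝ} (hk : ∀ j, MemLp (k j) 2 (volume.restrict T))
    (hR : MemLp R 2 (volume.restrict T)) (hdiv : IsWeakDivergence (interior T) k R)
    {Mk : ℝ} (hlayer : ∀ δ ∈ Ioc (0 : ℝ) (1 / 2),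
      ∫ x in boundaryLayer T z δ, ∑ j, k j x ^ 2 ≤ δ * Mk)
    {w : Plane → ℝ} (hw : ContDiff ℝ ∞ w) {τ : ℝ} (hτ : 0 < τ) :
    |∫ x in T, ((∑ j, k j x * partialDeriv j w x) + R x * w x)|
      ≤ (ρ * d)⁻¹ * (τ / 2 * Mk
        + τ⁻¹ * (d * ∑ e ∈ E, dist (a e) (b e) * edgeAvg a b (fun x => w x ^ 2) e)) := by
  have hw1 : ContDiff ℝ 1 w := hw.of_le (by exact_mod_cast le_top)
  have hp (j) := continuous_partialDeriv hw1 j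
  have hwc := hw1.continuous
  have hψ : MemLp (fun x => (∑ j, k j x * partialDeriv j w x) + R x * w x) 2 (volume.restrict T) :=
    (memLp_finsetSum _ fun j _ => hT.memLp_mul_continuous (hk j) (hp j)).add
      (hT.memLp_mul_continuous hR hwc)
  have hkw (j) := hT.memLp_mul_continuous (hk j) hwc
  have hdivw := hT.isWeakDivergence_mul hk hR hdiv hw
  set ψ : Plane → ℝ := fun x => (∑ j, k j x * partialDeriv j w x) + R x * w x with hψd
  have hlim1 : Tendsto (fun δ => ∫ x in boundaryLayer T z δ, |ψ x|) (𝓝[>] 0) (𝓝 0) := by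
    have h := (hT.integrableOn_of_memLp hψ).abs.tendsto_setIntegral_nhds_zero
      hT.tendsto_volume_boundaryLayer
    refine h.congr fun δ => ?_
    rw [Measure.restrict_restrict (hT.measurableSet_boundaryLayer δ),
      inter_eq_left.2 (boundaryLayer_subset T z δ)]
  have hlim2 := hT.tendsto_integral_boundaryLayer (f := fun x => w x ^ 2) (hwc.pow 2)
  have hlim := hlim1.add (((hlim2.const_mul τ⁻¹).const_add (τ / 2 * Mk)).const_mul (ρ * d)⁻¹)
  rw [zero_add] at hlim
  have hbound : ∀ᶠ δ in 𝓝[>] (0 : ℝ), |∫ x in T, ψ x| ≤ (∫ x in boundaryLayer T z δ, |ψ x|)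
      + (ρ * d)⁻¹ * (τ / 2 * Mk + τ⁻¹ * (δ⁻¹ * ∫ x in boundaryLayer T z δ, w x ^ 2)) := by
    filter_upwards [Ioc_mem_nhdsGT (show (0 : ℝ) < 1 / 2 by norm_num)] with δ hδ
    have hδ0 : 0 < δ := hδ.1
    refine (hT.abs_integral_weakDivergence_le hkw hψ hdivw hδ.1 (by linarith [hδ.2])).trans
      (add_le_add le_rfl ?_)
    have hle := Measure.restrict_mono (μ := volume) (boundaryLayer_subset T z δ) le_rfl
    have ik (j) : IntegrableOn (fun x => k j x ^ 2) (boundaryLayer T z δ) :=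
      ((hk j).mono_measure hle).integrable_sq
    have iks : IntegrableOn (fun x => ∑ j, k j x ^ 2) (boundaryLayer T z δ) :=
      integrable_finsetSum _ fun j _ => ik j
    have iw : IntegrableOn (fun x => w x ^ 2) (boundaryLayer T z δ) :=
      (hT.integrableOn (hwc.pow 2)).mono_set (boundaryLayer_subset T z δ)
    have ikw : IntegrableOn (fun x => ∑ j, |k j x * w x|) (boundaryLayer T z δ) :=
      integrable_finsetSum _ fun j _ => ((hT.integrableOn_of_memLp (hkw j)).mono_set
        (boundaryLayer_subset T z δ)).abs
    -- Young's inequality with parameter `τ`; both terms are of the order of the width `δ`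
    have h1 : ∫ x in boundaryLayer T z δ, ∑ j, |k j x * w x|
        ≤ τ / 2 * (δ * Mk) + τ⁻¹ * ∫ x in boundaryLayer T z δ, w x ^ 2 := by
      have h2 : ∫ x in boundaryLayer T z δ, ∑ j, |k j x * w x|
          ≤ ∫ x in boundaryLayer T z δ, (τ / 2 * (∑ j, k j x ^ 2) + τ⁻¹ * w x ^ 2) := by
        refine integral_mono ikw ((iks.const_mul _).add (iw.const_mul _)) fun x => ?_
        simp only [Fin.sum_univ_two]
        have hj (j) : |k j x * w x| ≤ τ / 2 * k j x ^ 2 + τ⁻¹ / 2 * w x ^ 2 := by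
          have e : τ / 2 * k j x ^ 2 + τ⁻¹ / 2 * w x ^ 2
              = τ⁻¹ / 2 * ((τ * |k j x|) ^ 2 + |w x| ^ 2) := by
            rw [mul_pow, sq_abs, sq_abs]; field_simp
          rw [e, abs_mul]
          have h3 : 2 * (τ * |k j x| * |w x|) ≤ (τ * |k j x|) ^ 2 + |w x| ^ 2 := by
            nlinarith [sq_nonneg (τ * |k j x| - |w x|)]
          calc |k j x| * |w x| = τ⁻¹ / 2 * (2 * (τ * |k j x| * |w x|)) := by field_simp
            _ ≤ _ := mul_le_mul_of_nonneg_left h3 (by positivity)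
        linarith [hj 0, hj 1]
      rw [integral_add (iks.const_mul _) (iw.const_mul _), integral_const_mul,
        integral_const_mul] at h2
      have h3 := mul_le_mul_of_nonneg_left (hlayer δ hδ) (show 0 ≤ τ / 2 by positivity)
      linarith
    have hpos := hT.pos
    calc (ρ * d * δ)⁻¹ * ∫ x in boundaryLayer T z δ, ∑ j, |k j x * w x|
        ≤ (ρ * d * δ)⁻¹ * (τ / 2 * (δ * Mk)
          + τ⁻¹ * ∫ x in boundaryLayer T z δ, w x ^ 2) :=
          mul_le_mul_of_nonneg_left h1 (by positivity)
      _ = _ := by rw [mul_inv]; field_simp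
  refine (ge_of_tendsto hlim hbound).trans ?_
  have hpos := hT.pos
  refine mul_le_mul_of_nonneg_left (add_le_add le_rfl (mul_le_mul_of_nonneg_left ?_
    (by positivity))) (by positivity)
  rw [edgeProfile_one, Finset.mul_sum]
  refine Finset.sum_le_sum fun e he => ?_
  rw [← mul_assoc]
  exact mul_le_mul_of_nonneg_right (hT.edgeWeight_le hd he)
    (edgeAvg_nonneg (fun _ => sq_nonneg _) e)

end diameter

end IsStarPolygon

/-! ### Consistency of the flux on one element -/

/-- The constant in the bound of `α∇u - α(z)m` for the average gradient `m` on an element, for a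
coefficient with bound `A` and Lipschitz constant `L`. -/
noncomputable def fluxConst (ρ A L : ℝ) : ℝ :=
  2 * A ^ 2 * (6 * (4 / ρ ^ 2) + 2) + 12 * L ^ 2 / ρ ^ 2

namespace IsStarPolygon

variable {ι : Type*} {T : Set Plane} {E : Finset ι} {a b n : ι → Plane} {z : Plane} {r : ℝ}
  {ρ d : ℝ}

theorem ae_mem_interior (hT : IsStarPolygon T E a b n z r) :
    ∀ᵐ x ∂volume.restrict T, x ∈ interior T := by
  rw [← hT.restrict_interior]
  exact ae_restrict_mem isOpen_interior.measurableSet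

theorem center_mem_interior (hT : IsStarPolygon T E a b n z r) : z ∈ interior T := by
  have := hT.shrink_mem_interior hT.center_mem (l := 0) le_rfl one_pos
  simpa using this

/-- The deviation of `αG` from the constant vector `α(z)m` in `L²`. -/
theorem integral_flux_sub_sq_le (hT : IsStarPolygon T E a b n z r)
    (hd : ∀ x ∈ T, ∀ y ∈ T, ‖x - y‖ ≤ d) {G : Plane → Plane} {α : Plane → (Plane →L[ℝ] Plane)}
    {A L : ℝ} (hA : ∀ x ∈ interior T, ‖α x‖ ≤ A) (hL : 0 ≤ L)
    (hαL : ∀ x ∈ interior T, ∀ y ∈ interior T, ‖α x - α y‖ ≤ L * ‖x - y‖)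
    (hG : ∀ j, MemLp (fun x => G x j) 2 (volume.restrict T))
    (hq : ∀ j, MemLp (fun x => α x (G x) j) 2 (volume.restrict T)) (m : Plane) {U : Set Plane}
    (hU : U ⊆ T) :
    ∫ x in U, ∑ j, (α x (G x) j - α z m j) ^ 2
      ≤ 2 * A ^ 2 * (∑ j, ∫ x in U, (G x j - m j) ^ 2)
        + 2 * (L * d) ^ 2 * ‖m‖ ^ 2 * volume.real U := by
  have := hT.isFiniteMeasure
  have hle := Measure.restrict_mono (μ := volume) hU le_rfl
  have : IsFiniteMeasure (volume.restrict U) :=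
    ⟨(hle univ).trans_lt (measure_lt_top (volume.restrict T) univ)⟩
  have i1 (j) : IntegrableOn (fun x => (α x (G x) j - α z m j) ^ 2) U :=
    (((hq j).mono_measure hle).sub (memLp_const _)).integrable_sq
  have i2 (j) : IntegrableOn (fun x => (G x j - m j) ^ 2) U :=
    (((hG j).mono_measure hle).sub (memLp_const _)).integrable_sq
  have i3 : IntegrableOn (fun x => 2 * A ^ 2 * ∑ j, (G x j - m j) ^ 2) U :=
    (integrable_finsetSum _ fun j _ => i2 j).const_mul _
  have h : ∫ x in U, ∑ j, (α x (G x) j - α z m j) ^ 2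
      ≤ ∫ x in U, (2 * A ^ 2 * (∑ j, (G x j - m j) ^ 2) + 2 * (L * d) ^ 2 * ‖m‖ ^ 2) := by
    refine integral_mono_ae (integrable_finsetSum _ fun j _ => i1 j)
      (i3.add (integrable_const _)) ?_
    have hae : ∀ᵐ x ∂volume.restrict U, x ∈ interior T :=
      ae_restrict_of_ae_restrict_of_subset hU hT.ae_mem_interior
    filter_upwards [hae] with x hx
    have hA0 : 0 ≤ A := (norm_nonneg _).trans (hA x hx)
    have e1 : ∑ j, (α x (G x) j - α z m j) ^ 2 = ‖α x (G x) - α z m‖ ^ 2 := by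
      rw [EuclideanSpace.real_norm_sq_eq]; rfl
    have e2 : ∑ j, (G x j - m j) ^ 2 = ‖G x - m‖ ^ 2 := by
      rw [EuclideanSpace.real_norm_sq_eq]; rfl
    rw [e1, e2]
    have h1 : ‖α x (G x) - α z m‖ ≤ A * ‖G x - m‖ + L * d * ‖m‖ := by
      have e3 : α x (G x) - α z m = α x (G x - m) + (α x - α z) m := by
        rw [map_sub, sub_apply]; abel
      rw [e3]
      refine (norm_add_le _ _).trans (add_le_add ?_ ?_)
      · exact (α x).le_of_opNorm_le (hA x hx) _
      · refine (α x - α z).le_of_opNorm_le ((hαL x hx z hT.center_mem_interior).trans ?_) _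
        exact mul_le_mul_of_nonneg_left (hd x (interior_subset hx) z hT.center_mem) hL
    calc ‖α x (G x) - α z m‖ ^ 2 ≤ (A * ‖G x - m‖ + L * d * ‖m‖) ^ 2 :=
          pow_le_pow_left₀ (norm_nonneg _) h1 2
      _ ≤ _ := by nlinarith [sq_nonneg (A * ‖G x - m‖ - L * d * ‖m‖)]
  rw [integral_add i3 (integrable_const _), integral_const_mul,
    integral_finsetSum _ fun j _ => i2 j, setIntegral_const, smul_eq_mul] at h
  linarith

theorem memLp_flux (hT : IsStarPolygon T E a b n z r) {G : Plane → Plane}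
    {α : Plane → (Plane →L[ℝ] Plane)} {A L : ℝ} (hA : ∀ x ∈ interior T, ‖α x‖ ≤ A)
    (hαL : ∀ x ∈ interior T, ∀ y ∈ interior T, ‖α x - α y‖ ≤ L * ‖x - y‖)
    (hG : MemLp G 2 (volume.restrict T)) :
    MemLp (fun x => α x (G x)) 2 (volume.restrict T) := by
  have hcont : ContinuousOn α (interior T) := by
    have : LipschitzOnWith L.toNNReal α (interior T) := by
      refine LipschitzOnWith.of_dist_le_mul fun x hx y hy => ?_
      rw [dist_eq_norm, dist_eq_norm]
      exact (hαL x hx y hy).trans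
        (mul_le_mul_of_nonneg_right (Real.le_coe_toNNReal L) (norm_nonneg _))
    exact this.continuousOn
  have hm : AEStronglyMeasurable α (volume.restrict T) := by
    rw [← hT.restrict_interior]
    exact hcont.aestronglyMeasurable isOpen_interior.measurableSet
  refine MemLp.of_le_mul (c := A) hG ?_ ?_
  · exact (ContinuousLinearMap.id ℝ (Plane →L[ℝ] Plane)).aestronglyMeasurable_comp₂ hm
      hG.aestronglyMeasurable
  · filter_upwards [hT.ae_mem_interior] with x hx
    exact (α x).le_of_opNorm_le (hA x hx) _

theorem _root_.memLp_coord {μ : Measure Plane} {q : Plane → Plane} (hq : MemLp q 2 μ) (j : Fin 2) :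
    MemLp (fun x => q x j) 2 μ :=
  (EuclideanSpace.proj j : Plane →L[ℝ] ℝ).comp_memLp' hq

/-- The consistency error of the flux on one element. After subtracting a constant vector from
`α∇u`, whose contribution is a boundary term, the rest is small on the element and near its
boundary. The parameter `τ` balances the two factors. -/
theorem exists_abs_flux_sub_le (hT : IsStarPolygon T E a b n z (ρ * d)) (hρ : 0 < ρ)
    (hd : ∀ x ∈ T, ∀ y ∈ T, ‖x - y‖ ≤ d) {u : Plane → ℝ} {G : Plane → Plane}
    {H : Fin 2 → Plane → Plane} (huc : Continuous u) (hu : HasL2Gradient T u G)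
    (hGm : MemLp G 2 (volume.restrict T)) (hG : ∀ i, HasL2Gradient T (fun x => G x i) (H i))
    {α : Plane → (Plane →L[ℝ] Plane)} {A L : ℝ} (hA : ∀ x ∈ interior T, ‖α x‖ ≤ A) (hL : 0 ≤ L)
    (hαL : ∀ x ∈ interior T, ∀ y ∈ interior T, ‖α x - α y‖ ≤ L * ‖x - y‖) {R : Plane → ℝ}
    (hR : MemLp R 2 (volume.restrict T))
    (hdiv : IsWeakDivergence (interior T) (fun j x => α x (G x) j) R) {v : ι → ℝ} {g : Plane}
    (hg : volume.real T • g = ∑ e ∈ E, (v e * dist (a e) (b e)) • n e) (s : Plane →ᵃ[ℝ] ℝ) :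
    ∃ q₀ : Plane, ∀ Ψ : Plane → ℝ, ContDiff ℝ ∞ Ψ → ∀ τ > 0,
      |(∫ x in T, (inner ℝ (α x (G x)) g + R x * s x))
        - (∫ x in T, (inner ℝ (α x (G x)) (gradient Ψ x) + R x * Ψ x))
        - ∑ e ∈ E, dist (a e) (b e) * (inner ℝ q₀ (n e) * (v e - edgeAvg a b Ψ e))|
      ≤ τ / 2 * ((1 + 1 / ρ) * (fluxConst ρ A L * d *
          ((∑ j, ∫ x in T, G x j ^ 2) + ∑ i, ∑ j, ∫ x in T, H i x j ^ 2)))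
        + τ⁻¹ * (1 / ρ * ((∑ e ∈ E, (s (midpoint ℝ (a e) (b e)) - v e) ^ 2 * dist (a e) (b e))
          + ∑ e ∈ E, dist (a e) (b e) * edgeAvg a b (fun x => (s x - Ψ x) ^ 2) e)) := by
  have := hT.isFiniteMeasure
  have hd0 := hT.diam_pos hρ
  obtain ⟨p, hp1, -, -, hp4⟩ := hT.exists_affine_approx hρ hd huc hu hG
  set m := affineGrad p with hm
  set N₁ := ∑ j, ∫ x in T, G x j ^ 2 with hN₁
  set NH := ∑ i, ∑ j, ∫ x in T, H i x j ^ 2 with hNH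
  have hN₁0 : 0 ≤ N₁ := Finset.sum_nonneg fun _ _ => integral_nonneg fun _ => sq_nonneg _
  have hNH0 : 0 ≤ NH := Finset.sum_nonneg fun _ _ => Finset.sum_nonneg fun _ _ =>
    integral_nonneg fun _ => sq_nonneg _
  have hqv := hT.memLp_flux hA hαL hGm
  have hq (j) := memLp_coord hqv j
  -- the constant vector: the value at the centre for the approximating affine function
  set q₀ := α z m with hq₀
  set k : Fin 2 → Plane → ℝ := fun j x => α x (G x) j - q₀ j with hk
  have hkL (j) : MemLp (k j) 2 (volume.restrict T) := (hq j).sub (memLp_const _)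
  have hkdiv : IsWeakDivergence (interior T) k R := by
    intro φ hφ
    have h1 := hdiv φ hφ
    have hpφ (j) := continuous_partialDeriv_of_isTestFunction hφ j
    have h0 (j) : ∫ x in T, partialDeriv j φ x = 0 := by
      have := (hT.hasL2Gradient_const 1).weak_grad φ hφ j
      simp only [gradient_apply, hT.restrict_interior] at this
      simpa using this
    rw [hT.restrict_interior] at h1 ⊢
    rw [← h1]
    have e (x : Plane) : ∑ j, k j x * partialDeriv j φ x
        = (∑ j, α x (G x) j * partialDeriv j φ x) - ∑ j, q₀ j * partialDeriv j φ x := by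
      rw [← Finset.sum_sub_distrib]
      exact Finset.sum_congr rfl fun j _ => by rw [hk]; ring
    have i0 (j) : IntegrableOn (fun x => q₀ j * partialDeriv j φ x) T :=
      hT.integrableOn (continuous_const.mul (hpφ j))
    simp only [e]
    rw [integral_sub (integrable_finsetSum _ fun j _ => hT.integrableOn_mul_of_memLp (hq j) (hpφ j))
      (integrable_finsetSum _ fun j _ => i0 j), integral_finsetSum _ fun j _ => i0 j]
    simp only [integral_const_mul, h0, mul_zero, Finset.sum_const_zero, sub_zero]
  -- bounds for `k` on the layers and on the element
  have hmV : 2 * (L * d) ^ 2 * ‖m‖ ^ 2 * (6 * volume.real T) ≤ 12 * L ^ 2 / ρ ^ 2 * d ^ 2 * N₁ := by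
    have := mul_le_mul_of_nonneg_left hp4 (show 0 ≤ 12 * L ^ 2 * d ^ 2 by positivity)
    calc _ = 12 * L ^ 2 * d ^ 2 * (volume.real T * ‖m‖ ^ 2) := by ring
      _ ≤ _ := this
      _ = _ := by rw [div_eq_mul_inv]; ring
  have hconst : 2 * A ^ 2 * ((6 * (4 / ρ ^ 2) + 2) * d ^ 2 * NH) + 12 * L ^ 2 / ρ ^ 2 * d ^ 2 * N₁
      ≤ fluxConst ρ A L * d ^ 2 * (N₁ + NH) := by
    have p1 : 0 ≤ 2 * A ^ 2 * (6 * (4 / ρ ^ 2) + 2) * d ^ 2 * N₁ := by positivity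
    have p2 : 0 ≤ 12 * L ^ 2 / ρ ^ 2 * d ^ 2 * NH := by positivity
    rw [fluxConst]
    linarith
  have hlayer : ∀ δ ∈ Ioc (0 : ℝ) (1 / 2), ∫ x in boundaryLayer T z δ, ∑ j, k j x ^ 2
      ≤ δ * (fluxConst ρ A L * d ^ 2 * (N₁ + NH)) := by
    intro δ hδ
    have hδ0 : 0 < δ := hδ.1
    have hDz : ∀ x ∈ T, ‖x - z‖ ≤ d := fun x hx => hd x hx z hT.center_mem
    have h1 := hT.integral_flux_sub_sq_le hd hA hL hαL hu.memLp_grad hq m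
      (boundaryLayer_subset T z δ)
    have h2 : ∑ j, ∫ x in boundaryLayer T z δ, (G x j - m j) ^ 2
        ≤ δ * ((6 * (4 / ρ ^ 2) + 2) * d ^ 2 * NH) := by
      have h3 (j) := hT.integral_layer_sq_le hDz
        (hT.hasL2Gradient_sub (hG j) (hT.hasL2Gradient_const (m j))) hδ.1 hδ.2
      simp only [sub_zero] at h3
      refine (Finset.sum_le_sum fun j _ => h3 j).trans ?_
      rw [← Finset.mul_sum, Finset.sum_add_distrib, ← Finset.mul_sum, ← Finset.mul_sum, ← hNH]
      refine mul_le_mul_of_nonneg_left ?_ hδ0.le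
      linarith
    have h3 : volume.real (boundaryLayer T z δ) ≤ δ * (6 * volume.real T) := by
      have := hT.integral_layer_sq_le hDz (hT.hasL2Gradient_const 1) hδ.1 hδ.2
      simpa using this
    refine h1.trans ?_
    have h4 := mul_le_mul_of_nonneg_left h2 (show 0 ≤ 2 * A ^ 2 by positivity)
    have h5 := mul_le_mul_of_nonneg_left h3 (show 0 ≤ 2 * (L * d) ^ 2 * ‖m‖ ^ 2 by positivity)
    have h6 := mul_le_mul_of_nonneg_left (hconst.trans' (add_le_add le_rfl hmV)) hδ0.le
    linarith
  have hkT : ∫ x in T, ∑ j, k j x ^ 2 ≤ fluxConst ρ A L * d ^ 2 * (N₁ + NH) := by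
    have h1 := hT.integral_flux_sub_sq_le hd hA hL hαL hu.memLp_grad hq m le_rfl
    refine h1.trans (le_trans ?_ hconst)
    have h4 := mul_le_mul_of_nonneg_left hp1 (show 0 ≤ 2 * A ^ 2 by positivity)
    have h5 : 0 ≤ 2 * (L * d) ^ 2 * ‖m‖ ^ 2 * volume.real T := by positivity
    have h6 : 2 * A ^ 2 * (4 / ρ ^ 2 * d ^ 2 * NH)
        ≤ 2 * A ^ 2 * ((6 * (4 / ρ ^ 2) + 2) * d ^ 2 * NH) := by
      have : 4 / ρ ^ 2 ≤ 6 * (4 / ρ ^ 2) + 2 := by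
        have : 0 ≤ 4 / ρ ^ 2 := by positivity
        linarith
      gcongr
    linarith
  clear_value k
  refine ⟨q₀, fun Ψ hΨ τ hτ => ?_⟩
  have hΨ1 : ContDiff ℝ 1 Ψ := hΨ.of_le (by exact_mod_cast le_top)
  have hs1 : ContDiff ℝ 1 s := (contDiff_affine s).of_le (by exact_mod_cast le_top)
  have hsc := continuous_affine s
  have hΨc := hΨ1.continuous
  have hpΨ (j) := continuous_partialDeriv hΨ1 j
  set y := g - affineGrad s with hy
  have hw : ContDiff ℝ ∞ fun x => s x - Ψ x := (contDiff_affine s).sub hΨ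
  have hpw (j) := continuous_partialDeriv (hw.of_le (by exact_mod_cast le_top) : ContDiff ℝ 1 _) j
  have hflux := hT.abs_integral_flux_le hρ hd hkL hR hkdiv hlayer hw hτ
  -- the decomposition of the integrand
  have i3 : IntegrableOn (fun x => ∑ j, k j x * y j) T :=
    integrable_finsetSum _ fun j _ => hT.integrableOn_mul_of_memLp (hkL j) continuous_const
  have i4 : IntegrableOn (fun x => (∑ j, k j x * partialDeriv j (fun x => s x - Ψ x) x)
      + R x * (s x - Ψ x)) T :=
    (integrable_finsetSum _ fun j _ => hT.integrableOn_mul_of_memLp (hkL j) (hpw j)).add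
      (hT.integrableOn_mul_of_memLp hR (hsc.sub hΨc))
  have i5 : IntegrableOn (fun x => inner ℝ q₀ g - fderiv ℝ Ψ x q₀) T := by
    have : Continuous fun x => fderiv ℝ Ψ x q₀ :=
      (hΨ1.continuous_fderiv one_ne_zero).clm_apply continuous_const
    exact hT.integrableOn (continuous_const.sub this)
  have i1 : IntegrableOn (fun x => inner ℝ (α x (G x)) g + R x * s x) T := by
    simp only [← sum_mul_eq_inner]
    exact (integrable_finsetSum _ fun j _ => hT.integrableOn_mul_of_memLp (hq j)
      continuous_const).add (hT.integrableOn_mul_of_memLp hR hsc)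
  have i2 : IntegrableOn (fun x => inner ℝ (α x (G x)) (gradient Ψ x) + R x * Ψ x) T := by
    simp only [← sum_mul_partialDeriv]
    exact (integrable_finsetSum _ fun j _ => hT.integrableOn_mul_of_memLp (hq j)
      (hpΨ j)).add (hT.integrableOn_mul_of_memLp hR hΨc)
  have hpt (x : Plane) : (inner ℝ (α x (G x)) g + R x * s x)
      - (inner ℝ (α x (G x)) (gradient Ψ x) + R x * Ψ x)
      = ((∑ j, k j x * y j) + ((∑ j, k j x * partialDeriv j (fun x => s x - Ψ x) x)
      + R x * (s x - Ψ x))) + (inner ℝ q₀ g - fderiv ℝ Ψ x q₀) := by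
    have e1 (j) : partialDeriv j (fun x => s x - Ψ x) x = affineGrad s j - partialDeriv j Ψ x := by
      rw [← partialDeriv_affine s j x]
      simp only [partialDeriv]
      rw [fderiv_fun_sub (hs1.differentiable one_ne_zero x) (hΨ1.differentiable one_ne_zero x)]
      rfl
    simp only [e1]
    rw [← sum_mul_eq_inner, ← sum_mul_partialDeriv, ← sum_mul_eq_inner, fderiv_apply_eq_sum]
    simp only [Fin.sum_univ_two, hk, hy, PiLp.sub_apply]
    ring
  have h5 : ∫ x in T, (inner ℝ q₀ g - fderiv ℝ Ψ x q₀)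
      = ∑ e ∈ E, dist (a e) (b e) * (inner ℝ q₀ (n e) * (v e - edgeAvg a b Ψ e)) := by
    have i6 : IntegrableOn (fun x => fderiv ℝ Ψ x q₀) T := by
      have : Continuous fun x => fderiv ℝ Ψ x q₀ :=
      (hΨ1.continuous_fderiv one_ne_zero).clm_apply continuous_const
      exact hT.integrableOn this
    rw [integral_sub (integrable_const _) i6, setIntegral_const, smul_eq_mul,
      hT.integral_fderiv hΨ1, edgeProfile_one, ← inner_smul_right, hg, inner_sum,
      ← Finset.sum_sub_distrib]
    refine Finset.sum_congr rfl fun e _ => ?_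
    rw [inner_smul_right, fluxWeight, real_inner_comm q₀ (n e)]
    ring
  have hid : (∫ x in T, (inner ℝ (α x (G x)) g + R x * s x))
        - (∫ x in T, (inner ℝ (α x (G x)) (gradient Ψ x) + R x * Ψ x))
        - ∑ e ∈ E, dist (a e) (b e) * (inner ℝ q₀ (n e) * (v e - edgeAvg a b Ψ e))
      = (∫ x in T, ∑ j, k j x * y j) + ∫ x in T, ((∑ j, k j x *
        partialDeriv j (fun x => s x - Ψ x) x) + R x * (s x - Ψ x)) := by
    have i34 : IntegrableOn (fun x => (∑ j, k j x * y j) + ((∑ j, k j x *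
        partialDeriv j (fun x => s x - Ψ x) x) + R x * (s x - Ψ x))) T := i3.add i4
    rw [← integral_sub i1 i2, ← h5]
    simp only [hpt]
    rw [integral_add i34 i5, integral_add i3 i4]
    ring
  -- the term with the constant vector `y`
  have h3 : |∫ x in T, ∑ j, k j x * y j| ≤ τ / 2 * (fluxConst ρ A L * d * (N₁ + NH))
      + τ⁻¹ * (1 / ρ * ∑ e ∈ E, (s (midpoint ℝ (a e) (b e)) - v e) ^ 2 * dist (a e) (b e)) := by
    have hW := hT.norm_affineGrad_sub_sq_le hρ hg s
    rw [norm_sub_rev, ← hy] at hW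
    have ik : IntegrableOn (fun x => ∑ j, k j x ^ 2) T :=
      integrable_finsetSum _ fun j _ => (hkL j).integrable_sq
    have hle : ∀ x, |∑ j, k j x * y j|
        ≤ τ / (2 * d) * (∑ j, k j x ^ 2) + d / (2 * τ) * ‖y‖ ^ 2 := by
      intro x
      refine (Finset.abs_sum_le_sum_abs _ _).trans ?_
      rw [EuclideanSpace.real_norm_sq_eq, Finset.mul_sum, Finset.mul_sum, ← Finset.sum_add_distrib]
      refine Finset.sum_le_sum fun j _ => ?_
      have e : τ / (2 * d) * k j x ^ 2 + d / (2 * τ) * y j ^ 2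
          = 1 / (2 * d * τ) * ((τ * |k j x|) ^ 2 + (d * |y j|) ^ 2) := by
        rw [mul_pow, mul_pow, sq_abs, sq_abs]; field_simp
      rw [e, abs_mul]
      calc |k j x| * |y j| = 1 / (2 * d * τ) * (2 * (τ * |k j x|) * (d * |y j|)) := by field_simp
        _ ≤ _ := mul_le_mul_of_nonneg_left (two_mul_le_add_sq _ _) (by positivity)
    have h6 : ∫ x in T, |∑ j, k j x * y j|
        ≤ ∫ x in T, (τ / (2 * d) * (∑ j, k j x ^ 2) + d / (2 * τ) * ‖y‖ ^ 2) :=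
      integral_mono i3.abs ((ik.const_mul _).add (integrable_const _)) hle
    rw [integral_add (ik.const_mul _) (integrable_const _), integral_const_mul, setIntegral_const,
      smul_eq_mul] at h6
    refine abs_integral_le_integral_abs.trans (h6.trans (add_le_add ?_ ?_))
    · refine (mul_le_mul_of_nonneg_left hkT (by positivity)).trans_eq ?_
      field_simp
    · have := mul_le_mul_of_nonneg_left hW (show 0 ≤ 1 / (2 * τ) by positivity)
      calc _ = 1 / (2 * τ) * (d * (volume.real T * ‖y‖ ^ 2)) := by ring
        _ ≤ _ := this
        _ = _ := by field_simp
  rw [hid]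
  refine (abs_add_le _ _).trans ((add_le_add h3 hflux).trans_eq ?_)
  rw [mul_inv]
  field_simp
  ring

end IsStarPolygon

/-! ### Discrete skew-symmetry -/

/-- Dominated convergence for averages over one edge. -/
theorem tendsto_edgeAvg_comp {ι : Type*} {a b : ι → Plane} {e : ι} {Φ : Plane → ℝ → ℝ}
    (hΦ : Continuous fun p : Plane × ℝ => Φ p.1 p.2) {Ψ : ℕ → Plane → ℝ}
    (hΨ : ∀ k, Continuous (Ψ k)) {B : ℝ} (hB : ∀ k x, |Ψ k x| ≤ B) {v : ℝ}
    (hv : ∀ t ∈ Ioo (0 : ℝ) 1, ∀ᶠ k in atTop, Ψ k (AffineMap.lineMap (a e) (b e) t) = v) :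
    Tendsto (fun k => edgeAvg a b (fun x => Φ x (Ψ k x)) e) atTop
      (𝓝 (edgeAvg a b (fun x => Φ x v) e)) := by
  have hK : IsCompact ((segment ℝ (a e) (b e)) ×ˢ (Icc (-B) B)) := by
    refine IsCompact.prod ?_ isCompact_Icc
    rw [segment_eq_image_lineMap]
    exact isCompact_Icc.image AffineMap.lineMap_continuous
  obtain ⟨C, hC⟩ := hK.exists_bound_of_continuousOn hΦ.continuousOn
  simp only [edgeAvg]
  simp only [intervalIntegral.integral_of_le zero_le_one, ← setIntegral_congr_set Ioo_ae_eq_Ioc]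
  refine tendsto_integral_of_dominated_convergence (fun _ => C) (fun k => ?_)
    (integrable_const _) (fun k => ?_) ?_
  · exact ((hΦ.comp (continuous_id.prodMk (hΨ k))).comp
      AffineMap.lineMap_continuous).aestronglyMeasurable
  · refine (ae_restrict_mem measurableSet_Ioo).mono fun t ht => ?_
    refine hC (_, _) ⟨?_, abs_le.1 (hB k _)⟩
    rw [segment_eq_image_lineMap]
    exact mem_image_of_mem _ ⟨ht.1.le, ht.2.le⟩
  · refine (ae_restrict_mem measurableSet_Ioo).mono fun t ht => ?_
    exact tendsto_const_nhds.congr' ((hv t ht).mono fun k hk => by simp only [hk])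

namespace PolyMesh

variable {Ω : Set Plane} (M : PolyMesh Ω)

theorem dist_le_diam (i : Fin M.numElem) :
    ∀ x ∈ M.elem i, ∀ y ∈ M.elem i, ‖x - y‖ ≤ Metric.diam (M.elem i) := fun x hx y hy => by
  rw [← dist_eq_norm]; exact Metric.dist_le_diam_of_mem (M.isCompact_elem i).isBounded hx hy

/-- The squared least-squares residual of `v` on the element `i`. -/
noncomputable def residual (v : M.W) (i : Fin M.numElem) : ℝ :=
  ∑ e ∈ M.bdry i, (M.ext v i (midpoint ℝ (M.src e) (M.tgt e)) - v e) ^ 2 * dist (M.src e) (M.tgt e)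

/-- The discrete energy `S(v, v) + ‖∇_w v‖²`. -/
noncomputable def energy (v : M.W) : ℝ :=
  M.S v v + ∑ i, volume.real (M.elem i) * ‖M.weakGrad v i‖ ^ 2

/-- The squared `L²` norm of `𝔰(v)`. -/
noncomputable def extSq (v : M.W) : ℝ := ∑ i, ∫ x in M.elem i, M.ext v i x ^ 2

theorem residual_nonneg (v : M.W) (i : Fin M.numElem) : 0 ≤ M.residual v i :=
  Finset.sum_nonneg fun _ _ => mul_nonneg (sq_nonneg _) dist_nonneg

theorem S_self (v : M.W) : M.S v v = M.meshSize⁻¹ * ∑ i, M.residual v i := by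
  rw [S, Finset.mul_sum]
  refine Finset.sum_congr rfl fun i _ => ?_
  simp only [residual, mid, len, sq]

theorem sum_residual (hΩ : IsPolygonalDomain Ω) (v : M.W) :
    ∑ i, M.residual v i = M.meshSize * M.S v v := by
  rw [S_self, mul_inv_cancel_left₀ (M.meshSize_pos hΩ).ne']

theorem S_self_nonneg (hΩ : IsPolygonalDomain Ω) (v : M.W) : 0 ≤ M.S v v := by
  rw [S_self]
  exact mul_nonneg (inv_nonneg.2 (M.meshSize_pos hΩ).le)
    (Finset.sum_nonneg fun i _ => M.residual_nonneg v i)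

theorem extSq_nonneg (v : M.W) : 0 ≤ M.extSq v :=
  Finset.sum_nonneg fun _ _ => integral_nonneg fun _ => sq_nonneg _

theorem energy_nonneg (hΩ : IsPolygonalDomain Ω) (v : M.W) : 0 ≤ M.energy v :=
  add_nonneg (M.S_self_nonneg hΩ v) (Finset.sum_nonneg fun _ _ => by positivity)

theorem sum_residual_add_le (hΩ : IsPolygonalDomain Ω) (v : M.W) :
    ∑ i, (M.residual v i + Metric.diam (M.elem i) * (volume.real (M.elem i) * ‖M.weakGrad v i‖ ^ 2))
      ≤ M.meshSize * M.energy v := by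
  rw [Finset.sum_add_distrib, M.sum_residual hΩ, energy, mul_add, Finset.mul_sum]
  gcongr with i
  exact M.diam_le_meshSize i

theorem volume_pos (i : Fin M.numElem) : 0 < volume.real (M.elem i) := by
  refine ENNReal.toReal_pos ?_ (M.isCompact_elem i).measure_lt_top.ne
  exact ((isOpen_interior.measure_pos volume (M.nonempty_interior i)).trans_le
    (measure_mono interior_subset)).ne'

theorem volume_smul_weakGrad (v : M.W) (i : Fin M.numElem) :
    volume.real (M.elem i) • M.weakGrad v i
      = ∑ e ∈ M.bdry i, (v e * dist (M.src e) (M.tgt e)) • M.normal i e := by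
  rw [weakGrad, smul_inv_smul₀ (M.volume_pos i).ne']
  rfl

theorem ext_spec_midpoint (v : M.W) (i : Fin M.numElem) (φ : Plane →ᵃ[ℝ] ℝ) :
    ∑ e ∈ M.bdry i, (M.ext v i (midpoint ℝ (M.src e) (M.tgt e)) - v e)
      * φ (midpoint ℝ (M.src e) (M.tgt e)) * dist (M.src e) (M.tgt e) = 0 := M.ext_spec v i φ

variable {ρ : ℝ}

theorem exists_isStarPolygon (hρ : 0 < ρ) (hM : M.IsShapeRegular ρ) (i : Fin M.numElem) :
    ∃ z, IsStarPolygon (M.elem i) (M.bdry i) M.src M.tgt (M.normal i) z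
      (ρ * Metric.diam (M.elem i)) := by
  obtain ⟨z, hz⟩ := hM i
  exact ⟨z, M.isStarPolygon hρ hz⟩

/-- The fluxes of `v²β` through the edges cancel: each interior edge is counted twice, with opposite
normals, and `v` vanishes on the boundary. The cancellation is read off from the divergence theorem
for test functions that converge to `v` on the edges. -/
theorem sum_flux_sq_eq_zero (hΩ : IsPolygonalDomain Ω) (hρ : 0 < ρ) (hM : M.IsShapeRegular ρ)
    {β : Plane → Plane} {D : Plane → (Plane →L[ℝ] Plane)} (hβ : Continuous β) (hD : Continuous D)
    (h : ∀ x ∈ Ω, HasFDerivAt β (D x) x) {v : M.W} (hv : M.VanishesOnBoundary v) :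
    ∑ i, ∑ e ∈ M.bdry i, dist (M.src e) (M.tgt e) *
      (v e ^ 2 * edgeAvg M.src M.tgt (fun x => inner ℝ (M.normal i e) (β x)) e) = 0 := by
  obtain ⟨Ψ, hΨ, ⟨B, hB⟩, hΨv⟩ := M.exists_isTestFunction_tendsto hΩ hv
  have hlim : Tendsto (fun k => ∑ i, ∑ e ∈ M.bdry i, dist (M.src e) (M.tgt e) *
      edgeAvg M.src M.tgt (fun x => inner ℝ (M.normal i e) (β x) * (Ψ k x * Ψ k x)) e) atTop
      (𝓝 (∑ i, ∑ e ∈ M.bdry i, dist (M.src e) (M.tgt e) *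
      edgeAvg M.src M.tgt (fun x => inner ℝ (M.normal i e) (β x) * (v e * v e)) e)) := by
    refine tendsto_finsetSum _ fun i _ => tendsto_finsetSum _ fun e _ => Tendsto.const_mul _ ?_
    exact tendsto_edgeAvg_comp (Φ := fun x y => inner ℝ (M.normal i e) (β x) * (y * y))
      (by fun_prop) (fun k => (hΨ k).smooth.continuous) hB (hΨv e)
  have hzero (k : ℕ) : ∑ i, ∑ e ∈ M.bdry i, dist (M.src e) (M.tgt e) *
      edgeAvg M.src M.tgt (fun x => inner ℝ (M.normal i e) (β x) * (Ψ k x * Ψ k x)) e = 0 := by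
    have hφ := (hΨ k).mul (hΨ k)
    have hc : Continuous fun x => traceField D x * (Ψ k x * Ψ k x)
        + fderiv ℝ (fun x => Ψ k x * Ψ k x) x (β x) :=
      ((continuous_traceField hD).mul hφ.smooth.continuous).add
        ((hφ.contDiff_one.continuous_fderiv one_ne_zero).clm_apply hβ)
    have hint : IntegrableOn (fun x => traceField D x * (Ψ k x * Ψ k x)
        + fderiv ℝ (fun x => Ψ k x * Ψ k x) x (β x)) Ω :=
      (hc.continuousOn.integrableOn_compact hΩ.isCompact_closure).mono_set subset_closure
    rw [← integral_divergence_mul_eq_zero hβ hD h hφ, M.integral_eq_sum hΩ hint]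
    refine Finset.sum_congr rfl fun i _ => ?_
    obtain ⟨z, hT⟩ := M.exists_isStarPolygon hρ hM i
    exact (hT.integral_divergence_mul hβ hD (fun x hx => h x (M.interior_elem_subset hΩ i hx))
      hφ.contDiff_one).symm
  simp only [hzero] at hlim
  have := tendsto_nhds_unique hlim tendsto_const_nhds
  rw [← this]
  refine Finset.sum_congr rfl fun i _ => Finset.sum_congr rfl fun e _ => ?_
  rw [show (fun x => inner ℝ (M.normal i e) (β x) * (v e * v e))
    = fun x => v e ^ 2 * inner ℝ (M.normal i e) (β x) from funext fun x => by ring,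
    edgeAvg_const_mul]

/-- The constant of `abs_convection_sub_le`. -/
noncomputable def _root_.convectionConst (ρ : ℝ) : ℝ :=
  (1 + 3 / ρ) * (4 + 6 / ρ + 4 / ρ * (2 + 4 / ρ))

/-- Discrete skew-symmetry of the convection form. -/
theorem abs_bForm_add_le (hΩ : IsPolygonalDomain Ω) (hρ : 0 < ρ) (hM : M.IsShapeRegular ρ)
    (hh : M.meshSize ≤ 1)
    {β : Plane → Plane} {D : Plane → (Plane →L[ℝ] Plane)} (hβ : Continuous β) (hD : Continuous D)
    (h : ∀ x ∈ Ω, HasFDerivAt β (D x) x) {L B : ℝ} (hL : ∀ x ∈ closure Ω, ‖D x‖ ≤ L)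
    (hB : ∀ x ∈ closure Ω, ‖β x‖ ≤ B) {v : M.W} (hv : M.VanishesOnBoundary v) :
    |M.bForm β v v + 1 / 2 * ∑ i, ∫ x in M.elem i, traceField D x * M.ext v i x ^ 2|
      ≤ (L + B) * convectionConst ρ * (M.meshSize * (M.energy v + M.extSq v)) := by
  obtain ⟨x₀, hx₀⟩ := hΩ.isConnected.nonempty
  have hL0 : 0 ≤ L := (norm_nonneg _).trans (hL x₀ (subset_closure hx₀))
  have hB0 : 0 ≤ B := (norm_nonneg _).trans (hB x₀ (subset_closure hx₀))
  have hfl := M.sum_flux_sq_eq_zero hΩ hρ hM hβ hD h hv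
  choose z hT using M.exists_isStarPolygon hρ hM
  have key (i : Fin M.numElem) :=
    (hT i).abs_convection_sub_le hρ (M.dist_le_diam i) ((M.diam_le_meshSize i).trans hh) hβ hD
      (fun x hx => h x (M.interior_elem_subset hΩ i hx)) (fun x hx => hL x (M.elem_subset i hx))
      (fun x hx => hB x (M.elem_subset i hx)) (M.volume_smul_weakGrad v i) (M.ext v i)
  have e : M.bForm β v v + 1 / 2 * ∑ i, ∫ x in M.elem i, traceField D x * M.ext v i x ^ 2
      = ∑ i, ((∫ x in M.elem i, inner ℝ (β x) (M.weakGrad v i) * M.ext v i x)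
        + 1 / 2 * (∫ x in M.elem i, traceField D x * M.ext v i x ^ 2)
        - 1 / 2 * ∑ e ∈ M.bdry i, dist (M.src e) (M.tgt e) *
        (v e ^ 2 * edgeAvg M.src M.tgt (fun x => inner ℝ (M.normal i e) (β x)) e)) := by
    rw [Finset.sum_sub_distrib, Finset.sum_add_distrib, ← Finset.mul_sum, ← Finset.mul_sum, hfl,
      bForm]
    ring
  rw [e]
  refine (Finset.abs_sum_le_sum_abs _ _).trans ((Finset.sum_le_sum fun i _ => key i).trans ?_)
  rw [← Finset.mul_sum]
  have hC : 0 ≤ (L + B) * convectionConst ρ := by unfold convectionConst; positivity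
  refine mul_le_mul_of_nonneg_left ?_ hC
  rw [mul_add, Finset.sum_add_distrib]
  refine add_le_add (M.sum_residual_add_le hΩ v) ?_
  rw [extSq, Finset.mul_sum]
  exact Finset.sum_le_sum fun i _ => mul_le_mul_of_nonneg_right (M.diam_le_meshSize i)
    (integral_nonneg fun _ => sq_nonneg _)

end PolyMesh

/-! ### The discrete Poincaré inequality -/

namespace PolyMesh

variable {Ω : Set Plane} (M : PolyMesh Ω) {ρ : ℝ}

theorem _root_.convectionConst_nonneg (hρ : 0 < ρ) : 0 ≤ convectionConst ρ := by
  unfold convectionConst; positivity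

theorem integrableOn_elem {f : Plane → ℝ} (hf : Continuous f) (i : Fin M.numElem) :
    IntegrableOn f (M.elem i) := hf.continuousOn.integrableOn_compact (M.isCompact_elem i)

/-- The discrete Poincaré inequality `‖𝔰(v)‖² ≤ C (S(v, v) + ‖∇_w v‖²)` on `W_h⁰`. It is the
discrete skew-symmetry of the convection form for the field `β(x) = x`, whose divergence is `2`. -/
theorem extSq_le (hΩ : IsPolygonalDomain Ω) (hρ : 0 < ρ) (hM : M.IsShapeRegular ρ)
    (hh : M.meshSize ≤ 1) {B : ℝ} (hB : ∀ x ∈ closure Ω, ‖x‖ ≤ B)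
    (hh' : (1 + B) * convectionConst ρ * M.meshSize ≤ 1 / 4) {v : M.W}
    (hv : M.VanishesOnBoundary v) :
    M.extSq v ≤ (2 * B ^ 2 + 1) * M.energy v := by
  obtain ⟨x₀, hx₀⟩ := hΩ.isConnected.nonempty
  have hB0 : 0 ≤ B := (norm_nonneg _).trans (hB x₀ (subset_closure hx₀))
  have h := M.abs_bForm_add_le hΩ hρ hM hh (β := fun x => x)
    (D := fun _ => ContinuousLinearMap.id ℝ Plane) continuous_id continuous_const
    (fun x _ => hasFDerivAt_id x) (fun x _ => ContinuousLinearMap.norm_id_le) hB hv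
  have htr (x : Plane) : traceField (fun _ => ContinuousLinearMap.id ℝ Plane) x = 2 := by
    simp [traceField]
  have e1 : 1 / 2 * ∑ i, ∫ x in M.elem i,
      traceField (fun _ => ContinuousLinearMap.id ℝ Plane) x * M.ext v i x ^ 2 = M.extSq v := by
    simp only [htr, integral_const_mul, ← Finset.mul_sum, extSq]
    ring
  rw [e1] at h
  have h2 : -M.bForm (fun x => x) v v ≤ 1 / 2 * M.extSq v + 1 / 2 * B ^ 2 * M.energy v := by
    have h3 : -M.bForm (fun x => x) v v ≤ ∑ i, (1 / 2 * (∫ x in M.elem i, M.ext v i x ^ 2)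
        + 1 / 2 * B ^ 2 * (volume.real (M.elem i) * ‖M.weakGrad v i‖ ^ 2)) := by
      rw [bForm, ← Finset.sum_neg_distrib]
      refine Finset.sum_le_sum fun i _ => ?_
      have hs := continuous_affine (M.ext v i)
      have e2 : 1 / 2 * (∫ x in M.elem i, M.ext v i x ^ 2)
          + 1 / 2 * B ^ 2 * (volume.real (M.elem i) * ‖M.weakGrad v i‖ ^ 2)
          = ∫ x in M.elem i, (1 / 2 * M.ext v i x ^ 2 + 1 / 2 * B ^ 2 * ‖M.weakGrad v i‖ ^ 2) := by
        rw [integral_add (M.integrableOn_elem (by fun_prop) i)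
          (M.integrableOn_elem (by fun_prop) i), integral_const_mul, setIntegral_const, smul_eq_mul]
        ring
      rw [e2, ← integral_neg]
      refine setIntegral_mono_on (M.integrableOn_elem (by fun_prop) i)
        (M.integrableOn_elem (by fun_prop) i) (M.measurableSet_elem i) fun x hx => ?_
      have h4 : |inner ℝ x (M.weakGrad v i)| ≤ B * ‖M.weakGrad v i‖ :=
        (abs_real_inner_le_norm _ _).trans
          (mul_le_mul_of_nonneg_right (hB x (M.elem_subset i hx)) (norm_nonneg _))
      have h5 : inner ℝ x (M.weakGrad v i) ^ 2 ≤ (B * ‖M.weakGrad v i‖) ^ 2 :=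
        sq_le_sq' (by linarith [neg_abs_le (inner ℝ x (M.weakGrad v i))]) ((le_abs_self _).trans h4)
      nlinarith [sq_nonneg (inner ℝ x (M.weakGrad v i) + M.ext v i x)]
    refine h3.trans ?_
    rw [Finset.sum_add_distrib, ← Finset.mul_sum, ← Finset.mul_sum, extSq, energy]
    have := M.S_self_nonneg hΩ v
    gcongr
    linarith
  have h6 := (abs_le.1 h).2
  have h7 : (1 + B) * convectionConst ρ * (M.meshSize * (M.energy v + M.extSq v))
      ≤ 1 / 4 * (M.energy v + M.extSq v) := by
    rw [← mul_assoc]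
    exact mul_le_mul_of_nonneg_right hh' (add_nonneg (M.energy_nonneg hΩ v) (M.extSq_nonneg v))
  linarith

/-! ### Restriction of Sobolev functions to the elements -/

theorem memLp_elem (hΩ : IsPolygonalDomain Ω) {F : Type*} [NormedAddCommGroup F] {f : Plane → F}
    (hf : MemLp f 2 (volume.restrict Ω)) (i : Fin M.numElem) :
    MemLp f 2 (volume.restrict (M.elem i)) := hf.mono_measure (M.restrict_elem_le hΩ i)

theorem _root_.IsTestFunction.setIntegral_eq {U V : Set Plane} {φ : Plane → ℝ}
    (hφ : IsTestFunction U φ) (hUV : U ⊆ V) (hV : MeasurableSet V)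
    {f : Plane → ℝ} (hf : ∀ x, x ∉ tsupport φ → f x = 0) : ∫ x in V, f x = ∫ x in U, f x :=
  setIntegral_eq_of_subset_of_forall_sdiff_eq_zero hV hUV fun x hx =>
    hf x fun h => hx.2 (hφ.support h)

theorem _root_.gradient_eq_zero_of_notMem_tsupport {φ : Plane → ℝ} {x : Plane}
    (hx : x ∉ tsupport φ) : gradient φ x = 0 := by
  have : fderiv ℝ φ x = 0 := by
    by_contra h
    exact hx (support_fderiv_subset ℝ h)
  simp [gradient, this]

theorem isWeakGradient_elem (hΩ : IsPolygonalDomain Ω) {w : Plane → ℝ} {G : Plane → Plane}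
    (h : IsWeakGradient Ω w G) (i : Fin M.numElem) : IsWeakGradient (interior (M.elem i)) w G := by
  intro φ hφ j
  have hsub := M.interior_elem_subset hΩ i
  have := h φ (hφ.mono hsub) j
  rwa [hφ.setIntegral_eq hsub hΩ.isOpen.measurableSet fun x hx => by
      simp [gradient_eq_zero_of_notMem_tsupport hx],
    hφ.setIntegral_eq hsub hΩ.isOpen.measurableSet fun x hx => by
      simp [image_eq_zero_of_notMem_tsupport hx]] at this

theorem hasL2Gradient_elem (hΩ : IsPolygonalDomain Ω) {w : Plane → ℝ} {G : Plane → Plane}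
    (hw : MemLp w 2 (volume.restrict Ω)) (hG : MemLp G 2 (volume.restrict Ω))
    (h : IsWeakGradient Ω w G) (i : Fin M.numElem) : HasL2Gradient (M.elem i) w G :=
  ⟨M.memLp_elem hΩ hw i, fun j => memLp_coord (M.memLp_elem hΩ hG i) j,
    M.isWeakGradient_elem hΩ h i⟩

end PolyMesh

/-! ### Consistency of the flux over the mesh -/

/-- The hypotheses on the coefficients of the equation, with one common bound `A`, for a field `β`
that is extended, together with its derivative `D`, to a continuous function on the plane. -/
structure AdmissibleCoefficients (Ω : Set Plane) (α : Plane → (Plane →L[ℝ] Plane))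
    (β : Plane → Plane) (D : Plane → (Plane →L[ℝ] Plane)) (c : Plane → ℝ) (α₀ A : ℝ) : Prop where
  norm_diffusion_le : ∀ x ∈ Ω, ‖α x‖ ≤ A
  coercive : ∀ x ∈ Ω, ∀ ξ : Plane, α₀ * ‖ξ‖ ^ 2 ≤ inner ℝ (α x ξ) ξ
  continuous_field : Continuous β
  continuous_deriv : Continuous D
  hasFDerivAt : ∀ x ∈ Ω, HasFDerivAt β (D x) x
  norm_field_le : ∀ x ∈ closure Ω, ‖β x‖ ≤ A
  norm_deriv_le : ∀ x ∈ closure Ω, ‖D x‖ ≤ A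
  norm_le : ∀ x ∈ closure Ω, ‖x‖ ≤ A
  measurable_reaction : AEStronglyMeasurable c (volume.restrict Ω)
  abs_reaction_le : ∀ x ∈ Ω, |c x| ≤ A
  reaction_nonneg : ∀ x ∈ Ω, 0 ≤ c x - 1 / 2 * traceField D x

theorem inner_gradient_eq_sum (q : Plane → Plane) (φ : Plane → ℝ) (x : Plane) :
    inner ℝ (q x) (gradient φ x) = ∑ j, q x j * partialDeriv j φ x :=
  (sum_mul_partialDeriv _ _ _).symm

/-- The residual `β·∇u + cu - f`, which is the weak divergence of `α∇u`. -/
noncomputable def sourceTerm (β : Plane → Plane) (c f u : Plane → ℝ) (G : Plane → Plane)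
    (x : Plane) : ℝ :=
  inner ℝ (β x) (G x) + c x * u x - f x

namespace PolyMesh

variable {Ω : Set Plane} (M : PolyMesh Ω) {ρ : ℝ}

theorem ae_mem_interior_elem (i : Fin M.numElem) :
    ∀ᵐ x ∂volume.restrict (M.elem i), x ∈ interior (M.elem i) := by
  rw [← M.restrict_interior_elem]
  exact ae_restrict_mem isOpen_interior.measurableSet

theorem ae_mem_elem (hΩ : IsPolygonalDomain Ω) (i : Fin M.numElem) :
    ∀ᵐ x ∂volume.restrict (M.elem i), x ∈ Ω :=
  (M.ae_mem_interior_elem i).mono fun _ hx => M.interior_elem_subset hΩ i hx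

theorem integrableOn_of_elem (hΩ : IsPolygonalDomain Ω) {f : Plane → ℝ}
    (h : ∀ i, IntegrableOn f (M.elem i)) : IntegrableOn f Ω := by
  rw [IntegrableOn, ← restrict_closure hΩ, ← M.iUnion_elem]
  exact integrableOn_finite_iUnion.2 h

variable {α : Plane → (Plane →L[ℝ] Plane)} {β : Plane → Plane} {D : Plane → (Plane →L[ℝ] Plane)}
  {c : Plane → ℝ} {α₀ A : ℝ} {L : ℝ≥0} {f u : Plane → ℝ} {G : Plane → Plane}
  {H : Fin 2 → Plane → Plane}

theorem memLp_reaction_mul (hΩ : IsPolygonalDomain Ω) (hc : AdmissibleCoefficients Ω α β D c α₀ A)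
    (i : Fin M.numElem) {w : Plane → ℝ} (hw : MemLp w 2 (volume.restrict (M.elem i))) :
    MemLp (fun x => c x * w x) 2 (volume.restrict (M.elem i)) := by
  refine MemLp.of_le_mul (c := A) hw ((hc.measurable_reaction.mono_measure
    (M.restrict_elem_le hΩ i)).mul hw.aestronglyMeasurable) ?_
  filter_upwards [M.ae_mem_elem hΩ i] with x hx
  rw [norm_mul]
  exact mul_le_mul_of_nonneg_right (hc.abs_reaction_le x hx) (norm_nonneg _)

theorem memLp_inner_field (hΩ : IsPolygonalDomain Ω) (hc : AdmissibleCoefficients Ω α β D c α₀ A)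
    (i : Fin M.numElem) {F : Plane → Plane} (hF : MemLp F 2 (volume.restrict (M.elem i))) :
    MemLp (fun x => inner ℝ (β x) (F x)) 2 (volume.restrict (M.elem i)) := by
  refine MemLp.of_le_mul (c := A) hF
    (hc.continuous_field.aestronglyMeasurable.inner hF.aestronglyMeasurable) ?_
  filter_upwards [M.ae_mem_elem hΩ i] with x hx
  exact (norm_inner_le_norm _ _).trans
    (mul_le_mul_of_nonneg_right (hc.norm_field_le x (subset_closure hx)) (norm_nonneg _))

theorem memLp_sourceTerm (hΩ : IsPolygonalDomain Ω) (hc : AdmissibleCoefficients Ω α β D c α₀ A)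
    (hf : MemLp f 2 (volume.restrict Ω)) (hu : IsH2 Ω u G H) (i : Fin M.numElem) :
    MemLp (sourceTerm β c f u G) 2 (volume.restrict (M.elem i)) :=
  ((M.memLp_inner_field hΩ hc i (M.memLp_elem hΩ hu.memLp_grad i)).add
    (M.memLp_reaction_mul hΩ hc i (M.memLp_elem hΩ hu.memLp i))).sub (M.memLp_elem hΩ hf i)

theorem norm_sub_le_of_lipschitz (hL : ∀ i, LipschitzOnWith L α (interior (M.elem i)))
    (i : Fin M.numElem) : ∀ x ∈ interior (M.elem i), ∀ y ∈ interior (M.elem i),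
      ‖α x - α y‖ ≤ L * ‖x - y‖ := fun x hx y hy => by
  rw [← dist_eq_norm, ← dist_eq_norm]
  exact (hL i).dist_le_mul x hx y hy

theorem memLp_flux_elem (hΩ : IsPolygonalDomain Ω) (hρ : 0 < ρ) (hM : M.IsShapeRegular ρ)
    (hc : AdmissibleCoefficients Ω α β D c α₀ A)
    (hL : ∀ i, LipschitzOnWith L α (interior (M.elem i))) (i : Fin M.numElem) {F : Plane → Plane}
    (hF : MemLp F 2 (volume.restrict (M.elem i))) :
    MemLp (fun x => α x (F x)) 2 (volume.restrict (M.elem i)) := by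
  obtain ⟨z, hT⟩ := M.exists_isStarPolygon hρ hM i
  exact hT.memLp_flux (fun x hx => hc.norm_diffusion_le x (M.interior_elem_subset hΩ i hx))
    (M.norm_sub_le_of_lipschitz hL i) hF

theorem integrableOn_flux_gradient (hΩ : IsPolygonalDomain Ω) (hρ : 0 < ρ)
    (hM : M.IsShapeRegular ρ) (hc : AdmissibleCoefficients Ω α β D c α₀ A)
    (hL : ∀ i, LipschitzOnWith L α (interior (M.elem i))) (hu : IsH2 Ω u G H)
    {φ : Plane → ℝ} (hφ : ContDiff ℝ 1 φ) (i : Fin M.numElem) :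
    IntegrableOn (fun x => inner ℝ (α x (G x)) (gradient φ x)) (M.elem i) := by
  obtain ⟨z, hT⟩ := M.exists_isStarPolygon hρ hM i
  have hq := M.memLp_flux_elem hΩ hρ hM hc hL i (M.memLp_elem hΩ hu.memLp_grad i)
  simp only [inner_gradient_eq_sum (fun x => α x (G x))]
  exact integrable_finsetSum _ fun j _ => hT.integrableOn_mul_of_memLp (memLp_coord hq j)
    (continuous_partialDeriv hφ j)

theorem integrableOn_source_mul (hΩ : IsPolygonalDomain Ω) (hρ : 0 < ρ)
    (hM : M.IsShapeRegular ρ) (hc : AdmissibleCoefficients Ω α β D c α₀ A)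
    (hf : MemLp f 2 (volume.restrict Ω)) (hu : IsH2 Ω u G H) {φ : Plane → ℝ} (hφ : Continuous φ)
    (i : Fin M.numElem) : IntegrableOn (fun x => sourceTerm β c f u G x * φ x) (M.elem i) := by
  obtain ⟨z, hT⟩ := M.exists_isStarPolygon hρ hM i
  exact hT.integrableOn_mul_of_memLp (M.memLp_sourceTerm hΩ hc hf hu i) hφ

/-- The weak form of the equation, with all terms on one side. -/
theorem integral_flux_add_source_eq_zero (hΩ : IsPolygonalDomain Ω) (hρ : 0 < ρ)
    (hM : M.IsShapeRegular ρ) (hc : AdmissibleCoefficients Ω α β D c α₀ A)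
    (hL : ∀ i, LipschitzOnWith L α (interior (M.elem i)))
    (hf : MemLp f 2 (volume.restrict Ω)) (hu : IsH2 Ω u G H) (hsol : SolvesEquation Ω α β c f u G)
    {φ : Plane → ℝ} (hφ : IsTestFunction Ω φ) :
    ∫ x in Ω, (inner ℝ (α x (G x)) (gradient φ x) + sourceTerm β c f u G x * φ x) = 0 := by
  have h := hsol φ hφ
  have i1 : IntegrableOn (fun x => inner ℝ (α x (G x)) (gradient φ x)
      + sourceTerm β c f u G x * φ x) Ω := M.integrableOn_of_elem hΩ fun i =>
    (M.integrableOn_flux_gradient hΩ hρ hM hc hL hu hφ.contDiff_one i).add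
      (M.integrableOn_source_mul hΩ hρ hM hc hf hu hφ.smooth.continuous i)
  have i2 : IntegrableOn (fun x => f x * φ x) Ω := M.integrableOn_of_elem hΩ fun i => by
    obtain ⟨z, hT⟩ := M.exists_isStarPolygon hρ hM i
    exact hT.integrableOn_mul_of_memLp (M.memLp_elem hΩ hf i) hφ.smooth.continuous
  have e (x : Plane) : inner ℝ (α x (G x)) (gradient φ x) + inner ℝ (β x) (G x) * φ x
      + c x * u x * φ x = (inner ℝ (α x (G x)) (gradient φ x) + sourceTerm β c f u G x * φ x)
        + f x * φ x := by
    rw [sourceTerm]; ring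
  simp only [e] at h
  rw [integral_add i1 i2] at h
  linarith

theorem isWeakDivergence_elem (hΩ : IsPolygonalDomain Ω) (hρ : 0 < ρ)
    (hM : M.IsShapeRegular ρ) (hc : AdmissibleCoefficients Ω α β D c α₀ A)
    (hL : ∀ i, LipschitzOnWith L α (interior (M.elem i)))
    (hf : MemLp f 2 (volume.restrict Ω)) (hu : IsH2 Ω u G H) (hsol : SolvesEquation Ω α β c f u G)
    (i : Fin M.numElem) :
    IsWeakDivergence (interior (M.elem i)) (fun j x => α x (G x) j) (sourceTerm β c f u G) := by
  intro φ hφ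
  have hsub := M.interior_elem_subset hΩ i
  have h := M.integral_flux_add_source_eq_zero hΩ hρ hM hc hL hf hu hsol (hφ.mono hsub)
  rw [hφ.setIntegral_eq hsub hΩ.isOpen.measurableSet fun x hx => by
      simp [gradient_eq_zero_of_notMem_tsupport hx, image_eq_zero_of_notMem_tsupport hx],
    M.restrict_interior_elem, integral_add
      (M.integrableOn_flux_gradient hΩ hρ hM hc hL hu hφ.contDiff_one i)
      (M.integrableOn_source_mul hΩ hρ hM hc hf hu hφ.smooth.continuous i)] at h
  simp only [inner_gradient_eq_sum (fun x => α x (G x))] at h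
  rw [M.restrict_interior_elem]
  linarith

/-- The sum of the squared `L²` norms of `∇u` and of the second derivatives. -/
noncomputable def _root_.h2Energy (Ω : Set Plane) (G : Plane → Plane) (H : Fin 2 → Plane → Plane) :
    ℝ := (∑ j, ∫ x in Ω, G x j ^ 2) + ∑ i, ∑ j, ∫ x in Ω, H i x j ^ 2

theorem _root_.integral_norm_sq_eq_sum {S : Set Plane} {F : Plane → Plane}
    (hF : MemLp F 2 (volume.restrict S)) :
    ∫ x in S, ‖F x‖ ^ 2 = ∑ j, ∫ x in S, F x j ^ 2 := by
  have h (j : Fin 2) : Integrable (fun x => F x j ^ 2) (volume.restrict S) :=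
    (memLp_coord hF j).integrable_sq
  rw [← integral_finsetSum _ fun j _ => h j]
  refine integral_congr_ae (ae_of_all _ fun x => ?_)
  simp only [EuclideanSpace.norm_sq_eq, Real.norm_eq_abs, sq_abs]

theorem _root_.IsH2.h2Energy_le (hu : IsH2 Ω u G H) : h2Energy Ω G H ≤ h2Norm Ω u G H ^ 2 := by
  have h1 : 0 ≤ ∫ x in Ω, u x ^ 2 := integral_nonneg fun _ => sq_nonneg _
  have h2 : 0 ≤ ∫ x in Ω, ‖G x‖ ^ 2 := integral_nonneg fun _ => sq_nonneg _
  have h3 : 0 ≤ ∑ i, ∫ x in Ω, ‖H i x‖ ^ 2 :=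
    Finset.sum_nonneg fun _ _ => integral_nonneg fun _ => sq_nonneg _
  have h4 : ∑ i, ∫ x in Ω, ‖H i x‖ ^ 2 = ∑ i, ∑ j, ∫ x in Ω, H i x j ^ 2 :=
    Finset.sum_congr rfl fun i _ => integral_norm_sq_eq_sum (hu.memLp_hess i)
  rw [h2Norm, Real.sq_sqrt (add_nonneg (add_nonneg h1 h2) h3), h2Energy, h4,
    ← integral_norm_sq_eq_sum hu.memLp_grad]
  linarith

theorem sum_integral_sq (hΩ : IsPolygonalDomain Ω) {F : Plane → Plane}
    (hF : MemLp F 2 (volume.restrict Ω)) :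
    ∑ i, ∑ j, ∫ x in M.elem i, F x j ^ 2 = ∑ j, ∫ x in Ω, F x j ^ 2 := by
  rw [Finset.sum_comm]
  exact Finset.sum_congr rfl fun j _ =>
    (M.integral_eq_sum hΩ (memLp_coord hF j).integrable_sq).symm

theorem sum_integral_hess_sq (hΩ : IsPolygonalDomain Ω) (hu : IsH2 Ω u G H) :
    ∑ k, ∑ i, ∑ j, ∫ x in M.elem k, H i x j ^ 2 = ∑ i, ∑ j, ∫ x in Ω, H i x j ^ 2 := by
  rw [Finset.sum_comm]
  exact Finset.sum_congr rfl fun j _ => M.sum_integral_sq hΩ (hu.memLp_hess j)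

theorem _root_.IsH2.sum_hess_le : ∑ i, ∑ j, ∫ x in Ω, H i x j ^ 2 ≤ h2Energy Ω G H := by
  have : 0 ≤ ∑ j, ∫ x in Ω, G x j ^ 2 :=
    Finset.sum_nonneg fun _ _ => integral_nonneg fun _ => sq_nonneg _
  rw [h2Energy]; linarith

theorem _root_.h2Energy_nonneg : 0 ≤ h2Energy Ω G H :=
  add_nonneg (Finset.sum_nonneg fun _ _ => integral_nonneg fun _ => sq_nonneg _)
    (Finset.sum_nonneg fun _ _ => Finset.sum_nonneg fun _ _ => integral_nonneg fun _ => sq_nonneg _)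

theorem _root_.fluxConst_nonneg {A L : ℝ} : 0 ≤ fluxConst ρ A L := by
  unfold fluxConst; positivity

/-- The constant in the bound of the edge jumps of `𝔰(v) - v` by the energy. -/
noncomputable def _root_.jumpConst (ρ : ℝ) : ℝ := 2 + 4 / ρ * (2 + 4 / ρ)

/-- The consistency error of the flux over the whole mesh. The elementwise terms that are not small
cancel: they are the weak form of the equation and the difference of `v` and the test functions on
the edges. -/
theorem abs_sum_flux_le (hΩ : IsPolygonalDomain Ω) (hρ : 0 < ρ)
    (hM : M.IsShapeRegular ρ) (hc : AdmissibleCoefficients Ω α β D c α₀ A)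
    (hL : ∀ i, LipschitzOnWith L α (interior (M.elem i)))
    (hf : MemLp f 2 (volume.restrict Ω)) (hu : IsH2 Ω u G H) (huc : Continuous u)
    (hsol : SolvesEquation Ω α β c f u G) {v : M.W} (hv : M.VanishesOnBoundary v) {τ : ℝ}
    (hτ : 0 < τ) :
    |∑ i, ∫ x in M.elem i, (inner ℝ (α x (G x)) (M.weakGrad v i)
        + sourceTerm β c f u G x * M.ext v i x)|
      ≤ τ / 2 * ((1 + 1 / ρ) * fluxConst ρ A L) * (M.meshSize * h2Energy Ω G H)
        + τ⁻¹ * (1 / ρ * (1 + jumpConst ρ)) * (M.meshSize * M.energy v) := by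
  obtain ⟨Ψ, hΨ, ⟨B, hB⟩, hΨv⟩ := M.exists_isTestFunction_tendsto hΩ hv
  choose z hT using M.exists_isStarPolygon hρ hM
  have hex (i : Fin M.numElem) := (hT i).exists_abs_flux_sub_le hρ (M.dist_le_diam i) huc
    (M.hasL2Gradient_elem hΩ hu.memLp hu.memLp_grad hu.weak_grad i)
    (M.memLp_elem hΩ hu.memLp_grad i)
    (fun j => M.hasL2Gradient_elem hΩ (memLp_coord hu.memLp_grad j) (hu.memLp_hess j)
      (hu.weak_hess j) i)
    (fun x hx => hc.norm_diffusion_le x (M.interior_elem_subset hΩ i hx)) L.coe_nonneg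
    (M.norm_sub_le_of_lipschitz hL i) (M.memLp_sourceTerm hΩ hc hf hu i)
    (M.isWeakDivergence_elem hΩ hρ hM hc hL hf hu hsol i) (M.volume_smul_weakGrad v i) (M.ext v i)
  choose q hq using hex
  set N : Fin M.numElem → ℝ := fun i =>
    (∑ j, ∫ x in M.elem i, G x j ^ 2) + ∑ k, ∑ j, ∫ x in M.elem i, H k x j ^ 2 with hN
  have hN0 (i) : 0 ≤ N i := h2Energy_nonneg
  have hNsum : ∑ i, N i = h2Energy Ω G H := by
    rw [hN, Finset.sum_add_distrib, M.sum_integral_sq hΩ hu.memLp_grad,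
      M.sum_integral_hess_sq hΩ hu, h2Energy]
  -- the estimate with the test function `Ψ k`
  have hk (k : ℕ) : |(∑ i, ∫ x in M.elem i, (inner ℝ (α x (G x)) (M.weakGrad v i)
        + sourceTerm β c f u G x * M.ext v i x))
        - ∑ i, ∑ e ∈ M.bdry i, dist (M.src e) (M.tgt e) *
          (inner ℝ (q i) (M.normal i e) * (v e - edgeAvg M.src M.tgt (Ψ k) e))|
      ≤ τ / 2 * ((1 + 1 / ρ) * fluxConst ρ A L) * (M.meshSize * h2Energy Ω G H)
        + τ⁻¹ * (1 / ρ * ((∑ i, M.residual v i) + ∑ i, ∑ e ∈ M.bdry i, dist (M.src e) (M.tgt e) *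
          edgeAvg M.src M.tgt (fun x => (M.ext v i x - Ψ k x) ^ 2) e)) := by
    have h0 : ∑ i, ∫ x in M.elem i, (inner ℝ (α x (G x)) (gradient (Ψ k) x)
        + sourceTerm β c f u G x * Ψ k x) = 0 := by
      rw [← M.integral_flux_add_source_eq_zero hΩ hρ hM hc hL hf hu hsol (hΨ k)]
      refine (M.integral_eq_sum hΩ (M.integrableOn_of_elem hΩ fun i => ?_)).symm
      exact (M.integrableOn_flux_gradient hΩ hρ hM hc hL hu (hΨ k).contDiff_one i).add
        (M.integrableOn_source_mul hΩ hρ hM hc hf hu (hΨ k).smooth.continuous i)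
    have h1 := (Finset.abs_sum_le_sum_abs _ _).trans
      (Finset.sum_le_sum fun i (_ : i ∈ Finset.univ) => hq i (Ψ k) (hΨ k).smooth τ hτ)
    rw [Finset.sum_sub_distrib, Finset.sum_sub_distrib, h0, sub_zero] at h1
    refine h1.trans ?_
    rw [Finset.sum_add_distrib]
    refine add_le_add ?_ ?_
    · rw [← Finset.mul_sum, ← Finset.mul_sum, mul_assoc, mul_assoc]
      refine mul_le_mul_of_nonneg_left (mul_le_mul_of_nonneg_left ?_ (by positivity))
        (by positivity)
      rw [← hNsum, Finset.mul_sum, Finset.mul_sum]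
      refine Finset.sum_le_sum fun i _ => ?_
      rw [mul_assoc]
      exact mul_le_mul_of_nonneg_left (mul_le_mul_of_nonneg_right (M.diam_le_meshSize i) (hN0 i))
        fluxConst_nonneg
    · rw [← Finset.mul_sum, ← Finset.mul_sum, Finset.sum_add_distrib]
      rfl
  -- in the limit `k → ∞` the fluxes of the constant vectors `q i` disappear
  have hlim1 : Tendsto (fun k => ∑ i, ∑ e ∈ M.bdry i, dist (M.src e) (M.tgt e) *
      (inner ℝ (q i) (M.normal i e) * (v e - edgeAvg M.src M.tgt (Ψ k) e))) atTop (𝓝 0) := by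
    have : Tendsto (fun k => ∑ i, ∑ e ∈ M.bdry i, dist (M.src e) (M.tgt e) *
      (inner ℝ (q i) (M.normal i e) * (v e - edgeAvg M.src M.tgt (Ψ k) e))) atTop
      (𝓝 (∑ i, ∑ e ∈ M.bdry i, dist (M.src e) (M.tgt e) *
      (inner ℝ (q i) (M.normal i e) * (v e - edgeAvg M.src M.tgt (fun _ => v e) e)))) := by
      refine tendsto_finsetSum _ fun i _ => tendsto_finsetSum _ fun e _ =>
        (Tendsto.const_mul _ (Tendsto.const_mul _ (tendsto_const_nhds.sub ?_)))
      exact tendsto_edgeAvg_comp (Φ := fun _ y => y) (by fun_prop)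
        (fun k => (hΨ k).smooth.continuous) hB (hΨv e)
    simpa only [edgeAvg_const, sub_self, mul_zero, Finset.sum_const_zero] using this
  -- and `Ψ k` is replaced by `v` in the jump terms
  have hlim2 : Tendsto (fun k => ∑ i, ∑ e ∈ M.bdry i, dist (M.src e) (M.tgt e) *
      edgeAvg M.src M.tgt (fun x => (M.ext v i x - Ψ k x) ^ 2) e) atTop
      (𝓝 (∑ i, ∑ e ∈ M.bdry i, dist (M.src e) (M.tgt e) *
      edgeAvg M.src M.tgt (fun x => (M.ext v i x - v e) ^ 2) e)) := by
    refine tendsto_finsetSum _ fun i _ => tendsto_finsetSum _ fun e _ => Tendsto.const_mul _ ?_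
    have hs := continuous_affine (M.ext v i)
    exact tendsto_edgeAvg_comp (Φ := fun x y => (M.ext v i x - y) ^ 2) (by fun_prop)
      (fun k => (hΨ k).smooth.continuous) hB (hΨv e)
  have hfin := le_of_tendsto_of_tendsto' ((tendsto_const_nhds.sub hlim1).abs)
    (tendsto_const_nhds.add ((((tendsto_const_nhds.add hlim2).const_mul (1 / ρ))).const_mul τ⁻¹)) hk
  rw [sub_zero] at hfin
  refine hfin.trans ?_
  refine add_le_add_right ?_ _
  rw [mul_assoc τ⁻¹, mul_assoc (1 / ρ)]
  refine mul_le_mul_of_nonneg_left (mul_le_mul_of_nonneg_left ?_ (by positivity)) (by positivity)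
  have hj : ∑ i, ∑ e ∈ M.bdry i, dist (M.src e) (M.tgt e) *
      edgeAvg M.src M.tgt (fun x => (M.ext v i x - v e) ^ 2) e
      ≤ jumpConst ρ * (M.meshSize * M.energy v) := by
    refine le_trans (Finset.sum_le_sum fun i _ => (hT i).sum_edgeAvg_sub_sq_le hρ (M.dist_le_diam i)
      (M.volume_smul_weakGrad v i) (M.ext v i)) ?_
    rw [← Finset.mul_sum]
    exact mul_le_mul_of_nonneg_left (M.sum_residual_add_le hΩ v) (by positivity)
  have hr : ∑ i, M.residual v i ≤ M.meshSize * M.energy v := by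
    rw [M.sum_residual hΩ, energy]
    refine mul_le_mul_of_nonneg_left ?_ (M.meshSize_pos hΩ).le
    exact le_add_of_nonneg_right (Finset.sum_nonneg fun _ _ => by positivity)
  linarith

end PolyMesh

/-! ### Discrete forms and their defects -/

namespace PolyMesh

variable {Ω : Set Plane} (M : PolyMesh Ω) {ρ : ℝ}

theorem weakGrad_sub (v w : M.W) (i : Fin M.numElem) :
    M.weakGrad (v - w) i = M.weakGrad v i - M.weakGrad w i := by
  simp only [weakGrad, ← smul_sub, ← Finset.sum_sub_distrib, ← sub_smul, Pi.sub_apply, sub_mul]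

/-- The least-squares fit is unique, hence linear in the data: an affine function vanishing at all
edge midpoints has zero gradient by the divergence theorem. -/
theorem ext_sub (hρ : 0 < ρ) (hM : M.IsShapeRegular ρ) (v w : M.W) (i : Fin M.numElem) :
    M.ext (v - w) i = M.ext v i - M.ext w i := by
  obtain ⟨z, hT⟩ := M.exists_isStarPolygon hρ hM i
  set σ := M.ext (v - w) i - (M.ext v i - M.ext w i) with hσ
  have h1 : ∑ e ∈ M.bdry i, σ (midpoint ℝ (M.src e) (M.tgt e)) ^ 2 * dist (M.src e) (M.tgt e)
      = 0 := by
    have h2 := M.ext_spec_midpoint (v - w) i σ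
    have h3 := M.ext_spec_midpoint v i σ
    have h4 := M.ext_spec_midpoint w i σ
    have h5 : ∑ e ∈ M.bdry i, σ (midpoint ℝ (M.src e) (M.tgt e)) ^ 2 * dist (M.src e) (M.tgt e)
      = (∑ e ∈ M.bdry i, (M.ext (v - w) i (midpoint ℝ (M.src e) (M.tgt e)) - (v - w) e)
        * σ (midpoint ℝ (M.src e) (M.tgt e)) * dist (M.src e) (M.tgt e))
      - ((∑ e ∈ M.bdry i, (M.ext v i (midpoint ℝ (M.src e) (M.tgt e)) - v e)
        * σ (midpoint ℝ (M.src e) (M.tgt e)) * dist (M.src e) (M.tgt e))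
      - ∑ e ∈ M.bdry i, (M.ext w i (midpoint ℝ (M.src e) (M.tgt e)) - w e)
        * σ (midpoint ℝ (M.src e) (M.tgt e)) * dist (M.src e) (M.tgt e)) := by
      rw [← Finset.sum_sub_distrib, ← Finset.sum_sub_distrib]
      refine Finset.sum_congr rfl fun e _ => ?_
      have h6 : σ (midpoint ℝ (M.src e) (M.tgt e))
          = M.ext (v - w) i (midpoint ℝ (M.src e) (M.tgt e))
        - (M.ext v i (midpoint ℝ (M.src e) (M.tgt e))
        - M.ext w i (midpoint ℝ (M.src e) (M.tgt e))) := rfl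
      rw [Pi.sub_apply]
      linear_combination (σ (midpoint ℝ (M.src e) (M.tgt e)) * dist (M.src e) (M.tgt e)) * h6
    rw [h5, h2, h3, h4]; ring
  have h7 : ∀ e ∈ M.bdry i, σ (midpoint ℝ (M.src e) (M.tgt e)) = 0 := fun e he => by
    have := (Finset.sum_eq_zero_iff_of_nonneg fun e _ =>
      mul_nonneg (sq_nonneg _) dist_nonneg).1 h1 e he
    have hd : dist (M.src e) (M.tgt e) ≠ 0 := (dist_pos.2 (M.src_ne_tgt e)).ne'
    simpa [hd] using this
  have h8 : affineGrad σ = 0 := by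
    have := hT.volume_smul_affineGrad σ
    rw [Finset.sum_eq_zero fun e he => by rw [h7 e he]; simp] at this
    exact (smul_eq_zero.1 this).resolve_left hT.volume_pos.ne'
  have h9 := hT.integral_affine_sq_le hρ (M.dist_le_diam i) σ
  rw [h1, mul_zero] at h9
  have h10 := hT.affine_sq_le (M.dist_le_diam i) σ hT.center_mem
  rw [h8, norm_zero] at h10
  have h11 : σ z = 0 := by
    have h12 : volume.real (M.elem i) * σ z ^ 2 ≤ 0 := by nlinarith
    have h13 : σ z ^ 2 ≤ 0 := nonpos_of_mul_nonpos_right h12 hT.volume_pos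
    exact pow_eq_zero_iff two_ne_zero |>.1 (le_antisymm h13 (sq_nonneg _))
  refine AffineMap.ext fun x => ?_
  have h14 : σ x = 0 := by rw [affine_eq_add_inner σ x z, h8, h11]; simp
  rw [← sub_eq_zero]
  exact h14

theorem ext_sub_apply (hρ : 0 < ρ) (hM : M.IsShapeRegular ρ) (v w : M.W) (i : Fin M.numElem)
    (x : Plane) : M.ext (v - w) i x = M.ext v i x - M.ext w i x := by
  rw [M.ext_sub hρ hM]; rfl

theorem S_sub_left (hρ : 0 < ρ) (hM : M.IsShapeRegular ρ) (v w y : M.W) :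
    M.S (v - w) y = M.S v y - M.S w y := by
  simp only [S, ← Finset.sum_sub_distrib, ← mul_sub, M.ext_sub_apply hρ hM, Pi.sub_apply]
  refine Finset.sum_congr rfl fun i _ => ?_
  congr 1
  exact Finset.sum_congr rfl fun e _ => by ring

/-- The Cauchy–Schwarz inequality for the stabilizer, with Young's inequality. -/
theorem S_le (hΩ : IsPolygonalDomain Ω) (v w : M.W) {δ : ℝ} (hδ : 0 < δ) :
    M.S v w ≤ δ / 2 * M.S w w + (2 * δ)⁻¹ * M.S v v := by
  simp only [S, Finset.mul_sum, ← Finset.sum_add_distrib]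
  refine Finset.sum_le_sum fun i _ => Finset.sum_le_sum fun e _ => ?_
  set a := M.ext v i (M.mid e) - v e
  set b := M.ext w i (M.mid e) - w e
  have h1 : a * b ≤ δ / 2 * (b * b) + (2 * δ)⁻¹ * (a * a) := by
    have : δ / 2 * (b * b) + (2 * δ)⁻¹ * (a * a) - a * b = (2 * δ)⁻¹ * (a - δ * b) ^ 2 := by
      field_simp; ring
    have h2 : 0 ≤ (2 * δ)⁻¹ * (a - δ * b) ^ 2 := by positivity
    linarith
  have h3 : 0 ≤ M.meshSize⁻¹ * M.len e :=
    mul_nonneg (inv_nonneg.2 (M.meshSize_pos hΩ).le) dist_nonneg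
  have := mul_le_mul_of_nonneg_left h1 h3
  linarith

variable {α : Plane → (Plane →L[ℝ] Plane)} {β : Plane → Plane} {D : Plane → (Plane →L[ℝ] Plane)}
  {c : Plane → ℝ} {α₀ A : ℝ} {L : ℝ≥0} {f u : Plane → ℝ} {G : Plane → Plane}
  {H : Fin 2 → Plane → Plane}

theorem memLp_const_elem {F : Type*} [NormedAddCommGroup F] (p : F) (i : Fin M.numElem) :
    MemLp (fun _ => p) 2 (volume.restrict (M.elem i)) := by
  have : IsFiniteMeasure (volume.restrict (M.elem i)) :=
    ⟨by rw [Measure.restrict_apply_univ]; exact (M.isCompact_elem i).measure_lt_top⟩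
  exact memLp_const p

theorem integrableOn_mul_ext (hρ : 0 < ρ) (hM : M.IsShapeRegular ρ) {i : Fin M.numElem}
    {w : Plane → ℝ} (hw : MemLp w 2 (volume.restrict (M.elem i))) (v : M.W) :
    IntegrableOn (fun x => w x * M.ext v i x) (M.elem i) := by
  obtain ⟨z, hT⟩ := M.exists_isStarPolygon hρ hM i
  exact hT.integrableOn_mul_of_memLp hw (continuous_affine _)

theorem integrableOn_inner_const {i : Fin M.numElem}
    {F : Plane → Plane} (hF : MemLp F 2 (volume.restrict (M.elem i))) (p : Plane) :
    IntegrableOn (fun x => inner ℝ (F x) p) (M.elem i) := by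
  have : IsFiniteMeasure (volume.restrict (M.elem i)) :=
    ⟨by rw [Measure.restrict_apply_univ]; exact (M.isCompact_elem i).measure_lt_top⟩
  exact (hF.integrable (by norm_num)).inner_const p

theorem memLp_ext (i : Fin M.numElem) (v : M.W) (hρ : 0 < ρ) (hM : M.IsShapeRegular ρ) :
    MemLp (M.ext v i) 2 (volume.restrict (M.elem i)) := by
  obtain ⟨z, hT⟩ := M.exists_isStarPolygon hρ hM i
  exact hT.memLp_of_continuous (continuous_affine _)

/-- `𝓑(v, w) - (α∇u, ∇_w w) - (β·∇u + cu, 𝔰(w))` in terms of the errors of `∇_w v` and `𝔰(v)`. -/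
noncomputable def formDefect (α : Plane → (Plane →L[ℝ] Plane)) (β : Plane → Plane) (c : Plane → ℝ)
    (u : Plane → ℝ) (G : Plane → Plane) (v w : M.W) (i : Fin M.numElem) (x : Plane) : ℝ :=
  inner ℝ (α x (M.weakGrad v i - G x)) (M.weakGrad w i)
    + inner ℝ (β x) (M.weakGrad v i - G x) * M.ext w i x
    + c x * (M.ext v i x - u x) * M.ext w i x

theorem integrableOn_formDefect (hΩ : IsPolygonalDomain Ω) (hρ : 0 < ρ)
    (hM : M.IsShapeRegular ρ) (hc : AdmissibleCoefficients Ω α β D c α₀ A)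
    (hL : ∀ i, LipschitzOnWith L α (interior (M.elem i))) {i : Fin M.numElem}
    (hu : MemLp u 2 (volume.restrict (M.elem i))) (hG : MemLp G 2 (volume.restrict (M.elem i)))
    (v w : M.W) : IntegrableOn (M.formDefect α β c u G v w i) (M.elem i) := by
  have h1 : MemLp (fun x => M.weakGrad v i - G x) 2 (volume.restrict (M.elem i)) :=
    (M.memLp_const_elem _ i).sub hG
  have h2 : MemLp (fun x => M.ext v i x - u x) 2 (volume.restrict (M.elem i)) :=
    (M.memLp_ext i v hρ hM).sub hu
  exact ((M.integrableOn_inner_const (M.memLp_flux_elem hΩ hρ hM hc hL i h1) _).add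
    (M.integrableOn_mul_ext hρ hM (M.memLp_inner_field hΩ hc i h1) w)).add
    (M.integrableOn_mul_ext hρ hM (M.memLp_reaction_mul hΩ hc i h2) w)

theorem forms_eq_sum (hΩ : IsPolygonalDomain Ω) (hρ : 0 < ρ)
    (hM : M.IsShapeRegular ρ) (hc : AdmissibleCoefficients Ω α β D c α₀ A)
    (hL : ∀ i, LipschitzOnWith L α (interior (M.elem i))) (v w : M.W) :
    M.aForm α v w + M.bForm β v w + M.cForm c v w
      = ∑ i, ∫ x in M.elem i, M.formDefect α β c (fun _ => 0) (fun _ => 0) v w i x := by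
  rw [aForm, bForm, cForm, ← Finset.sum_add_distrib, ← Finset.sum_add_distrib]
  refine Finset.sum_congr rfl fun i _ => ?_
  have h1 := M.memLp_const_elem (M.weakGrad v i) i
  have i1 : IntegrableOn (fun x => inner ℝ (α x (M.weakGrad v i)) (M.weakGrad w i)) (M.elem i) :=
    M.integrableOn_inner_const (M.memLp_flux_elem hΩ hρ hM hc hL i h1) _
  have i2 := M.integrableOn_mul_ext hρ hM (M.memLp_inner_field hΩ hc i h1) w
  have i12 : IntegrableOn (fun x => inner ℝ (α x (M.weakGrad v i)) (M.weakGrad w i)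
    + inner ℝ (β x) (M.weakGrad v i) * M.ext w i x) (M.elem i) := i1.add i2
  rw [← integral_add i1 i2, ← integral_add i12
    (M.integrableOn_mul_ext hρ hM (M.memLp_reaction_mul hΩ hc i (M.memLp_ext i v hρ hM)) w)]
  simp only [formDefect, sub_zero]

theorem forms_sub_left (hΩ : IsPolygonalDomain Ω) (hρ : 0 < ρ)
    (hM : M.IsShapeRegular ρ) (hc : AdmissibleCoefficients Ω α β D c α₀ A)
    (hL : ∀ i, LipschitzOnWith L α (interior (M.elem i))) (v v' w : M.W) :
    M.aForm α (v - v') w + M.bForm β (v - v') w + M.cForm c (v - v') w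
      = (M.aForm α v w + M.bForm β v w + M.cForm c v w)
        - (M.aForm α v' w + M.bForm β v' w + M.cForm c v' w) := by
  simp only [M.forms_eq_sum hΩ hρ hM hc hL]
  rw [← Finset.sum_sub_distrib]
  refine Finset.sum_congr rfl fun i _ => ?_
  have h0 := M.memLp_const_elem (0 : ℝ) i
  have h1 := M.memLp_const_elem (0 : Plane) i
  rw [← integral_sub (M.integrableOn_formDefect hΩ hρ hM hc hL h0 h1 v w)
    (M.integrableOn_formDefect hΩ hρ hM hc hL h0 h1 v' w)]
  refine integral_congr_ae (ae_of_all _ fun x => ?_)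
  simp only [formDefect, sub_zero, M.weakGrad_sub, M.ext_sub_apply hρ hM, map_sub, inner_sub_left,
    inner_sub_right]
  ring

/-- The defect of an approximation `v` of `u` in the discrete equation tested with `w`. -/
theorem forms_sub_source (hΩ : IsPolygonalDomain Ω) (hρ : 0 < ρ)
    (hM : M.IsShapeRegular ρ) (hc : AdmissibleCoefficients Ω α β D c α₀ A)
    (hL : ∀ i, LipschitzOnWith L α (interior (M.elem i)))
    (hf : MemLp f 2 (volume.restrict Ω)) (hu : IsH2 Ω u G H) (v w : M.W) :
    M.aForm α v w + M.bForm β v w + M.cForm c v w - ∑ i, ∫ x in M.elem i, f x * M.ext w i x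
      = (∑ i, ∫ x in M.elem i, M.formDefect α β c u G v w i x)
        + ∑ i, ∫ x in M.elem i, (inner ℝ (α x (G x)) (M.weakGrad w i)
          + sourceTerm β c f u G x * M.ext w i x) := by
  rw [M.forms_eq_sum hΩ hρ hM hc hL, ← Finset.sum_sub_distrib, ← Finset.sum_add_distrib]
  refine Finset.sum_congr rfl fun i _ => ?_
  have hGi := M.memLp_elem hΩ hu.memLp_grad i
  have i1 : IntegrableOn (fun x => inner ℝ (α x (G x)) (M.weakGrad w i)
      + sourceTerm β c f u G x * M.ext w i x) (M.elem i) :=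
    (M.integrableOn_inner_const (M.memLp_flux_elem hΩ hρ hM hc hL i hGi) _).add
      (M.integrableOn_mul_ext hρ hM (M.memLp_sourceTerm hΩ hc hf hu i) w)
  rw [← integral_sub (M.integrableOn_formDefect hΩ hρ hM hc hL (M.memLp_const_elem (0 : ℝ) i)
      (M.memLp_const_elem (0 : Plane) i) v w)
    (M.integrableOn_mul_ext hρ hM (M.memLp_elem hΩ hf i) w),
    ← integral_add (M.integrableOn_formDefect hΩ hρ hM hc hL (M.memLp_elem hΩ hu.memLp i) hGi v w)
      i1]
  refine integral_congr_ae (ae_of_all _ fun x => ?_)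
  simp only [formDefect, sourceTerm, sub_zero, map_sub, inner_sub_left, inner_sub_right]
  ring

/-- The defect is bounded by the test function, with a small factor `δ`, and by the errors of `v`
(Young's inequality). -/
theorem integral_formDefect_le (hΩ : IsPolygonalDomain Ω) (hρ : 0 < ρ)
    (hM : M.IsShapeRegular ρ) (hc : AdmissibleCoefficients Ω α β D c α₀ A) (hA : 0 ≤ A)
    (hL : ∀ i, LipschitzOnWith L α (interior (M.elem i))) (hu : IsH2 Ω u G H) (v w : M.W) {δ : ℝ}
    (hδ : 0 < δ) :
    ∑ i, ∫ x in M.elem i, M.formDefect α β c u G v w i x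
      ≤ δ / 2 * (A * ((∑ i, volume.real (M.elem i) * ‖M.weakGrad w i‖ ^ 2) + 2 * M.extSq w))
        + (2 * δ)⁻¹ * (A * (2 * (∑ i, ∫ x in M.elem i, ‖M.weakGrad v i - G x‖ ^ 2)
          + ∑ i, ∫ x in M.elem i, (M.ext v i x - u x) ^ 2)) := by
  have key (i : Fin M.numElem) : ∫ x in M.elem i, M.formDefect α β c u G v w i x
      ≤ δ / 2 * (A * (volume.real (M.elem i) * ‖M.weakGrad w i‖ ^ 2
          + 2 * ∫ x in M.elem i, M.ext w i x ^ 2))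
        + (2 * δ)⁻¹ * (A * (2 * (∫ x in M.elem i, ‖M.weakGrad v i - G x‖ ^ 2)
          + ∫ x in M.elem i, (M.ext v i x - u x) ^ 2)) := by
    have hGi := M.memLp_elem hΩ hu.memLp_grad i
    have hui := M.memLp_elem hΩ hu.memLp i
    have i1 : IntegrableOn (fun x => ‖M.weakGrad v i - G x‖ ^ 2) (M.elem i) :=
      ((M.memLp_const_elem (M.weakGrad v i) i).sub hGi).norm.integrable_sq
    have i2 : IntegrableOn (fun x => (M.ext v i x - u x) ^ 2) (M.elem i) :=
      ((M.memLp_ext i v hρ hM).sub hui).integrable_sq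
    have i3 : IntegrableOn (fun x => M.ext w i x ^ 2) (M.elem i) :=
      (M.memLp_ext i w hρ hM).integrable_sq
    have i4 : IntegrableOn (fun _ => ‖M.weakGrad w i‖ ^ 2) (M.elem i) :=
      M.integrableOn_elem continuous_const i
    have i5 : IntegrableOn (fun x => ‖M.weakGrad w i‖ ^ 2 + 2 * M.ext w i x ^ 2) (M.elem i) :=
      i4.add (i3.const_mul 2)
    have i6 : IntegrableOn (fun x => 2 * ‖M.weakGrad v i - G x‖ ^ 2 + (M.ext v i x - u x) ^ 2)
      (M.elem i) := (i1.const_mul 2).add i2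
    have e : δ / 2 * (A * (volume.real (M.elem i) * ‖M.weakGrad w i‖ ^ 2
          + 2 * ∫ x in M.elem i, M.ext w i x ^ 2))
        + (2 * δ)⁻¹ * (A * (2 * (∫ x in M.elem i, ‖M.weakGrad v i - G x‖ ^ 2)
          + ∫ x in M.elem i, (M.ext v i x - u x) ^ 2))
        = ∫ x in M.elem i, (δ / 2 * (A * (‖M.weakGrad w i‖ ^ 2 + 2 * M.ext w i x ^ 2))
          + (2 * δ)⁻¹ * (A * (2 * ‖M.weakGrad v i - G x‖ ^ 2 + (M.ext v i x - u x) ^ 2))) := by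
      rw [integral_add ((i5.const_mul A).const_mul (δ / 2)) ((i6.const_mul A).const_mul (2 * δ)⁻¹)]
      simp only [integral_const_mul]
      rw [integral_add i4 (i3.const_mul 2), integral_add (i1.const_mul 2) i2]
      simp only [integral_const_mul, setIntegral_const, smul_eq_mul]
    rw [e]
    refine integral_mono_ae (M.integrableOn_formDefect hΩ hρ hM hc hL hui hGi v w)
      (((i5.const_mul A).const_mul (δ / 2)).add ((i6.const_mul A).const_mul (2 * δ)⁻¹)) ?_
    filter_upwards [M.ae_mem_elem hΩ i] with x hx
    have am (a b : ℝ) : a * b ≤ δ / 2 * b ^ 2 + (2 * δ)⁻¹ * a ^ 2 := by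
      have : δ / 2 * b ^ 2 + (2 * δ)⁻¹ * a ^ 2 - a * b = (2 * δ)⁻¹ * (a - δ * b) ^ 2 := by
        field_simp; ring
      have h2 : 0 ≤ (2 * δ)⁻¹ * (a - δ * b) ^ 2 := by positivity
      linarith
    set p := M.weakGrad v i - G x
    have b1 : inner ℝ (α x p) (M.weakGrad w i) ≤ A * (‖p‖ * ‖M.weakGrad w i‖) := by
      rw [← mul_assoc]
      exact (real_inner_le_norm _ _).trans (mul_le_mul_of_nonneg_right
        ((α x).le_of_opNorm_le (hc.norm_diffusion_le x hx) _) (norm_nonneg _))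
    have b2 : inner ℝ (β x) p * M.ext w i x ≤ A * (‖p‖ * |M.ext w i x|) := by
      refine (le_abs_self _).trans ?_
      rw [abs_mul, ← mul_assoc]
      exact mul_le_mul_of_nonneg_right ((abs_real_inner_le_norm _ _).trans
        (mul_le_mul_of_nonneg_right (hc.norm_field_le x (subset_closure hx)) (norm_nonneg _)))
        (abs_nonneg _)
    have b3 : c x * (M.ext v i x - u x) * M.ext w i x
        ≤ A * (|M.ext v i x - u x| * |M.ext w i x|) := by
      refine (le_abs_self _).trans ?_
      rw [abs_mul, abs_mul, ← mul_assoc]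
      gcongr
      exact hc.abs_reaction_le x hx
    have c1 := mul_le_mul_of_nonneg_left (am ‖p‖ ‖M.weakGrad w i‖) hA
    have c2 := mul_le_mul_of_nonneg_left (am ‖p‖ |M.ext w i x|) hA
    have c3 := mul_le_mul_of_nonneg_left (am |M.ext v i x - u x| |M.ext w i x|) hA
    rw [sq_abs] at c2
    rw [sq_abs, sq_abs] at c3
    rw [formDefect]
    linarith
  refine (Finset.sum_le_sum fun i _ => key i).trans_eq ?_
  simp only [Finset.sum_add_distrib, ← Finset.mul_sum, extSq]

/-- The interpolation errors of `Q_b u`: the stabilizer, the error of the extension, and the error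
of the weak gradient. -/
theorem S_Qb_le (hΩ : IsPolygonalDomain Ω) (hρ : 0 < ρ) (hM : M.IsShapeRegular ρ)
    (hu : IsH2 Ω u G H) (huc : Continuous u) :
    M.S (M.Qb u) (M.Qb u) ≤ approxConst ρ * (M.meshSize ^ 2 * h2Energy Ω G H) ∧
    ∑ i, ∫ x in M.elem i, (M.ext (M.Qb u) i x - u x) ^ 2
      ≤ (2 * ((1 + 4 / ρ) * approxConst ρ) + 2 * (4 / ρ ^ 2) ^ 2)
        * (M.meshSize ^ 4 * h2Energy Ω G H) ∧
    ∑ i, ∫ x in M.elem i, ‖M.weakGrad (M.Qb u) i - G x‖ ^ 2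
      ≤ 4 / ρ ^ 2 * (M.meshSize ^ 2 * h2Energy Ω G H) := by
  choose z hT using M.exists_isStarPolygon hρ hM
  have hh := M.meshSize_pos hΩ
  have hgr (i : Fin M.numElem) := M.hasL2Gradient_elem hΩ hu.memLp hu.memLp_grad hu.weak_grad i
  have hgr2 (i : Fin M.numElem) (j : Fin 2) := M.hasL2Gradient_elem hΩ
    (memLp_coord hu.memLp_grad j) (hu.memLp_hess j) (hu.weak_hess j) i
  have h1 (i : Fin M.numElem) := (hT i).leastSquares_consistency hρ (M.dist_le_diam i) huc (hgr i)
    (hgr2 i) (s := M.ext (M.Qb u) i) (M.ext_spec_midpoint (M.Qb u) i)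
  have h2 (i : Fin M.numElem) := (hT i).gradient_consistency hρ (M.dist_le_diam i) huc (hgr i)
    (hgr2 i) (M.volume_smul_weakGrad (M.Qb u) i)
  have hap : 0 ≤ approxConst ρ := by unfold approxConst; positivity
  have hsum (k : ℕ) : ∑ i, Metric.diam (M.elem i) ^ k * ∑ l, ∑ j, ∫ x in M.elem i, H l x j ^ 2
      ≤ M.meshSize ^ k * h2Energy Ω G H := by
    refine le_trans ?_ (mul_le_mul_of_nonneg_left IsH2.sum_hess_le (pow_nonneg hh.le k))
    rw [← M.sum_integral_hess_sq hΩ hu, Finset.mul_sum]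
    refine Finset.sum_le_sum fun i _ => mul_le_mul_of_nonneg_right
      (pow_le_pow_left₀ Metric.diam_nonneg (M.diam_le_meshSize i) k) ?_
    exact Finset.sum_nonneg fun _ _ => Finset.sum_nonneg fun _ _ =>
      integral_nonneg fun _ => sq_nonneg _
  refine ⟨?_, ?_, ?_⟩
  · rw [S_self]
    have h3 : ∑ i, M.residual (M.Qb u) i ≤ approxConst ρ * (M.meshSize ^ 3 * h2Energy Ω G H) := by
      refine (Finset.sum_le_sum fun i _ => (h1 i).1).trans ?_
      simp only [mul_assoc, ← Finset.mul_sum]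
      exact mul_le_mul_of_nonneg_left (hsum 3) hap
    refine (mul_le_mul_of_nonneg_left h3 (inv_nonneg.2 hh.le)).trans_eq ?_
    field_simp
  · refine (Finset.sum_le_sum fun i _ => (h1 i).2).trans ?_
    simp only [mul_assoc, ← Finset.mul_sum]
    exact mul_le_mul_of_nonneg_left (hsum 4) (by positivity)
  · have h4 (i : Fin M.numElem) : ∫ x in M.elem i, ‖M.weakGrad (M.Qb u) i - G x‖ ^ 2
        = ∑ j, ∫ x in M.elem i, (G x j - M.weakGrad (M.Qb u) i j) ^ 2 := by
      simp only [norm_sub_rev (M.weakGrad (M.Qb u) i)]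
      exact integral_norm_sq_eq_sum
        ((M.memLp_elem hΩ hu.memLp_grad i).sub (M.memLp_const_elem (M.weakGrad (M.Qb u) i) i))
    simp only [h4]
    refine (Finset.sum_le_sum fun i _ => h2 i).trans ?_
    simp only [mul_assoc, ← Finset.mul_sum]
    exact mul_le_mul_of_nonneg_left (hsum 2) (by positivity)

end PolyMesh

/-! ### The error estimate -/

namespace PolyMesh

variable {Ω : Set Plane} (M : PolyMesh Ω) {ρ : ℝ}
  {α : Plane → (Plane →L[ℝ] Plane)} {β : Plane → Plane} {D : Plane → (Plane →L[ℝ] Plane)}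
  {c : Plane → ℝ} {α₀ A : ℝ} {L : ℝ≥0} {f u : Plane → ℝ} {G : Plane → Plane}
  {H : Fin 2 → Plane → Plane}

/-- The lower-order terms are almost nonnegative, as `c - ½∇·β ≥ 0`. -/
theorem neg_le_bForm_add_cForm (hΩ : IsPolygonalDomain Ω) (hρ : 0 < ρ) (hM : M.IsShapeRegular ρ)
    (hh : M.meshSize ≤ 1) (hc : AdmissibleCoefficients Ω α β D c α₀ A) {v : M.W}
    (hv : M.VanishesOnBoundary v) :
    -((A + A) * convectionConst ρ * (M.meshSize * (M.energy v + M.extSq v)))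
      ≤ M.bForm β v v + M.cForm c v v := by
  have h1 := M.abs_bForm_add_le hΩ hρ hM hh hc.continuous_field hc.continuous_deriv hc.hasFDerivAt
    hc.norm_deriv_le hc.norm_field_le hv
  have h2 : 1 / 2 * ∑ i, ∫ x in M.elem i, traceField D x * M.ext v i x ^ 2 ≤ M.cForm c v v := by
    rw [cForm, Finset.mul_sum]
    refine Finset.sum_le_sum fun i _ => ?_
    have hs := continuous_affine (M.ext v i)
    have htr := continuous_traceField hc.continuous_deriv
    rw [← integral_const_mul]
    refine integral_mono_ae (M.integrableOn_elem (by fun_prop) i)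
      (M.integrableOn_mul_ext hρ hM (M.memLp_reaction_mul hΩ hc i (M.memLp_ext i v hρ hM)) v) ?_
    filter_upwards [M.ae_mem_elem hΩ i] with x hx
    have := mul_nonneg (hc.reaction_nonneg x hx) (sq_nonneg (M.ext v i x))
    linarith
  have h3 := (abs_le.1 h1).1
  linarith

theorem coercive_le_aForm (hΩ : IsPolygonalDomain Ω) (hρ : 0 < ρ) (hM : M.IsShapeRegular ρ)
    (hc : AdmissibleCoefficients Ω α β D c α₀ A)
    (hL : ∀ i, LipschitzOnWith L α (interior (M.elem i))) (v : M.W) :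
    α₀ * ∑ i, volume.real (M.elem i) * ‖M.weakGrad v i‖ ^ 2 ≤ M.aForm α v v := by
  rw [aForm, Finset.mul_sum]
  refine Finset.sum_le_sum fun i _ => ?_
  have h : α₀ * (volume.real (M.elem i) * ‖M.weakGrad v i‖ ^ 2)
      = ∫ x in M.elem i, α₀ * ‖M.weakGrad v i‖ ^ 2 := by
    rw [setIntegral_const, smul_eq_mul]; ring
  rw [h]
  refine integral_mono_ae (M.integrableOn_elem continuous_const i) (M.integrableOn_inner_const
    (M.memLp_flux_elem hΩ hρ hM hc hL i (M.memLp_const_elem (M.weakGrad v i) i)) _) ?_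
  filter_upwards [M.ae_mem_elem hΩ i] with x hx using hc.coercive x hx _

/-- The error equation: the scheme is consistent up to the terms bounded by
`integral_formDefect_le`, `abs_sum_flux_le` and the stabilizer of `Q_b u`. -/
theorem error_equation (hΩ : IsPolygonalDomain Ω) (hρ : 0 < ρ) (hM : M.IsShapeRegular ρ)
    (hc : AdmissibleCoefficients Ω α β D c α₀ A)
    (hL : ∀ i, LipschitzOnWith L α (interior (M.elem i)))
    (hf : MemLp f 2 (volume.restrict Ω)) (hu : IsH2 Ω u G H) {κ : ℝ} {v u_b w : M.W}
    (hsol : κ * M.S u_b w + (M.aForm α u_b w + M.bForm β u_b w + M.cForm c u_b w)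
      = ∑ i, ∫ x in M.elem i, f x * M.ext w i x) :
    κ * M.S (v - u_b) w
        + (M.aForm α (v - u_b) w + M.bForm β (v - u_b) w + M.cForm c (v - u_b) w)
      = κ * M.S v w + (∑ i, ∫ x in M.elem i, M.formDefect α β c u G v w i x)
        + ∑ i, ∫ x in M.elem i, (inner ℝ (α x (G x)) (M.weakGrad w i)
          + sourceTerm β c f u G x * M.ext w i x) := by
  have h := M.forms_sub_source hΩ hρ hM hc hL hf hu v w
  rw [M.S_sub_left hρ hM, M.forms_sub_left hΩ hρ hM hc hL]
  linarith

/-- The triangle inequality for the gradient error, through the weak gradient of `v`. -/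
theorem gradError_sq_le (hΩ : IsPolygonalDomain Ω) (hu : IsH2 Ω u G H) (v u_b : M.W) :
    ∑ i, ∫ x in M.elem i, ‖M.weakGrad u_b i - G x‖ ^ 2
      ≤ 2 * (∑ i, ∫ x in M.elem i, ‖M.weakGrad v i - G x‖ ^ 2)
        + 2 * ∑ i, volume.real (M.elem i) * ‖M.weakGrad (v - u_b) i‖ ^ 2 := by
  rw [Finset.mul_sum, Finset.mul_sum, ← Finset.sum_add_distrib]
  refine Finset.sum_le_sum fun i _ => ?_
  have hGi := M.memLp_elem hΩ hu.memLp_grad i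
  have i1 (v : M.W) : IntegrableOn (fun x => ‖M.weakGrad v i - G x‖ ^ 2) (M.elem i) :=
    ((M.memLp_const_elem (M.weakGrad v i) i).sub hGi).norm.integrable_sq
  have i2 : IntegrableOn (fun _ => 2 * ‖M.weakGrad (v - u_b) i‖ ^ 2) (M.elem i) :=
    M.integrableOn_elem continuous_const i
  have e : 2 * (∫ x in M.elem i, ‖M.weakGrad v i - G x‖ ^ 2)
        + 2 * (volume.real (M.elem i) * ‖M.weakGrad (v - u_b) i‖ ^ 2)
      = ∫ x in M.elem i, (2 * ‖M.weakGrad v i - G x‖ ^ 2 + 2 * ‖M.weakGrad (v - u_b) i‖ ^ 2) := by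
    rw [integral_add ((i1 v).const_mul 2) i2, integral_const_mul, setIntegral_const, smul_eq_mul]
    ring
  rw [e]
  refine integral_mono (i1 u_b) (((i1 v).const_mul 2).add i2) fun x => ?_
  have h : M.weakGrad u_b i - G x = (M.weakGrad v i - G x) - M.weakGrad (v - u_b) i := by
    rw [M.weakGrad_sub]; abel
  have h2 := norm_sub_le (M.weakGrad v i - G x) (M.weakGrad (v - u_b) i)
  rw [← h] at h2
  have h3 := pow_le_pow_left₀ (norm_nonneg _) h2 2
  change _ ≤ 2 * ‖M.weakGrad v i - G x‖ ^ 2 + 2 * ‖M.weakGrad (v - u_b) i‖ ^ 2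
  nlinarith [sq_nonneg (‖M.weakGrad v i - G x‖ - ‖M.weakGrad (v - u_b) i‖)]

end PolyMesh

/-- The absorption argument: `X` is the energy norm of the error, controlling `lam Y`, and the terms
on the right-hand side that contain `Y` are absorbed for small `h` and for a suitable `δ`. -/
theorem absorption {X Y lam h N C₀ C₁ C₂ δ : ℝ} (hY : 0 ≤ Y) (hlam : lam * Y ≤ X)
    (hC0 : C₀ * h ≤ lam / 4) (hδ : C₁ * δ ≤ lam / 4)
    (hX : X ≤ C₀ * h * Y + C₁ * δ * Y + C₂ * (h ^ 2 * N)) :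
    X ≤ 2 * C₂ * (h ^ 2 * N) := by
  have h1 := mul_le_mul_of_nonneg_right hC0 hY
  have h2 := mul_le_mul_of_nonneg_right hδ hY
  linarith

/-- The bounds of the terms in the error equation, collected: `s`, `W` are the two parts of the
energy `Y` and `E` is the squared norm of the extension of the error, `Q₁`, `Q₂`, `Q₃` are the
interpolation errors. -/
theorem collect_bounds {κ A P K K₁ K₂ K₃ K₄ K₅ δ h N s W Y E Q₁ Q₂ Q₃ a b c S p q : ℝ}
    (hκ : 0 ≤ κ) (hA : 0 ≤ A) (hK : 0 ≤ K) (hδ : 0 < δ) (hh : 0 < h) (hh1 : h ≤ 1) (hN : 0 ≤ N)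
    (hs : 0 ≤ s) (hW : 0 ≤ W) (hK₅ : 0 ≤ K₅) (hY : Y = s + W) (hE : E ≤ P * Y)
    (heq : κ * s + (a + b + c) = κ * S + p + q)
    (hlow : -((A + A) * K * (h * (Y + E))) ≤ b + c) (hQ₁ : Q₁ ≤ K₃ * (h ^ 2 * N))
    (hQ₂ : Q₂ ≤ K₅ * (h ^ 4 * N)) (hQ₃ : Q₃ ≤ K₄ * (h ^ 2 * N))
    (hS : κ * S ≤ κ * (δ / 2 * s + (2 * δ)⁻¹ * Q₁))
    (hp : p ≤ δ / 2 * (A * (W + 2 * E)) + (2 * δ)⁻¹ * (A * (2 * Q₃ + Q₂)))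
    (hq : q ≤ h / δ / 2 * K₁ * (h * N) + (h / δ)⁻¹ * K₂ * (h * Y)) :
    κ * s + a ≤ 2 * A * K * (1 + P) * h * Y + (κ / 2 + A / 2 * (1 + 2 * P) + K₂) * δ * Y
      + (κ * K₃ + A * (2 * K₄ + K₅) + K₁) * (2 * δ)⁻¹ * (h ^ 2 * N) := by
  have g1 : h / δ / 2 * K₁ * (h * N) = K₁ * (2 * δ)⁻¹ * (h ^ 2 * N) := by
    field_simp
  have g2 : (h / δ)⁻¹ * K₂ * (h * Y) = δ * K₂ * Y := by
    field_simp
  rw [g1, g2] at hq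
  have g3 : (A + A) * K * (h * (Y + E)) ≤ (A + A) * K * (h * (Y + P * Y)) := by gcongr
  have g4 : κ * (δ / 2 * s) ≤ κ * (δ / 2 * Y) := by
    gcongr; linarith
  have g5 : κ * ((2 * δ)⁻¹ * Q₁) ≤ κ * ((2 * δ)⁻¹ * (K₃ * (h ^ 2 * N))) := by gcongr
  have g6 : δ / 2 * (A * (W + 2 * E)) ≤ δ / 2 * (A * (Y + 2 * (P * Y))) := by
    gcongr; linarith
  have g7 : h ^ 4 * N ≤ h ^ 2 * N :=
    mul_le_mul_of_nonneg_right (pow_le_pow_of_le_one hh.le hh1 (by norm_num)) hN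
  have g8 := hQ₂.trans (mul_le_mul_of_nonneg_left g7 hK₅)
  have g9 : (2 * δ)⁻¹ * (A * (2 * Q₃ + Q₂))
      ≤ (2 * δ)⁻¹ * (A * (2 * (K₄ * (h ^ 2 * N)) + K₅ * (h ^ 2 * N))) := by gcongr
  linarith

set_option maxHeartbeats 1000000 in
/-- The error estimate for `β`, its derivative and `u` continuous on the whole plane, with `u`
itself as the boundary data. -/
theorem exists_error_bound {Ω : Set Plane} (hΩ : IsPolygonalDomain Ω)
    {α : Plane → (Plane →L[ℝ] Plane)} {β : Plane → Plane} {D : Plane → (Plane →L[ℝ] Plane)}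
    {c : Plane → ℝ} {α₀ κ ρ A : ℝ} (L : ℝ≥0) (hα₀ : 0 < α₀) (hκ : 0 < κ) (hρ : 0 < ρ)
    (hc : AdmissibleCoefficients Ω α β D c α₀ A) :
    ∃ C h₀ : ℝ, 0 < C ∧ 0 < h₀ ∧
      ∀ M : PolyMesh Ω, M.IsShapeRegular ρ →
        (∀ i, LipschitzOnWith L α (interior (M.elem i))) → M.meshSize ≤ h₀ →
      ∀ (f u : Plane → ℝ) (G : Plane → Plane) (H : Fin 2 → Plane → Plane) (u_b : M.W),
        MemLp f 2 (volume.restrict Ω) → IsH2 Ω u G H → Continuous u →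
        SolvesEquation Ω α β c f u G → M.IsSWGSolution α β c κ f u u_b →
        κ * M.S (M.Qb u - u_b) (M.Qb u - u_b) + M.aForm α (M.Qb u - u_b) (M.Qb u - u_b)
            ≤ C * M.meshSize ^ 2 * h2Norm Ω u G H ^ 2 ∧
          M.gradError u_b G ≤ C * M.meshSize * h2Norm Ω u G H := by
  obtain ⟨x₀, hx₀⟩ := hΩ.isConnected.nonempty
  have hA : 0 ≤ A := (norm_nonneg _).trans (hc.norm_le x₀ (subset_closure hx₀))
  set K := convectionConst ρ with hK
  set P := 2 * A ^ 2 + 1 with hP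
  set lam := min κ α₀ with hlam
  set K₁ := (1 + 1 / ρ) * fluxConst ρ A L with hK₁
  set K₂ := 1 / ρ * (1 + jumpConst ρ) with hK₂
  set K₃ := approxConst ρ with hK₃
  set K₄ := 4 / ρ ^ 2 with hK₄
  set K₅ := 2 * ((1 + 4 / ρ) * approxConst ρ) + 2 * (4 / ρ ^ 2) ^ 2 with hK₅
  have hK0 : 0 ≤ K := convectionConst_nonneg hρ
  have hP0 : 0 ≤ P := by positivity
  have hlam0 : 0 < lam := lt_min hκ hα₀
  have hK₁0 : 0 ≤ K₁ := mul_nonneg (by positivity) fluxConst_nonneg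
  have hK₂0 : 0 ≤ K₂ := by rw [hK₂]; unfold jumpConst; positivity
  have hK₃0 : 0 ≤ K₃ := by rw [hK₃]; unfold approxConst; positivity
  have hK₄0 : 0 ≤ K₄ := by positivity
  have hK₅0 : 0 ≤ K₅ := by
    have : K₅ = 2 * ((1 + 4 / ρ) * K₃) + 2 * (4 / ρ ^ 2) ^ 2 := rfl
    rw [this]; positivity
  set m := κ / 2 + A / 2 * (1 + 2 * P) + K₂ with hm
  have hm0 : 0 < m := by positivity
  -- the parameter of Young's inequality: the terms with the energy of the error and the factor `δ`
  -- add up to at most `lam / 4` times the energy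
  set δ := lam / (4 * m) with hδ
  have hδ0 : 0 < δ := by positivity
  set C₁ := (κ * K₃ + A * (2 * K₄ + K₅) + K₁) * (2 * δ)⁻¹ with hC₁
  have hC₁0 : 0 ≤ C₁ := by positivity
  set C₀ := 2 * A * K * (1 + P) with hC₀
  have hC₀0 : 0 ≤ C₀ := by positivity
  set C' := 2 * K₄ + 2 * (lam⁻¹ * (2 * C₁)) with hC'
  have hC'0 : 0 ≤ C' := by positivity
  have hq (x : ℝ) (hx : 0 ≤ x) {y h : ℝ} (hy : 0 ≤ y) (hh : h ≤ y / (x + 1)) : x * h ≤ y := by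
    have h1 := mul_le_mul_of_nonneg_left hh hx
    refine h1.trans ?_
    rw [mul_div_assoc', div_le_iff₀ (by positivity)]
    nlinarith
  -- the three conditions on the mesh size: `h ≤ 1`, the discrete Poincaré inequality, and the
  -- absorption of the defect of skew-symmetry
  refine ⟨2 * C₁ + 1 + Real.sqrt C', min 1 (min (1 / 4 / ((1 + A) * K + 1)) (lam / 4 / (C₀ + 1))),
    by positivity, by positivity, fun M hM hL hh f u G H u_b hf hu huc hsol hub => ?_⟩
  have hh1 := hh.trans (min_le_left _ _)
  have hh2 := hq ((1 + A) * K) (by positivity) (by norm_num)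
    (hh.trans ((min_le_right _ _).trans (min_le_left _ _)))
  have hh3 := hq C₀ hC₀0 (by positivity) (hh.trans ((min_le_right _ _).trans (min_le_right _ _)))
  have hhp := M.meshSize_pos hΩ
  set h := M.meshSize with hhdef
  set N := h2Energy Ω G H with hN
  have hN0 : 0 ≤ N := h2Energy_nonneg
  have hNle : N ≤ h2Norm Ω u G H ^ 2 := hu.h2Energy_le
  set e := M.Qb u - u_b with he
  have hev : M.VanishesOnBoundary e := fun b hb => by
    rw [he, Pi.sub_apply, hub.1 b hb, sub_self]
  set W := ∑ i, volume.real (M.elem i) * ‖M.weakGrad e i‖ ^ 2 with hW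
  have hW0 : 0 ≤ W := Finset.sum_nonneg fun _ _ => by positivity
  have hS0 := M.S_self_nonneg hΩ e
  have hY0 := M.energy_nonneg hΩ e
  have hYdef : M.energy e = M.S e e + W := rfl
  set Y := M.energy e with hY
  have hE : M.extSq e ≤ P * Y := M.extSq_le hΩ hρ hM hh1 hc.norm_le hh2 hev
  have hcoer := M.coercive_le_aForm hΩ hρ hM hc hL e
  have hlow := M.neg_le_bForm_add_cForm hΩ hρ hM hh1 hc hev
  have heq := M.error_equation hΩ hρ hM hc hL hf hu (v := M.Qb u) (hub.2 e hev)
  rw [← he] at heq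
  obtain ⟨hQ1, hQ2, hQ3⟩ := M.S_Qb_le hΩ hρ hM hu huc
  have hSle := mul_le_mul_of_nonneg_left (M.S_le hΩ (M.Qb u) e hδ0) hκ.le
  have hdef := M.integral_formDefect_le hΩ hρ hM hc hA hL hu (M.Qb u) e hδ0
  -- with `τ = h / δ`, the two flux terms are `O(h²)` and `O(δ)` times the energy
  have hflux := (le_abs_self _).trans (M.abs_sum_flux_le hΩ hρ hM hc hL hf hu huc hsol hev
    (τ := h / δ) (by positivity))
  set X := κ * M.S e e + M.aForm α e e with hX
  have hXY : lam * Y ≤ X := by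
    have h1 := mul_le_mul_of_nonneg_right (min_le_left κ α₀) hS0
    have h2 := mul_le_mul_of_nonneg_right (min_le_right κ α₀) hW0
    rw [hYdef, mul_add]
    linarith
  have hmain : X ≤ C₀ * h * Y + m * δ * Y + C₁ * (h ^ 2 * N) :=
    collect_bounds hκ.le hA hK0 hδ0 hhp hh1 hN0 hS0 hW0 hK₅0 hYdef hE heq hlow hQ1 hQ2 hQ3 hSle
      hdef hflux
  have hmδ : m * δ ≤ lam / 4 := by
    rw [hδ]
    refine le_of_eq ?_
    field_simp
  have hfin := absorption hY0 hXY hh3 hmδ hmain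
  have hN2 : h ^ 2 * N ≤ h ^ 2 * h2Norm Ω u G H ^ 2 := by gcongr
  refine ⟨?_, ?_⟩
  · have h1 := hfin.trans (mul_le_mul_of_nonneg_left hN2 (by positivity))
    have h2 : 0 ≤ (1 + Real.sqrt C') * (h ^ 2 * h2Norm Ω u G H ^ 2) := by positivity
    linarith
  · have h1 := M.gradError_sq_le hΩ hu (M.Qb u) u_b
    have hWY : W ≤ lam⁻¹ * (2 * C₁ * (h ^ 2 * N)) := by
      rw [← div_eq_inv_mul, le_div_iff₀ hlam0]
      have h2 : W ≤ Y := by linarith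
      have h3 := mul_le_mul_of_nonneg_left h2 hlam0.le
      linarith
    have h4 : ∑ i, ∫ x in M.elem i, ‖M.weakGrad u_b i - G x‖ ^ 2
        ≤ C' * (h * h2Norm Ω u G H) ^ 2 := by
      have h5 : C' * (h ^ 2 * N) ≤ C' * (h * h2Norm Ω u G H) ^ 2 := by
        rw [mul_pow]; gcongr
      have h6 : C' * (h ^ 2 * N)
          = 2 * (K₄ * (h ^ 2 * N)) + 2 * (lam⁻¹ * (2 * C₁ * (h ^ 2 * N))) := by
        rw [hC']; ring
      linarith
    have hn0 : 0 ≤ h2Norm Ω u G H := Real.sqrt_nonneg _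
    have h7 : M.gradError u_b G ≤ Real.sqrt C' * (h * h2Norm Ω u G H) := by
      rw [PolyMesh.gradError]
      refine (Real.sqrt_le_sqrt h4).trans_eq ?_
      rw [Real.sqrt_mul hC'0, Real.sqrt_sq (by positivity)]
    have h8 : 0 ≤ (2 * C₁ + 1) * (h * h2Norm Ω u G H) := by positivity
    linarith

/-! ### Extension of the data -/

/-- Continuous functions on the closure of a set extend to the plane (Tietze). -/
theorem exists_continuous_extension {Ω : Set Plane} {Y : Type*} [TopologicalSpace Y]
    [TietzeExtension.{0} Y] {f : Plane → Y} (hf : ContinuousOn f (closure Ω)) :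
    ∃ F : Plane → Y, Continuous F ∧ EqOn F f (closure Ω) := by
  obtain ⟨F, hF⟩ := ContinuousMap.exists_restrict_eq (isClosed_closure (s := Ω))
    ⟨(closure Ω).domRestrict f, hf.domRestrict⟩
  refine ⟨F, F.continuous, fun x hx => ?_⟩
  exact congrArg (fun g : C(closure Ω, Y) => g ⟨x, hx⟩) hF

/-- The coefficients of the problem, with the field `β` replaced by an extension. -/
theorem exists_admissibleCoefficients {Ω : Set Plane} (hΩ : IsPolygonalDomain Ω)
    {α : Plane → (Plane →L[ℝ] Plane)} {β : Plane → Plane} {c : Plane → ℝ} {α₀ : ℝ}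
    (hα_bdd : ∃ A : ℝ, ∀ x ∈ Ω, ‖α x‖ ≤ A)
    (hα_pos : ∀ x ∈ Ω, ∀ ξ : Plane, α₀ * ‖ξ‖ ^ 2 ≤ inner ℝ (α x ξ) ξ)
    (hβ : IsC1UpToBoundary Ω β) (hc_meas : AEStronglyMeasurable c (volume.restrict Ω))
    (hc_bdd : ∃ B : ℝ, ∀ x ∈ Ω, |c x| ≤ B)
    (hc_pos : ∀ x ∈ Ω, 0 ≤ c x - 1 / 2 * divergence β x) :
    ∃ β' D A, EqOn β' β (closure Ω) ∧ AdmissibleCoefficients Ω α β' D c α₀ A := by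
  obtain ⟨hβc, D₀, hD₀, hβD⟩ := hβ
  obtain ⟨β', hβ'c, hβ'⟩ := exists_continuous_extension hβc
  obtain ⟨D, hDc, hD⟩ := exists_continuous_extension hD₀
  obtain ⟨A₁, hA₁⟩ := hα_bdd
  obtain ⟨A₂, hA₂⟩ := hc_bdd
  obtain ⟨A₃, hA₃⟩ := hΩ.isCompact_closure.exists_bound_of_continuousOn hβ'c.continuousOn
  obtain ⟨A₄, hA₄⟩ := hΩ.isCompact_closure.exists_bound_of_continuousOn hDc.continuousOn
  obtain ⟨A₅, hA₅⟩ := hΩ.isCompact_closure.exists_bound_of_continuousOn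
    (continuous_id (X := Plane)).continuousOn
  refine ⟨β', D, max A₁ (max A₂ (max A₃ (max A₄ A₅))), hβ', ?_⟩
  refine ⟨fun x hx => (hA₁ x hx).trans (by simp), hα_pos, hβ'c, hDc, fun x hx => ?_,
    fun x hx => (hA₃ x hx).trans (by simp), fun x hx => (hA₄ x hx).trans (by simp),
    fun x hx => (hA₅ x hx).trans (by simp), hc_meas, fun x hx => (hA₂ x hx).trans (by simp),
    fun x hx => ?_⟩
  · rw [hD (subset_closure hx)]
    refine (hβD x hx).congr_of_eventuallyEq ?_
    filter_upwards [hΩ.isOpen.mem_nhds hx] with y hy using hβ' (subset_closure hy)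
  · have h := hc_pos x hx
    rw [divergence, (hβD x hx).fderiv] at h
    rw [traceField, hD (subset_closure hx)]
    exact h

namespace PolyMesh

variable {Ω : Set Plane} (M : PolyMesh Ω)

theorem Qb_apply_congr {f g : Plane → ℝ} {e : Fin M.numEdge}
    (h : EqOn f g (segment ℝ (M.src e) (M.tgt e))) : M.Qb f e = M.Qb g e := by
  refine intervalIntegral.integral_congr fun t ht => h ?_
  rw [uIcc_of_le zero_le_one] at ht
  rw [segment_eq_image_lineMap]
  exact mem_image_of_mem _ ht

theorem bForm_congr {β β' : Plane → Plane} (h : EqOn β β' (closure Ω)) (v w : M.W) :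
    M.bForm β v w = M.bForm β' v w :=
  Finset.sum_congr rfl fun i _ => setIntegral_congr_fun (M.measurableSet_elem i) fun x hx => by
    simp only [h (M.elem_subset i hx)]

end PolyMesh

theorem mainTheorem3 (Ω : Set Plane) (hΩ : IsPolygonalDomain Ω)
    (α : Plane → (Plane →L[ℝ] Plane)) (β : Plane → Plane) (c : Plane → ℝ)
    (α₀ κ ρ : ℝ) (L : ℝ≥0) (hα₀ : 0 < α₀) (hκ : 0 < κ) (hρ : 0 < ρ)
    (hα_bdd : ∃ A : ℝ, ∀ x ∈ Ω, ‖α x‖ ≤ A)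
    (hα_pos : ∀ x ∈ Ω, ∀ ξ : Plane, α₀ * ‖ξ‖ ^ 2 ≤ inner ℝ (α x ξ) ξ)
    (hβ : IsC1UpToBoundary Ω β)
    (hc_meas : AEStronglyMeasurable c (volume.restrict Ω))
    (hc_bdd : ∃ B : ℝ, ∀ x ∈ Ω, |c x| ≤ B)
    (hc_pos : ∀ x ∈ Ω, 0 ≤ c x - 1 / 2 * divergence β x) :
    ∃ C h₀ : ℝ, 0 < C ∧ 0 < h₀ ∧
      ∀ M : PolyMesh Ω, M.IsShapeRegular ρ →
        (∀ i, LipschitzOnWith L α (interior (M.elem i))) → M.meshSize ≤ h₀ →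
      ∀ (f g u : Plane → ℝ) (G : Plane → Plane) (H : Fin 2 → Plane → Plane) (u_b : M.W),
        MemLp f 2 (volume.restrict Ω) →
        IsH2 Ω u G H → ContinuousOn u (closure Ω) →
        SolvesEquation Ω α β c f u G → EqOn u g (frontier Ω) →
        M.IsSWGSolution α β c κ f g u_b →
        κ * M.S (M.Qb u - u_b) (M.Qb u - u_b) + M.aForm α (M.Qb u - u_b) (M.Qb u - u_b)
            ≤ C * M.meshSize ^ 2 * h2Norm Ω u G H ^ 2 ∧
          M.gradError u_b G ≤ C * M.meshSize * h2Norm Ω u G H := by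
  obtain ⟨β', D, A, hβ', hc⟩ :=
    exists_admissibleCoefficients hΩ hα_bdd hα_pos hβ hc_meas hc_bdd hc_pos
  obtain ⟨C, h₀, hC, hh₀, hmain⟩ := exists_error_bound hΩ L hα₀ hκ hρ hc
  -- the representative of `u` that is continuous on the closure is extended; values outside of the
  -- closure of `Ω` enter none of the quantities
  refine ⟨C, h₀, hC, hh₀, fun M hM hL hh f g u G H u_b hf hu huc hsol hug hub => ?_⟩
  obtain ⟨u', hu'c, hu'⟩ := exists_continuous_extension huc
  have hΩm := hΩ.isOpen.measurableSet
  have hu'Ω : EqOn u' u Ω := hu'.mono subset_closure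
  have hae : u =ᵐ[volume.restrict Ω] u' := by
    filter_upwards [ae_restrict_mem hΩm] with x hx using (hu'Ω hx).symm
  have hQ : M.Qb u = M.Qb u' := funext fun e =>
    M.Qb_apply_congr fun x hx => (hu' (M.edge_subset_closure e hx)).symm
  have hu2 : IsH2 Ω u' G H := by
    refine ⟨hu.memLp.ae_eq hae, hu.memLp_grad, hu.memLp_hess, fun φ hφ i => ?_, hu.weak_hess⟩
    rw [← hu.weak_grad φ hφ i]
    exact setIntegral_congr_fun hΩm fun x hx => by simp only [hu'Ω hx]
  have hsol' : SolvesEquation Ω α β' c f u' G := fun φ hφ => by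
    rw [← hsol φ hφ]
    exact setIntegral_congr_fun hΩm fun x hx => by
      simp only [hu'Ω hx, hβ' (subset_closure hx)]
  have hub' : M.IsSWGSolution α β' c κ f u' u_b := by
    refine ⟨fun e he => ?_, fun v hv => ?_⟩
    · rw [hub.1 e he]
      exact M.Qb_apply_congr fun x hx =>
        ((hu' (M.edge_subset_closure e hx)).trans (hug (he hx))).symm
    · rw [M.bForm_congr hβ']
      exact hub.2 v hv
  have hnorm : h2Norm Ω u' G H = h2Norm Ω u G H := by
    have : ∫ x in Ω, u' x ^ 2 = ∫ x in Ω, u x ^ 2 :=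
      setIntegral_congr_fun hΩm fun x hx => by simp only [hu'Ω hx]
    rw [h2Norm, h2Norm, this]
  rw [hQ, ← hnorm]
  exact hmain M hM hL hh f u' G H u_b hf hu2 hu'c hsol' hub'
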